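/- **Setting.** Let $d\ge 2$ ($d=2,3$ for triangles/tetrahedra) and $k\ge 0$. Let $\Omega\subset\mathbb R^d$ be a polyhedral domain (lying on one side of its boundary, $\Omega=\operatorname{int}\overline\Omega$), $f\in L^2(\Omega)$, $\kappa\in L^\infty(\Omega)$ with $0<\kappa_0\le\kappa\le\kappa_1$, and let $(\mathbf q,u)\in \mathbf H(\mathrm{div},\Omega)\times H^1(\Omega)$ solve $$\kappa^{-1}\mathbf q+\nabla u=0,\quad \mathrm{div}\,\mathbf q=f\ \text{ in }\Omega,\qquad u=g\ \text{ on }\Gamma=\partial\Omega .$$ Let $\mathcal T_h$ be a conforming partition of $\Omega$ into $d$-simplices that is shape-regular: $h_K\le\gamma\rho_K$ for every $K\in\mathcal T_h$, where $h_K$ is the diameter of $K$ and $\rho_K$ the diameter of the largest ball contained in $K$. Let $h=\max_K h_K$; $\mathcal P_k(K)$ denotes the polynomials of degree at most $k$ on $K$, $\mathcal P^0_{k+1}(K)$ those in $\mathcal P_{k+1}(K)$ with zero mean on $K$, $\Pi_k$ the elementwise $L^2(K)$-orthogonal projection onto $\mathcal P_k(K)$, $|\cdot|_{1,K}$ the $L^2(K)$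 norm of the gradient, and $\|\mu\|_h:=\big(\sum_{K}h_K\|\mu\|^2_{L^2(\partial K)}\big)^{1/2}$. **Proposition 4.2 (Postprocessing).** There is a constant $C$ depending only on $d,k,\gamma,\kappa_0,\kappa_1$ with the following properties. Let $(u_h,\mathbf q_h)$ be any approximation of $(u,\mathbf q)$ (elementwise defined, with $u_h\in L^2(K)$ and $\mathbf q_h\cdot\mathbf n\in L^2(\partial K)$ for all $K$), and assume $\mathbf q\cdot\mathbf n\in L^2(\partial K)$ for all $K$. (a) If $(f,1)_K=\langle\mathbf q_h\cdot\mathbf n,1\rangle_{\partial K}$ for all $K\in\mathcal T_h$, then there is a unique $u_h^\star\in\prod_K\mathcal P_{k+1}(K)$ (the Stenberg postprocessing) such that for all $K\in\mathcal T_h$ $$(\kappa\nabla u_h^\star,\nabla v)_K=(f,v)_K-\langle\mathbf q_h\cdot\mathbf n,v\rangle_{\partial K}\quad\forall v\in\mathcal P_{k+1}(K),\qquad (u_h^\star,1)_K=(u_h,1)_K,$$ and it satisfies $$\|u-u_h^\star\|_\Omega\le C\Big(\|u-\Pi_{k+1}u\|_\Omega+\Big(\sum_{K\in\mathcal T_h}h_K^2|u-\Pi_{k+1}u|_{1,K}^2\Big)^{1/2}+\|u_h-\Pi_ku\|_\Omega+h\,\|\mathbf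 q\cdot\mathbf n-\mathbf q_h\cdot\mathbf n\|_h\Big).$$ (b) Whether or not this conservation property holds, there is a unique $u_h^\star=c_h+\omega_h$ with $c_h\in\prod_K\mathcal P_0(K)$, $\omega_h\in\prod_K\mathcal P_{k+1}^0(K)$ such that for all $K\in\mathcal T_h$ $$(\kappa\nabla\omega_h,\nabla v)_K=(f,v)_K-\langle\mathbf q_h\cdot\mathbf n,v\rangle_{\partial K}\quad\forall v\in\mathcal P^0_{k+1}(K),\qquad (c_h,1)_K=(u_h,1)_K,$$ and it satisfies the same bound. (c) Let $(\mathbf q_h,u_h,\widehat u_h)$ be a solution of the hybridized Raviart–Thomas equations of order $k$: with $\mathbf V_h=\prod_K(\mathcal P_k(K)^d\oplus\mathbf x\,\widetilde{\mathcal P}_k(K))$, where $\widetilde{\mathcal P}_k$ are the homogeneous polynomials of degree $k$, $W_h=\prod_K\mathcal P_k(K)$ and $M_h=\prod_e\mathcal P_k(e)$ over the facets $e$ of $\mathcal T_h$, $(\mathbf q_h,u_h,\widehat u_h)\in\mathbf V_h\times W_h\times M_h$ satisfies $$\begin{aligned}&\textstyle\sum_K\big[(\kappa^{-1}\mathbf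 q_h,\mathbf r)_K-(u_h,\mathrm{div}\,\mathbf r)_K+\langle\widehat u_h,\mathbf r\cdot\mathbf n\rangle_{\partial K}\big]=0&&\forall\mathbf r\in\mathbf V_h,\\&\textstyle\sum_K(\mathrm{div}\,\mathbf q_h,w)_K=\sum_K(f,w)_K&&\forall w\in W_h,\\&\textstyle\sum_K\langle\mathbf q_h\cdot\mathbf n,\mu\rangle_{\partial K\setminus\Gamma}=0,\quad \langle\widehat u_h,\mu\rangle_\Gamma=\langle g,\mu\rangle_\Gamma&&\forall\mu\in M_h.\end{aligned}$$ Assume that $u\in H^{k+2}(\Omega)$, $\mathbf q\in H^{k+1}(\Omega)^d$, and superconvergence: $\|u_h-\Pi_ku\|_\Omega\le S\,h^{k+2}$. Then the Stenberg postprocessing of (a) exists, is unique, and satisfies $\|u-u_h^\star\|_\Omega=O(h^{k+2})$; more precisely $$\|u-u_h^\star\|_\Omega\le C\big(|u|_{k+2,\Omega}+|\mathbf q|_{k+1,\Omega}+S\big)\,h^{k+2}.$$ -/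

import Mathlib

open MeasureTheory Filter Topology
open scoped ContDiff RealInnerProductSpace Gradient

noncomputable section

namespace MixedFEM

/-- The Euclidean space `ℝ^d`. -/
abbrev Pt (d : ℕ) := EuclideanSpace ℝ (Fin d)

/-- Real polynomials in `d` variables. -/
abbrev MPoly (d : ℕ) := MvPolynomial (Fin d) ℝ

variable {d : ℕ}

/-! ### Polynomials as functions on `ℝ^d` -/

/-- The value of a polynomial at a point. -/
def pval (p : MPoly d) (x : Pt d) : ℝ := MvPolynomial.eval (fun i => x i) p

/-- The gradient of a polynomial at a point. -/
def pgrad (p : MPoly d) (x : Pt d) : Pt d :=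
  WithLp.toLp 2 fun i => pval (MvPolynomial.pderiv i p) x

/-- The vector field whose components are the given polynomials. -/
def vval (Q : Fin d → MPoly d) (x : Pt d) : Pt d := WithLp.toLp 2 fun i => pval (Q i) x

/-- The divergence of a polynomial vector field. -/
def pdiv (Q : Fin d → MPoly d) : MPoly d := ∑ i, MvPolynomial.pderiv i (Q i)

/-- The Raviart-Thomas space: fields `p + x r` where the components of `p` have degree at most `k`
and `r` is homogeneous of degree `k`. -/
def IsRT (k : ℕ) (Q : Fin d → MPoly d) : Prop :=
  ∃ (p : Fin d → MPoly d) (r : MPoly d), (∀ i, (p i).totalDegree ≤ k) ∧ r.IsHomogeneous k ∧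
    ∀ i, Q i = p i + MvPolynomial.X i * r

/-! ### Simplices, given by their finite sets of vertices -/

/-- The closed simplex with vertex set `K`. -/
def hull (K : Finset (Pt d)) : Set (Pt d) := convexHull ℝ (K : Set (Pt d))

/-- The diameter of the simplex. -/
def diamK (K : Finset (Pt d)) : ℝ := Metric.diam (hull K)

open Classical in
/-- The vertex set of the facet of `K` opposite to the vertex `v`. -/
def facet (K : Finset (Pt d)) (v : Pt d) : Finset (Pt d) := K.erase v

/-- A vector pointing from the vertex `v` of a `d`-simplex `K` to the opposite facet, orthogonally
to that facet: the projection of (barycenter of `K`) `- v` to the normal direction. -/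
def rawNormal (K : Finset (Pt d)) (v : Pt d) : Pt d :=
  (vectorSpan ℝ (facet K v : Set (Pt d)))ᗮ.starProjection ((K.card : ℝ)⁻¹ • (∑ p ∈ K, p) - v)

/-- The unit normal vector, exterior to `K`, on the facet of `K` opposite to `v`. -/
def normal (K : Finset (Pt d)) (v : Pt d) : Pt d := ‖rawNormal K v‖⁻¹ • rawNormal K v

/-- Surface measure on the `(d-1)`-simplex with vertex set `e`. -/
def surf (e : Finset (Pt d)) : Measure (Pt d) := (μHE[d - 1]).restrict (hull e)

/-- The integral over `∂K`, facet by facet, of `F`, where `F v` is the integrand on the facet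
opposite to the vertex `v`. -/
def bdryInt (K : Finset (Pt d)) (F : Pt d → Pt d → ℝ) : ℝ :=
  ∑ v ∈ K, ∫ x, F v x ∂(surf (facet K v))

/-! ### The `L²` projection -/

/-- `p` is the `L²(K)`-orthogonal projection of `u` to the polynomials of degree at most `k`. -/
def IsL2Proj (k : ℕ) (K : Finset (Pt d)) (u : Pt d → ℝ) (p : MPoly d) : Prop :=
  p.totalDegree ≤ k ∧ ∀ v : MPoly d, v.totalDegree ≤ k →
    ∫ x in hull K, pval p x * pval v x = ∫ x in hull K, u x * pval v x

/-- The `L²(K)`-orthogonal projection of `u` to the polynomials of degree at most `k`; it exists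
and is unique for `u` in `L²(K)` on a nondegenerate simplex `K`. -/
def proj (k : ℕ) (K : Finset (Pt d)) (u : Pt d → ℝ) : MPoly d :=
  Classical.epsilon (IsL2Proj k K u)

/-! ### Weak derivatives -/

/-- `φ ∈ C_c^∞(Ω)`. -/
structure IsTest (Ω : Set (Pt d)) (φ : Pt d → ℝ) : Prop where
  smooth : ContDiff ℝ ∞ φ
  compact : HasCompactSupport φ
  support : tsupport φ ⊆ Ω

/-- `u ∈ H¹(Ω)` with weak gradient `G`. -/
structure HasWeakGrad (Ω : Set (Pt d)) (u : Pt d → ℝ) (G : Pt d → Pt d) : Prop where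
  memLp : MemLp u 2 (volume.restrict Ω)
  memLp_grad : MemLp G 2 (volume.restrict Ω)
  weak : ∀ φ, IsTest Ω φ → ∀ i : Fin d,
    ∫ x in Ω, u x * (∇ φ x) i = - ∫ x in Ω, G x i * φ x

/-- `q ∈ H(div, Ω)` with weak divergence `f`. -/
structure HasWeakDiv (Ω : Set (Pt d)) (q : Pt d → Pt d) (f : Pt d → ℝ) : Prop where
  memLp : MemLp q 2 (volume.restrict Ω)
  memLp_div : MemLp f 2 (volume.restrict Ω)
  weak : ∀ φ, IsTest Ω φ → ∫ x in Ω, ⟪q x, ∇ φ x⟫ = - ∫ x in Ω, f x * φ x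

/-- `u ∈ H^m(Ω)`, where `D n i` is the weak partial derivative of `u` of order `n` in the coordinate
directions `i 0, …, i (n-1)`, for all `n ≤ m`. -/
def IsSobolev (m : ℕ) (Ω : Set (Pt d)) (u : Pt d → ℝ)
    (D : (n : ℕ) → (Fin n → Fin d) → Pt d → ℝ) : Prop :=
  MemLp u 2 (volume.restrict Ω) ∧
  ∀ n ≤ m, ∀ i : Fin n → Fin d, MemLp (D n i) 2 (volume.restrict Ω) ∧
    ∀ φ, IsTest Ω φ →
      ∫ x in Ω, u x * iteratedFDeriv ℝ n φ x (fun j => EuclideanSpace.single (i j) 1) =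
        (-1) ^ n * ∫ x in Ω, D n i x * φ x

/-- The square of the Sobolev seminorm of order `m`: the sum of the squares of the `L²(Ω)` norms of
all partial derivatives of order `m`. -/
def seminormSq (m : ℕ) (Ω : Set (Pt d)) (D : (n : ℕ) → (Fin n → Fin d) → Pt d → ℝ) : ℝ :=
  ∑ i : Fin m → Fin d, ∫ x in Ω, D m i x ^ 2

/-- `g ∈ L²(∂Ω)` is the trace of the function `u ∈ H¹(Ω)` with weak gradient `G`: there are smooth
functions that tend to `u` in `H¹(Ω)` and whose restrictions to `∂Ω` tend to `g` in `L²(∂Ω)`. -/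
def HasTrace (Ω : Set (Pt d)) (u : Pt d → ℝ) (G : Pt d → Pt d) (g : Pt d → ℝ) : Prop :=
  MemLp g 2 ((μHE[d - 1]).restrict (frontier Ω)) ∧
  ∃ φ : ℕ → Pt d → ℝ, (∀ n, ContDiff ℝ ∞ (φ n)) ∧
    Tendsto (fun n => eLpNorm (fun x => φ n x - u x) 2 (volume.restrict Ω)) atTop (𝓝 0) ∧
    Tendsto (fun n => eLpNorm (fun x => ∇ (φ n) x - G x) 2 (volume.restrict Ω)) atTop (𝓝 0) ∧
    Tendsto (fun n => eLpNorm (fun x => φ n x - g x) 2 ((μHE[d - 1]).restrict (frontier Ω)))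
      atTop (𝓝 0)

/-- `σ ∈ L²(∂K)` is the normal component on `∂K` of the field `q` whose divergence is `f`, that is,
`(f, v)_K + (q, ∇ v)_K = ⟨σ, v⟩_∂K` for all smooth `v`. -/
def HasNormalTrace (K : Finset (Pt d)) (q : Pt d → Pt d) (f σ : Pt d → ℝ) : Prop :=
  (∀ v ∈ K, MemLp σ 2 (surf (facet K v))) ∧
  ∀ v : Pt d → ℝ, ContDiff ℝ ∞ v →
    (∫ x in hull K, f x * v x) + ∫ x in hull K, ⟪q x, ∇ v x⟫ = bdryInt K fun _ x => σ x * v x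

/-! ### The diffusion problem -/

/-- `κ` is a coefficient in `L^∞(Ω)` with `κ₀ ≤ κ ≤ κ₁`. -/
def IsCoeff (Ω : Set (Pt d)) (κ₀ κ₁ : ℝ) (κ : Pt d → ℝ) : Prop :=
  AEStronglyMeasurable κ (volume.restrict Ω) ∧
    ∀ᵐ x ∂(volume.restrict Ω), κ₀ ≤ κ x ∧ κ x ≤ κ₁

/-- `(q, u) ∈ H(div, Ω) × H¹(Ω)` solves `κ⁻¹ q + ∇u = 0`, `div q = f` in `Ω`; `G` is `∇u`. -/
structure IsSolution (Ω : Set (Pt d)) (κ f u : Pt d → ℝ) (G q : Pt d → Pt d) : Prop where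
  grad : HasWeakGrad Ω u G
  div : HasWeakDiv Ω q f
  law : ∀ᵐ x ∂(volume.restrict Ω), (κ x)⁻¹ • q x + G x = 0

/-! ### Triangulations -/

/-- A conforming partition of `Ω` into `d`-simplices (triangles, tetrahedra): a finite simplicial
complex that fills `closure Ω`, all of whose simplices are faces of `d`-dimensional ones. -/
structure Mesh (Ω : Set (Pt d)) where
  complex : Geometry.SimplicialComplex ℝ (Pt d)
  finite : complex.faces.Finite
  pure : ∀ s ∈ complex.faces, ∃ K ∈ complex.faces, s ⊆ K ∧ K.card = d + 1
  cover : complex.space = closure Ω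

namespace Mesh

variable {Ω : Set (Pt d)} (T : Mesh Ω)

open Classical in
/-- The elements (`d`-simplices) of the triangulation. -/
def cells : Finset (Finset (Pt d)) := T.finite.toFinset.filter fun s => s.card = d + 1

open Classical in
/-- The facets (edges of triangles, faces of tetrahedra) contained in the boundary of `Ω`. -/
def bdryFacets : Finset (Finset (Pt d)) :=
  T.finite.toFinset.filter fun s => s.card = d ∧ hull s ⊆ frontier Ω

/-- The mesh size `h`, the maximum of the diameters of the elements. -/
def size : ℝ := ⨆ K : T.cells, diamK K.1

/-- Every element `K` contains a ball whose diameter `2 r` satisfies `h_K ≤ γ (2 r)`. -/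
def ShapeRegular (γ : ℝ) : Prop :=
  ∀ K ∈ T.cells, ∃ (c : Pt d) (r : ℝ), 0 < r ∧ Metric.closedBall c r ⊆ hull K ∧
    diamK K ≤ γ * (2 * r)

/-- The `L²(Ω)` norm of the function that equals `F K` on each element `K`. -/
def norm (F : T.cells → Pt d → ℝ) : ℝ := √(∑ K, ∫ x in hull K.1, F K x ^ 2)

/-- The square root of the sum of `h_K² ‖F K‖²_K` for vector fields `F K` on the elements. -/
def scaledNorm (F : T.cells → Pt d → Pt d) : ℝ :=
  √(∑ K, diamK K.1 ^ 2 * ∫ x in hull K.1, ‖F K x‖ ^ 2)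

/-- The square root of the sum of `h_K ‖F K‖²_∂K`; `F K v` is the function on the facet of `K`
opposite to the vertex `v`. -/
def bdryNorm (F : T.cells → Pt d → Pt d → ℝ) : ℝ :=
  √(∑ K, diamK K.1 * bdryInt K.1 fun v x => F K v x ^ 2)

/-! ### The local postprocessing -/

/-- `w ∈ ∏ P_{k+1}(K)` solves, on each element `K`, the equations
`(κ ∇w, ∇v)_K = (f, v)_K - ⟨q_h · n, v⟩_∂K` for all `v ∈ P_{k+1}(K)` and `(w, 1)_K = (u_h, 1)_K`. -/
structure IsPostprocessing (k : ℕ) (κ f : Pt d → ℝ) (uh : T.cells → Pt d → ℝ)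
    (qh : T.cells → Pt d → Pt d) (w : T.cells → MPoly d) : Prop where
  degree : ∀ K, (w K).totalDegree ≤ k + 1
  flux : ∀ K, ∀ v : MPoly d, v.totalDegree ≤ k + 1 →
    ∫ x in hull K.1, κ x * ⟪pgrad (w K) x, pgrad v x⟫ =
      (∫ x in hull K.1, f x * pval v x) -
        bdryInt K.1 fun a x => ⟪qh K x, normal K.1 a⟫ * pval v x
  mean : ∀ K, ∫ x in hull K.1, pval (w K) x = ∫ x in hull K.1, uh K x

/-- `w = c + z` with `c ∈ ∏ P_0(K)`, `z ∈ ∏ P_{k+1}^0(K)`, where `P_{k+1}^0(K)` is the space of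
polynomials of degree at most `k+1` with zero mean on `K`, and on each element `K`
`(κ ∇z, ∇v)_K = (f, v)_K - ⟨q_h · n, v⟩_∂K` for all `v ∈ P_{k+1}^0(K)` and
`(c, 1)_K = (u_h, 1)_K`. -/
def IsSplitPostprocessing (k : ℕ) (κ f : Pt d → ℝ) (uh : T.cells → Pt d → ℝ)
    (qh : T.cells → Pt d → Pt d) (w : T.cells → MPoly d) : Prop :=
  ∃ (c : T.cells → ℝ) (z : T.cells → MPoly d), ∀ K,
    w K = MvPolynomial.C (c K) + z K ∧
    (z K).totalDegree ≤ k + 1 ∧ (∫ x in hull K.1, pval (z K) x = 0) ∧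
    (∀ v : MPoly d, v.totalDegree ≤ k + 1 → (∫ x in hull K.1, pval v x = 0) →
      ∫ x in hull K.1, κ x * ⟪pgrad (z K) x, pgrad v x⟫ =
        (∫ x in hull K.1, f x * pval v x) -
          bdryInt K.1 fun a x => ⟪qh K x, normal K.1 a⟫ * pval v x) ∧
    ∫ _ in hull K.1, c K = ∫ x in hull K.1, uh K x

/-- Local conservation: `(f, 1)_K = ⟨q_h · n, 1⟩_∂K` for all elements `K`. -/
def IsConservative (f : Pt d → ℝ) (qh : T.cells → Pt d → Pt d) : Prop :=
  ∀ K, ∫ x in hull K.1, f x = bdryInt K.1 fun a x => ⟪qh K x, normal K.1 a⟫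

/-- The postprocessing error bound: `‖u - w‖` is at most `C` times the sum of `‖u - Π_{k+1} u‖`,
`(∑ h_K² |u - Π_{k+1} u|²_{1,K})^{1/2}`, `‖u_h - Π_k u‖` and `h ‖q · n - q_h · n‖_h`. Here `G` is
the gradient of `u`, and `σ K` is `q · n` on `∂K`. -/
def ErrorBound (k : ℕ) (C : ℝ) (u : Pt d → ℝ) (G : Pt d → Pt d) (σ : T.cells → Pt d → ℝ)
    (uh : T.cells → Pt d → ℝ) (qh : T.cells → Pt d → Pt d) (w : T.cells → MPoly d) : Prop :=
  T.norm (fun K x => u x - pval (w K) x) ≤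
    C * (T.norm (fun K x => u x - pval (proj (k + 1) K.1 u) x) +
      T.scaledNorm (fun K x => G x - pgrad (proj (k + 1) K.1 u) x) +
      T.norm (fun K x => uh K x - pval (proj k K.1 u) x) +
      T.size * T.bdryNorm (fun K a x => σ K x - ⟪qh K x, normal K.1 a⟫))

/-! ### The Raviart-Thomas method -/

/-- The hybridized Raviart-Thomas equations for `(q_h, u_h, û_h) ∈ V_h × W_h × M_h`. A function in
`M_h` is given by its polynomials on the facets (values on other sets of vertices do not matter). -/
structure IsRTSolution (k : ℕ) (κ f g : Pt d → ℝ) (qh : T.cells → Fin d → MPoly d)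
    (uh : T.cells → MPoly d) (lam : Finset (Pt d) → MPoly d) : Prop where
  mem_V : ∀ K, IsRT k (qh K)
  mem_W : ∀ K, (uh K).totalDegree ≤ k
  mem_M : ∀ e, (lam e).totalDegree ≤ k
  /-- `(κ⁻¹ q_h, r) - (u_h, div r) + ⟨û_h, r · n⟩ = 0` for all `r ∈ V_h`. -/
  gradient : ∀ r : T.cells → Fin d → MPoly d, (∀ K, IsRT k (r K)) →
    ∑ K, ((∫ x in hull K.1, (κ x)⁻¹ * ⟪vval (qh K) x, vval (r K) x⟫) -
      (∫ x in hull K.1, pval (uh K) x * pval (pdiv (r K)) x) +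
      bdryInt K.1 fun a x => pval (lam (facet K.1 a)) x * ⟪vval (r K) x, normal K.1 a⟫) = 0
  /-- `(div q_h, w) = (f, w)` for all `w ∈ W_h`. -/
  divergence : ∀ w : T.cells → MPoly d, (∀ K, (w K).totalDegree ≤ k) →
    ∑ K, ∫ x in hull K.1, pval (pdiv (qh K)) x * pval (w K) x =
      ∑ K, ∫ x in hull K.1, f x * pval (w K) x
  /-- `⟨q_h · n, μ⟩ = 0` on the union of the sets `∂K` minus `∂Ω`, for all `μ ∈ M_h` that vanish
  on `∂Ω`. -/
  continuity : ∀ m : Finset (Pt d) → MPoly d, (∀ e, (m e).totalDegree ≤ k) →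
    (∀ e ∈ T.bdryFacets, m e = 0) →
    ∑ K : T.cells, bdryInt K.1
      (fun a x => ⟪vval (qh K) x, normal K.1 a⟫ * pval (m (facet K.1 a)) x) = 0
  /-- `⟨û_h, μ⟩ = ⟨g, μ⟩` on `∂Ω` for all `μ ∈ M_h`. -/
  boundary : ∀ m : Finset (Pt d) → MPoly d, (∀ e, (m e).totalDegree ≤ k) →
    ∑ e ∈ T.bdryFacets, ∫ x, pval (lam e) x * pval (m e) x ∂(surf e) =
      ∑ e ∈ T.bdryFacets, ∫ x, g x * pval (m e) x ∂(surf e)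

end Mesh

end MixedFEM

end

open MixedFEM

/-! All estimates are made on one element and then summed. Write `G = ∇u`, so that `q = -κ G`, and
let `P` be a polynomial of degree at most `k+1`. For mean-free `v`, the local equation for `w` and
Green's formula for `q` (the definition of its normal trace `σ`) give the error equation `(κ(∇w -
∇P), ∇v) = (κ(G - ∇P), ∇v) + ⟨σ - q_h·n, v⟩_∂K`. Take for `v` the mean-free part of `w - P`.
Coercivity bounds `‖∇v‖`, and the Poincaré inequality gains a factor `h_K` when passing to `‖v‖`.
The boundary term is controlled by a trace inequality, which supplies a factor `h_K^{1/2}`. The mean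
of `w - P` is the mean of `u - P` plus the mean of `u_h - Π_k u`, because `w` has the mean of `u_h`
and `Π_k` preserves means. This is `IsSimplex.local_error`; with `P = Π_{k+1} u` it leads to
`Mesh.errorBound`. Existence and uniqueness are those of a definite form on mean-free polynomials.
Conservation is the solvability condition for the test function `1`, so it makes the unsplit problem
equivalent to the split one, and (a) follows from (b).

Part (c) does not use the boundary norm. Since `div q_h = Π_k f`, Green's formula turns the right
side of the local problem into volume terms, and the error involves only `G - ∇P`, `h (f - Π_k f)`
and `q - q_h` in `L²(K)` (`IsSimplex.postprocessing_error_le`). It remains to show that `‖q - q_h‖`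
has order `h^{k+1}`. The error `q - q_h` is orthogonal, in the inner product weighted by `κ⁻¹`, to
divergence-free Raviart-Thomas fields with continuous normal components. So `q_h` is as good, up to
a constant, as any conforming `Q` with `div Q = Π_k f` (`IsRTSolution.flux_error_le`).

Such a `Q` is built directly on each simplex, with constants that depend on the shape only through
`γ` (`exists_rt_interpolant`). Start from componentwise polynomial approximations `p` of `q`.
Correct the facet moments by radial fields `(x - a) β_a`: these are tangential on the facets through
`a`, and a `β_a` homogeneous about `a` is determined by a problem in `L²(K)`. Then correct the
divergence by a field `∑ λ_a ((a - x)·∇w)(a - x)`, tangential on all facets. Its form `∑ λ_a ((a -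
x)·∇w)²` is coercive by `exists_tangField_coercive`.

The facet moments of an `H¹` function are expressed by the volume integral `coneInt`, which for
smooth functions is a multiple of the facet integral. That the two sides of an interior facet see
the same moments (`Mesh.coneInt_neighbor`) is proved by cutting off near the other facets and
mollifying on compact subsets of `Ω`.

The analysis rests on two elementary facts. The divergence theorem on a simplex follows from slicing
it as a cone over a facet (`IsSimplex.integral_cone`). The Poincaré inequality on convex sets
follows from integrating along segments through midpoints (`poincare_smooth`). Iterating the latter
on a function whose derivatives have been made mean-free gives the approximation orders
(`IsSimplex.bramble_hilbert`). -/

set_option linter.unusedSectionVars false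

open MeasureTheory Filter Topology
open scoped ContDiff RealInnerProductSpace Gradient
open MixedFEM

noncomputable section

namespace MixedFEM

variable {d : ℕ}

/-! ### Polynomials -/

@[simp] theorem pval_add (p q : MPoly d) (x : Pt d) : pval (p + q) x = pval p x + pval q x := by
  simp [pval]

@[simp] theorem pval_sub (p q : MPoly d) (x : Pt d) : pval (p - q) x = pval p x - pval q x := by
  simp [pval]

@[simp] theorem pval_neg (p : MPoly d) (x : Pt d) : pval (-p) x = -pval p x := by
  simp [pval]

@[simp] theorem pval_mul (p q : MPoly d) (x : Pt d) : pval (p * q) x = pval p x * pval q x := by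
  simp [pval]

@[simp] theorem pval_pow (p : MPoly d) (n : ℕ) (x : Pt d) : pval (p ^ n) x = pval p x ^ n := by
  simp [pval]

@[simp] theorem pval_C (c : ℝ) (x : Pt d) : pval (MvPolynomial.C c) x = c := by
  simp [pval]

@[simp] theorem pval_zero (x : Pt d) : pval (0 : MPoly d) x = 0 := by
  simp [pval]

@[simp] theorem pval_one (x : Pt d) : pval (1 : MPoly d) x = 1 := by
  simp [pval]

@[simp] theorem pval_smul (c : ℝ) (p : MPoly d) (x : Pt d) : pval (c • p) x = c * pval p x := by
  simp [pval]

@[simp] theorem pval_X (i : Fin d) (x : Pt d) : pval (MvPolynomial.X i) x = x i := by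
  simp [pval]

@[simp] theorem pval_sum {ι : Type*} (s : Finset ι) (p : ι → MPoly d) (x : Pt d) :
    pval (∑ i ∈ s, p i) x = ∑ i ∈ s, pval (p i) x := by
  simp [pval]

@[simp] theorem pgrad_apply (p : MPoly d) (x : Pt d) (i : Fin d) :
    pgrad p x i = pval (MvPolynomial.pderiv i p) x := rfl

@[simp] theorem vval_apply (Q : Fin d → MPoly d) (x : Pt d) (i : Fin d) :
    vval Q x i = pval (Q i) x := rfl

@[simp] theorem pgrad_add (p q : MPoly d) (x : Pt d) : pgrad (p + q) x = pgrad p x + pgrad q x := by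
  ext i; simp

@[simp] theorem pgrad_sub (p q : MPoly d) (x : Pt d) : pgrad (p - q) x = pgrad p x - pgrad q x := by
  ext i; simp

@[simp] theorem pgrad_smul (c : ℝ) (p : MPoly d) (x : Pt d) : pgrad (c • p) x = c • pgrad p x := by
  ext i; simp

@[simp] theorem pgrad_C (c : ℝ) (x : Pt d) : pgrad (MvPolynomial.C c) x = 0 := by
  ext i; simp

theorem pgrad_mul (p q : MPoly d) (x : Pt d) :
    pgrad (p * q) x = pval p x • pgrad q x + pval q x • pgrad p x := by
  ext i; simp

theorem contDiff_pval (p : MPoly d) : ContDiff ℝ ∞ (pval p) := by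
  induction p using MvPolynomial.induction_on with
  | C a => simpa [funext (pval_C a)] using contDiff_const
  | add p q hp hq => simpa [funext (pval_add p q)] using hp.add hq
  | mul_X p i hp =>
    have : ContDiff ℝ ∞ fun x : Pt d => x i := by fun_prop
    simpa [funext (pval_mul p _)] using hp.mul this

theorem hasGradientAt_pval (p : MPoly d) (x : Pt d) : HasGradientAt (pval p) (pgrad p x) x := by
  rw [hasGradientAt_iff_hasFDerivAt]
  induction p using MvPolynomial.induction_on with
  | C a => simpa [funext (pval_C a)] using hasFDerivAt_const a x
  | add p q hp hq =>
    have e : pval (p + q) = pval p + pval q := by ext y; simp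
    rw [e, pgrad_add, map_add]
    exact hp.add hq
  | mul_X p i hp =>
    have h1 : HasFDerivAt (fun x : Pt d => x i) (EuclideanSpace.proj i : Pt d →L[ℝ] ℝ) x :=
      (EuclideanSpace.proj i : Pt d →L[ℝ] ℝ).hasFDerivAt
    have h2 := hp.mul h1
    have e : pval (p * MvPolynomial.X i) = pval p * fun x : Pt d => x i := by
      ext y; simp
    rw [e]
    convert! h2 using 1
    ext v
    have : pgrad (MvPolynomial.X i : MPoly d) x = EuclideanSpace.single i (1 : ℝ) := by
      ext j
      by_cases hj : j = i
      · subst hj; simp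
      · simp [hj, MvPolynomial.pderiv_X_of_ne (Ne.symm hj)]
    have h3 : ⟪EuclideanSpace.single i (1 : ℝ), v⟫ = v i := by
      simp [EuclideanSpace.inner_single_left]
    simp [pgrad_mul, this, h3]

theorem gradient_pval (p : MPoly d) (x : Pt d) : ∇ (pval p) x = pgrad p x :=
  (hasGradientAt_pval p x).gradient

@[fun_prop] theorem continuous_pval (p : MPoly d) : Continuous (pval p) :=
  (contDiff_pval p).continuous

@[fun_prop] theorem continuous_pgrad (p : MPoly d) : Continuous (pgrad p) := by
  unfold pgrad; fun_prop

@[fun_prop] theorem continuous_vval (Q : Fin d → MPoly d) : Continuous (vval Q) := by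
  unfold vval; fun_prop

theorem continuous_gradient {φ : Pt d → ℝ} (hφ : ContDiff ℝ 1 φ) : Continuous fun x => ∇ φ x := by
  unfold gradient
  exact (LinearIsometryEquiv.continuous _).comp (hφ.continuous_fderiv (by norm_num))

theorem totalDegree_pderiv_le (p : MPoly d) (i : Fin d) :
    (MvPolynomial.pderiv i p).totalDegree ≤ p.totalDegree - 1 := by
  refine Finset.sup_le fun s hs => ?_
  rw [MvPolynomial.mem_support_iff, MvPolynomial.coeff_pderiv] at hs
  have h1 : s + Finsupp.single i 1 ∈ p.support := by
    rw [MvPolynomial.mem_support_iff]; intro h; simp [h] at hs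
  have h2 := MvPolynomial.le_totalDegree h1
  rw [Finsupp.sum_add_index' (fun _ => rfl) fun _ _ _ => rfl] at h2
  simp at h2
  omega

/-- An open set contains a product of intervals, and a polynomial is determined by its values on a
product of infinite sets. -/
theorem poly_eq_of_eqOn_open {p q : MPoly d} {U : Set (Pt d)} (hU : IsOpen U) (hne : U.Nonempty)
    (h : ∀ x ∈ U, pval p x = pval q x) : p = q := by
  obtain ⟨x₀, hx₀⟩ := hne
  obtain ⟨ε, hε, hb⟩ := Metric.isOpen_iff.1
    (hU.preimage (PiLp.continuous_toLp 2 (fun _ : Fin d => ℝ))) (WithLp.ofLp x₀) (by simpa using hx₀)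
  refine MvPolynomial.funext_set (fun i => Metric.ball (x₀ i) ε) (fun i => ?_) fun y hy => ?_
  · rw [Real.ball_eq_Ioo]; exact Set.Ioo_infinite (by linarith)
  · have : y ∈ Metric.ball (WithLp.ofLp x₀) ε := by
      rw [ball_pi _ hε]; exact hy
    simpa [pval] using h _ (hb this)

theorem pderiv_comm (i j : Fin d) (p : MPoly d) :
    MvPolynomial.pderiv i (MvPolynomial.pderiv j p) =
      MvPolynomial.pderiv j (MvPolynomial.pderiv i p) := by
  induction p using MvPolynomial.induction_on with
  | C a => simp
  | add p q hp hq => simp [hp, hq]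
  | mul_X p l hp =>
    classical
    simp only [Derivation.leibniz, map_add, smul_eq_mul, hp, MvPolynomial.pderiv_X, Pi.single_apply]
    split_ifs <;> simp <;> ring

/-! ### Linear algebra -/

/-- Definiteness makes `B` injective into the dual space, and equality of dimensions makes it
surjective. Symmetry plays no part, so it need not be checked for the forms used below. -/
theorem exists_unique_of_definite {V : Type*} [AddCommGroup V] [Module ℝ V] [FiniteDimensional ℝ V]
    (B : V →ₗ[ℝ] V →ₗ[ℝ] ℝ) (hB : ∀ v, B v v = 0 → v = 0) (l : V →ₗ[ℝ] ℝ) :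
    ∃! w, ∀ v, B w v = l v := by
  have hinj : Function.Injective B := by
    rw [← LinearMap.ker_eq_bot, LinearMap.ker_eq_bot']
    intro v hv
    exact hB v (by simp [hv])
  have hsurj : Function.Surjective B :=
    (LinearMap.injective_iff_surjective_of_finrank_eq_finrank
      (Subspace.dual_finrank_eq (K := ℝ) (V := V)).symm).1 hinj
  obtain ⟨w, hw⟩ := hsurj l
  exact ⟨w, fun v => by rw [hw], fun w' h' => hinj (by rw [hw]; ext v; exact h' v)⟩

/-! ### Square integrable functions -/

section L2

variable {α : Type*} [MeasurableSpace α] {μ : Measure α} {E : Type*} [NormedAddCommGroup E]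

/-- The `L²` norm of a function. -/
def l2 (μ : Measure α) (f : α → E) : ℝ := √(∫ x, ‖f x‖ ^ 2 ∂μ)

theorem l2_nonneg (f : α → E) : 0 ≤ l2 μ f := Real.sqrt_nonneg _

theorem l2_sq (f : α → E) : l2 μ f ^ 2 = ∫ x, ‖f x‖ ^ 2 ∂μ :=
  Real.sq_sqrt (integral_nonneg fun _ => by positivity)

theorem l2_mono {F : Type*} [NormedAddCommGroup F] {f : α → E} {g : α → F}
    (hg : MemLp g 2 μ) {c : ℝ} (hc : 0 ≤ c) (h : ∀ᵐ x ∂μ, ‖f x‖ ≤ c * ‖g x‖) :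
    l2 μ f ≤ c * l2 μ g := by
  refine Real.sqrt_le_iff.2 ⟨by have := l2_nonneg (μ := μ) g; positivity, ?_⟩
  rw [mul_pow, l2_sq, ← integral_const_mul]
  refine integral_mono_of_nonneg (ae_of_all _ fun _ => by positivity)
    ((hg.integrable_norm_pow (by norm_num)).const_mul _) ?_
  filter_upwards [h] with x hx
  rw [← mul_pow]
  gcongr

variable [InnerProductSpace ℝ E]

/-- The bridge to the Hilbert space `L²`, from which the triangle and Cauchy-Schwarz inequalities
below are inherited. -/
theorem l2_eq_norm {f : α → E} (hf : MemLp f 2 μ) : l2 μ f = ‖hf.toLp f‖ := by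
  have h := L2.inner_def (𝕜 := ℝ) (hf.toLp f) (hf.toLp f)
  rw [real_inner_self_eq_norm_sq] at h
  rw [l2, Real.sqrt_eq_iff_mul_self_eq (integral_nonneg fun _ => by positivity) (norm_nonneg _),
    ← sq, h]
  refine integral_congr_ae ?_
  filter_upwards [hf.coeFn_toLp] with x hx
  rw [hx, real_inner_self_eq_norm_sq]

theorem l2_add_le {f g : α → E} (hf : MemLp f 2 μ) (hg : MemLp g 2 μ) :
    l2 μ (fun x => f x + g x) ≤ l2 μ f + l2 μ g := by
  have := norm_add_le (hf.toLp f) (hg.toLp g)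
  rw [← MemLp.toLp_add] at this
  rw [l2_eq_norm hf, l2_eq_norm hg]
  exact (l2_eq_norm (hf.add hg)).trans_le this

theorem l2_sub_le {f g : α → E} (hf : MemLp f 2 μ) (hg : MemLp g 2 μ) :
    l2 μ (fun x => f x - g x) ≤ l2 μ f + l2 μ g := by
  have := norm_sub_le (hf.toLp f) (hg.toLp g)
  rw [← MemLp.toLp_sub] at this
  rw [l2_eq_norm hf, l2_eq_norm hg]
  exact (l2_eq_norm (hf.sub hg)).trans_le this

theorem l2_sum_le {ι : Type*} (s : Finset ι) {f : ι → α → E} (hf : ∀ i ∈ s, MemLp (f i) 2 μ) :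
    l2 μ (fun x => ∑ i ∈ s, f i x) ≤ ∑ i ∈ s, l2 μ (f i) := by
  classical
  induction s using Finset.induction_on with
  | empty => simp [l2]
  | insert a s ha ih =>
    simp only [Finset.sum_insert ha]
    have h2 : MemLp (fun x => ∑ i ∈ s, f i x) 2 μ :=
      memLp_finsetSum s fun i hi => hf i (Finset.mem_insert_of_mem hi)
    refine (l2_add_le (hf a (Finset.mem_insert_self a s)) h2).trans ?_
    gcongr
    exact ih fun i hi => hf i (Finset.mem_insert_of_mem hi)

theorem integrable_inner_of_memLp {f g : α → E} (hf : MemLp f 2 μ) (hg : MemLp g 2 μ) :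
    Integrable (fun x => ⟪f x, g x⟫) μ := by
  have := L2.integrable_inner (𝕜 := ℝ) (hf.toLp f) (hg.toLp g)
  refine this.congr ?_
  filter_upwards [hf.coeFn_toLp, hg.coeFn_toLp] with x hx hy
  rw [hx, hy]

theorem integrable_mul_of_memLp {f g : α → ℝ} (hf : MemLp f 2 μ) (hg : MemLp g 2 μ) :
    Integrable (fun x => f x * g x) μ :=
  (integrable_inner_of_memLp hg hf)

theorem abs_integral_inner_le {f g : α → E} (hf : MemLp f 2 μ) (hg : MemLp g 2 μ) :
    |∫ x, ⟪f x, g x⟫ ∂μ| ≤ l2 μ f * l2 μ g := by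
  have := abs_real_inner_le_norm (hf.toLp f) (hg.toLp g)
  rw [L2.inner_def, ← l2_eq_norm, ← l2_eq_norm] at this
  refine (le_of_eq ?_).trans this
  congr 1
  refine integral_congr_ae ?_
  filter_upwards [hf.coeFn_toLp, hg.coeFn_toLp] with x hx hy
  rw [hx, hy]

theorem abs_integral_mul_le {f g : α → ℝ} (hf : MemLp f 2 μ) (hg : MemLp g 2 μ) :
    |∫ x, f x * g x ∂μ| ≤ l2 μ f * l2 μ g := by
  rw [mul_comm]
  exact abs_integral_inner_le hg hf

theorem l2_const_smul (c : ℝ) (f : α → E) : l2 μ (fun x => c • f x) = |c| * l2 μ f := by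
  rw [l2, l2]
  simp_rw [norm_smul, mul_pow]
  rw [integral_const_mul, Real.sqrt_mul (by positivity), Real.norm_eq_abs, Real.sqrt_sq (abs_nonneg c)]

end L2

/-- The `ℓ²` triangle inequality for sums of four terms, with weights. -/
theorem sqrt_sum_sq_le {ι : Type*} (s : Finset ι) (f g : ι → ℝ) (h : ∀ i ∈ s, 0 ≤ f i)
    (hfg : ∀ i ∈ s, f i ≤ g i) : √(∑ i ∈ s, f i ^ 2) ≤ √(∑ i ∈ s, g i ^ 2) := by
  refine Real.sqrt_le_sqrt (Finset.sum_le_sum fun i hi => ?_)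
  have := h i hi; have := hfg i hi
  gcongr

theorem sqrt_sum_add_sq_le {ι : Type*} (s : Finset ι) (f g : ι → ℝ) :
    √(∑ i ∈ s, (f i + g i) ^ 2) ≤ √(∑ i ∈ s, f i ^ 2) + √(∑ i ∈ s, g i ^ 2) := by
  have := norm_add_le (WithLp.toLp 2 fun i : s => f i) (WithLp.toLp 2 fun i : s => g i)
  simpa [EuclideanSpace.norm_eq, Finset.sum_attach s fun i => (f i + g i) ^ 2,
    Finset.sum_attach s fun i => f i ^ 2, Finset.sum_attach s fun i => g i ^ 2] using this

/-! ### Barycentric coordinates -/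

/-- `K` is the vertex set of a nondegenerate `d`-simplex. -/
structure IsSimplex (K : Finset (Pt d)) : Prop where
  indep : AffineIndependent ℝ ((↑) : K → Pt d)
  card : K.card = d + 1

/-- The constant term and the gradient of the barycentric coordinate that is `1` at `a` and vanishes
at the other vertices. -/
def baryCoef (K : Finset (Pt d)) (a : Pt d) : ℝ × Pt d :=
  open Classical in
  Classical.epsilon fun c : ℝ × Pt d => ∀ b ∈ K, c.1 + ⟪c.2, b⟫ = if b = a then 1 else 0

/-- The gradient of the barycentric coordinate of the vertex `a`. -/
def bgrad (K : Finset (Pt d)) (a : Pt d) : Pt d := (baryCoef K a).2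

/-- The barycentric coordinate of the vertex `a`, as a polynomial. -/
def bary (K : Finset (Pt d)) (a : Pt d) : MPoly d :=
  MvPolynomial.C (baryCoef K a).1 + ∑ i, MvPolynomial.C (bgrad K a i) * MvPolynomial.X i

theorem pval_bary (K : Finset (Pt d)) (a x : Pt d) :
    pval (bary K a) x = (baryCoef K a).1 + ⟪bgrad K a, x⟫ := by
  simp [bary, PiLp.inner_apply, mul_comm]

theorem bary_sub (K : Finset (Pt d)) (a x y : Pt d) :
    pval (bary K a) x - pval (bary K a) y = ⟪bgrad K a, x - y⟫ := by
  rw [pval_bary, pval_bary, inner_sub_right]; ring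

@[simp] theorem pgrad_bary (K : Finset (Pt d)) (a x : Pt d) : pgrad (bary K a) x = bgrad K a := by
  ext i
  classical
  simp [bary, MvPolynomial.pderiv_X, Pi.single_apply]

theorem totalDegree_bary_le (K : Finset (Pt d)) (a : Pt d) : (bary K a).totalDegree ≤ 1 := by
  unfold bary
  refine (MvPolynomial.totalDegree_add _ _).trans (max_le (by simp) ?_)
  refine MvPolynomial.totalDegree_finsetSum_le fun i _ => ?_
  refine (MvPolynomial.totalDegree_mul _ _).trans ?_
  simp

theorem mem_facet {K : Finset (Pt d)} {a b : Pt d} : b ∈ facet K a ↔ b ≠ a ∧ b ∈ K := by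
  simp [facet]

namespace IsSimplex

variable {K : Finset (Pt d)} (hK : IsSimplex K)

include hK

/-- The affine basis formed by the vertices. -/
def basis : AffineBasis K ℝ (Pt d) :=
  ⟨(↑), hK.indep, by
    have := hK.indep.affineSpan_eq_top_iff_card_eq_finrank_add_one
    rw [this]
    simp [hK.card]⟩

/-- The coordinate of an affine basis is an affine function; its linear part is represented by a
vector through the Riesz isomorphism. This supplies the pair needed by the choice operator. -/
theorem baryCoef_spec {a : Pt d} (ha : a ∈ K) :
    open Classical in
    ∀ b ∈ K, (baryCoef K a).1 + ⟪(baryCoef K a).2, b⟫ = if b = a then 1 else 0 := by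
  classical
  have : ∃ c : ℝ × Pt d, ∀ b ∈ K, c.1 + ⟪c.2, b⟫ = if b = a then 1 else 0 := by
    let f := hK.basis.coord ⟨a, ha⟩
    let g : Pt d →L[ℝ] ℝ := LinearMap.toContinuousLinearMap f.linear
    refine ⟨(f 0, (InnerProductSpace.toDual ℝ (Pt d)).symm g), fun b hb => ?_⟩
    have h1 := f.linearMap_vsub b 0
    have h2 : f b = if b = a then 1 else 0 := by
      have := hK.basis.coord_apply ⟨a, ha⟩ ⟨b, hb⟩
      simp only [f]
      refine this.trans ?_
      simp [Subtype.ext_iff, eq_comm]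
    have h3 : g b = f b - f 0 := by
      rw [← vsub_eq_sub (f b), ← h1]; simp [g]
    simp only [InnerProductSpace.toDual_symm_apply, h3, h2]
    ring
  convert! Classical.epsilon_spec this

theorem bary_self {a : Pt d} (ha : a ∈ K) : pval (bary K a) a = 1 := by
  rw [pval_bary]; simpa [bgrad] using hK.baryCoef_spec ha a ha

theorem bary_of_ne {a b : Pt d} (ha : a ∈ K) (hb : b ∈ K) (h : b ≠ a) : pval (bary K a) b = 0 := by
  rw [pval_bary]; simpa [bgrad, h] using hK.baryCoef_spec ha b hb

omit hK in
theorem bary_combination (a : Pt d) {t : Pt d → ℝ} (ht : ∑ b ∈ K, t b = 1) :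
    pval (bary K a) (∑ b ∈ K, t b • b) = ∑ b ∈ K, t b * pval (bary K a) b := by
  simp only [pval_bary, inner_sum, inner_smul_right, mul_add, Finset.sum_add_distrib,
    ← Finset.sum_mul, ht, one_mul]

theorem bary_combination_eq {a : Pt d} (ha : a ∈ K) {t : Pt d → ℝ} (ht : ∑ b ∈ K, t b = 1) :
    pval (bary K a) (∑ b ∈ K, t b • b) = t a := by
  classical
  rw [bary_combination (K := K) (t := t) a ht, Finset.sum_eq_single a, hK.bary_self ha, mul_one]
  · intro b hb hba; rw [hK.bary_of_ne ha hb hba, mul_zero]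
  · exact fun h => (h ha).elim

theorem exists_combination (x : Pt d) :
    ∃ t : Pt d → ℝ, ∑ b ∈ K, t b = 1 ∧ ∑ b ∈ K, t b • b = x := by
  classical
  refine ⟨fun b => if h : b ∈ K then hK.basis.coord ⟨b, h⟩ x else 0, ?_, ?_⟩
  · rw [← Finset.sum_coe_sort]
    simpa using hK.basis.sum_coord_apply_eq_one x
  · rw [← Finset.sum_coe_sort]
    refine Eq.trans ?_ (hK.basis.linear_combination_coord_eq_self x)
    rw [Finset.univ_eq_attach]
    simp only [Finset.coe_mem, dite_true, Subtype.coe_eta]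
    rfl

theorem sum_bary (x : Pt d) : ∑ a ∈ K, pval (bary K a) x = 1 := by
  obtain ⟨t, ht, rfl⟩ := hK.exists_combination x
  rw [← ht]
  exact Finset.sum_congr rfl fun a ha => hK.bary_combination_eq ha ht

theorem sum_bary_smul (x : Pt d) : ∑ a ∈ K, pval (bary K a) x • a = x := by
  obtain ⟨t, ht, rfl⟩ := hK.exists_combination x
  exact Finset.sum_congr rfl fun a ha => by rw [hK.bary_combination_eq ha ht]

theorem mem_hull_iff {x : Pt d} : x ∈ hull K ↔ ∀ a ∈ K, 0 ≤ pval (bary K a) x := by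
  constructor
  · intro hx a ha
    obtain ⟨t, h0, h1, rfl⟩ := Finset.mem_convexHull'.1 hx
    rw [hK.bary_combination_eq ha h1]
    exact h0 a ha
  · intro h
    exact Finset.mem_convexHull'.2 ⟨fun a => pval (bary K a) x, h, hK.sum_bary x, hK.sum_bary_smul x⟩

theorem bary_nonneg {a x : Pt d} (ha : a ∈ K) (hx : x ∈ hull K) : 0 ≤ pval (bary K a) x :=
  hK.mem_hull_iff.1 hx a ha

theorem bary_le_one {a x : Pt d} (ha : a ∈ K) (hx : x ∈ hull K) : pval (bary K a) x ≤ 1 := by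
  rw [← hK.sum_bary x]
  exact Finset.single_le_sum (f := fun a => pval (bary K a) x)
    (fun b hb => hK.bary_nonneg hb hx) ha

/-- A combination of the vertices in `s` extends by zero weights to one of all vertices of `K`, and
the weights are the barycentric coordinates. -/
theorem mem_hull_subset_iff {s : Finset (Pt d)} (hs : s ⊆ K) {x : Pt d} :
    x ∈ hull s ↔ x ∈ hull K ∧ ∀ a ∈ K, a ∉ s → pval (bary K a) x = 0 := by
  classical
  constructor
  · intro hx
    refine ⟨convexHull_mono (by exact_mod_cast hs) hx, fun a ha has => ?_⟩
    obtain ⟨t, h0, h1, rfl⟩ := Finset.mem_convexHull'.1 hx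
    have e1 : ∑ b ∈ K, (if b ∈ s then t b else 0) = 1 := by
      rw [← h1, ← Finset.sum_filter]; congr 1; ext b; simpa using fun h => hs h
    have e2 : ∑ b ∈ K, (if b ∈ s then t b else 0) • b = ∑ b ∈ s, t b • b := by
      simp only [ite_smul, zero_smul]
      rw [← Finset.sum_filter]; congr 1; ext b; simpa using fun h => hs h
    rw [← e2, hK.bary_combination_eq ha e1, if_neg has]
  · rintro ⟨hx, h⟩
    have e : ∀ a ∈ K, a ∉ s → pval (bary K a) x • a = 0 := fun a ha hs => by rw [h a ha hs, zero_smul]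
    refine Finset.mem_convexHull'.2 ⟨fun a => pval (bary K a) x,
      fun a ha => hK.bary_nonneg (hs ha) hx, ?_, ?_⟩
    · rw [Finset.sum_subset hs h, hK.sum_bary]
    · rw [Finset.sum_subset hs e, hK.sum_bary_smul]

omit hK in
theorem facet_subset (a : Pt d) : facet K a ⊆ K := by classical exact Finset.erase_subset a K

theorem mem_hull_facet_iff {a : Pt d} (ha : a ∈ K) {x : Pt d} :
    x ∈ hull (facet K a) ↔ x ∈ hull K ∧ pval (bary K a) x = 0 := by
  rw [hK.mem_hull_subset_iff (facet_subset a)]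
  refine and_congr_right fun _ => ⟨fun h => h a ha (by simp [mem_facet]), fun h b hb hbf => ?_⟩
  have : b = a := by by_contra hne; exact hbf (mem_facet.2 ⟨hne, hb⟩)
  rwa [this]

/-! ### Topology and measure of simplices -/

/-- If the coordinate of `a` vanished at an interior point, a small step directly away from `a`
would stay in the simplex and make this coordinate negative. -/
theorem interior_hull : interior (hull K) = {x | ∀ a ∈ K, 0 < pval (bary K a) x} := by
  have hsub : {x | ∀ a ∈ K, 0 < pval (bary K a) x} ⊆ hull K :=
    fun x hx => hK.mem_hull_iff.2 fun a ha => (hx a ha).le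
  have hopen : IsOpen {x : Pt d | ∀ a ∈ K, 0 < pval (bary K a) x} := by
    have : {x : Pt d | ∀ a ∈ K, 0 < pval (bary K a) x} =
        ⋂ a ∈ K, {x | 0 < pval (bary K a) x} := by ext; simp
    rw [this]
    exact isOpen_biInter_finset fun a _ => isOpen_lt continuous_const (by fun_prop)
  refine Set.Subset.antisymm (fun x hx a ha => ?_) (interior_maximal hsub hopen)
  by_contra hle
  have h0 : pval (bary K a) x = 0 :=
    le_antisymm (not_lt.1 hle) (hK.bary_nonneg ha (interior_subset hx))
  have hc : Tendsto (fun t : ℝ => x - t • (a - x)) (𝓝[>] 0) (𝓝 x) := by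
    have : Continuous fun t : ℝ => x - t • (a - x) := by fun_prop
    simpa using (this.tendsto 0).mono_left nhdsWithin_le_nhds
  obtain ⟨t, ht, ht0⟩ := ((hc.eventually (isOpen_interior.mem_nhds hx)).and
    (eventually_mem_nhdsWithin)).exists
  have h1 := hK.bary_nonneg ha (interior_subset ht)
  have h2 := bary_sub K a (x - t • (a - x)) x
  have h3 := bary_sub K a a x
  rw [hK.bary_self ha, h0] at h3
  rw [h0, sub_sub_cancel_left, inner_neg_right, inner_smul_right, ← h3] at h2
  have : 0 < t := ht0
  linarith

theorem nonempty : K.Nonempty := by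
  rw [← Finset.card_pos, hK.card]; omega

theorem interior_nonempty : (interior (hull K)).Nonempty := by
  rw [hK.interior_hull]
  refine ⟨∑ b ∈ K, ((d : ℝ) + 1)⁻¹ • b, fun a ha => ?_⟩
  rw [hK.bary_combination_eq ha (t := fun _ => ((d : ℝ) + 1)⁻¹)]
  · positivity
  · simp [hK.card]; field_simp

omit hK in
theorem isCompact_hull : IsCompact (hull K) := K.finite_toSet.isCompact_convexHull ℝ

omit hK in
theorem measurableSet_hull : MeasurableSet (hull K) := (isCompact_hull).isClosed.measurableSet

omit hK in
theorem convex_hull : Convex ℝ (hull K) := convex_convexHull ℝ _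

omit hK in
theorem volume_frontier_hull : volume (frontier (hull K)) = 0 := convex_hull.addHaar_frontier volume

omit hK in
theorem volume_hull_lt_top : volume (hull K) < ⊤ := isCompact_hull.measure_lt_top

theorem volume_hull_pos : 0 < volume.real (hull K) :=
  ENNReal.toReal_pos (ne_of_gt ((isOpen_interior.measure_pos volume hK.interior_nonempty).trans_le
    (measure_mono interior_subset))) volume_hull_lt_top.ne

theorem poly_eq_of_ae {p q : MPoly d} (h : ∀ᵐ x ∂(volume.restrict (hull K)), pval p x = pval q x) :
    p = q := by
  refine poly_eq_of_eqOn_open isOpen_interior hK.interior_nonempty fun x hx => ?_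
  have h1 : ∀ᵐ x ∂(volume.restrict (interior (hull K))), pval p x = pval q x :=
    ae_restrict_of_ae_restrict_of_subset interior_subset h
  exact Measure.eqOn_open_of_ae_eq h1 isOpen_interior (by fun_prop) (by fun_prop) hx

omit hK in
theorem memLp_of_continuous {E : Type*} [NormedAddCommGroup E] {f : Pt d → E} (hf : Continuous f)
    (p : ENNReal) : MemLp f p (volume.restrict (hull K)) := by
  have : IsFiniteMeasure (volume.restrict (hull K)) := ⟨by
    rw [Measure.restrict_apply_univ]; exact volume_hull_lt_top⟩
  obtain ⟨C, hC⟩ := (isCompact_hull (K := K)).exists_bound_of_continuousOn hf.continuousOn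
  refine MemLp.of_bound hf.aestronglyMeasurable C ?_
  exact (ae_restrict_iff' measurableSet_hull).2 (ae_of_all _ hC)

omit hK in
theorem integrable_of_continuous {E : Type*} [NormedAddCommGroup E] {f : Pt d → E}
    (hf : Continuous f) : Integrable f (volume.restrict (hull K)) :=
  memLp_one_iff_integrable.1 (memLp_of_continuous hf 1)

/-! ### Sizes -/

omit hK in
theorem norm_sub_le_diam {x y : Pt d} (hx : x ∈ hull K) (hy : y ∈ hull K) : ‖x - y‖ ≤ diamK K := by
  rw [← dist_eq_norm]
  exact Metric.dist_le_diam_of_mem isCompact_hull.isBounded hx hy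

omit hK in
theorem mem_hull_of_mem {a : Pt d} (ha : a ∈ K) : a ∈ hull K :=
  subset_convexHull ℝ _ (by exact_mod_cast ha)

omit hK in
theorem diamK_nonneg : 0 ≤ diamK K := Metric.diam_nonneg

-- The witnesses are the two ends of the diameter of the ball in the direction of `ξ`.
omit hK in
theorem exists_width {c : Pt d} {r : ℝ} (hr : 0 < r) (hb : Metric.closedBall c r ⊆ hull K)
    (ξ : Pt d) : ∃ x ∈ hull K, ∃ y ∈ hull K, ⟪ξ, x - y⟫ = 2 * r * ‖ξ‖ := by
  by_cases h : ξ = 0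
  · have := hb (Metric.mem_closedBall_self hr.le)
    exact ⟨c, this, c, this, by simp [h]⟩
  have h0 : ‖ξ‖ ≠ 0 := norm_ne_zero_iff.2 h
  have hn : ‖(r / ‖ξ‖) • ξ‖ = r := by
    rw [norm_smul, Real.norm_eq_abs, abs_of_nonneg (by positivity)]; field_simp
  refine ⟨c + (r / ‖ξ‖) • ξ, hb (by simp [hn]), c - (r / ‖ξ‖) • ξ, hb (by simp [hn]), ?_⟩
  rw [show c + (r / ‖ξ‖) • ξ - (c - (r / ‖ξ‖) • ξ) = (2 * (r / ‖ξ‖)) • ξ by module,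
    inner_smul_right, real_inner_self_eq_norm_sq]
  field_simp

/-- Over the simplex a barycentric coordinate varies by at most one, while over the ball it varies
by `2 * r` times the length of its gradient. Through this bound shape regularity enters the trace
estimates. -/
theorem bgrad_norm_le {c : Pt d} {r : ℝ} (hr : 0 < r) (hb : Metric.closedBall c r ⊆ hull K)
    {a : Pt d} (ha : a ∈ K) : 2 * r * ‖bgrad K a‖ ≤ 1 := by
  obtain ⟨x, hx, y, hy, h⟩ := exists_width hr hb (bgrad K a)
  rw [← h, ← bary_sub]
  linarith [hK.bary_le_one ha hx, hK.bary_nonneg ha hy]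

/-- A linear function attains its extrema over a simplex at vertices, so its variation over the ball
is at most its difference along one edge. The sum over all pairs of vertices avoids singling out
that edge. -/
theorem sq_width_le {c : Pt d} {r : ℝ} (hr : 0 < r) (hb : Metric.closedBall c r ⊆ hull K)
    (ξ : Pt d) : (2 * r * ‖ξ‖) ^ 2 ≤ ∑ a ∈ K, ∑ b ∈ K, ⟪ξ, b - a⟫ ^ 2 := by
  obtain ⟨x, hx, y, hy, h⟩ := exists_width hr hb ξ
  obtain ⟨b, hbK, hbmax⟩ := K.exists_max_image (fun a => ⟪ξ, a⟫) hK.nonempty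
  obtain ⟨a, haK, hamin⟩ := K.exists_min_image (fun a => ⟪ξ, a⟫) hK.nonempty
  have hx' : ⟪ξ, x⟫ ≤ ⟪ξ, b⟫ := by
    rw [← hK.sum_bary_smul x, inner_sum, ← one_mul ⟪ξ, b⟫, ← hK.sum_bary x, Finset.sum_mul]
    refine Finset.sum_le_sum fun c hc => ?_
    rw [inner_smul_right]
    exact mul_le_mul_of_nonneg_left (hbmax c hc) (hK.bary_nonneg hc hx)
  have hy' : ⟪ξ, a⟫ ≤ ⟪ξ, y⟫ := by
    rw [← hK.sum_bary_smul y, inner_sum, ← one_mul ⟪ξ, a⟫, ← hK.sum_bary y, Finset.sum_mul]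
    refine Finset.sum_le_sum fun c hc => ?_
    rw [inner_smul_right]
    exact mul_le_mul_of_nonneg_left (hamin c hc) (hK.bary_nonneg hc hy)
  have h1 : 2 * r * ‖ξ‖ ≤ ⟪ξ, b - a⟫ := by
    rw [← h, inner_sub_right, inner_sub_right]; linarith
  calc (2 * r * ‖ξ‖) ^ 2 ≤ ⟪ξ, b - a⟫ ^ 2 := by gcongr
    _ ≤ ∑ b ∈ K, ⟪ξ, b - a⟫ ^ 2 :=
      Finset.single_le_sum (f := fun b => ⟪ξ, b - a⟫ ^ 2) (fun _ _ => sq_nonneg _) hbK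
    _ ≤ _ := Finset.single_le_sum (f := fun a => ∑ b ∈ K, ⟪ξ, b - a⟫ ^ 2)
      (fun _ _ => Finset.sum_nonneg fun _ _ => sq_nonneg _) haK

/-! ### Normal vectors -/

/-- This identity and the next one are the derivatives of `∑ λ_a = 1` and `∑ λ_a a = x`. The
divergence theorems below are obtained by summing over the vertices with their help. -/
theorem sum_bgrad : ∑ a ∈ K, bgrad K a = 0 := by
  refine ext_inner_right ℝ fun v => ?_
  have h : ∀ a, ⟪bgrad K a, v⟫ = pval (bary K a) v - pval (bary K a) 0 := fun a => by
    rw [bary_sub, sub_zero]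
  simp only [sum_inner, h, Finset.sum_sub_distrib, hK.sum_bary, sub_self, inner_zero_left]

theorem sum_inner_bgrad_smul (v : Pt d) : ∑ a ∈ K, ⟪bgrad K a, v⟫ • a = v := by
  have h : ∀ a, ⟪bgrad K a, v⟫ = pval (bary K a) v - pval (bary K a) 0 := fun a => by
    rw [bary_sub, sub_zero]
  simp only [h, sub_smul, Finset.sum_sub_distrib, hK.sum_bary_smul, sub_zero]

theorem bgrad_ne_zero (hd : 1 ≤ d) {a : Pt d} (ha : a ∈ K) : bgrad K a ≠ 0 := by
  intro h
  obtain ⟨b, hb, hba⟩ := Finset.exists_mem_ne (by rw [hK.card]; omega) a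
  have := bary_sub K a a b
  rw [hK.bary_self ha, hK.bary_of_ne ha hb hba, h] at this
  simp at this

theorem finrank_vectorSpan (hd : 1 ≤ d) {s : Finset (Pt d)} (hs : s ⊆ K) (hcard : s.card = d) :
    Module.finrank ℝ (vectorSpan ℝ (s : Set (Pt d))) = d - 1 := by
  have hi : AffineIndependent ℝ ((↑) : s → Pt d) :=
    hK.indep.comp_embedding (Subtype.impEmbedding _ _ hs)
  have := hi.finrank_vectorSpan (n := d - 1) (by rw [Fintype.card_coe]; omega)
  rwa [show Set.range ((↑) : s → Pt d) = s by ext; simp] at this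

/-- The coordinate of `a` vanishes at all vertices of the opposite facet, so its gradient is
orthogonal to the facet; a count of dimensions shows that there is no other normal direction. -/
theorem vectorSpan_facet_orthogonal (hd : 1 ≤ d) {a : Pt d} (ha : a ∈ K) :
    (vectorSpan ℝ (facet K a : Set (Pt d)))ᗮ = ℝ ∙ bgrad K a := by
  classical
  symm
  refine Submodule.eq_of_le_of_finrank_eq ?_ ?_
  · rw [Submodule.span_singleton_le_iff_mem, Submodule.mem_orthogonal]
    intro u hu
    induction hu using Submodule.span_induction with
    | mem x hx =>
      obtain ⟨y, hy, z, hz, rfl⟩ := Set.mem_vsub.1 hx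
      have hy' := mem_facet.1 (Finset.mem_coe.1 hy)
      have hz' := mem_facet.1 (Finset.mem_coe.1 hz)
      rw [vsub_eq_sub, real_inner_comm, ← bary_sub, hK.bary_of_ne ha hy'.2 hy'.1,
        hK.bary_of_ne ha hz'.2 hz'.1, sub_zero]
    | zero => simp
    | add x y _ _ hx hy => rw [inner_add_left, hx, hy, add_zero]
    | smul c x _ hx => rw [inner_smul_left, hx, mul_zero]
  · rw [finrank_span_singleton (hK.bgrad_ne_zero hd ha)]
    have h1 := (vectorSpan ℝ (facet K a : Set (Pt d))).finrank_add_finrank_orthogonal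
    have hcard : (facet K a).card = d := by
      rw [facet, Finset.card_erase_of_mem ha, hK.card, Nat.add_sub_cancel]
    have h2 := hK.finrank_vectorSpan hd (facet_subset a) hcard
    rw [h2, finrank_euclideanSpace_fin] at h1
    omega

/-- Going from `a` to the barycenter lowers the coordinate of `a` from `1` to `1 / (d + 1)`, so the
projection of this vector to the normal line is a negative multiple of the gradient. -/
theorem normal_eq (hd : 1 ≤ d) {a : Pt d} (ha : a ∈ K) :
    normal K a = -(‖bgrad K a‖⁻¹ • bgrad K a) := by
  have h0 := norm_pos_iff.2 (hK.bgrad_ne_zero hd ha)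
  have hc : ⟪bgrad K a, (K.card : ℝ)⁻¹ • ∑ p ∈ K, p - a⟫ = ((d : ℝ) + 1)⁻¹ - 1 := by
    rw [← bary_sub, hK.bary_self ha, Finset.smul_sum,
      hK.bary_combination_eq ha (t := fun _ => (K.card : ℝ)⁻¹)]
    · rw [hK.card]; push_cast; ring
    · simp [hK.card]; field_simp
  have hneg : ((d : ℝ) + 1)⁻¹ - 1 < 0 := by
    have : ((d : ℝ) + 1)⁻¹ < 1 := inv_lt_one_of_one_lt₀ (by
      have : (1 : ℝ) ≤ d := by exact_mod_cast hd
      linarith)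
    linarith
  have hraw : rawNormal K a = ((((d : ℝ) + 1)⁻¹ - 1) / ‖bgrad K a‖ ^ 2) • bgrad K a := by
    unfold rawNormal
    have := hK.vectorSpan_facet_orthogonal hd ha
    rw [show (vectorSpan ℝ (facet K a : Set (Pt d)))ᗮ.starProjection =
      (ℝ ∙ bgrad K a).starProjection by congr!]
    rw [Submodule.starProjection_singleton, hc]
    simp
  rw [normal, hraw, norm_smul, Real.norm_eq_abs, abs_of_neg (div_neg_of_neg_of_pos hneg (by positivity)),
    smul_smul, ← neg_smul]
  congr 1
  generalize ((d : ℝ) + 1)⁻¹ - 1 = t at hneg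
  have := hneg.ne
  field_simp

end IsSimplex

/-! ### Slicing -/

section Slicing

variable {n : Pt d}

/-- The coordinates consisting of the component along the unit vector `n` and the component
orthogonal to `n`, centered at `a`. -/
theorem measurePreserving_slice (hn : ‖n‖ = 1) (a : Pt d) :
    MeasurePreserving (fun p : ℝ × (ℝ ∙ n)ᗮ => a + p.1 • n + p.2) volume volume ∧
      MeasurableEmbedding (fun p : ℝ × (ℝ ∙ n)ᗮ => a + p.1 • n + p.2) := by
  have h1 := ((ℝ ∙ n).measurePreserving_measurableEquivProd a).symm
  have h2 := (LinearIsometryEquiv.toSpanUnitSingleton (𝕜 := ℝ) n hn).measurePreserving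
  have h3 : MeasurePreserving (Prod.map (LinearIsometryEquiv.toSpanUnitSingleton (𝕜 := ℝ) n hn)
    (id : (ℝ ∙ n)ᗮ → (ℝ ∙ n)ᗮ)) volume volume := h2.prod (MeasurePreserving.id volume)
  have e : (fun p : ℝ × (ℝ ∙ n)ᗮ => a + p.1 • n + p.2) = ((ℝ ∙ n).measurableEquivProd a).symm ∘
      (Prod.map (LinearIsometryEquiv.toSpanUnitSingleton (𝕜 := ℝ) n hn)
        (id : (ℝ ∙ n)ᗮ → (ℝ ∙ n)ᗮ)) := by
    funext p
    simp only [Function.comp, Submodule.measurableEquivProd_symm_apply, Prod.map]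
    simp [LinearIsometryEquiv.toSpanUnitSingleton_apply]
    abel
  have hvol : (μHE[Module.finrank ℝ (Pt d)] : Measure (Pt d)) = volume :=
    InnerProductSpace.euclideanHausdorffMeasure_eq_volume
  rw [hvol] at h1
  rw [e]
  refine ⟨h1.comp h3, ((ℝ ∙ n).measurableEquivProd a).symm.measurableEmbedding.comp ?_⟩
  exact ((LinearIsometryEquiv.toSpanUnitSingleton (𝕜 := ℝ) n
    hn).toHomeomorph.toMeasurableEquiv.prodCongr (MeasurableEquiv.refl _)).measurableEmbedding

theorem isometry_orthogonal_add (c : Pt d) : Isometry (fun y : (ℝ ∙ n)ᗮ => c + y) :=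
  fun x y => by simp [edist_add_left, Subtype.edist_eq]

theorem finrank_orthogonal_unit (hn : ‖n‖ = 1) : Module.finrank ℝ (ℝ ∙ n)ᗮ = d - 1 := by
  have h1 := (ℝ ∙ n).finrank_add_finrank_orthogonal
  rw [finrank_span_singleton (by rintro rfl; simp at hn), finrank_euclideanSpace_fin] at h1
  omega

/-- The embedding of the hyperplane is an isometry and hence carries its Lebesgue measure to the
Hausdorff measure of dimension `d - 1`. Facet integrals thereby become ordinary integrals over a
hyperplane. -/
theorem restrict_hausdorff_eq (hn : ‖n‖ = 1) (c : Pt d) {s : Set (Pt d)} (hs : MeasurableSet s)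
    (hsub : s ⊆ Set.range (fun y : (ℝ ∙ n)ᗮ => c + y)) :
    (μHE[d - 1] : Measure (Pt d)).restrict s =
      (volume.restrict ((fun y : (ℝ ∙ n)ᗮ => c + (y : Pt d)) ⁻¹' s)).map
        (fun y : (ℝ ∙ n)ᗮ => c + (y : Pt d)) := by
  have hi := isometry_orthogonal_add (n := n) c
  have h := hi.map_euclideanHausdorffMeasure (d := Module.finrank ℝ (ℝ ∙ n)ᗮ)
  rw [InnerProductSpace.euclideanHausdorffMeasure_eq_volume, finrank_orthogonal_unit hn] at h
  rw [← Measure.restrict_map hi.continuous.measurable hs, h, Measure.restrict_restrict hs,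
    Set.inter_eq_left.2 hsub]

end Slicing

/-! ### The divergence theorem on simplices -/

namespace IsSimplex

variable {K : Finset (Pt d)} (hK : IsSimplex K)

include hK

theorem norm_normal (hd : 1 ≤ d) {a : Pt d} (ha : a ∈ K) : ‖normal K a‖ = 1 := by
  have h0 := norm_pos_iff.2 (hK.bgrad_ne_zero hd ha)
  rw [hK.normal_eq hd ha, norm_neg, norm_smul, norm_inv, norm_norm, inv_mul_cancel₀ h0.ne']

theorem bgrad_eq (hd : 1 ≤ d) {a : Pt d} (ha : a ∈ K) :
    bgrad K a = -(‖bgrad K a‖ • normal K a) := by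
  have h0 := norm_pos_iff.2 (hK.bgrad_ne_zero hd ha)
  rw [hK.normal_eq hd ha, smul_neg, neg_neg, smul_smul, mul_inv_cancel₀ h0.ne', one_smul]

theorem inner_bgrad_normal (hd : 1 ≤ d) {a : Pt d} (ha : a ∈ K) :
    ⟪bgrad K a, normal K a⟫ = -‖bgrad K a‖ := by
  conv_lhs => rw [hK.bgrad_eq hd ha]
  rw [inner_neg_left, inner_smul_left, real_inner_self_eq_norm_sq, hK.norm_normal hd ha]
  simp

/-- The foot of the altitude from `a`. -/
theorem bary_altitude (hd : 1 ≤ d) {a : Pt d} (ha : a ∈ K) (s : ℝ)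
    (y : (ℝ ∙ normal K a)ᗮ) :
    pval (bary K a) (a + s • normal K a + y) = 1 - s * ‖bgrad K a‖ := by
  have h := bary_sub K a (a + s • normal K a + y) a
  have hy : ⟪bgrad K a, (y : Pt d)⟫ = 0 := by
    rw [hK.bgrad_eq hd ha, inner_neg_left, inner_smul_left,
      Submodule.mem_orthogonal_singleton_iff_inner_right.1 y.2]
    simp
  rw [hK.bary_self ha, show a + s • normal K a + y - a = s • normal K a + (y : Pt d) by abel,
    inner_add_right, hy, inner_smul_right, hK.inner_bgrad_normal hd ha] at h
  linarith

/-- The coordinates of the vertices other than `a` vanish at `a`, hence are linear along rays from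
`a`. So the simplex is a cone with apex `a` over the opposite facet, and `‖bgrad K a‖⁻¹` is its
height. -/
theorem mem_hull_cone (hd : 1 ≤ d) {a : Pt d} (ha : a ∈ K) {s : ℝ} (hs : 0 < s)
    (y : (ℝ ∙ normal K a)ᗮ) :
    a + s • normal K a + ((s * ‖bgrad K a‖) • y : (ℝ ∙ normal K a)ᗮ) ∈ hull K ↔
      s ≤ ‖bgrad K a‖⁻¹ ∧ a + ‖bgrad K a‖⁻¹ • normal K a + y ∈ hull (facet K a) := by
  have h0 := norm_pos_iff.2 (hK.bgrad_ne_zero hd ha)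
  have hself : pval (bary K a) (a + ‖bgrad K a‖⁻¹ • normal K a + y) = 0 := by
    rw [hK.bary_altitude hd ha, inv_mul_cancel₀ h0.ne', sub_self]
  have hne : ∀ b ∈ K, b ≠ a →
      pval (bary K b) (a + s • normal K a + ((s * ‖bgrad K a‖) • y : (ℝ ∙ normal K a)ᗮ)) =
      (s * ‖bgrad K a‖) * pval (bary K b) (a + ‖bgrad K a‖⁻¹ • normal K a + y) := by
    intro b hb hba
    have h1 := bary_sub K b (a + s • normal K a + ((s * ‖bgrad K a‖) • y : (ℝ ∙ normal K a)ᗮ)) a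
    have h2 := bary_sub K b (a + ‖bgrad K a‖⁻¹ • normal K a + y) a
    rw [hK.bary_of_ne hb ha hba.symm, sub_zero] at h1 h2
    rw [h1, h2, ← inner_smul_right]
    congr 1
    push_cast
    rw [show a + ‖bgrad K a‖⁻¹ • normal K a + (y : Pt d) - a = ‖bgrad K a‖⁻¹ • normal K a + y by abel,
      smul_add, smul_smul, mul_assoc, mul_inv_cancel₀ h0.ne', mul_one]
    abel
  have hp : 0 < s * ‖bgrad K a‖ := by positivity
  rw [hK.mem_hull_facet_iff ha, hK.mem_hull_iff, hK.mem_hull_iff]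
  constructor
  · intro h
    refine ⟨?_, fun b hb => ?_, hself⟩
    · have := h a ha
      rw [hK.bary_altitude hd ha] at this
      rw [← one_div, le_div_iff₀ h0]; linarith
    · by_cases hba : b = a
      · rw [hba, hself]
      · have := h b hb
        rw [hne b hb hba] at this
        exact nonneg_of_mul_nonneg_right this hp
  · rintro ⟨h1, h2, -⟩ b hb
    by_cases hba : b = a
    · subst hba
      rw [hK.bary_altitude hd ha]
      rw [← one_div, le_div_iff₀ h0] at h1; linarith
    · rw [hne b hb hba]
      exact mul_nonneg hp.le (h2 b hb)

theorem hull_facet_subset_range (hd : 1 ≤ d) {a : Pt d} (ha : a ∈ K) :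
    hull (facet K a) ⊆ Set.range
      (fun y : (ℝ ∙ normal K a)ᗮ => a + ‖bgrad K a‖⁻¹ • normal K a + (y : Pt d)) := by
  have h0 := norm_pos_iff.2 (hK.bgrad_ne_zero hd ha)
  intro x hx
  have h1 := ((hK.mem_hull_facet_iff ha).1 hx).2
  refine ⟨⟨x - (a + ‖bgrad K a‖⁻¹ • normal K a), ?_⟩, by simp⟩
  rw [Submodule.mem_orthogonal_singleton_iff_inner_right]
  have h2 := bary_sub K a x (a + ‖bgrad K a‖⁻¹ • normal K a + ((0 : (ℝ ∙ normal K a)ᗮ) : Pt d))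
  rw [h1, hK.bary_altitude hd ha, inv_mul_cancel₀ h0.ne'] at h2
  have h3 : ⟪bgrad K a, x - (a + ‖bgrad K a‖⁻¹ • normal K a)⟫ = 0 := by simpa using h2.symm
  rw [hK.normal_eq hd ha, inner_neg_left, inner_smul_left, ← hK.normal_eq hd ha, h3, mul_zero,
    neg_zero]

theorem surf_eq (hd : 1 ≤ d) {a : Pt d} (ha : a ∈ K) :
    surf (facet K a) = (volume.restrict ((fun y : (ℝ ∙ normal K a)ᗮ =>
        a + ‖bgrad K a‖⁻¹ • normal K a + (y : Pt d)) ⁻¹' hull (facet K a))).map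
        (fun y : (ℝ ∙ normal K a)ᗮ => a + ‖bgrad K a‖⁻¹ • normal K a + (y : Pt d)) :=
  restrict_hausdorff_eq (hK.norm_normal hd ha) _ measurableSet_hull (hK.hull_facet_subset_range hd ha)

omit hK in
theorem isCompact_facet_slice (a c : Pt d) :
    IsCompact ((fun y : (ℝ ∙ normal K a)ᗮ => c + (y : Pt d)) ⁻¹' hull (facet K a)) :=
  (isometry_orthogonal_add c).isClosedEmbedding.isCompact_preimage isCompact_hull

theorem integral_surf (hd : 1 ≤ d) {a : Pt d} (ha : a ∈ K) (φ : Pt d → ℝ) :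
    ∫ x, φ x ∂(surf (facet K a)) = ∫ y in ((fun y : (ℝ ∙ normal K a)ᗮ =>
        a + ‖bgrad K a‖⁻¹ • normal K a + (y : Pt d)) ⁻¹' hull (facet K a)),
        φ (a + ‖bgrad K a‖⁻¹ • normal K a + (y : Pt d)) := by
  rw [hK.surf_eq hd ha]
  exact (isometry_orthogonal_add _).isClosedEmbedding.measurableEmbedding.integral_map _

theorem isFiniteMeasure_surf (hd : 1 ≤ d) {a : Pt d} (ha : a ∈ K) :
    IsFiniteMeasure (surf (facet K a)) := by
  have : IsFiniteMeasure (volume.restrict ((fun y : (ℝ ∙ normal K a)ᗮ =>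
        a + ‖bgrad K a‖⁻¹ • normal K a + (y : Pt d)) ⁻¹' hull (facet K a))) :=
    ⟨by rw [Measure.restrict_apply_univ]; exact (isCompact_facet_slice a _).measure_lt_top⟩
  rw [hK.surf_eq hd ha]
  infer_instance

omit hK in
theorem ae_surf_mem (e : Finset (Pt d)) : ∀ᵐ x ∂(surf e), x ∈ hull e :=
  ae_restrict_mem measurableSet_hull

theorem memLp_surf_of_continuous (hd : 1 ≤ d) {a : Pt d} (ha : a ∈ K) {E : Type*}
    [NormedAddCommGroup E] {f : Pt d → E} (hf : Continuous f) (p : ENNReal) :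
    MemLp f p (surf (facet K a)) := by
  have := hK.isFiniteMeasure_surf hd ha
  obtain ⟨C, hC⟩ := (isCompact_hull (K := facet K a)).exists_bound_of_continuousOn hf.continuousOn
  refine MemLp.of_bound hf.aestronglyMeasurable C ?_
  filter_upwards [ae_surf_mem _] with x hx using hC x hx

theorem integrable_surf_of_continuous (hd : 1 ≤ d) {a : Pt d} (ha : a ∈ K) {E : Type*}
    [NormedAddCommGroup E] {f : Pt d → E} (hf : Continuous f) :
    Integrable f (surf (facet K a)) :=
  memLp_one_iff_integrable.1 (hK.memLp_surf_of_continuous hd ha hf 1)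

-- The integrand is the derivative of `D * (τ ^ d * φ (a + τ • z))` with `τ = s * D⁻¹`.
omit hK in
theorem integral_radial (hd : 1 ≤ d) {φ : Pt d → ℝ} (hφ : ContDiff ℝ 1 φ) (a z : Pt d) {D : ℝ}
    (hD : 0 < D) :
    ∫ s in Set.Ioc 0 D, (s * D⁻¹) ^ (d - 1) * (d * φ (a + (s * D⁻¹) • z) +
      ⟪∇ φ (a + (s * D⁻¹) • z), (s * D⁻¹) • z⟫) = D * φ (a + z) := by
  have hder : ∀ s ∈ Set.uIcc 0 D, HasDerivAt (fun s : ℝ => D * ((s * D⁻¹) ^ d * φ (a + (s * D⁻¹) • z)))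
      ((s * D⁻¹) ^ (d - 1) * (d * φ (a + (s * D⁻¹) • z) +
      ⟪∇ φ (a + (s * D⁻¹) • z), (s * D⁻¹) • z⟫)) s := by
    intro s _
    have h1 : HasDerivAt (fun s : ℝ => s * D⁻¹) D⁻¹ s := by simpa using (hasDerivAt_id s).mul_const D⁻¹
    have h2 : HasDerivAt (fun s : ℝ => a + (s * D⁻¹) • z) (D⁻¹ • z) s :=
      (h1.smul_const z).const_add a
    have h3 : HasDerivAt (fun s : ℝ => φ (a + (s * D⁻¹) • z))
        (⟪∇ φ (a + (s * D⁻¹) • z), D⁻¹ • z⟫) s := by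
      have hg := (hφ.differentiable (by norm_num) (a + (s * D⁻¹) • z)).hasGradientAt
      have := (hasGradientAt_iff_hasFDerivAt.1 hg).comp_hasDerivAt s h2
      simp only [InnerProductSpace.toDual_apply_apply] at this
      exact this
    have h4 := ((h1.pow d).mul h3).const_mul D
    convert! h4 using 1
    simp only [inner_smul_right, Pi.pow_apply]
    obtain ⟨m, rfl⟩ : ∃ m, d = m + 1 := ⟨d - 1, by omega⟩
    simp only [Nat.add_sub_cancel, pow_succ]
    field_simp
  rw [← intervalIntegral.integral_of_le hD.le]
  have hcont : Continuous fun x => ∇ φ x := by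
    unfold gradient
    exact (LinearIsometryEquiv.continuous _).comp (hφ.continuous_fderiv (by norm_num))
  rw [intervalIntegral.integral_eq_sub_of_hasDerivAt hder]
  · rw [mul_inv_cancel₀ hD.ne']
    obtain ⟨m, rfl⟩ : ∃ m, d = m + 1 := ⟨d - 1, by omega⟩
    simp
  · have hφc := hφ.continuous
    apply Continuous.intervalIntegrable
    fun_prop

/-- The integrand is the divergence of `φ(x) (x - a)`, a field that is tangential on the facets
through `a` and has normal component `φ` times the height on the opposite facet. The proof slices
the simplex orthogonally to the altitude, rescales every slice to the facet, exchanges the integrals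
and integrates along the rays from `a`. -/
theorem integral_cone (hd : 1 ≤ d) {a : Pt d} (ha : a ∈ K) {φ : Pt d → ℝ} (hφ : ContDiff ℝ 1 φ) :
    ∫ x in hull K, (d * φ x + ⟪∇ φ x, x - a⟫) =
      ‖bgrad K a‖⁻¹ * ∫ x, φ x ∂(surf (facet K a)) := by
  have h0 := norm_pos_iff.2 (hK.bgrad_ne_zero hd ha)
  have hn := hK.norm_normal hd ha
  set D := ‖bgrad K a‖⁻¹ with hD
  have hD0 : 0 < D := by positivity
  have hDi : ‖bgrad K a‖ = D⁻¹ := by rw [hD, inv_inv]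
  set n := normal K a
  set e := (fun y : (ℝ ∙ n)ᗮ => a + D • n + (y : Pt d)) ⁻¹' hull (facet K a) with he
  have hec : IsCompact e := isCompact_facet_slice a _
  have hcont : Continuous fun x => ∇ φ x := by
    unfold gradient
    exact (LinearIsometryEquiv.continuous _).comp (hφ.continuous_fderiv (by norm_num))
  have hφc := hφ.continuous
  set F : Pt d → ℝ := fun x => d * φ x + ⟪∇ φ x, x - a⟫ with hF
  have hFc : Continuous F := by fun_prop
  obtain ⟨hmp, hme⟩ := measurePreserving_slice hn a
  have hint : Integrable (fun p : ℝ × (ℝ ∙ n)ᗮ => (hull K).indicator F (a + p.1 • n + p.2))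
      (volume.prod volume) := by
    have := (integrable_indicator_iff measurableSet_hull).2 (integrable_of_continuous (K := K) hFc)
    exact (hmp.integrable_comp_emb hme).2 this
  -- Only slices at distance `s ∈ (0, D]` from the apex matter. Rescaling such a slice to the facet
  -- produces the Jacobian `(s * D⁻¹) ^ (d - 1)`; at `s = 0` the scaling degenerates, but this is a
  -- null set.
  have key : ∀ s : ℝ, s ≠ 0 → ∫ y : (ℝ ∙ n)ᗮ, (hull K).indicator F (a + s • n + y) =
      (Set.Ioc 0 D).indicator (fun s => ∫ y in e, (s * D⁻¹) ^ (d - 1) *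
        F (a + (s * D⁻¹) • (D • n + (y : Pt d)))) s := by
    intro s hs
    by_cases hpos : 0 < s
    swap
    · rw [Set.indicator_of_notMem (fun h => hpos h.1)]
      have : ∀ y : (ℝ ∙ n)ᗮ, (hull K).indicator F (a + s • n + y) = 0 := fun y => by
        refine Set.indicator_of_notMem (fun h => ?_) _
        have h1 := hK.bary_le_one ha h
        rw [hK.bary_altitude hd ha] at h1
        have : s < 0 := lt_of_le_of_ne (not_lt.1 hpos) hs
        nlinarith
      simp [this]
    have hsD : 0 < s * D⁻¹ := by positivity
    have h1 := Measure.integral_comp_smul (μ := (volume : Measure (ℝ ∙ n)ᗮ))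
      (fun y => (hull K).indicator F (a + s • n + y)) (s * D⁻¹)
    rw [finrank_orthogonal_unit hn, abs_of_nonneg (by positivity)] at h1
    have h2 : ∫ y : (ℝ ∙ n)ᗮ, (hull K).indicator F (a + s • n + y) = (s * D⁻¹) ^ (d - 1) *
        ∫ y : (ℝ ∙ n)ᗮ, (hull K).indicator F (a + s • n + ((s * D⁻¹) • y : (ℝ ∙ n)ᗮ)) := by
      rw [h1, smul_eq_mul, ← mul_assoc, mul_inv_cancel₀ (by positivity), one_mul]
    rw [h2]
    have hmem : ∀ y : (ℝ ∙ n)ᗮ, a + s • n + ((s * D⁻¹) • y : (ℝ ∙ n)ᗮ) ∈ hull K ↔ s ≤ D ∧ y ∈ e := by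
      intro y
      have := hK.mem_hull_cone hd ha hpos y
      rw [hDi, show (D⁻¹)⁻¹ = D from inv_inv D] at this
      exact this
    by_cases hsle : s ≤ D
    · rw [Set.indicator_of_mem (Set.mem_Ioc.2 ⟨hpos, hsle⟩), integral_const_mul, ← integral_indicator hec.measurableSet]
      congr 1
      refine integral_congr_ae (ae_of_all _ fun y => ?_)
      simp only
      by_cases hy : y ∈ e
      · rw [Set.indicator_of_mem ((hmem y).2 ⟨hsle, hy⟩), Set.indicator_of_mem hy]
        congr 1
        push_cast
        rw [smul_add, smul_smul, mul_assoc, inv_mul_cancel₀ hD0.ne', mul_one]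
        abel
      · rw [Set.indicator_of_notMem (fun h => hy ((hmem y).1 h).2), Set.indicator_of_notMem hy]
    · rw [Set.indicator_of_notMem (fun h => hsle h.2)]
      have : ∀ y : (ℝ ∙ n)ᗮ, (hull K).indicator F (a + s • n + ((s * D⁻¹) • y : (ℝ ∙ n)ᗮ)) = 0 :=
        fun y => Set.indicator_of_notMem (fun h => hsle ((hmem y).1 h).1) _
      simp only [this, integral_zero, mul_zero]
  calc ∫ x in hull K, F x = ∫ x, (hull K).indicator F x := (integral_indicator measurableSet_hull).symm
    _ = ∫ p : ℝ × (ℝ ∙ n)ᗮ, (hull K).indicator F (a + p.1 • n + p.2) :=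
      (hmp.integral_comp hme _).symm
    _ = ∫ s : ℝ, ∫ y : (ℝ ∙ n)ᗮ, (hull K).indicator F (a + s • n + y) := integral_prod _ hint
    _ = ∫ s : ℝ, (Set.Ioc 0 D).indicator (fun s => ∫ y in e, (s * D⁻¹) ^ (d - 1) *
        F (a + (s * D⁻¹) • (D • n + (y : Pt d)))) s := by
      refine integral_congr_ae ?_
      filter_upwards [Measure.ae_ne volume (0 : ℝ)] with s hs using key s hs
    _ = ∫ s in Set.Ioc 0 D, ∫ y in e, (s * D⁻¹) ^ (d - 1) *
        F (a + (s * D⁻¹) • (D • n + (y : Pt d))) := integral_indicator measurableSet_Ioc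
    _ = ∫ y in e, ∫ s in Set.Ioc 0 D, (s * D⁻¹) ^ (d - 1) *
        F (a + (s * D⁻¹) • (D • n + (y : Pt d))) := by
      refine integral_integral_swap ?_
      rw [Measure.prod_restrict]
      refine IntegrableOn.mono_set (t := Set.Icc 0 D ×ˢ e) ?_
        (Set.prod_mono Set.Ioc_subset_Icc_self le_rfl)
      refine ContinuousOn.integrableOn_compact (isCompact_Icc.prod hec) (Continuous.continuousOn ?_)
      unfold Function.uncurry
      fun_prop
    _ = ∫ y in e, D * φ (a + D • n + (y : Pt d)) := by
      refine integral_congr_ae (ae_of_all _ fun y => ?_)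
      simp only [hF, add_sub_cancel_left, add_assoc]
      exact integral_radial hd hφ a _ hD0
    _ = D * ∫ x, φ x ∂(surf (facet K a)) := by
      rw [integral_const_mul, hK.integral_surf hd ha φ]

/-- The divergence theorem for a `C¹` function times a constant vector. -/
theorem integral_inner_gradient (hd : 1 ≤ d) {φ : Pt d → ℝ} (hφ : ContDiff ℝ 1 φ) (c : Pt d) :
    ∫ x in hull K, ⟪∇ φ x, c⟫ =
      ∑ a ∈ K, ⟪c, normal K a⟫ * ∫ x, φ x ∂(surf (facet K a)) := by
  have hg := continuous_gradient hφ
  have hφc := hφ.continuous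
  -- The weights `-⟪bgrad K a, c⟫` sum to zero, which removes the terms that do not depend on the
  -- vertex. The remaining terms combine to `⟪∇ φ x, c⟫` because `∑ ⟪bgrad K a, c⟫ • a = c`.
  have hsum : ∀ x, ⟪∇ φ x, c⟫ = ∑ a ∈ K, -⟪bgrad K a, c⟫ * (d * φ x + ⟪∇ φ x, x - a⟫) := by
    intro x
    have h1 : ∑ a ∈ K, ⟪bgrad K a, c⟫ = 0 := by
      rw [← sum_inner, hK.sum_bgrad, inner_zero_left]
    have h2 := congrArg (fun v => ⟪∇ φ x, v⟫) (hK.sum_inner_bgrad_smul c)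
    simp only [inner_sum, inner_smul_right] at h2
    rw [← h2]
    have h3 : ∀ a, -⟪bgrad K a, c⟫ * (d * φ x + ⟪∇ φ x, x - a⟫) =
        ⟪bgrad K a, c⟫ * ⟪∇ φ x, a⟫ - ⟪bgrad K a, c⟫ * (d * φ x + ⟪∇ φ x, x⟫) := fun a => by
      rw [inner_sub_right]; ring
    simp only [h3, Finset.sum_sub_distrib, ← Finset.sum_mul, h1]
    ring
  simp only [hsum]
  rw [integral_finsetSum _ fun a _ => (integrable_of_continuous (by fun_prop))]
  refine Finset.sum_congr rfl fun a ha => ?_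
  have h0 := norm_pos_iff.2 (hK.bgrad_ne_zero hd ha)
  rw [integral_const_mul, hK.integral_cone hd ha hφ, hK.normal_eq hd ha, inner_neg_right,
    inner_smul_right, real_inner_comm]
  ring

/-- The divergence theorem for a smooth function times a polynomial vector field. -/
theorem integral_divergence (hd : 1 ≤ d) {φ : Pt d → ℝ} (hφ : ContDiff ℝ 1 φ) (Q : Fin d → MPoly d) :
    (∫ x in hull K, φ x * pval (pdiv Q) x) + ∫ x in hull K, ⟪vval Q x, ∇ φ x⟫ =
      bdryInt K fun a x => ⟪vval Q x, normal K a⟫ * φ x := by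
  have hg := continuous_gradient hφ
  have hφc := hφ.continuous
  have hi : ∀ i, ∫ x in hull K, (φ x * pval (MvPolynomial.pderiv i (Q i)) x +
      pval (Q i) x * (∇ φ x) i) =
        ∑ a ∈ K, normal K a i * ∫ x, φ x * pval (Q i) x ∂(surf (facet K a)) := by
    intro i
    have h := hK.integral_inner_gradient hd
      (hφ.mul ((contDiff_pval (Q i)).of_le (by exact_mod_cast le_top)))
      (EuclideanSpace.single i (1 : ℝ))
    have e : ∀ x, ⟪∇ (fun y => φ y * pval (Q i) y) x, EuclideanSpace.single i (1 : ℝ)⟫ =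
        φ x * pval (MvPolynomial.pderiv i (Q i)) x + pval (Q i) x * (∇ φ x) i := by
      intro x
      have h1 := hasGradientAt_iff_hasFDerivAt.1
        (hφ.differentiable (by norm_num) x).hasGradientAt
      have h2 := hasGradientAt_iff_hasFDerivAt.1 (hasGradientAt_pval (Q i) x)
      have h3 := (h1.mul h2)
      have h4 : HasGradientAt (fun y => φ y * pval (Q i) y)
          (φ x • pgrad (Q i) x + pval (Q i) x • ∇ φ x) x := by
        rw [hasGradientAt_iff_hasFDerivAt, map_add, map_smul, map_smul]
        exact h3
      rw [h4.gradient]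
      generalize ∇ φ x = g
      simp [inner_add_left, inner_smul_left, EuclideanSpace.inner_single_right]
    simp only [e, EuclideanSpace.inner_single_left] at h
    simpa using h
  have hs := congrArg (fun f : Fin d → ℝ => ∑ i, f i) (funext hi)
  simp only at hs
  rw [← integral_finsetSum _ fun i _ => integrable_of_continuous (by fun_prop)] at hs
  rw [← integral_add (integrable_of_continuous (by fun_prop)) (integrable_of_continuous (by fun_prop))]
  rw [bdryInt]
  refine Eq.trans ?_ (hs.trans ?_)
  · refine integral_congr_ae (ae_of_all _ fun x => ?_)
    simp only [pdiv, PiLp.inner_apply, pval_sum, vval_apply, Finset.mul_sum,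
      Finset.sum_add_distrib]
    congr 1
    refine Finset.sum_congr rfl fun i _ => ?_
    simp only [RCLike.inner_apply, RCLike.conj_to_real, mul_comm]
  · rw [Finset.sum_comm]
    refine Finset.sum_congr rfl fun a ha => ?_
    simp only [← integral_const_mul]
    rw [← integral_finsetSum _ fun i _ => hK.integrable_surf_of_continuous hd ha (by fun_prop)]
    refine integral_congr_ae (ae_of_all _ fun x => ?_)
    simp only [PiLp.inner_apply, vval_apply, Finset.sum_mul]
    refine Finset.sum_congr rfl fun i _ => ?_
    simp
    ring

/-- The trace inequality on a facet. -/
theorem trace_inequality (hd : 1 ≤ d) {a : Pt d} (ha : a ∈ K) (p : MPoly d) :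
    ∫ x, pval p x ^ 2 ∂(surf (facet K a)) ≤ ‖bgrad K a‖ *
      (d * l2 (volume.restrict (hull K)) (pval p) ^ 2 +
        2 * diamK K * l2 (volume.restrict (hull K)) (pval p) *
          l2 (volume.restrict (hull K)) (pgrad p)) := by
  have h0 := norm_pos_iff.2 (hK.bgrad_ne_zero hd ha)
  -- The cone identity for `p ^ 2` turns the facet integral into volume integrals. Its gradient term
  -- is then bounded by `‖x - a‖ ≤ diamK K` and Cauchy-Schwarz.
  have h := hK.integral_cone hd ha ((contDiff_pval (p ^ 2)).of_le (by exact_mod_cast le_top))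
  simp only [gradient_pval, pval_pow] at h
  have e : ∫ x, pval p x ^ 2 ∂(surf (facet K a)) =
      ‖bgrad K a‖ * ∫ x in hull K, (d * pval p x ^ 2 + ⟪pgrad (p ^ 2) x, x - a⟫) := by
    rw [h, ← mul_assoc, mul_inv_cancel₀ h0.ne', one_mul]
  rw [e, integral_add (integrable_of_continuous (by fun_prop))
    (integrable_of_continuous (by fun_prop)), integral_const_mul, l2_sq]
  simp only [Real.norm_eq_abs, sq_abs]
  gcongr
  have hp : MemLp (pval p) 2 (volume.restrict (hull K)) := memLp_of_continuous (by fun_prop) 2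
  have hq : MemLp (fun x => diamK K * ‖pgrad p x‖) 2 (volume.restrict (hull K)) :=
    memLp_of_continuous (by fun_prop) 2
  have e2 : ∀ x ∈ hull K, ⟪pgrad (p ^ 2) x, x - a⟫ ≤ 2 * (|pval p x| * (diamK K * ‖pgrad p x‖)) := by
    intro x hx
    have : pgrad (p ^ 2) x = (2 * pval p x) • pgrad p x := by
      rw [sq, pgrad_mul]; module
    rw [this, inner_smul_left]
    refine (le_abs_self _).trans ?_
    rw [abs_mul]
    have h1 := abs_real_inner_le_norm (pgrad p x) (x - a)
    have h2 := norm_sub_le_diam hx (mem_hull_of_mem ha)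
    have h3 : |⟪pgrad p x, x - a⟫| ≤ diamK K * ‖pgrad p x‖ := by
      rw [mul_comm]; exact h1.trans (by gcongr)
    simp only [RCLike.conj_to_real, abs_mul, abs_two]
    rw [mul_assoc]
    gcongr
  calc ∫ x in hull K, ⟪pgrad (p ^ 2) x, x - a⟫
      ≤ ∫ x in hull K, 2 * (|pval p x| * (diamK K * ‖pgrad p x‖)) :=
        setIntegral_mono_on (integrable_of_continuous (by fun_prop))
          (integrable_of_continuous (by fun_prop)) measurableSet_hull e2
    _ = 2 * ∫ x in hull K, |pval p x| * (diamK K * ‖pgrad p x‖) := integral_const_mul _ _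
    _ ≤ 2 * (l2 (volume.restrict (hull K)) (fun x => |pval p x|) *
        l2 (volume.restrict (hull K)) (fun x => diamK K * ‖pgrad p x‖)) := by
      gcongr
      exact (le_abs_self _).trans (abs_integral_mul_le hp.abs hq)
    _ = _ := by
      have h1 : l2 (volume.restrict (hull K)) (fun x => |pval p x|) =
        l2 (volume.restrict (hull K)) (pval p) := by simp [l2]
      have h2 : l2 (volume.restrict (hull K)) (fun x => diamK K * ‖pgrad p x‖) =
          diamK K * l2 (volume.restrict (hull K)) (pgrad p) := by
        have := l2_const_smul (μ := volume.restrict (hull K)) (diamK K) fun x => ‖pgrad p x‖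
        rw [abs_of_nonneg diamK_nonneg] at this
        simp only [smul_eq_mul] at this
        rw [this]; simp [l2]
      rw [h1, h2]; ring

end IsSimplex

/-! ### The Poincaré inequality for smooth functions on convex sets -/

theorem integrable_prod_of_continuous {X Y : Type*} [TopologicalSpace X] [MeasurableSpace X]
    [OpensMeasurableSpace X] [TopologicalSpace Y] [MeasurableSpace Y] [OpensMeasurableSpace Y]
    [T2Space X] [T2Space Y] [SecondCountableTopology X] [SecondCountableTopology Y]
    {μ : Measure X} {ν : Measure Y} [SFinite μ] [SFinite ν] [IsFiniteMeasureOnCompacts μ]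
    [IsFiniteMeasureOnCompacts ν]
    {S : Set X} {T : Set Y} (hS : IsCompact S) (hT : IsCompact T) {F : X → Y → ℝ}
    (hF : Continuous (Function.uncurry F)) :
    Integrable (Function.uncurry F) ((μ.restrict S).prod (ν.restrict T)) := by
  rw [Measure.prod_restrict]
  have : (μ.prod ν) (S ×ˢ T) < ⊤ := by
    rw [Measure.prod_prod]
    exact ENNReal.mul_lt_top hS.measure_lt_top hT.measure_lt_top
  have hfin : IsFiniteMeasure ((μ.prod ν).restrict (S ×ˢ T)) :=
    ⟨by rwa [Measure.restrict_apply_univ]⟩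
  obtain ⟨C, hC⟩ := (hS.prod hT).exists_bound_of_continuousOn hF.continuousOn
  refine Integrable.of_bound hF.aestronglyMeasurable C ?_
  exact (ae_restrict_iff' (hS.measurableSet.prod hT.measurableSet)).2 (ae_of_all _ hC)

/-- Contraction towards `y` maps the convex set `S` into itself, and for `t ≥ 1/2` the change of
variables costs at most `2 ^ d`. -/
theorem integral_contract_le {S : Set (Pt d)} (hS : IsCompact S) (hconv : Convex ℝ S)
    {g : Pt d → ℝ} (hg : Continuous g) (h0 : ∀ x, 0 ≤ g x) {y : Pt d} (hy : y ∈ S) {t : ℝ}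
    (ht : 2⁻¹ ≤ t) (ht1 : t ≤ 1) :
    ∫ x in S, g (y + t • (x - y)) ≤ 2 ^ d * ∫ x in S, g x := by
  have ht0 : 0 < t := lt_of_lt_of_le (by norm_num) ht
  have h1 := Measure.integral_comp_smul (μ := (volume : Measure (Pt d)))
    (fun x => S.indicator g ((1 - t) • y + x)) t
  rw [finrank_euclideanSpace_fin, integral_add_left_eq_self (fun x => S.indicator g x),
    integral_indicator hS.measurableSet] at h1
  have hI : 0 ≤ ∫ x in S, g x := integral_nonneg h0
  have h2 : |(t ^ d)⁻¹| ≤ 2 ^ d := by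
    rw [abs_of_nonneg (by positivity), ← inv_pow]
    gcongr
    rw [inv_le_comm₀ ht0 (by norm_num)]
    exact ht
  have e : ∀ x, y + t • (x - y) = (1 - t) • y + t • x := fun x => by module
  have hint : Integrable (fun x => S.indicator g ((1 - t) • y + t • x)) volume := by
    have h3 : Integrable (S.indicator g) volume :=
      (integrable_indicator_iff hS.measurableSet).2 (hg.continuousOn.integrableOn_compact hS)
    exact (h3.comp_add_left ((1 - t) • y)).comp_smul ht0.ne'
  calc ∫ x in S, g (y + t • (x - y))
      = ∫ x, S.indicator (fun x => g ((1 - t) • y + t • x)) x := by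
        rw [integral_indicator hS.measurableSet]
        simp only [e]
    _ ≤ ∫ x, S.indicator g ((1 - t) • y + t • x) := by
        refine integral_mono_of_nonneg (ae_of_all _ fun x => Set.indicator_nonneg (fun _ _ => h0 _) _)
          hint (ae_of_all _ fun x => ?_)
        by_cases hx : x ∈ S
        · have : (1 - t) • y + t • x ∈ S := hconv hy hx (by linarith) ht0.le (by ring)
          simp only [Set.indicator_of_mem hx, Set.indicator_of_mem this, le_refl]
        · simp only [Set.indicator_of_notMem hx]
          exact Set.indicator_nonneg (fun _ _ => h0 _) _
    _ = |(t ^ d)⁻¹| * ∫ x in S, g x := h1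
    _ ≤ _ := by gcongr

/-- Integration starts at the midpoint so that only parameters `t ≥ 1/2` occur, for which the
contraction estimate applies. The factor `2⁻¹` is the length of the parameter interval in the
Cauchy-Schwarz inequality. -/
theorem sq_sub_midpoint_le {φ : Pt d → ℝ} (hφ : ContDiff ℝ 1 φ) (x y : Pt d) :
    (φ x - φ ((2 : ℝ)⁻¹ • (x + y))) ^ 2 ≤ 2⁻¹ * ‖x - y‖ ^ 2 *
      ∫ t in Set.Icc (2⁻¹ : ℝ) 1, ‖∇ φ (y + t • (x - y))‖ ^ 2 := by
  have hg := continuous_gradient hφ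
  have hder : ∀ t ∈ Set.uIcc (2⁻¹ : ℝ) 1, HasDerivAt (fun t : ℝ => φ (y + t • (x - y)))
      ⟪∇ φ (y + t • (x - y)), x - y⟫ t := by
    intro t _
    have h2 : HasDerivAt (fun s : ℝ => y + s • (x - y)) (x - y) t := by
      simpa using ((hasDerivAt_id t).smul_const (x - y)).const_add y
    have hg := (hφ.differentiable (by norm_num) (y + t • (x - y))).hasGradientAt
    have := (hasGradientAt_iff_hasFDerivAt.1 hg).comp_hasDerivAt t h2
    simp only [InnerProductSpace.toDual_apply_apply] at this
    exact this
  have hftc := intervalIntegral.integral_eq_sub_of_hasDerivAt hder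
    (Continuous.intervalIntegrable (by fun_prop) _ _)
  rw [one_smul, add_sub_cancel, show y + (2⁻¹ : ℝ) • (x - y) = (2 : ℝ)⁻¹ • (x + y) by module,
    intervalIntegral.integral_of_le (by norm_num), ← integral_Icc_eq_integral_Ioc] at hftc
  set μ := (volume : Measure ℝ).restrict (Set.Icc (2⁻¹ : ℝ) 1) with hμ
  have hfin : IsFiniteMeasure μ := ⟨by simp [hμ]⟩
  have hmem : ∀ {f : ℝ → ℝ}, Continuous f → MemLp f 2 μ := fun {f} hf => by
    obtain ⟨C, hC⟩ := (isCompact_Icc (a := (2⁻¹ : ℝ)) (b := 1)).exists_bound_of_continuousOn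
      hf.continuousOn
    exact MemLp.of_bound hf.aestronglyMeasurable C
      ((ae_restrict_iff' measurableSet_Icc).2 (ae_of_all _ hC))
  have h1 : MemLp (fun t : ℝ => ⟪∇ φ (y + t • (x - y)), x - y⟫) 2 μ := hmem (by fun_prop)
  have h2 : MemLp (fun _ : ℝ => (1 : ℝ)) 2 μ := hmem continuous_const
  have h3 : MemLp (fun t : ℝ => ‖∇ φ (y + t • (x - y))‖) 2 μ := hmem (by fun_prop)
  have hcs := abs_integral_mul_le h1 h2
  simp only [mul_one, hftc] at hcs
  have hl1 : l2 μ (fun _ : ℝ => (1 : ℝ)) ^ 2 = 2⁻¹ := by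
    rw [l2_sq]; simp [hμ]; norm_num
  have hl : l2 μ (fun t : ℝ => ⟪∇ φ (y + t • (x - y)), x - y⟫) ≤
      ‖x - y‖ * l2 μ (fun t : ℝ => ‖∇ φ (y + t • (x - y))‖) := by
    refine l2_mono h3 (norm_nonneg _) (ae_of_all _ fun t => ?_)
    rw [norm_norm, mul_comm]
    exact norm_inner_le_norm _ _
  have hl2 := l2_sq (μ := μ) fun t : ℝ => ‖∇ φ (y + t • (x - y))‖
  simp only [norm_norm] at hl2
  generalize φ ((2 : ℝ)⁻¹ • (x + y)) = m at hcs
  rw [← hl2, ← sq_abs, mul_assoc, ← mul_pow, ← hl1, mul_comm, ← mul_pow]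
  exact pow_le_pow_left₀ (abs_nonneg _) (hcs.trans
    (mul_le_mul_of_nonneg_right hl (l2_nonneg _))) 2

/-- The left side is half the double integral of `(φ x - φ y) ^ 2`. Passing through the midpoint
splits the difference into two parts, each an integral of the gradient over contractions towards `x`
or `y` with parameter at least `1/2`. The contraction estimate then bounds one of the two
integrations, and the other one gives the volume. Stated without division by the volume, the
inequality passes easily to limits of sets. -/
theorem poincare_smooth {S : Set (Pt d)} (hS : IsCompact S) (hconv : Convex ℝ S) {h : ℝ}
    (hh : ∀ x ∈ S, ∀ y ∈ S, ‖x - y‖ ≤ h) {φ : Pt d → ℝ} (hφ : ContDiff ℝ 1 φ) :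
    volume.real S * (∫ x in S, φ x ^ 2) - (∫ x in S, φ x) ^ 2 ≤
      2 ^ d * h ^ 2 * volume.real S * ∫ x in S, ‖∇ φ x‖ ^ 2 := by
  have hg := continuous_gradient hφ
  have hφc := hφ.continuous
  obtain ⟨g, hgdef⟩ : ∃ g : Pt d → ℝ, ∀ x, g x = ‖∇ φ x‖ ^ 2 := ⟨_, fun _ => rfl⟩
  have hgc : Continuous g := by
    rw [show g = fun x => ‖∇ φ x‖ ^ 2 from funext hgdef]; fun_prop
  have hg0 : ∀ x, 0 ≤ g x := fun x => by rw [hgdef]; positivity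
  simp only [← hgdef]
  have hintS : ∀ {f : Pt d → ℝ}, Continuous f → IntegrableOn f S volume :=
    fun hf => hf.continuousOn.integrableOn_compact hS
  obtain ⟨A, hA⟩ : ∃ A : Pt d → Pt d → ℝ, ∀ y x, A y x =
    ∫ t in Set.Icc (2⁻¹ : ℝ) 1, g (y + t • (x - y)) := ⟨_, fun _ _ => rfl⟩
  have hAc : Continuous (Function.uncurry A) := by
    have := continuous_parametric_integral_of_continuous (μ := (volume : Measure ℝ))
      (f := fun (p : Pt d × Pt d) (t : ℝ) => g (p.1 + t • (p.2 - p.1)))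
      (by unfold Function.uncurry; fun_prop) (isCompact_Icc (a := (2⁻¹ : ℝ)) (b := 1))
    exact this.congr fun p => (hA p.1 p.2).symm
  have hAint := integrable_prod_of_continuous (μ := (volume : Measure (Pt d)))
    (ν := (volume : Measure (Pt d))) hS hS hAc
  have hAc1 : ∀ y, Continuous (A y) := fun y => hAc.comp (by fun_prop : Continuous fun x => (y, x))
  have hAc2 : ∀ x, Continuous fun y => A y x := fun x =>
    hAc.comp (by fun_prop : Continuous fun y => (y, x))
  obtain ⟨I, hI⟩ : ∃ I, I = ∫ x in S, g x := ⟨_, rfl⟩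
  rw [← hI]
  have hI0 : 0 ≤ I := hI ▸ integral_nonneg hg0
  have hAle : ∀ y ∈ S, ∫ x in S, A y x ≤ 2⁻¹ * (2 ^ d * I) := by
    intro y hy
    simp only [hA]
    rw [integral_integral_swap (integrable_prod_of_continuous hS isCompact_Icc
      (by unfold Function.uncurry; fun_prop))]
    calc ∫ t in Set.Icc (2⁻¹ : ℝ) 1, ∫ x in S, g (y + t • (x - y))
        ≤ ∫ t in Set.Icc (2⁻¹ : ℝ) 1, 2 ^ d * I := by
          refine setIntegral_mono_on ?_ (integrableOn_const (by simp)) measurableSet_Icc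
            fun t ht => hI ▸ integral_contract_le hS hconv hgc hg0 hy ht.1 ht.2
          refine ContinuousOn.integrableOn_compact isCompact_Icc (Continuous.continuousOn ?_)
          exact continuous_parametric_integral_of_continuous
            (f := fun (t : ℝ) (x : Pt d) => g (y + t • (x - y)))
            (by unfold Function.uncurry; fun_prop) hS
      _ = _ := by simp; norm_num
  have hAI1 : IntegrableOn (fun y => ∫ x in S, A y x) S volume :=
    hintS (continuous_parametric_integral_of_continuous hAc hS)
  have hAI2 : IntegrableOn (fun y => ∫ x in S, A x y) S volume :=
    hintS (continuous_parametric_integral_of_continuous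
      (f := fun y x => A x y) (hAc.comp continuous_swap) hS)
  have hvol : volume S ≠ ⊤ := hS.measure_lt_top.ne
  have hA1 : ∫ y in S, ∫ x in S, A y x ≤ volume.real S * (2⁻¹ * (2 ^ d * I)) := by
    calc _ ≤ ∫ y in S, 2⁻¹ * (2 ^ d * I) :=
          setIntegral_mono_on hAI1 (integrableOn_const hvol) hS.measurableSet hAle
      _ = _ := by simp
  have hA2 : ∫ y in S, ∫ x in S, A x y ≤ volume.real S * (2⁻¹ * (2 ^ d * I)) := by
    rw [integral_integral_swap]
    · exact hA1
    · exact integrable_prod_of_continuous hS hS (F := fun y x => A x y) (hAc.comp continuous_swap)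
  -- With the midpoint value `m`, the inequality `(a - b)² ≤ 2 (a - m)² + 2 (b - m)²` is combined
  -- with the two one-sided bounds.
  have hpt : ∀ y ∈ S, ∀ x ∈ S, φ x ^ 2 - 2 * φ y * φ x + φ y ^ 2 ≤ h ^ 2 * (A y x + A x y) := by
    intro y hy x hx
    have h1 := sq_sub_midpoint_le hφ x y
    have h2 := sq_sub_midpoint_le hφ y x
    simp only [← hgdef, ← hA] at h1 h2
    rw [add_comm y x, norm_sub_rev y x] at h2
    have h3 : ‖x - y‖ ^ 2 ≤ h ^ 2 := by gcongr; exact hh x hx y hy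
    have hAn : ∀ y x, 0 ≤ A y x := fun y x => by
      rw [hA]; exact integral_nonneg fun _ => hg0 _
    have h4 : 2⁻¹ * ‖x - y‖ ^ 2 * A y x ≤ 2⁻¹ * h ^ 2 * A y x := by
      have := hAn y x; gcongr
    have h5 : 2⁻¹ * ‖x - y‖ ^ 2 * A x y ≤ 2⁻¹ * h ^ 2 * A x y := by
      have := hAn x y; gcongr
    generalize φ ((2 : ℝ)⁻¹ • (x + y)) = m at h1 h2
    have h6 : (φ x - m) ^ 2 ≤ 2⁻¹ * h ^ 2 * A y x := h1.trans h4
    have h7 : (φ y - m) ^ 2 ≤ 2⁻¹ * h ^ 2 * A x y := h2.trans h5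
    nlinarith [sq_nonneg (φ x + φ y - 2 * m)]
  have hinner : ∀ y, ∫ x in S, (φ x ^ 2 - 2 * φ y * φ x + φ y ^ 2) =
      (∫ x in S, φ x ^ 2) - 2 * φ y * (∫ x in S, φ x) + volume.real S * φ y ^ 2 := by
    intro y
    rw [integral_add (hintS (by fun_prop)) (hintS (by fun_prop)),
      integral_sub (hintS (by fun_prop)) (hintS (by fun_prop)), integral_const_mul]
    simp
  have hdouble : ∫ y in S, ∫ x in S, (φ x ^ 2 - 2 * φ y * φ x + φ y ^ 2) =
      2 * (volume.real S * (∫ x in S, φ x ^ 2) - (∫ x in S, φ x) ^ 2) := by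
    simp only [hinner]
    have e : ∀ y, (∫ x in S, φ x ^ 2) - 2 * φ y * (∫ x in S, φ x) + volume.real S * φ y ^ 2 =
      (∫ x in S, φ x ^ 2) - 2 * (∫ x in S, φ x) * φ y + volume.real S * φ y ^ 2 := fun y => by ring
    simp only [e]
    rw [integral_add (hintS (by fun_prop)) (hintS (by fun_prop)),
      integral_sub (hintS (by fun_prop)) (hintS (by fun_prop)), integral_const_mul,
      integral_const_mul]
    simp
    ring
  have hfinal : ∫ y in S, ∫ x in S, (φ x ^ 2 - 2 * φ y * φ x + φ y ^ 2) ≤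
      h ^ 2 * (volume.real S * (2⁻¹ * (2 ^ d * I)) + volume.real S * (2⁻¹ * (2 ^ d * I))) := by
    calc _ ≤ ∫ y in S, h ^ 2 * ((∫ x in S, A y x) + ∫ x in S, A x y) := by
          refine setIntegral_mono_on ?_ ((hAI1.add hAI2).const_mul _) hS.measurableSet
            fun y hy => ?_
          · simp only [hinner]; exact hintS (by fun_prop)
          · rw [← integral_add (hintS (hAc1 y)) (hintS (hAc2 y)), ← integral_const_mul]
            exact setIntegral_mono_on (hintS (by fun_prop))
              (((hintS (hAc1 y)).add (hintS (hAc2 y))).const_mul _) hS.measurableSet (hpt y hy)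
      _ ≤ _ := by
          rw [integral_const_mul, integral_add hAI1 hAI2]
          gcongr
  rw [hdouble] at hfinal
  have : 0 ≤ 2 ^ d * h ^ 2 * volume.real S * I := by positivity
  linarith

/-! ### Mollification -/

section Mollify

variable {E : Type*} [NormedAddCommGroup E]

theorem eLpNorm_two_sq {α : Type*} [MeasurableSpace α] {μ : Measure α} (f : α → E) :
    eLpNorm f 2 μ ^ 2 = ∫⁻ x, ‖f x‖ₑ ^ 2 ∂μ := by
  have := eLpNorm_nnreal_pow_eq_lintegral (f := f) (μ := μ) (p := 2) (by norm_num)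
  simpa using this

theorem sq_lintegral_enorm_le {α : Type*} [MeasurableSpace α] {ν : Measure α}
    [IsProbabilityMeasure ν] {f : α → E} (hf : AEStronglyMeasurable f ν) :
    (∫⁻ x, ‖f x‖ₑ ∂ν) ^ 2 ≤ ∫⁻ x, ‖f x‖ₑ ^ 2 ∂ν := by
  rw [← eLpNorm_one_eq_lintegral_enorm, ← eLpNorm_two_sq]
  gcongr
  exact eLpNorm_le_eLpNorm_of_exponent_le (by norm_num) hf

/-- Pointwise convergence without increase of the norm implies convergence in `L²`. Fatou's lemma is
applied to the nonnegative functions `2‖F n‖² + 2‖f‖² - ‖F n - f‖²`, whose pointwise limit is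
`4‖f‖²`. -/
theorem tendsto_eLpNorm_sub_of_ae {α : Type*} [MeasurableSpace α] {μ : Measure α} {F : ℕ → α → E}
    {f : α → E} (hf : MemLp f 2 μ) (hF : ∀ n, AEStronglyMeasurable (F n) μ)
    (hle : ∀ n, ∫⁻ x, ‖F n x‖ₑ ^ 2 ∂μ ≤ ∫⁻ x, ‖f x‖ₑ ^ 2 ∂μ)
    (hlim : ∀ᵐ x ∂μ, Tendsto (fun n => F n x) atTop (𝓝 (f x))) :
    Tendsto (fun n => eLpNorm (fun x => F n x - f x) 2 μ) atTop (𝓝 0) := by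
  set N := ∫⁻ x, ‖f x‖ₑ ^ 2 ∂μ with hN
  have hNtop : N ≠ ⊤ := by
    rw [hN, ← eLpNorm_two_sq]; exact ENNReal.pow_ne_top hf.2.ne
  set a : ℕ → ENNReal := fun n => ∫⁻ x, ‖F n x - f x‖ₑ ^ 2 ∂μ with ha
  have hpt : ∀ n x, ‖F n x - f x‖ₑ ^ 2 ≤ 2 * ‖F n x‖ₑ ^ 2 + 2 * ‖f x‖ₑ ^ 2 := by
    intro n x
    have h1 : ‖F n x - f x‖ₑ ≤ ‖F n x‖ₑ + ‖f x‖ₑ := enorm_sub_le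
    calc ‖F n x - f x‖ₑ ^ 2 ≤ (‖F n x‖ₑ + ‖f x‖ₑ) ^ 2 := by gcongr
      _ ≤ 2 * ‖F n x‖ₑ ^ 2 + 2 * ‖f x‖ₑ ^ 2 := by
        have := ENNReal.rpow_add_le_mul_rpow_add_rpow ‖F n x‖ₑ ‖f x‖ₑ (p := 2) (by norm_num)
        norm_num at this
        rw [← mul_add]
        simpa using this
  have hFm : ∀ n, AEMeasurable (fun x => ‖F n x‖ₑ ^ 2) μ := fun n => (hF n).enorm.pow_const 2
  have hfm : AEMeasurable (fun x => ‖f x‖ₑ ^ 2) μ := hf.1.enorm.pow_const 2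
  have hdm : ∀ n, AEMeasurable (fun x => ‖F n x - f x‖ₑ ^ 2) μ :=
    fun n => ((hF n).sub hf.1).enorm.pow_const 2
  have hsum : ∀ n, ∫⁻ x, (2 * ‖F n x‖ₑ ^ 2 + 2 * ‖f x‖ₑ ^ 2) ∂μ ≤ 4 * N := by
    intro n
    rw [lintegral_add_left' ((hFm n).const_mul 2), lintegral_const_mul'' _ (hFm n),
      lintegral_const_mul'' _ hfm]
    calc 2 * ∫⁻ x, ‖F n x‖ₑ ^ 2 ∂μ + 2 * N ≤ 2 * N + 2 * N := by gcongr; exact hle n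
      _ = 4 * N := by ring
  have hale : ∀ n, a n ≤ 4 * N := fun n => (lintegral_mono (hpt n)).trans (hsum n)
  have h4top : 4 * N ≠ ⊤ := ENNReal.mul_ne_top (by norm_num) hNtop
  have hatop : ∀ n, a n ≠ ⊤ := fun n => ne_top_of_le_ne_top h4top (hale n)
  have hfatou := lintegral_liminf_le' (μ := μ) (u := atTop)
    (f := fun n x => 2 * ‖F n x‖ₑ ^ 2 + 2 * ‖f x‖ₑ ^ 2 - ‖F n x - f x‖ₑ ^ 2)
    fun n => (((hFm n).const_mul 2).add (hfm.const_mul 2)).sub (hdm n)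
  have hleft : ∫⁻ x, liminf (fun n => 2 * ‖F n x‖ₑ ^ 2 + 2 * ‖f x‖ₑ ^ 2 - ‖F n x - f x‖ₑ ^ 2)
      atTop ∂μ = 4 * N := by
    rw [hN, ← lintegral_const_mul'' _ hfm]
    refine lintegral_congr_ae ?_
    filter_upwards [hlim] with x hx
    have h1 : Tendsto (fun n => 2 * ‖F n x‖ₑ ^ 2 + 2 * ‖f x‖ₑ ^ 2 - ‖F n x - f x‖ₑ ^ 2) atTop
        (𝓝 (2 * ‖f x‖ₑ ^ 2 + 2 * ‖f x‖ₑ ^ 2 - ‖f x - f x‖ₑ ^ 2)) := by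
      have e1 : Tendsto (fun n => ‖F n x‖ₑ ^ 2) atTop (𝓝 (‖f x‖ₑ ^ 2)) :=
        ((ENNReal.continuous_pow 2).tendsto _).comp (hx.enorm)
      have e2 : Tendsto (fun n => ‖F n x - f x‖ₑ ^ 2) atTop (𝓝 (‖f x - f x‖ₑ ^ 2)) :=
        ((ENNReal.continuous_pow 2).tendsto _).comp ((hx.sub_const (f x)).enorm)
      refine ENNReal.Tendsto.sub
        ((ENNReal.Tendsto.const_mul e1 (Or.inr (by norm_num))).add tendsto_const_nhds) e2
        (Or.inr ?_)
      simp
    rw [h1.liminf_eq]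
    simp
    ring
  have hright : ∀ n, ∫⁻ x, (2 * ‖F n x‖ₑ ^ 2 + 2 * ‖f x‖ₑ ^ 2 - ‖F n x - f x‖ₑ ^ 2) ∂μ ≤
      4 * N - a n := by
    intro n
    rw [lintegral_sub' (hdm n) (hatop n) (ae_of_all _ (hpt n))]
    exact tsub_le_tsub_right (hsum n) _
  have h4 : 4 * N ≤ liminf (fun n => 4 * N - a n) atTop := by
    refine hleft.symm.le.trans (hfatou.trans ?_)
    exact liminf_le_liminf (Eventually.of_forall hright)
  have hsub : Tendsto (fun n => 4 * N - a n) atTop (𝓝 (4 * N)) :=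
    tendsto_of_le_liminf_of_limsup_le h4 (limsup_le_of_le (h := Eventually.of_forall
      fun n => tsub_le_self))
  have ha0 : Tendsto a atTop (𝓝 0) := by
    have h5 : Tendsto (fun n => 4 * N - (4 * N - a n)) atTop (𝓝 (4 * N - 4 * N)) :=
      ENNReal.Tendsto.sub tendsto_const_nhds hsub (Or.inl h4top)
    rw [tsub_self] at h5
    refine h5.congr fun n => ENNReal.sub_sub_cancel h4top (hale n)
  have h6 : (fun n => eLpNorm (fun x => F n x - f x) 2 μ) = fun n => a n ^ (2⁻¹ : ℝ) := by
    funext n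
    rw [ha]
    simp only
    rw [← eLpNorm_two_sq, ← ENNReal.rpow_natCast, ← ENNReal.rpow_mul]
    norm_num
  rw [h6]
  have := (ENNReal.continuous_rpow_const (y := (2⁻¹ : ℝ))).tendsto 0
  rw [ENNReal.zero_rpow_of_pos (by norm_num)] at this
  exact this.comp ha0

variable [NormedSpace ℝ E] [CompleteSpace E]

open scoped Convolution

/-- Convolution with a normalized bump is averaging against a probability measure, so Jensen's
inequality and translation invariance give the bound. -/
theorem lintegral_sq_convolution_le (ψ : ContDiffBump (0 : Pt d)) {f : Pt d → E}
    (hf : AEStronglyMeasurable f volume) :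
    ∫⁻ x, ‖(ψ.normed volume ⋆[ContinuousLinearMap.lsmul ℝ ℝ, volume] f) x‖ₑ ^ 2 ≤
      ∫⁻ x, ‖f x‖ₑ ^ 2 := by
  -- The exchange of integrals needs joint measurability of `f (x - t)`; a strongly measurable
  -- representative has the same convolution.
  wlog hsm : StronglyMeasurable f generalizing f
  · have h := this (hf.stronglyMeasurable_mk).aestronglyMeasurable hf.stronglyMeasurable_mk
    rw [convolution_congr _ (EventuallyEq.refl _ _) hf.ae_eq_mk.symm] at h
    refine h.trans (le_of_eq (lintegral_congr_ae ?_))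
    filter_upwards [hf.ae_eq_mk] with x hx
    rw [hx]
  set r : Pt d → ENNReal := fun t => ENNReal.ofReal (ψ.normed volume t) with hr
  have hrm : Measurable r := ENNReal.measurable_ofReal.comp ψ.continuous_normed.measurable
  set ν : Measure (Pt d) := volume.withDensity r with hν
  have hprob : IsProbabilityMeasure ν := ⟨by
    rw [hν, withDensity_apply _ MeasurableSet.univ, Measure.restrict_univ, hr,
      ← ofReal_integral_eq_lintegral_ofReal ψ.integrable_normed
        (ae_of_all _ fun x => ψ.nonneg_normed x), ψ.integral_normed, ENNReal.ofReal_one]⟩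
  have hpt : ∀ x, ‖(ψ.normed volume ⋆[ContinuousLinearMap.lsmul ℝ ℝ, volume] f) x‖ₑ ^ 2 ≤
      ∫⁻ t, ‖f (x - t)‖ₑ ^ 2 ∂ν := by
    intro x
    have hm : StronglyMeasurable fun t => f (x - t) := hsm.comp_measurable (by fun_prop)
    refine le_trans ?_ (sq_lintegral_enorm_le hm.aestronglyMeasurable)
    gcongr
    rw [convolution_def]
    refine (enorm_integral_le_lintegral_enorm _).trans (le_of_eq ?_)
    rw [hν, lintegral_withDensity_eq_lintegral_mul _ hrm hm.enorm]
    refine lintegral_congr fun t => ?_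
    simp only [ContinuousLinearMap.lsmul_apply, enorm_smul, Pi.mul_apply, hr]
    rw [Real.enorm_of_nonneg (ψ.nonneg_normed t)]
  refine (lintegral_mono hpt).trans (le_of_eq ?_)
  rw [lintegral_lintegral_swap]
  · have : ∀ t : Pt d, ∫⁻ x, ‖f (x - t)‖ₑ ^ 2 = ∫⁻ x, ‖f x‖ₑ ^ 2 := fun t =>
      lintegral_sub_right_eq_self (fun x => ‖f x‖ₑ ^ 2) t
    simp [this]
  · exact ((hsm.comp_measurable (measurable_fst.sub measurable_snd)).enorm.pow_const 2).aemeasurable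

/-- A sequence of bump functions that shrinks to the origin. -/
def bump (d n : ℕ) : ContDiffBump (0 : Pt d) where
  rIn := ((n : ℝ) + 1)⁻¹ / 2
  rOut := ((n : ℝ) + 1)⁻¹
  rIn_pos := by positivity
  rIn_lt_rOut := half_lt_self (by positivity)

theorem tendsto_rOut_bump (d : ℕ) : Tendsto (fun n => (bump d n).rOut) atTop (𝓝 0) := by
  simpa [bump, one_div] using tendsto_one_div_add_atTop_nhds_zero_nat (𝕜 := ℝ)

/-- The mollifications of a function. -/
def mollify (n : ℕ) (f : Pt d → E) : Pt d → E :=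
  (bump d n).normed volume ⋆[ContinuousLinearMap.lsmul ℝ ℝ, volume] f

theorem contDiff_mollify (n : ℕ) {f : Pt d → E} (hf : LocallyIntegrable f volume) :
    ContDiff ℝ ∞ (mollify n f) :=
  (bump d n).hasCompactSupport_normed.contDiff_convolution_left _ (bump d n).contDiff_normed hf

theorem tendsto_mollify {f : Pt d → E} (hf : MemLp f 2 volume) :
    Tendsto (fun n => eLpNorm (fun x => mollify n f x - f x) 2 volume) atTop (𝓝 0) := by
  have hli := hf.locallyIntegrable (by norm_num)
  refine tendsto_eLpNorm_sub_of_ae hf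
    (fun n => (contDiff_mollify n hli).continuous.aestronglyMeasurable)
    (fun n => lintegral_sq_convolution_le _ hf.1) ?_
  exact ContDiffBump.ae_convolution_tendsto_right_of_locallyIntegrable (φ := bump d) (K := 2)
    (tendsto_rOut_bump d) (Eventually.of_forall fun n => by simp [bump]; linarith) hli

end Mollify

theorem gradient_apply (η : Pt d → ℝ) (y : Pt d) (i : Fin d) :
    (∇ η y) i = fderiv ℝ η y (EuclideanSpace.single i 1) := by
  have h : ⟪∇ η y, EuclideanSpace.single i (1 : ℝ)⟫ = fderiv ℝ η y (EuclideanSpace.single i 1) := by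
    unfold gradient
    rw [InnerProductSpace.toDual_symm_apply]
  rw [← h, EuclideanSpace.inner_single_right]
  simp

/-- Mollification commutes with weak gradients away from the boundary. -/
theorem gradient_mollify {Ω : Set (Pt d)} (hΩ : IsOpen Ω) {φ : Pt d → ℝ} {G : Pt d → Pt d}
    (h : HasWeakGrad Ω φ G) (n : ℕ) {x : Pt d} (hx : Metric.closedBall x (bump d n).rOut ⊆ Ω) :
    ∇ (mollify n (Ω.indicator φ)) x = mollify n (Ω.indicator G) x := by
  set ρ := (bump d n).normed (volume : Measure (Pt d)) with hρ
  have hm := hΩ.measurableSet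
  have hφ : MemLp (Ω.indicator φ) 2 volume := (memLp_indicator_iff_restrict hm).2 h.memLp
  have hG : MemLp (Ω.indicator G) 2 volume := (memLp_indicator_iff_restrict hm).2 h.memLp_grad
  have hφl := hφ.locallyIntegrable (by norm_num)
  have hGl := hG.locallyIntegrable (by norm_num)
  have hcs : HasCompactSupport ρ := (bump d n).hasCompactSupport_normed
  have hsm : ContDiff ℝ ∞ ρ := (bump d n).contDiff_normed
  have hfd := hcs.hasFDerivAt_convolution_left (ContinuousLinearMap.lsmul ℝ ℝ)
    (hsm.of_le (by exact_mod_cast le_top)) hφl x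
  have hex := (hcs.fderiv (𝕜 := ℝ)).convolutionExists_left
    ((ContinuousLinearMap.lsmul ℝ ℝ : ℝ →L[ℝ] ℝ →L[ℝ] ℝ).precompL (Pt d))
    (hsm.continuous_fderiv (by simp)) hφl x
  have hexG := hcs.convolutionExists_left
    (ContinuousLinearMap.lsmul ℝ ℝ : ℝ →L[ℝ] Pt d →L[ℝ] Pt d) hsm.continuous hGl x
  -- The reflected and translated kernel is a test function on `Ω` because its support lies in the
  -- ball around `x`. The weak gradient identity for it is the assertion.
  set η : Pt d → ℝ := fun y => ρ (x - y) with hη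
  have hsupp : Function.support η ⊆ Metric.closedBall x (bump d n).rOut := by
    intro y hy
    have : x - y ∈ Function.support ρ := hy
    rw [hρ, (bump d n).support_normed_eq, Metric.mem_ball, dist_zero_right] at this
    rw [Metric.mem_closedBall, dist_comm, dist_eq_norm]
    exact this.le
  have hηs : ContDiff ℝ ∞ η := hsm.comp (contDiff_const.sub contDiff_id)
  have htest : IsTest Ω η := by
    refine ⟨hηs, HasCompactSupport.of_support_subset_isCompact (isCompact_closedBall _ _) hsupp, ?_⟩
    exact (closure_minimal hsupp Metric.isClosed_closedBall).trans hx
  ext i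
  rw [gradient_apply]
  have e1 : fderiv ℝ (mollify n (Ω.indicator φ)) x (EuclideanSpace.single i 1) =
      ∫ t, fderiv ℝ ρ t (EuclideanSpace.single i 1) * Ω.indicator φ (x - t) := by
    rw [show fderiv ℝ (mollify n (Ω.indicator φ)) x = _ from hfd.fderiv, convolution_def,
      ContinuousLinearMap.integral_apply hex]
    rfl
  have e2 : ∫ t, fderiv ℝ ρ t (EuclideanSpace.single i 1) * Ω.indicator φ (x - t) =
      ∫ y in Ω, fderiv ℝ ρ (x - y) (EuclideanSpace.single i 1) * φ y := by
    rw [← integral_sub_left_eq_self _ volume x, ← integral_indicator hm]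
    refine integral_congr_ae (ae_of_all _ fun y => ?_)
    by_cases hy : y ∈ Ω <;> simp [hy]
  have e3 : ∀ y, (∇ η y) i = -fderiv ℝ ρ (x - y) (EuclideanSpace.single i 1) := by
    intro y
    rw [gradient_apply]
    have h1 : HasFDerivAt (fun y => x - y) (-ContinuousLinearMap.id ℝ (Pt d)) y :=
      (hasFDerivAt_id y).const_sub x
    have h2 := ((hsm.differentiable (by simp)) (x - y)).hasFDerivAt.comp y h1
    rw [show fderiv ℝ η y = _ from h2.fderiv]
    simp
  have e4 : mollify n (Ω.indicator G) x i = ∫ y in Ω, G y i * η y := by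
    have h1 := (EuclideanSpace.proj i : Pt d →L[ℝ] ℝ).integral_comp_comm hexG
    rw [← convolution_def] at h1
    refine Eq.trans h1.symm ?_
    rw [← integral_sub_left_eq_self _ volume x, ← integral_indicator hm]
    refine integral_congr_ae (ae_of_all _ fun y => ?_)
    by_cases hy : y ∈ Ω <;> simp [hy, hη, mul_comm]
  have e5 := h.weak η htest i
  simp only [e3, mul_neg] at e5
  rw [integral_neg, neg_inj] at e5
  rw [e1, e2, e4, ← e5]
  simp only [mul_comm]

/-- Functions in `H¹(Ω)` can be approximated by smooth functions on compact subsets of `Ω`. -/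
theorem exists_smooth_approx {Ω : Set (Pt d)} (hΩ : IsOpen Ω) {φ : Pt d → ℝ} {G : Pt d → Pt d}
    (h : HasWeakGrad Ω φ G) {S : Set (Pt d)} (hS : IsCompact S) (hSΩ : S ⊆ Ω) :
    ∃ χ : ℕ → Pt d → ℝ, (∀ n, ContDiff ℝ ∞ (χ n)) ∧
      Tendsto (fun n => eLpNorm (fun x => χ n x - φ x) 2 (volume.restrict S)) atTop (𝓝 0) ∧
      Tendsto (fun n => eLpNorm (fun x => ∇ (χ n) x - G x) 2 (volume.restrict S)) atTop (𝓝 0) := by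
  have hm := hΩ.measurableSet
  have hφ : MemLp (Ω.indicator φ) 2 volume := (memLp_indicator_iff_restrict hm).2 h.memLp
  have hG : MemLp (Ω.indicator G) 2 volume := (memLp_indicator_iff_restrict hm).2 h.memLp_grad
  refine ⟨fun n => mollify n (Ω.indicator φ),
    fun n => contDiff_mollify n (hφ.locallyIntegrable (by norm_num)), ?_, ?_⟩
  · refine tendsto_of_tendsto_of_tendsto_of_le_of_le tendsto_const_nhds (tendsto_mollify hφ)
      (fun _ => zero_le) fun n => ?_
    refine (le_of_eq (eLpNorm_congr_ae ?_)).trans (eLpNorm_mono_measure _ Measure.restrict_le_self)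
    refine (ae_restrict_iff' hS.measurableSet).2 (ae_of_all _ fun x hx => ?_)
    simp [Set.indicator_of_mem (hSΩ hx)]
  -- As soon as the radius of the bump is below `δ`, the balls around the points of `S` lie in `Ω`,
  -- and mollification commutes with the gradient on `S`.
  · obtain ⟨δ, hδ, hsub⟩ := hS.exists_cthickening_subset_open hΩ hSΩ
    have hev : ∀ᶠ n in atTop, (bump d n).rOut < δ := (tendsto_rOut_bump d).eventually_lt_const hδ
    refine tendsto_of_tendsto_of_tendsto_of_le_of_le' tendsto_const_nhds (tendsto_mollify hG)
      (Eventually.of_forall fun _ => zero_le) ?_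
    filter_upwards [hev] with n hn
    refine (le_of_eq (eLpNorm_congr_ae ?_)).trans (eLpNorm_mono_measure _ Measure.restrict_le_self)
    refine (ae_restrict_iff' hS.measurableSet).2 (ae_of_all _ fun x hx => ?_)
    simp only
    rw [gradient_mollify hΩ h n, Set.indicator_of_mem (hSΩ hx)]
    exact ((Metric.closedBall_subset_closedBall hn.le).trans
      (Metric.closedBall_subset_cthickening hx δ)).trans hsub

/-! ### The Poincaré inequality in `H¹` -/

section L2lim

variable {α : Type*} [MeasurableSpace α] {μ : Measure α} {E : Type*} [NormedAddCommGroup E]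
  [InnerProductSpace ℝ E] {F : ℕ → α → E} {f : α → E}

theorem tendsto_toLp (hf : MemLp f 2 μ) (hF : ∀ n, MemLp (F n) 2 μ)
    (h : Tendsto (fun n => eLpNorm (fun x => F n x - f x) 2 μ) atTop (𝓝 0)) :
    Tendsto (fun n => (hF n).toLp (F n)) atTop (𝓝 (hf.toLp f)) := by
  rw [Lp.tendsto_Lp_iff_tendsto_eLpNorm'']
  exact h

theorem tendsto_integral_inner (hf : MemLp f 2 μ) (hF : ∀ n, MemLp (F n) 2 μ)
    (h : Tendsto (fun n => eLpNorm (fun x => F n x - f x) 2 μ) atTop (𝓝 0)) {g : α → E}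
    (hg : MemLp g 2 μ) :
    Tendsto (fun n => ∫ x, ⟪F n x, g x⟫ ∂μ) atTop (𝓝 (∫ x, ⟪f x, g x⟫ ∂μ)) := by
  have e : ∀ {u : α → E} (hu : MemLp u 2 μ), ∫ x, ⟪u x, g x⟫ ∂μ = ⟪hu.toLp u, hg.toLp g⟫ := by
    intro u hu
    rw [L2.inner_def]
    refine integral_congr_ae ?_
    filter_upwards [hu.coeFn_toLp, hg.coeFn_toLp] with x hx hy
    rw [hx, hy]
  rw [e hf]
  simp only [fun n => e (hF n)]
  exact (tendsto_toLp hf hF h).inner tendsto_const_nhds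

theorem tendsto_integral_norm_sq (hf : MemLp f 2 μ) (hF : ∀ n, MemLp (F n) 2 μ)
    (h : Tendsto (fun n => eLpNorm (fun x => F n x - f x) 2 μ) atTop (𝓝 0)) :
    Tendsto (fun n => ∫ x, ‖F n x‖ ^ 2 ∂μ) atTop (𝓝 (∫ x, ‖f x‖ ^ 2 ∂μ)) := by
  simp only [← l2_sq]
  rw [l2_eq_norm hf]
  simp only [fun n => l2_eq_norm (hF n)]
  exact (tendsto_toLp hf hF h).norm.pow 2

end L2lim

theorem memLp_restrict_of_continuous {E : Type*} [NormedAddCommGroup E] {f : Pt d → E}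
    (hf : Continuous f) {S : Set (Pt d)} (hS : IsCompact S) (p : ENNReal) :
    MemLp f p (volume.restrict S) := by
  have : IsFiniteMeasure (volume.restrict S) := ⟨by
    rw [Measure.restrict_apply_univ]; exact hS.measure_lt_top⟩
  obtain ⟨C, hC⟩ := hS.exists_bound_of_continuousOn hf.continuousOn
  exact MemLp.of_bound hf.aestronglyMeasurable C
    ((ae_restrict_iff' hS.measurableSet).2 (ae_of_all _ hC))

/-- Both sides are continuous in `H¹`. Smooth approximation is available on compact subsets of `Ω`,
so the inequality is first transferred on these. -/
theorem poincare_compact {Ω : Set (Pt d)} (hΩ : IsOpen Ω) {φ : Pt d → ℝ} {G : Pt d → Pt d}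
    (hφ : HasWeakGrad Ω φ G) {S : Set (Pt d)} (hS : IsCompact S) (hSΩ : S ⊆ Ω)
    (hconv : Convex ℝ S) {h : ℝ} (hh : ∀ x ∈ S, ∀ y ∈ S, ‖x - y‖ ≤ h) :
    volume.real S * (∫ x in S, φ x ^ 2) - (∫ x in S, φ x) ^ 2 ≤
      2 ^ d * h ^ 2 * volume.real S * ∫ x in S, ‖G x‖ ^ 2 := by
  obtain ⟨χ, hχ, h1, h2⟩ := exists_smooth_approx hΩ hφ hS hSΩ
  have hres : volume.restrict S ≤ volume.restrict Ω := Measure.restrict_mono hSΩ le_rfl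
  have hφS := hφ.memLp.mono_measure hres
  have hGS := hφ.memLp_grad.mono_measure hres
  have hc1 : ∀ n, ContDiff ℝ 1 (χ n) := fun n => (hχ n).of_le (by exact_mod_cast le_top)
  have hχS : ∀ n, MemLp (χ n) 2 (volume.restrict S) :=
    fun n => memLp_restrict_of_continuous (hχ n).continuous hS 2
  have hgS : ∀ n, MemLp (∇ (χ n)) 2 (volume.restrict S) :=
    fun n => memLp_restrict_of_continuous (continuous_gradient (hc1 n)) hS 2
  have t1 := tendsto_integral_norm_sq hφS hχS h1
  have t2 := tendsto_integral_norm_sq hGS hgS h2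
  have t3 := tendsto_integral_inner hφS hχS h1
    (memLp_restrict_of_continuous (continuous_const (y := (1 : ℝ))) hS 2)
  simp only [Real.norm_eq_abs, sq_abs] at t1
  simp only [RCLike.inner_apply, one_mul, RCLike.conj_to_real] at t3
  exact le_of_tendsto_of_tendsto' ((t1.const_mul _).sub (t3.pow 2)) (t2.const_mul _)
    fun n => poincare_smooth hS hconv hh (hc1 n)

namespace IsSimplex

variable {K : Finset (Pt d)} (hK : IsSimplex K)

include hK

/-- The points of the simplex all of whose barycentric coordinates are at least `ε n`. -/
theorem exists_exhaustion : ∃ S : ℕ → Set (Pt d), Monotone S ∧ ⋃ n, S n = interior (hull K) ∧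
    ∀ n, IsCompact (S n) ∧ Convex ℝ (S n) := by
  have hS : ∀ n : ℕ, {x | ∀ a ∈ K, ((n : ℝ) + 1)⁻¹ ≤ pval (bary K a) x} =
      ⋂ a ∈ K, {x | ((n : ℝ) + 1)⁻¹ ≤ pval (bary K a) x} := fun n => by ext; simp
  refine ⟨fun n => {x | ∀ a ∈ K, ((n : ℝ) + 1)⁻¹ ≤ pval (bary K a) x}, ?_, ?_, fun n => ⟨?_, ?_⟩⟩
  · intro m n hmn x hx a ha
    refine le_trans ?_ (hx a ha)
    gcongr
  · rw [hK.interior_hull]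
    ext x
    simp only [Set.mem_iUnion, Set.mem_ofPred_eq]
    constructor
    · rintro ⟨n, hn⟩ a ha
      exact lt_of_lt_of_le (by positivity) (hn a ha)
    · intro hx
      have : ∀ᶠ n : ℕ in atTop, ∀ a ∈ K, ((n : ℝ) + 1)⁻¹ ≤ pval (bary K a) x := by
        rw [Finset.eventually_all]
        intro a ha
        have := tendsto_one_div_add_atTop_nhds_zero_nat (𝕜 := ℝ)
        simp only [one_div] at this
        exact (this.eventually_lt_const (hx a ha)).mono fun n hn => hn.le
      exact this.exists
  · refine (isCompact_hull (K := K)).of_isClosed_subset ?_ fun x (hx : ∀ a ∈ K, _ ≤ _) =>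
      hK.mem_hull_iff.2 fun a ha => le_trans (by positivity) (hx a ha)
    show IsClosed {x | ∀ a ∈ K, ((n : ℝ) + 1)⁻¹ ≤ pval (bary K a) x}
    rw [hS]
    exact isClosed_biInter fun a _ => isClosed_le continuous_const (by fun_prop)
  · show Convex ℝ {x | ∀ a ∈ K, ((n : ℝ) + 1)⁻¹ ≤ pval (bary K a) x}
    rw [hS]
    refine convex_iInter₂ fun a _ => ?_
    intro x hx y hy s t hs ht hst
    simp only [Set.mem_ofPred_eq, pval_bary] at hx hy ⊢
    rw [inner_add_right, inner_smul_right, inner_smul_right]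
    obtain rfl : t = 1 - s := by linarith
    nlinarith [mul_le_mul_of_nonneg_left hx hs, mul_le_mul_of_nonneg_left hy ht]

/-- The frontier of a convex set is a null set. Hence integrals may run over closed simplices while
weak derivatives live on the interiors. -/
theorem ae_restrict_interior : (volume.restrict (interior (hull K))) = volume.restrict (hull K) := by
  refine Measure.restrict_congr_set ?_
  refine (interior_subset.eventuallyLE).antisymm ?_
  rw [ae_le_set]
  refine measure_mono_null ?_ (volume_frontier_hull (K := K))
  intro x hx
  exact ⟨subset_closure hx.1, hx.2⟩

/-- Exhausting the interior by compact convex sets avoids any extension of `φ` beyond the simplex;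
the diameter of `K` bounds those of all members, so the constant survives the limit. -/
theorem poincare {Ω : Set (Pt d)} (hΩ : IsOpen Ω) {φ : Pt d → ℝ} {G : Pt d → Pt d}
    (hφ : HasWeakGrad Ω φ G) (hKΩ : interior (hull K) ⊆ Ω) :
    volume.real (hull K) * (∫ x in hull K, φ x ^ 2) - (∫ x in hull K, φ x) ^ 2 ≤
      2 ^ d * diamK K ^ 2 * volume.real (hull K) * ∫ x in hull K, ‖G x‖ ^ 2 := by
  obtain ⟨S, hmono, hU, hS⟩ := hK.exists_exhaustion
  have hSK : ∀ n, S n ⊆ interior (hull K) := fun n => hU ▸ Set.subset_iUnion S n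
  have hres : volume.restrict (hull K) ≤ volume.restrict Ω := by
    rw [← hK.ae_restrict_interior]; exact Measure.restrict_mono hKΩ le_rfl
  have hφK := hφ.memLp.mono_measure hres
  have hGK := hφ.memLp_grad.mono_measure hres
  have hlim : ∀ {f : Pt d → ℝ}, Integrable f (volume.restrict (hull K)) →
      Tendsto (fun n => ∫ x in S n, f x) atTop (𝓝 (∫ x in hull K, f x)) := by
    intro f hf
    have := tendsto_setIntegral_of_monotone (μ := volume) (f := f)
      (fun n => (hS n).1.measurableSet) hmono (by
        rw [hU, IntegrableOn, hK.ae_restrict_interior]; exact hf)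
    rwa [hU, hK.ae_restrict_interior] at this
  have hfin : IsFiniteMeasure (volume.restrict (hull K)) := ⟨by
    rw [Measure.restrict_apply_univ]; exact volume_hull_lt_top⟩
  have i1 : Integrable (fun x => φ x ^ 2) (volume.restrict (hull K)) := by
    simpa using hφK.integrable_norm_pow (by norm_num)
  have i2 : Integrable (fun x => ‖G x‖ ^ 2) (volume.restrict (hull K)) :=
    hGK.integrable_norm_pow (by norm_num)
  have t0 := hlim (integrable_const (1 : ℝ))
  simp only [integral_const, MeasurableSet.univ, measureReal_restrict_apply, Set.univ_inter,
    smul_eq_mul, mul_one] at t0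
  exact le_of_tendsto_of_tendsto' ((t0.mul (hlim i1)).sub ((hlim (hφK.integrable (by norm_num))).pow 2))
    ((t0.const_mul _).mul (hlim i2)) fun n =>
      poincare_compact hΩ hφ (hS n).1 ((hSK n).trans hKΩ) (hS n).2 fun x hx y hy =>
        norm_sub_le_diam (interior_subset (hSK n hx)) (interior_subset (hSK n hy))

end IsSimplex

/-! ### Coefficients -/

namespace IsCoeff

variable {S : Set (Pt d)} {κ₀ κ₁ : ℝ} {κ : Pt d → ℝ}

theorem mono (hκ : IsCoeff S κ₀ κ₁ κ) {T : Set (Pt d)}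
    (h : volume.restrict T ≤ volume.restrict S) : IsCoeff T κ₀ κ₁ κ :=
  ⟨hκ.1.mono_measure h, ae_mono h hκ.2⟩

theorem ae_norm_le (hκ : IsCoeff S κ₀ κ₁ κ) (h₀ : 0 < κ₀) :
    ∀ᵐ x ∂(volume.restrict S), ‖κ x‖ ≤ κ₁ := by
  filter_upwards [hκ.2] with x hx
  rw [Real.norm_of_nonneg (h₀.le.trans hx.1)]
  exact hx.2

theorem memLp_smul (hκ : IsCoeff S κ₀ κ₁ κ) (h₀ : 0 < κ₀) {E : Type*} [NormedAddCommGroup E]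
    [NormedSpace ℝ E] {G : Pt d → E} (hG : MemLp G 2 (volume.restrict S)) :
    MemLp (fun x => κ x • G x) 2 (volume.restrict S) := by
  refine hG.of_le_mul (c := κ₁) (hκ.1.smul hG.1) ?_
  filter_upwards [hκ.ae_norm_le h₀] with x hx
  rw [norm_smul]
  gcongr

theorem integrable_inner (hκ : IsCoeff S κ₀ κ₁ κ) (h₀ : 0 < κ₀) {G H : Pt d → Pt d}
    (hG : MemLp G 2 (volume.restrict S)) (hH : MemLp H 2 (volume.restrict S)) :
    Integrable (fun x => κ x * ⟪G x, H x⟫) (volume.restrict S) := by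
  simpa only [real_inner_smul_left] using integrable_inner_of_memLp (hκ.memLp_smul h₀ hG) hH

theorem integral_inner_le (hκ : IsCoeff S κ₀ κ₁ κ) (h₀ : 0 < κ₀) (h₁ : 0 ≤ κ₁) {G H : Pt d → Pt d}
    (hG : MemLp G 2 (volume.restrict S)) (hH : MemLp H 2 (volume.restrict S)) :
    ∫ x in S, κ x * ⟪G x, H x⟫ ≤
      κ₁ * l2 (volume.restrict S) G * l2 (volume.restrict S) H := by
  have h1 := (le_abs_self _).trans (abs_integral_inner_le (hκ.memLp_smul h₀ hG) hH)
  simp only [real_inner_smul_left] at h1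
  refine h1.trans (mul_le_mul_of_nonneg_right (l2_mono hG h₁ ?_) (l2_nonneg _))
  filter_upwards [hκ.ae_norm_le h₀] with x hx
  rw [norm_smul]
  gcongr

theorem mul_l2_sq_le (hκ : IsCoeff S κ₀ κ₁ κ) (h₀ : 0 < κ₀) {G : Pt d → Pt d}
    (hG : MemLp G 2 (volume.restrict S)) :
    κ₀ * l2 (volume.restrict S) G ^ 2 ≤ ∫ x in S, κ x * ⟪G x, G x⟫ := by
  rw [l2_sq, ← integral_const_mul]
  refine integral_mono_ae ((hG.integrable_norm_pow (by norm_num)).const_mul _)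
    (hκ.integrable_inner h₀ hG hG) ?_
  filter_upwards [hκ.2] with x hx
  rw [real_inner_self_eq_norm_sq]
  have := hx.1
  gcongr

end IsCoeff

/-! ### Local problems on a simplex -/

theorem exists_unique_on_submodule (V : Submodule ℝ (MPoly d)) [FiniteDimensional ℝ V]
    (B : MPoly d → MPoly d → ℝ) (hadd : ∀ p q v, B (p + q) v = B p v + B q v)
    (hsmul : ∀ (c : ℝ) p v, B (c • p) v = c * B p v) (hadd' : ∀ p q v, B v (p + q) = B v p + B v q)
    (hsmul' : ∀ (c : ℝ) p v, B v (c • p) = c * B v p)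
    (hB : ∀ v ∈ V, B v v = 0 → v = 0) (l : MPoly d →ₗ[ℝ] ℝ) :
    ∃! w, w ∈ V ∧ ∀ v ∈ V, B w v = l v := by
  obtain ⟨w, hw, hu⟩ := exists_unique_of_definite (V := V)
    (LinearMap.mk₂ ℝ (fun p q => B p q) (fun p q v => hadd p q v) (fun c p v => hsmul c p v)
      (fun v p q => hadd' p q v) (fun c v p => hsmul' c p v))
    (fun v hv => Subtype.ext (hB v v.2 (by simpa using hv))) (l ∘ₗ V.subtype)
  refine ⟨w, ⟨w.2, fun v hv => by simpa using hw ⟨v, hv⟩⟩, fun w' hw' => ?_⟩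
  exact congrArg Subtype.val (hu ⟨w', hw'.1⟩ fun v => by simpa using hw'.2 v v.2)

namespace IsSimplex

variable {K : Finset (Pt d)} (hK : IsSimplex K)
include hK

theorem isFiniteMeasure : IsFiniteMeasure (volume.restrict (hull K)) := ⟨by
  rw [Measure.restrict_apply_univ]; exact volume_hull_lt_top⟩

theorem poly_eq_zero_of_l2 {p : MPoly d} (h : ∫ x in hull K, pval p x * pval p x = 0) : p = 0 := by
  refine hK.poly_eq_of_ae ?_
  have hi : Integrable (fun x => pval p x * pval p x) (volume.restrict (hull K)) :=
    integrable_of_continuous (by fun_prop)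
  rw [integral_eq_zero_iff_of_nonneg (fun x => mul_self_nonneg _) hi] at h
  filter_upwards [h] with x hx
  simpa using hx

theorem existsUnique_isL2Proj (k : ℕ) {u : Pt d → ℝ} (hu : MemLp u 2 (volume.restrict (hull K))) :
    ∃! p, IsL2Proj k K u p := by
  have hi : ∀ p q : MPoly d, Integrable (fun x => pval p x * pval q x) (volume.restrict (hull K)) :=
    fun p q => integrable_of_continuous (by fun_prop)
  have hi' : ∀ p : MPoly d, Integrable (fun x => u x * pval p x) (volume.restrict (hull K)) :=
    fun p => integrable_mul_of_memLp hu (memLp_of_continuous (by fun_prop) _)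
  have := exists_unique_on_submodule (MvPolynomial.restrictTotalDegree (Fin d) ℝ k)
    (fun p q => ∫ x in hull K, pval p x * pval q x)
    (fun p q v => by simp only [pval_add, add_mul]; exact integral_add (hi _ _) (hi _ _))
    (fun c p v => by simp only [pval_smul, mul_assoc]; exact integral_const_mul _ _)
    (fun p q v => by simp only [pval_add, mul_add]; exact integral_add (hi _ _) (hi _ _))
    (fun c p v => by simp only [pval_smul, mul_left_comm]; exact integral_const_mul _ _)
    (fun v _ hv => hK.poly_eq_zero_of_l2 hv)
    { toFun := fun v => ∫ x in hull K, u x * pval v x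
      map_add' := fun p q => by
        simp only [pval_add, mul_add]; exact integral_add (hi' _) (hi' _)
      map_smul' := fun c p => by
        simp only [pval_smul, mul_left_comm]; exact integral_const_mul _ _ }
  simpa only [MvPolynomial.mem_restrictTotalDegree, IsL2Proj, LinearMap.coe_mk, AddHom.coe_mk]
    using this

theorem isL2Proj_proj (k : ℕ) {u : Pt d → ℝ} (hu : MemLp u 2 (volume.restrict (hull K))) :
    IsL2Proj k K u (proj k K u) :=
  Classical.epsilon_spec (hK.existsUnique_isL2Proj k hu).exists

theorem integral_proj (k : ℕ) {u : Pt d → ℝ} (hu : MemLp u 2 (volume.restrict (hull K))) :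
    ∫ x in hull K, pval (proj k K u) x = ∫ x in hull K, u x := by
  simpa using (hK.isL2Proj_proj k hu).2 1 (by simp)

/-- The projection error is orthogonal to `π - p`, so this is Pythagoras. -/
theorem l2_sub_proj_le (k : ℕ) {u : Pt d → ℝ} (hu : MemLp u 2 (volume.restrict (hull K)))
    {p : MPoly d} (hp : p.totalDegree ≤ k) :
    l2 (volume.restrict (hull K)) (fun x => u x - pval (proj k K u) x) ≤
      l2 (volume.restrict (hull K)) (fun x => u x - pval p x) := by
  obtain ⟨hd, ho⟩ := hK.isL2Proj_proj k hu
  obtain ⟨π, hπ⟩ : ∃ π, π = proj k K u := ⟨_, rfl⟩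
  rw [← hπ] at hd ho ⊢
  refine Real.sqrt_le_sqrt ?_
  have hpm : ∀ q : MPoly d, MemLp (pval q) 2 (volume.restrict (hull K)) :=
    fun q => memLp_of_continuous (by fun_prop) _
  have h1 : ∫ x in hull K, (u x - pval π x) * pval (π - p) x = 0 := by
    have := ho (π - p) ((MvPolynomial.totalDegree_sub _ _).trans (max_le hd hp))
    simp only [sub_mul]
    rw [integral_sub (integrable_mul_of_memLp hu (hpm _))
      (integrable_mul_of_memLp (hpm _) (hpm _)), this, sub_self]
  have h2 : ∀ x, ‖u x - pval p x‖ ^ 2 = ‖u x - pval π x‖ ^ 2 +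
      (2 * ((u x - pval π x) * pval (π - p) x) + pval (π - p) x ^ 2) := fun x => by
    simp only [Real.norm_eq_abs, sq_abs, pval_sub]; ring
  simp only [h2]
  have i1 := (hu.sub (hpm π)).integrable_norm_pow (by norm_num : (2 : ℕ) ≠ 0)
  have i2 := (integrable_mul_of_memLp (hu.sub (hpm π)) (hpm (π - p))).const_mul 2
  have i3 : Integrable (fun x => pval (π - p) x ^ 2) (volume.restrict (hull K)) :=
    integrable_of_continuous (by fun_prop)
  rw [integral_add (by exact_mod_cast i1) (by exact i2.add i3), integral_add (by exact i2) i3,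
    integral_const_mul, h1]
  have : 0 ≤ ∫ x in hull K, pval (π - p) x ^ 2 := integral_nonneg fun _ => by positivity
  linarith

theorem abs_integral_le_l2 {φ : Pt d → ℝ} (hφ : MemLp φ 2 (volume.restrict (hull K))) :
    |∫ x in hull K, φ x| ≤ √(volume.real (hull K)) * l2 (volume.restrict (hull K)) φ := by
  have hfin := hK.isFiniteMeasure
  have := abs_integral_mul_le (memLp_const (1 : ℝ)) hφ
  simpa [l2] using this

/-- The square root of `2 ^ d` is enlarged to `2 ^ d` to keep roots out of the constants. -/
theorem poincare_l2_of_le {φ : Pt d → ℝ} {G : Pt d → Pt d}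
    (hP : volume.real (hull K) * (∫ x in hull K, φ x ^ 2) - (∫ x in hull K, φ x) ^ 2 ≤
      2 ^ d * diamK K ^ 2 * volume.real (hull K) * ∫ x in hull K, ‖G x‖ ^ 2)
    (h0 : ∫ x in hull K, φ x = 0) :
    l2 (volume.restrict (hull K)) φ ≤ 2 ^ d * diamK K * l2 (volume.restrict (hull K)) G := by
  rw [h0] at hP
  have hv := hK.volume_hull_pos
  have hd := diamK_nonneg (K := K)
  refine Real.sqrt_le_iff.2 ⟨by have := l2_nonneg (μ := volume.restrict (hull K)) G; positivity, ?_⟩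
  rw [mul_pow, l2_sq]
  simp only [Real.norm_eq_abs, sq_abs]
  have h1 : ∫ x in hull K, φ x ^ 2 ≤ 2 ^ d * diamK K ^ 2 * ∫ x in hull K, ‖G x‖ ^ 2 := by
    refine le_of_mul_le_mul_left ?_ hv
    linarith
  refine h1.trans ?_
  have h2 : (2 : ℝ) ^ d * diamK K ^ 2 ≤ (2 ^ d * diamK K) ^ 2 := by
    rw [mul_pow]
    refine mul_le_mul_of_nonneg_right ?_ (sq_nonneg _)
    exact le_self_pow₀ (one_le_pow₀ (by norm_num)) (by norm_num)
  exact mul_le_mul_of_nonneg_right h2 (integral_nonneg fun _ => by positivity)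

theorem poincare_poly {p : MPoly d} (h0 : ∫ x in hull K, pval p x = 0) :
    l2 (volume.restrict (hull K)) (pval p) ≤
      2 ^ d * diamK K * l2 (volume.restrict (hull K)) (pgrad p) := by
  refine hK.poincare_l2_of_le ?_ h0
  have := poincare_smooth (isCompact_hull (K := K)) convex_hull
    (fun x hx y hy => norm_sub_le_diam hx hy) ((contDiff_pval p).of_le (by norm_num))
  simpa only [gradient_pval] using this

theorem exists_mean (φ : Pt d → ℝ) : ∃ m : ℝ, ∫ _ in hull K, m = ∫ x in hull K, φ x := by
  have hv := hK.volume_hull_pos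
  refine ⟨(volume.real (hull K))⁻¹ * ∫ x in hull K, φ x, ?_⟩
  simp [measureReal_restrict_apply MeasurableSet.univ]
  field_simp

theorem l2_const_le {m : ℝ} {φ : Pt d → ℝ} (hφ : MemLp φ 2 (volume.restrict (hull K)))
    (hm : ∫ _ in hull K, m = ∫ x in hull K, φ x) :
    l2 (volume.restrict (hull K)) (fun _ => m) ≤ l2 (volume.restrict (hull K)) φ := by
  have hv := hK.volume_hull_pos
  have h1 := hK.abs_integral_le_l2 hφ
  rw [← hm] at h1
  simp only [integral_const, MeasurableSet.univ, measureReal_restrict_apply, Set.univ_inter,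
    smul_eq_mul, abs_mul, abs_of_pos hv] at h1
  have h2 : l2 (volume.restrict (hull K)) (fun _ => m) = √(volume.real (hull K)) * |m| := by
    rw [l2]
    simp [Real.sqrt_sq_eq_abs]
  rw [h2]
  have h3 := Real.sqrt_pos.2 hv
  refine le_of_mul_le_mul_left ?_ h3
  rwa [← mul_assoc, Real.mul_self_sqrt hv.le]

/-- Coercivity gives existence and uniqueness for the local Neumann problem. -/
theorem existsUnique_neumann (n : ℕ) {κ₀ κ₁ : ℝ} (h₀ : 0 < κ₀) {κ : Pt d → ℝ}
    (hκ : IsCoeff (hull K) κ₀ κ₁ κ) (l : MPoly d →ₗ[ℝ] ℝ) :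
    ∃! z : MPoly d, (z.totalDegree ≤ n ∧ ∫ x in hull K, pval z x = 0) ∧
      ∀ v : MPoly d, (v.totalDegree ≤ n ∧ ∫ x in hull K, pval v x = 0) →
        ∫ x in hull K, κ x * ⟪pgrad z x, pgrad v x⟫ = l v := by
  have hi : ∀ p q : MPoly d, Integrable (fun x => κ x * ⟪pgrad p x, pgrad q x⟫)
      (volume.restrict (hull K)) := fun p q =>
    hκ.integrable_inner h₀ (memLp_of_continuous (by fun_prop) _)
      (memLp_of_continuous (by fun_prop) _)
  obtain ⟨M, hM⟩ : ∃ M : MPoly d →ₗ[ℝ] ℝ, ∀ p, M p = ∫ x in hull K, pval p x :=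
    ⟨{ toFun := fun p => ∫ x in hull K, pval p x
       map_add' := fun p q => by
        simp only [pval_add]
        exact integral_add (integrable_of_continuous (by fun_prop))
          (integrable_of_continuous (by fun_prop))
       map_smul' := fun c p => by simp only [pval_smul]; exact integral_const_mul _ _ },
      fun p => rfl⟩
  have hmem : ∀ p : MPoly d, p ∈ MvPolynomial.restrictTotalDegree (Fin d) ℝ n ⊓ LinearMap.ker M ↔
      p.totalDegree ≤ n ∧ ∫ x in hull K, pval p x = 0 := fun p => by
    rw [Submodule.mem_inf, MvPolynomial.mem_restrictTotalDegree, LinearMap.mem_ker, hM]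
  have : FiniteDimensional ℝ
      (MvPolynomial.restrictTotalDegree (Fin d) ℝ n ⊓ LinearMap.ker M : Submodule ℝ (MPoly d)) :=
    Submodule.finiteDimensional_of_le inf_le_left
  have := exists_unique_on_submodule
    (MvPolynomial.restrictTotalDegree (Fin d) ℝ n ⊓ LinearMap.ker M)
    (fun p q => ∫ x in hull K, κ x * ⟪pgrad p x, pgrad q x⟫)
    (fun p q v => by
      simp only [pgrad_add, inner_add_left, mul_add]; exact integral_add (hi _ _) (hi _ _))
    (fun c p v => by
      simp only [pgrad_smul, real_inner_smul_left, mul_left_comm]; exact integral_const_mul _ _)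
    (fun p q v => by
      simp only [pgrad_add, inner_add_right, mul_add]; exact integral_add (hi _ _) (hi _ _))
    (fun c p v => by
      simp only [pgrad_smul, real_inner_smul_right, mul_left_comm]; exact integral_const_mul _ _)
    -- Coercivity forces the gradient of `v` to vanish, and then the Poincaré inequality forces the
    -- mean-free polynomial `v` itself to vanish.
    (fun v hv h => by
      have h1 := hκ.mul_l2_sq_le h₀ (G := pgrad v) (memLp_of_continuous (by fun_prop) _)
      rw [h] at h1
      have h2 : l2 (volume.restrict (hull K)) (pgrad v) = 0 := by
        have : l2 (volume.restrict (hull K)) (pgrad v) ^ 2 ≤ 0 := by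
          by_contra! hlt
          nlinarith
        exact pow_eq_zero_iff (two_ne_zero) |>.1 (le_antisymm this (sq_nonneg _))
      have h3 := hK.poincare_poly ((hmem v).1 hv).2
      rw [h2, mul_zero] at h3
      have h4 := l2_sq (μ := volume.restrict (hull K)) (pval v)
      rw [le_antisymm h3 (l2_nonneg _)] at h4
      refine hK.poly_eq_zero_of_l2 ?_
      simp only [Real.norm_eq_abs, sq_abs] at h4
      simp only [← sq, ← h4]
      norm_num) l
  simpa only [hmem] using this

/-- The local error of the postprocessing, for a flux functional that is consistent up to `A`. -/
theorem local_error {n : ℕ} {κ₀ κ₁ : ℝ} (h₀ : 0 < κ₀) {κ : Pt d → ℝ}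
    (hκ : IsCoeff (hull K) κ₀ κ₁ κ) {u uh : Pt d → ℝ}
    (hu : MemLp u 2 (volume.restrict (hull K))) (huh : MemLp uh 2 (volume.restrict (hull K)))
    (k : ℕ) {w P : MPoly d} (hw : w.totalDegree ≤ n) (hP : P.totalDegree ≤ n)
    (hmean : ∫ x in hull K, pval w x = ∫ x in hull K, uh x) {A : ℝ} (hA : 0 ≤ A)
    (hflux : ∀ v : MPoly d, v.totalDegree ≤ n → ∫ x in hull K, pval v x = 0 →
      ∫ x in hull K, κ x * ⟪pgrad w x - pgrad P x, pgrad v x⟫ ≤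
        A * l2 (volume.restrict (hull K)) (pgrad v)) :
    l2 (volume.restrict (hull K)) (fun x => u x - pval w x) ≤
      2 * l2 (volume.restrict (hull K)) (fun x => u x - pval P x) +
      l2 (volume.restrict (hull K)) (fun x => uh x - pval (proj k K u) x) +
      2 ^ d * κ₀⁻¹ * diamK K * A := by
  have hpm : ∀ q : MPoly d, MemLp (pval q) 2 (volume.restrict (hull K)) :=
    fun q => memLp_of_continuous (by fun_prop) _
  have hfin := hK.isFiniteMeasure
  have hint : ∀ {φ : Pt d → ℝ}, MemLp φ 2 (volume.restrict (hull K)) →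
    Integrable φ (volume.restrict (hull K)) := fun h => h.integrable (by norm_num)
  -- Since `Π_k` preserves means and `w` has the mean of `u_h`, the mean of `w - P` is `m₁ + m₂`,
  -- and `v` below is the mean-free part of `w - P`. The constant `m₁`, bounded by `u - P`, is the
  -- reason for the factor `2` in the estimate.
  obtain ⟨m₁, hm₁⟩ := hK.exists_mean (fun x => u x - pval P x)
  obtain ⟨m₂, hm₂⟩ := hK.exists_mean (fun x => uh x - pval (proj k K u) x)
  have hl₁ : _ ≤ l2 _ (fun x => u x - pval P x) := hK.l2_const_le (hu.sub (hpm P)) hm₁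
  have hl₂ : _ ≤ l2 _ (fun x => uh x - pval (proj k K u) x) := hK.l2_const_le (huh.sub (hpm (proj k K u))) hm₂
  obtain ⟨v, hv⟩ : ∃ v, v = w - P - MvPolynomial.C (m₁ + m₂) := ⟨_, rfl⟩
  have hvd : v.totalDegree ≤ n := by
    rw [hv]
    refine (MvPolynomial.totalDegree_sub _ _).trans (max_le
      ((MvPolynomial.totalDegree_sub _ _).trans (max_le hw hP)) ((MvPolynomial.totalDegree_C _).trans_le (Nat.zero_le n)))
  have hv0 : ∫ x in hull K, pval v x = 0 := by
    rw [hv]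
    simp only [pval_sub, pval_C]
    rw [integral_sub (hint (by exact (hpm w).sub (hpm P))) (integrable_const _),
      integral_sub (hint (hpm _)) (hint (hpm _)), integral_add (integrable_const _) (integrable_const _), hm₁, hm₂, integral_sub (hint hu) (hint (hpm _)),
      integral_sub (hint huh) (hint (hpm _)), hK.integral_proj k hu, hmean]
    ring
  have hg : ∀ x, pgrad w x - pgrad P x = pgrad v x := fun x => by
    rw [hv, pgrad_sub, pgrad_sub, pgrad_C, sub_zero]
  have h1 := hflux v hvd hv0
  simp only [hg] at h1
  have hgm : MemLp (pgrad v) 2 (volume.restrict (hull K)) := memLp_of_continuous (by fun_prop) _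
  have h2 := (hκ.mul_l2_sq_le h₀ hgm).trans h1
  have h3 : l2 (volume.restrict (hull K)) (pgrad v) ≤ κ₀⁻¹ * A := by
    rcases (l2_nonneg (μ := volume.restrict (hull K)) (pgrad v)).eq_or_lt with h | h
    · rw [← h]; positivity
    · rw [inv_mul_eq_div, le_div_iff₀ h₀]
      refine le_of_mul_le_mul_right ?_ h
      linarith [sq (l2 (volume.restrict (hull K)) (pgrad v))]
  have h4 := hK.poincare_poly hv0
  have h5 : l2 (volume.restrict (hull K)) (pval v) ≤ 2 ^ d * κ₀⁻¹ * diamK K * A := by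
    refine h4.trans ?_
    have := diamK_nonneg (K := K)
    calc _ ≤ 2 ^ d * diamK K * (κ₀⁻¹ * A) := by gcongr
      _ = _ := by ring
  have hsplit : (fun x => u x - pval w x) =
      fun x => (u x - pval P x) - ((pval v x + m₁) + m₂) := by
    ext x; rw [hv]; simp only [pval_sub, pval_C]; ring
  rw [hsplit]
  have c1 : MemLp (fun _ : Pt d => m₁) 2 (volume.restrict (hull K)) := memLp_const _
  have c2 : MemLp (fun _ : Pt d => m₂) 2 (volume.restrict (hull K)) := memLp_const _
  have t1 : _ ≤ l2 _ (fun x => u x - pval P x) + l2 _ (fun x => (pval v x + m₁) + m₂) :=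
    l2_sub_le (hu.sub (hpm P)) (((hpm v).add c1).add c2)
  have t2 : _ ≤ l2 _ (fun x => pval v x + m₁) + l2 _ (fun _ => m₂) := l2_add_le ((hpm v).add c1) c2
  have t3 := l2_add_le (hpm v) c1
  refine t1.trans ?_
  linarith

end IsSimplex

/-! ### Boundary integrals -/

namespace IsSimplex

variable {K : Finset (Pt d)} (hK : IsSimplex K)
include hK

theorem diamK_mul_norm_bgrad_le {γ r : ℝ} (hr : 0 < r) {c : Pt d}
    (hb : Metric.closedBall c r ⊆ hull K) (hγ : diamK K ≤ γ * (2 * r)) {a : Pt d} (ha : a ∈ K) :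
    diamK K * ‖bgrad K a‖ ≤ γ := by
  have hγ0 : 0 ≤ γ := by
    have := diamK_nonneg (K := K)
    by_contra! h
    nlinarith
  calc diamK K * ‖bgrad K a‖ ≤ γ * (2 * r) * ‖bgrad K a‖ := by gcongr
    _ = γ * (2 * r * ‖bgrad K a‖) := by ring
    _ ≤ γ * 1 := by have := hK.bgrad_norm_le hr hb ha; gcongr
    _ = γ := mul_one γ

/-- The trace inequality on each of the `d + 1` facets, with `‖v‖` bounded by the Poincaré
inequality. Shape regularity bounds `diamK K * ‖bgrad K a‖`, and the power of `h_K` that remains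
matches the weight in the boundary norm. -/
theorem bdryInt_sq_le (hd : 1 ≤ d) {γ r : ℝ} (hr : 0 < r) {c : Pt d}
    (hb : Metric.closedBall c r ⊆ hull K) (hγ : diamK K ≤ γ * (2 * r)) {v : MPoly d}
    (h0 : ∫ x in hull K, pval v x = 0) :
    bdryInt K (fun _ x => pval v x ^ 2) ≤ (d + 1) * (γ * (d * 4 ^ d + 2 * 2 ^ d)) *
      diamK K * l2 (volume.restrict (hull K)) (pgrad v) ^ 2 := by
  have hh := diamK_nonneg (K := K)
  have hL := l2_nonneg (μ := volume.restrict (hull K)) (pgrad v)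
  have hP := hK.poincare_poly h0
  have hv := l2_nonneg (μ := volume.restrict (hull K)) (pval v)
  have key : ∀ a ∈ K, ∫ x, pval v x ^ 2 ∂(surf (facet K a)) ≤
      γ * (d * 4 ^ d + 2 * 2 ^ d) * diamK K * l2 (volume.restrict (hull K)) (pgrad v) ^ 2 := by
    intro a ha
    refine (hK.trace_inequality hd ha v).trans ?_
    have h1 : ‖bgrad K a‖ * diamK K ≤ γ :=
      (mul_comm _ _).trans_le (hK.diamK_mul_norm_bgrad_le hr hb hγ ha)
    calc _ ≤ ‖bgrad K a‖ * (d * (2 ^ d * diamK K * l2 (volume.restrict (hull K)) (pgrad v)) ^ 2 +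
          2 * diamK K * (2 ^ d * diamK K * l2 (volume.restrict (hull K)) (pgrad v)) *
            l2 (volume.restrict (hull K)) (pgrad v)) := by gcongr
      _ = (‖bgrad K a‖ * diamK K) * ((d * 4 ^ d + 2 * 2 ^ d) * diamK K *
            l2 (volume.restrict (hull K)) (pgrad v) ^ 2) := by
        rw [show (4 : ℝ) ^ d = (2 ^ d) ^ 2 by rw [← pow_mul, mul_comm, pow_mul]; norm_num]
        ring
      _ ≤ γ * ((d * 4 ^ d + 2 * 2 ^ d) * diamK K *
            l2 (volume.restrict (hull K)) (pgrad v) ^ 2) := by gcongr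
      _ = _ := by ring
  refine (Finset.sum_le_sum key).trans_eq ?_
  rw [Finset.sum_const, hK.card, nsmul_eq_mul]
  push_cast
  ring

omit hK in
theorem bdryInt_nonneg {F : Pt d → Pt d → ℝ} (hF : ∀ a x, 0 ≤ F a x) : 0 ≤ bdryInt K F :=
  Finset.sum_nonneg fun a _ => integral_nonneg fun x => hF a x

omit hK in
theorem bdryInt_mul_le {F : Pt d → Pt d → ℝ} {φ : Pt d → Pt d → ℝ}
    (hF : ∀ a ∈ K, MemLp (F a) 2 (surf (facet K a)))
    (hφ : ∀ a ∈ K, MemLp (φ a) 2 (surf (facet K a))) :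
    bdryInt K (fun a x => F a x * φ a x) ≤
      √(bdryInt K fun a x => F a x ^ 2) * √(bdryInt K fun a x => φ a x ^ 2) := by
  have h1 : bdryInt K (fun a x => F a x * φ a x) ≤
      ∑ a ∈ K, l2 (surf (facet K a)) (F a) * l2 (surf (facet K a)) (φ a) :=
    Finset.sum_le_sum fun a ha => (le_abs_self _).trans (abs_integral_mul_le (hF a ha) (hφ a ha))
  refine h1.trans ((Real.sum_mul_le_sqrt_mul_sqrt _ _ _).trans_eq ?_)
  simp only [l2_sq, Real.norm_eq_abs, sq_abs, bdryInt]

/-- The functional `v ↦ (f, v)_K - ⟨F, v⟩_∂K`. -/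
theorem exists_rhs (hd : 1 ≤ d) {f : Pt d → ℝ} (hf : MemLp f 2 (volume.restrict (hull K)))
    {F : Pt d → Pt d → ℝ} (hF : ∀ a ∈ K, MemLp (F a) 2 (surf (facet K a))) :
    ∃ l : MPoly d →ₗ[ℝ] ℝ, ∀ v, l v =
      (∫ x in hull K, f x * pval v x) - bdryInt K fun a x => F a x * pval v x := by
  have hi : ∀ p : MPoly d, Integrable (fun x => f x * pval p x) (volume.restrict (hull K)) :=
    fun p => integrable_mul_of_memLp hf (memLp_of_continuous (by fun_prop) _)
  have hi' : ∀ a ∈ K, ∀ p : MPoly d, Integrable (fun x => F a x * pval p x) (surf (facet K a)) :=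
    fun a ha p => integrable_mul_of_memLp (hF a ha)
      (hK.memLp_surf_of_continuous hd ha (by fun_prop) _)
  refine ⟨{ toFun := fun v =>
      (∫ x in hull K, f x * pval v x) - bdryInt K fun a x => F a x * pval v x
            map_add' := fun p q => ?_
            map_smul' := fun c p => ?_ }, fun v => rfl⟩
  · simp only [pval_add, mul_add, bdryInt]
    rw [integral_add (hi p) (hi q), Finset.sum_congr rfl fun a ha =>
      integral_add (hi' a ha p) (hi' a ha q), Finset.sum_add_distrib]
    ring
  · simp only [pval_smul, mul_left_comm _ c, bdryInt, integral_const_mul, RingHom.id_apply,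
      ← Finset.mul_sum, smul_eq_mul]
    ring

end IsSimplex

/-! ### Elements of a mesh -/

namespace Mesh

variable {Ω : Set (Pt d)} (T : Mesh Ω)

theorem mem_cells {K : Finset (Pt d)} : K ∈ T.cells ↔ K ∈ T.complex.faces ∧ K.card = d + 1 := by
  simp [cells]

theorem isSimplex {K : Finset (Pt d)} (hK : K ∈ T.cells) : IsSimplex K :=
  ⟨T.complex.indep (T.mem_cells.1 hK).1, (T.mem_cells.1 hK).2⟩

theorem hull_subset {K : Finset (Pt d)} (hK : K ∈ T.cells) : hull K ⊆ closure Ω :=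
  T.cover ▸ T.complex.convexHull_subset_space (T.mem_cells.1 hK).1

theorem interior_hull_subset (hΩ : interior (closure Ω) = Ω) {K : Finset (Pt d)}
    (hK : K ∈ T.cells) : interior (hull K) ⊆ Ω :=
  hΩ ▸ interior_mono (T.hull_subset hK)

theorem restrict_hull_le (hΩ : interior (closure Ω) = Ω) {K : Finset (Pt d)} (hK : K ∈ T.cells) :
    volume.restrict (hull K) ≤ volume.restrict Ω := by
  rw [← (T.isSimplex hK).ae_restrict_interior]
  exact Measure.restrict_mono (T.interior_hull_subset hΩ hK) le_rfl

theorem diamK_le_size (K : T.cells) : diamK K.1 ≤ T.size :=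
  le_ciSup (f := fun K : T.cells => diamK K.1) (Set.finite_range _).bddAbove K

theorem size_nonneg : 0 ≤ T.size := Real.iSup_nonneg fun _ => IsSimplex.diamK_nonneg

theorem norm_eq (F : T.cells → Pt d → ℝ) :
    T.norm F = √(∑ K, l2 (volume.restrict (hull K.1)) (F K) ^ 2) := by
  simp only [norm, l2_sq, Real.norm_eq_abs, sq_abs]

theorem scaledNorm_eq (F : T.cells → Pt d → Pt d) :
    T.scaledNorm F = √(∑ K, (diamK K.1 * l2 (volume.restrict (hull K.1)) (F K)) ^ 2) := by
  simp only [scaledNorm, mul_pow, l2_sq]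

theorem norm_nonneg (F : T.cells → Pt d → ℝ) : 0 ≤ T.norm F := Real.sqrt_nonneg _

/-! ### Existence and uniqueness of the postprocessings -/

variable {k : ℕ} {κ₀ κ₁ : ℝ} {κ f : Pt d → ℝ} {uh : T.cells → Pt d → ℝ}
  {qh : T.cells → Pt d → Pt d}

/-- On each element the mean-free part solves a Neumann problem and the mean condition fixes the
constant; no compatibility of the data is needed, as constants are not among the test functions. -/
theorem existsUnique_isSplitPostprocessing (hd : 1 ≤ d) (h₀ : 0 < κ₀)
    (hκ : ∀ K : T.cells, IsCoeff (hull K.1) κ₀ κ₁ κ)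
    (hf : ∀ K : T.cells, MemLp f 2 (volume.restrict (hull K.1)))
    (hq : ∀ K : T.cells, ∀ a ∈ K.1, MemLp (fun x => ⟪qh K x, normal K.1 a⟫) 2
      (surf (facet K.1 a))) (k : ℕ) (uh : T.cells → Pt d → ℝ) :
    ∃! w, T.IsSplitPostprocessing k κ f uh qh w := by
  choose l hl using fun K : T.cells => (T.isSimplex K.2).exists_rhs hd (hf K) (hq K)
  choose z hz hu using fun K : T.cells =>
    (T.isSimplex K.2).existsUnique_neumann (k + 1) h₀ (hκ K) (l K)
  choose c hc using fun K : T.cells => (T.isSimplex K.2).exists_mean (uh K)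
  refine ⟨fun K => MvPolynomial.C (c K) + z K, ⟨c, z, fun K => ⟨rfl, (hz K).1.1, (hz K).1.2,
    fun v hv hv0 => ?_, hc K⟩⟩, ?_⟩
  · rw [(hz K).2 v ⟨hv, hv0⟩, hl]
  · rintro w ⟨c', z', h⟩
    funext K
    obtain ⟨hw, h1, h2, h3, h4⟩ := h K
    have e1 : z' K = z K := hu K _ ⟨⟨h1, h2⟩, fun v hv => by rw [h3 v hv.1 hv.2, hl]⟩
    have e2 : c' K = c K := by
      have := h4.trans (hc K).symm
      simpa [(T.isSimplex K.2).volume_hull_pos.ne'] using this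
    rw [hw, e1, e2]

/-- For a constant test function the left side of the flux equation vanishes, and conservation says
that the right side does too. So testing with all polynomials is the same as testing with mean-free
ones. -/
theorem isPostprocessing_iff (hd : 1 ≤ d)
    (hf : ∀ K : T.cells, MemLp f 2 (volume.restrict (hull K.1)))
    (hq : ∀ K : T.cells, ∀ a ∈ K.1, MemLp (fun x => ⟪qh K x, normal K.1 a⟫) 2
      (surf (facet K.1 a))) (hc : T.IsConservative f qh) (w : T.cells → MPoly d) :
    T.IsPostprocessing k κ f uh qh w ↔ T.IsSplitPostprocessing k κ f uh qh w := by
  have hint : ∀ (K : T.cells) (p : MPoly d), Integrable (pval p) (volume.restrict (hull K.1)) :=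
    fun K p => IsSimplex.integrable_of_continuous (by fun_prop)
  constructor
  · intro h
    choose c hc using fun K : T.cells => (T.isSimplex K.2).exists_mean (pval (w K))
    refine ⟨c, fun K => w K - MvPolynomial.C (c K), fun K => ⟨by ring, ?_, ?_, fun v hv _ => ?_, ?_⟩⟩
    · exact (MvPolynomial.totalDegree_sub _ _).trans (max_le (h.degree K)
        ((MvPolynomial.totalDegree_C _).trans_le (Nat.zero_le _)))
    · have hfin := (T.isSimplex K.2).isFiniteMeasure
      simp only [pval_sub, pval_C]
      rw [integral_sub (hint K _) (integrable_const _), hc, sub_self]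
    · simpa only [pgrad_sub, pgrad_C, sub_zero] using h.flux K v hv
    · rw [hc, h.mean]
  · rintro ⟨c, z, h⟩
    refine ⟨fun K => ?_, fun K v hv => ?_, fun K => ?_⟩ <;> obtain ⟨hw, h1, h2, h3, h4⟩ := h K
    · rw [hw]
      exact (MvPolynomial.totalDegree_add _ _).trans (max_le
        ((MvPolynomial.totalDegree_C _).trans_le (Nat.zero_le _)) h1)
    · obtain ⟨m, hm⟩ := (T.isSimplex K.2).exists_mean (pval v)
      obtain ⟨l, hl⟩ := (T.isSimplex K.2).exists_rhs hd (hf K) (hq K)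
      have hfin := (T.isSimplex K.2).isFiniteMeasure
      have key := h3 (v - MvPolynomial.C m) ((MvPolynomial.totalDegree_sub _ _).trans (max_le hv
        ((MvPolynomial.totalDegree_C _).trans_le (Nat.zero_le _)))) (by
          simp only [pval_sub, pval_C]
          rw [integral_sub (hint K _) (integrable_const _), hm, sub_self])
      have hl1 : l 1 = 0 := by
        rw [hl]
        simpa using sub_eq_zero.2 (hc K)
      rw [← hl, map_sub, ← mul_one (MvPolynomial.C m), ← MvPolynomial.smul_eq_C_mul, map_smul, hl1,
        smul_zero, sub_zero, hl] at key
      rw [← key, hw]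
      simp [pgrad_sub, pgrad_add, MvPolynomial.smul_eq_C_mul]
    · have hfin := (T.isSimplex K.2).isFiniteMeasure
      rw [hw]
      simp only [pval_add, pval_C]
      rw [integral_add (integrable_const _) (hint K _), h2, h4, add_zero]

/-- Summation of the local error bounds. -/
theorem norm_sub_le_of_local {C : ℝ} (hC : 0 ≤ C) {u : Pt d → ℝ} {w P : T.cells → MPoly d}
    {B D : T.cells → ℝ}
    (h : ∀ K, l2 (volume.restrict (hull K.1)) (fun x => u x - pval (w K) x) ≤
      2 * l2 (volume.restrict (hull K.1)) (fun x => u x - pval (P K) x) +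
      l2 (volume.restrict (hull K.1)) (fun x => uh K x - pval (proj k K.1 u) x) + C * (B K + D K)) :
    T.norm (fun K x => u x - pval (w K) x) ≤
      2 * T.norm (fun K x => u x - pval (P K) x) +
      T.norm (fun K x => uh K x - pval (proj k K.1 u) x) +
      C * (√(∑ K, B K ^ 2) + √(∑ K, D K ^ 2)) := by
  simp only [norm_eq]
  have hs : ∀ (c : ℝ) (F : T.cells → ℝ), 0 ≤ c → √(∑ K, (c * F K) ^ 2) = c * √(∑ K, F K ^ 2) := by
    intro c F hc
    simp_rw [mul_pow]
    rw [← Finset.mul_sum, Real.sqrt_mul (sq_nonneg c), Real.sqrt_sq hc]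
  refine (sqrt_sum_sq_le _ _ _ (fun K _ => l2_nonneg _) fun K _ => h K).trans ?_
  refine (sqrt_sum_add_sq_le _ _ _).trans ?_
  rw [hs C _ hC]
  refine add_le_add ?_ (mul_le_mul_of_nonneg_left (sqrt_sum_add_sq_le _ _ _) hC)
  refine (sqrt_sum_add_sq_le _ _ _).trans ?_
  rw [hs 2 _ (by norm_num)]

/-- The error bound for the postprocessings, with its constant. -/
theorem errorBound (hd : 1 ≤ d) (hΩ : interior (closure Ω) = Ω) {γ : ℝ} (hT : T.ShapeRegular γ)
    (h₀ : 0 < κ₀) (hκ : IsCoeff Ω κ₀ κ₁ κ) {u : Pt d → ℝ} {G q : Pt d → Pt d}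
    (hs : IsSolution Ω κ f u G q) {σ : T.cells → Pt d → ℝ}
    (hσ : ∀ K, HasNormalTrace K.1 q f (σ K))
    (huh : ∀ K : T.cells, MemLp (uh K) 2 (volume.restrict (hull K.1)))
    (hq : ∀ K : T.cells, ∀ a ∈ K.1, MemLp (fun x => ⟪qh K x, normal K.1 a⟫) 2
      (surf (facet K.1 a)))
    {w : T.cells → MPoly d} (hw : T.IsSplitPostprocessing k κ f uh qh w) :
    T.ErrorBound k (2 + 2 ^ d * κ₀⁻¹ * (|κ₁| + √((d + 1) * (|γ| * (d * 4 ^ d + 2 * 2 ^ d)))))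
      u G σ uh qh w := by
  obtain ⟨c₁, hc₁⟩ : ∃ c, c = √((d + 1) * (|γ| * (d * 4 ^ d + 2 * 2 ^ d))) := ⟨_, rfl⟩
  have hc₁0 : 0 ≤ c₁ := hc₁ ▸ Real.sqrt_nonneg _
  rw [← hc₁]
  have hloc : ∀ K : T.cells, l2 (volume.restrict (hull K.1)) (fun x => u x - pval (w K) x) ≤
      2 * l2 (volume.restrict (hull K.1)) (fun x => u x - pval (proj (k + 1) K.1 u) x) +
      l2 (volume.restrict (hull K.1)) (fun x => uh K x - pval (proj k K.1 u) x) +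
      2 ^ d * κ₀⁻¹ * (|κ₁| * (diamK K.1 * l2 (volume.restrict (hull K.1))
          (fun x => G x - pgrad (proj (k + 1) K.1 u) x)) +
        c₁ * (T.size * √(diamK K.1 *
          bdryInt K.1 fun a x => (σ K x - ⟪qh K x, normal K.1 a⟫) ^ 2))) := by
    intro K
    obtain ⟨c, r, hr, hb, hγ⟩ := hT K.1 K.2
    have hK := T.isSimplex K.2
    have hle := T.restrict_hull_le hΩ K.2
    have hκK := hκ.mono hle
    have hu := hs.grad.memLp.mono_measure hle
    have hG := hs.grad.memLp_grad.mono_measure hle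
    have hqm := hs.div.memLp.mono_measure hle
    have hfm := hs.div.memLp_div.mono_measure hle
    have hlaw := ae_mono hle hs.law
    obtain ⟨c', z, hz⟩ := hw
    obtain ⟨hwK, h1, h2, h3, h4⟩ := hz K
    obtain ⟨π, hπ⟩ : ∃ π, π = proj (k + 1) K.1 u := ⟨_, rfl⟩
    have hπd : π.totalDegree ≤ k + 1 := hπ ▸ (hK.isL2Proj_proj (k + 1) hu).1
    have hfin := hK.isFiniteMeasure
    have hh := IsSimplex.diamK_nonneg (K := K.1)
    have hgm : ∀ p : MPoly d, MemLp (pgrad p) 2 (volume.restrict (hull K.1)) :=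
      fun p => IsSimplex.memLp_of_continuous (by fun_prop) _
    -- The consistency bound `A` has two terms: the approximation error of the gradient, and the
    -- flux error on the boundary times the trace constant `c₁ * √(diamK K)`.
    have hm := hK.local_error (n := k + 1) (A := |κ₁| * l2 (volume.restrict (hull K.1))
        (fun x => G x - pgrad π x) + √(bdryInt K.1 fun a x => (σ K x - ⟪qh K x, normal K.1 a⟫) ^ 2) *
        (c₁ * √(diamK K.1))) h₀ hκK hu (huh K) k (w := w K) (P := π) ?_ hπd ?_ ?_ ?_
    · rw [← hπ]
      refine hm.trans (add_le_add le_rfl ?_)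
      rw [mul_assoc]
      refine mul_le_mul_of_nonneg_left ?_ (by positivity)
      rw [mul_add, Real.sqrt_mul hh]
      have hds := T.diamK_le_size K
      have : diamK K.1 * (√(bdryInt K.1 fun a x => (σ K x - ⟪qh K x, normal K.1 a⟫) ^ 2) *
          (c₁ * √(diamK K.1))) ≤ T.size * (√(bdryInt K.1 fun a x =>
            (σ K x - ⟪qh K x, normal K.1 a⟫) ^ 2) * (c₁ * √(diamK K.1))) := by gcongr
      linarith
    · rw [hwK]
      exact (MvPolynomial.totalDegree_add _ _).trans (max_le
        ((MvPolynomial.totalDegree_C _).trans_le (Nat.zero_le _)) h1)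
    · rw [hwK]
      simp only [pval_add, pval_C]
      rw [integral_add (integrable_const _) (IsSimplex.integrable_of_continuous (by fun_prop)),
        h2, h4, add_zero]
    · have := l2_nonneg (μ := volume.restrict (hull K.1)) (fun x => G x - pgrad π x)
      positivity
    · intro v hv hv0
      -- Neither `κ₁` nor `γ` is assumed to be nonnegative, so the bounds are weakened to absolute
      -- values.
      have hκ1 : 0 ≤ |κ₁| := abs_nonneg _
      have hκabs : IsCoeff (hull K.1) κ₀ |κ₁| κ :=
        ⟨hκK.1, hκK.2.mono fun x hx => ⟨hx.1, hx.2.trans (le_abs_self _)⟩⟩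
      obtain ⟨hσm, hσv⟩ := hσ K
      have e1 : ∫ x in hull K.1, κ x * ⟪pgrad (w K) x, pgrad v x⟫ =
          (∫ x in hull K.1, f x * pval v x) -
            bdryInt K.1 fun a x => ⟪qh K x, normal K.1 a⟫ * pval v x := by
        rw [← h3 v hv hv0, hwK]
        simp [pgrad_add]
      have e2 : ∫ x in hull K.1, ⟪q x, pgrad v x⟫ = - ∫ x in hull K.1, κ x * ⟪G x, pgrad v x⟫ := by
        rw [← integral_neg]
        refine integral_congr_ae ?_
        filter_upwards [hlaw, hκK.2] with x hx hx'
        have hne : κ x ≠ 0 := (h₀.trans_le hx'.1).ne'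
        have : q x = -(κ x • G x) := by
          rw [eq_neg_iff_add_eq_zero, ← smul_eq_zero_iff_right (inv_ne_zero hne), smul_add,
            inv_smul_smul₀ hne, hx]
        rw [this, inner_neg_left, real_inner_smul_left]
      have e3 := hσv (pval v) (contDiff_pval v)
      simp only [gradient_pval] at e3
      rw [e2] at e3
      have e4 : (bdryInt K.1 fun a x => (σ K x - ⟪qh K x, normal K.1 a⟫) * pval v x) =
          (bdryInt K.1 fun a x => σ K x * pval v x) -
            bdryInt K.1 fun a x => ⟪qh K x, normal K.1 a⟫ * pval v x := by
        simp only [bdryInt]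
        rw [← Finset.sum_sub_distrib]
        refine Finset.sum_congr rfl fun a ha => ?_
        rw [← integral_sub (integrable_mul_of_memLp (hσm a ha)
          (hK.memLp_surf_of_continuous hd ha (by fun_prop) _)) (integrable_mul_of_memLp (hq K a ha)
          (hK.memLp_surf_of_continuous hd ha (by fun_prop) _))]
        simp only [sub_mul]
      -- The error equation: Green's formula for the exact flux has eliminated `f`, leaving the
      -- gradient error and the jump between the exact and the approximate normal fluxes.
      have e5 : ∫ x in hull K.1, κ x * ⟪pgrad (w K) x - pgrad π x, pgrad v x⟫ =
          (∫ x in hull K.1, κ x * ⟪G x - pgrad π x, pgrad v x⟫) +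
            bdryInt K.1 fun a x => (σ K x - ⟪qh K x, normal K.1 a⟫) * pval v x := by
        simp only [inner_sub_left, mul_sub]
        rw [integral_sub (hκK.integrable_inner h₀ (hgm _) (hgm _))
          (hκK.integrable_inner h₀ (hgm _) (hgm _)), integral_sub (hκK.integrable_inner h₀ hG
          (hgm _)) (hκK.integrable_inner h₀ (hgm _) (hgm _)), e1, e4]
        linarith
      rw [e5, add_mul]
      refine add_le_add (hκabs.integral_inner_le h₀ hκ1 (hG.sub (hgm π)) (hgm v)) ?_
      refine (IsSimplex.bdryInt_mul_le (F := fun a x => σ K x - ⟪qh K x, normal K.1 a⟫)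
        (φ := fun _ => pval v) (fun a ha => (hσm a ha).sub (hq K a ha))
        (fun a ha => hK.memLp_surf_of_continuous hd ha (by fun_prop) _)).trans ?_
      rw [mul_assoc]
      refine mul_le_mul_of_nonneg_left ?_ (Real.sqrt_nonneg _)
      have hγ' : diamK K.1 ≤ |γ| * (2 * r) :=
        hγ.trans (mul_le_mul_of_nonneg_right (le_abs_self _) (by positivity))
      refine (Real.sqrt_le_sqrt (hK.bdryInt_sq_le hd hr hb hγ' hv0)).trans_eq ?_
      rw [Real.sqrt_mul (by positivity), Real.sqrt_mul (by positivity), Real.sqrt_sq (l2_nonneg _),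
        hc₁]
  have hsum := T.norm_sub_le_of_local (by positivity) hloc
  have hs' : ∀ (c : ℝ) (F : T.cells → ℝ), 0 ≤ c → √(∑ K, (c * F K) ^ 2) = c * √(∑ K, F K ^ 2) := by
    intro c F hc
    simp_rw [mul_pow]
    rw [← Finset.mul_sum, Real.sqrt_mul (sq_nonneg c), Real.sqrt_sq hc]
  rw [hs' _ _ (abs_nonneg _), hs' _ _ hc₁0, hs' _ _ T.size_nonneg, ← scaledNorm_eq] at hsum
  have hbd : √(∑ K : T.cells, √(diamK K.1 *
      bdryInt K.1 fun a x => (σ K x - ⟪qh K x, normal K.1 a⟫) ^ 2) ^ 2) =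
      T.bdryNorm (fun K a x => σ K x - ⟪qh K x, normal K.1 a⟫) := by
    rw [bdryNorm]
    congr 1
    refine Finset.sum_congr rfl fun K _ => Real.sq_sqrt ?_
    exact mul_nonneg IsSimplex.diamK_nonneg (IsSimplex.bdryInt_nonneg fun _ _ => sq_nonneg _)
  rw [hbd] at hsum
  refine hsum.trans ?_
  have n1 := T.norm_nonneg (fun K x => u x - pval (proj (k + 1) K.1 u) x)
  have n2 : 0 ≤ T.scaledNorm (fun K x => G x - pgrad (proj (k + 1) K.1 u) x) := Real.sqrt_nonneg _
  have n3 := T.norm_nonneg (fun K x => uh K x - pval (proj k K.1 u) x)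
  have n4 : 0 ≤ T.bdryNorm (fun K a x => σ K x - ⟪qh K x, normal K.1 a⟫) := Real.sqrt_nonneg _
  have n5 := T.size_nonneg
  obtain ⟨N4, hN4⟩ : ∃ N, N = T.size * T.bdryNorm (fun K a x => σ K x - ⟪qh K x, normal K.1 a⟫) :=
    ⟨_, rfl⟩
  have n6 : 0 ≤ N4 := hN4 ▸ mul_nonneg n5 n4
  rw [← hN4]
  obtain ⟨D, hD⟩ : ∃ D, D = 2 ^ d * κ₀⁻¹ := ⟨_, rfl⟩
  have hD0 : 0 ≤ D := hD ▸ by positivity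
  rw [← hD]
  have m1 := mul_nonneg hD0 (abs_nonneg κ₁)
  have m2 := mul_nonneg hD0 hc₁0
  -- The coefficients `2`, `1`, `D * |κ₁|` and `D * c₁` of the four terms are all bounded by the
  -- single constant `2 + D * (|κ₁| + c₁)`.
  nlinarith [mul_nonneg m1 n1, mul_nonneg m1 n3, mul_nonneg m1 n6, mul_nonneg m2 n1,
    mul_nonneg m2 n2, mul_nonneg m2 n3]

end Mesh

/-! ### Facets shared by two elements -/

namespace IsSimplex

variable {K : Finset (Pt d)} (hK : IsSimplex K)
include hK

omit hK in
theorem facet_injOn {a b : Pt d} (ha : a ∈ K) (h : facet K a = facet K b) : a = b := by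
  by_contra hab
  have : a ∈ facet K b := mem_facet.2 ⟨hab, ha⟩
  rw [← h] at this
  exact (mem_facet.1 this).1 rfl

theorem card_facet {a : Pt d} (ha : a ∈ K) : (facet K a).card = d := by
  classical
  have := Finset.card_erase_of_mem ha
  rw [hK.card] at this
  simpa [facet] using this

omit hK in
theorem eq_of_facet_eq {K' : Finset (Pt d)} {a a' : Pt d} (ha : a ∈ K) (ha' : a' ∈ K')
    (h : facet K a = facet K' a') (haa : a = a') : K = K' := by
  classical
  subst haa
  ext b
  by_cases hb : b = a
  · subst hb; simp [ha, ha']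
  · have := congrArg (b ∈ ·) h
    simpa [mem_facet, hb] using this

theorem bgrad_eq_smul (hd : 1 ≤ d) {K' : Finset (Pt d)} (hK' : IsSimplex K') {a a' : Pt d}
    (ha : a ∈ K) (ha' : a' ∈ K') (h : facet K a = facet K' a') :
    ∃ c : ℝ, c ≠ 0 ∧ bgrad K' a' = c • bgrad K a := by
  have h1 := hK.vectorSpan_facet_orthogonal hd ha
  rw [h, hK'.vectorSpan_facet_orthogonal hd ha'] at h1
  have h2 : bgrad K' a' ∈ (ℝ ∙ bgrad K a) := h1 ▸ Submodule.mem_span_singleton_self _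
  obtain ⟨c, hc⟩ := Submodule.mem_span_singleton.1 h2
  refine ⟨c, ?_, hc.symm⟩
  rintro rfl
  exact hK'.bgrad_ne_zero hd ha' (by rw [← hc, zero_smul])

/-- The barycenter of a facet. -/
theorem exists_mem_facet_interior (hd : 1 ≤ d) {a : Pt d} (ha : a ∈ K) :
    ∃ x, pval (bary K a) x = 0 ∧ ∀ b ∈ K, b ≠ a → 0 < pval (bary K b) x := by
  classical
  have hdp : (0 : ℝ) < d := by exact_mod_cast hd
  have hc : ∑ b ∈ K, (if b = a then (0 : ℝ) else (d : ℝ)⁻¹) = 1 := by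
    rw [← Finset.add_sum_erase _ _ ha, if_pos rfl, zero_add,
      Finset.sum_congr rfl fun b hb => if_neg (Finset.ne_of_mem_erase hb), Finset.sum_const,
      show (K.erase a).card = d from hK.card_facet ha, nsmul_eq_mul, mul_inv_cancel₀ hdp.ne']
  refine ⟨∑ b ∈ K, (if b = a then (0 : ℝ) else (d : ℝ)⁻¹) • b, ?_, fun b hb hba => ?_⟩
  · rw [hK.bary_combination_eq ha hc, if_pos rfl]
  · rw [hK.bary_combination_eq hb hc, if_neg hba]
    positivity

theorem mem_hull_facet_of_pos {a x : Pt d} (ha : a ∈ K) (h0 : pval (bary K a) x = 0)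
    (hpos : ∀ b ∈ K, b ≠ a → 0 < pval (bary K b) x) : x ∈ hull (facet K a) := by
  refine (hK.mem_hull_facet_iff ha).2 ⟨hK.mem_hull_iff.2 fun b hb => ?_, h0⟩
  by_cases hba : b = a
  · rw [hba, h0]
  · exact (hpos b hb hba).le

end IsSimplex

namespace Mesh

variable {Ω : Set (Pt d)} (T : Mesh Ω)

theorem hull_inter_subset {K K' : Finset (Pt d)} (hK : K ∈ T.cells) (hK' : K' ∈ T.cells)
    {s : Finset (Pt d)} (hs : ∀ b ∈ K, b ∈ K' → b ∈ s) : hull K ∩ hull K' ⊆ hull s := by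
  refine (T.complex.inter_subset_convexHull (T.mem_cells.1 hK).1 (T.mem_cells.1 hK').1).trans ?_
  exact convexHull_mono fun b hb => hs b hb.1 hb.2

/-- Two elements with a common facet lie on opposite sides of it. -/
theorem bgrad_opposite (hd : 1 ≤ d) {K K' : Finset (Pt d)} (hK : K ∈ T.cells) (hK' : K' ∈ T.cells)
    (hne : K ≠ K') {a a' : Pt d} (ha : a ∈ K) (ha' : a' ∈ K') (h : facet K a = facet K' a') :
    ∃ c : ℝ, c < 0 ∧ bgrad K' a' = c • bgrad K a := by
  have sK := T.isSimplex hK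
  have sK' := T.isSimplex hK'
  obtain ⟨c, hc0, hc⟩ := sK.bgrad_eq_smul hd sK' ha ha' h
  refine ⟨c, lt_of_le_of_ne (le_of_not_gt fun hcpos => ?_) hc0, hc⟩
  -- If both gradients pointed the same way, a small step from the barycenter of the facet towards
  -- `a'` would enter both simplices off the facet. But they meet only in the hull of their common
  -- vertices.
  obtain ⟨x, hx0, hxpos⟩ := sK.exists_mem_facet_interior hd ha
  have hxe := sK.mem_hull_facet_of_pos ha hx0 hxpos
  have hxe' : x ∈ hull (facet K' a') := h ▸ hxe
  have hx' := (sK'.mem_hull_facet_iff ha').1 hxe'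
  have hcont : ∀ b, Continuous fun t : ℝ => pval (bary K b) (x + t • (a' - x)) := fun b => by
    fun_prop
  have hev : ∀ᶠ t in 𝓝[>] (0 : ℝ), (∀ b ∈ K, b ≠ a → 0 < pval (bary K b) (x + t • (a' - x))) := by
    rw [Filter.eventually_all_finset]
    intro b hb
    by_cases hba : b = a
    · simp [hba]
    · refine nhdsWithin_le_nhds (Filter.Eventually.mono ((hcont b).continuousAt.eventually_const_lt
        (u := 0) ?_) fun t ht _ => ht)
      simpa using hxpos b hb hba
  obtain ⟨t, ht, ht0, ht1⟩ : ∃ t : ℝ, (∀ b ∈ K, b ≠ a → 0 < pval (bary K b) (x + t • (a' - x))) ∧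
      0 < t ∧ t < 1 := by
    have h1 : ∀ᶠ t in 𝓝[>] (0 : ℝ), t < 1 :=
      nhdsWithin_le_nhds (eventually_lt_nhds one_pos)
    obtain ⟨t, ht⟩ := (hev.and (h1.and self_mem_nhdsWithin)).exists
    exact ⟨t, ht.1, ht.2.2, ht.2.1⟩
  have e1 : pval (bary K' a') a' - pval (bary K' a') x = 1 := by
    rw [sK'.bary_self ha', hx'.2, sub_zero]
  rw [bary_sub, hc, real_inner_smul_left] at e1
  have hpos : 0 < pval (bary K a) (x + t • (a' - x)) := by
    have e2 := bary_sub K a (x + t • (a' - x)) x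
    rw [add_sub_cancel_left, real_inner_smul_right, hx0, sub_zero] at e2
    rw [e2]
    have : 0 < ⟪bgrad K a, a' - x⟫ := by
      by_contra! hle
      nlinarith
    positivity
  have m1 : x + t • (a' - x) ∈ hull K := sK.mem_hull_iff.2 fun b hb => by
    by_cases hba : b = a
    · rw [hba]; exact hpos.le
    · exact (ht b hb hba).le
  have m2 : x + t • (a' - x) ∈ hull K' :=
    IsSimplex.convex_hull.add_smul_sub_mem hx'.1 (IsSimplex.mem_hull_of_mem ha') ⟨ht0.le, ht1.le⟩
  have m3 := T.hull_inter_subset hK hK' (s := facet K a) (fun b hb hb' => mem_facet.2 ⟨?_, hb⟩)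
    ⟨m1, m2⟩
  · exact hpos.ne' ((sK.mem_hull_facet_iff ha).1 m3).2
  · rintro rfl
    by_cases hba : b = a'
    · exact hne (IsSimplex.eq_of_facet_eq ha ha' h hba)
    · have : b ∈ facet K' a' := mem_facet.2 ⟨hba, hb'⟩
      rw [← h] at this
      exact (mem_facet.1 this).1 rfl

theorem normal_opposite (hd : 1 ≤ d) {K K' : Finset (Pt d)} (hK : K ∈ T.cells) (hK' : K' ∈ T.cells)
    (hne : K ≠ K') {a a' : Pt d} (ha : a ∈ K) (ha' : a' ∈ K') (h : facet K a = facet K' a') :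
    normal K' a' = -normal K a := by
  obtain ⟨c, hc, h⟩ := T.bgrad_opposite hd hK hK' hne ha ha' h
  rw [(T.isSimplex hK).normal_eq hd ha, (T.isSimplex hK').normal_eq hd ha', h, norm_smul,
    Real.norm_of_nonpos hc.le, smul_smul]
  have hw : ‖bgrad K a‖ ≠ 0 := norm_ne_zero_iff.2 ((T.isSimplex hK).bgrad_ne_zero hd ha)
  rw [show (-c * ‖bgrad K a‖)⁻¹ * c = -‖bgrad K a‖⁻¹ by
    have := hc.ne
    field_simp, neg_smul]

theorem exists_cell {x : Pt d} (hx : x ∈ closure Ω) : ∃ K ∈ T.cells, x ∈ hull K := by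
  rw [← T.cover, Geometry.SimplicialComplex.mem_space_iff] at hx
  obtain ⟨s, hs, hxs⟩ := hx
  obtain ⟨K, hK, hsK, hcard⟩ := T.pure s hs
  exact ⟨K, T.mem_cells.2 ⟨hK, hcard⟩, convexHull_mono (by exact_mod_cast hsK) hxs⟩

theorem mem_bdryFacets_of_subset {K : Finset (Pt d)} (hd : 1 ≤ d) (hK : K ∈ T.cells) {a : Pt d}
    (ha : a ∈ K) (h : hull (facet K a) ⊆ frontier Ω) : facet K a ∈ T.bdryFacets := by
  have hcard := (T.isSimplex hK).card_facet ha
  simp only [bdryFacets, Finset.mem_filter, Set.Finite.mem_toFinset]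
  refine ⟨T.complex.down_closed (T.mem_cells.1 hK).1 (IsSimplex.facet_subset a) ?_, hcard, h⟩
  rw [← Finset.card_pos]; omega

/-- A facet that is not contained in the boundary belongs to a second element. -/
theorem exists_neighbor (hd : 1 ≤ d) (hΩ : IsOpen Ω) {K : Finset (Pt d)} (hK : K ∈ T.cells)
    {a : Pt d} (ha : a ∈ K) (h : facet K a ∉ T.bdryFacets) :
    ∃ K' ∈ T.cells, K' ≠ K ∧ ∃ a' ∈ K', facet K' a' = facet K a := by
  classical
  have sK := T.isSimplex hK
  obtain ⟨x₀, hx₀, hxΩ⟩ := Set.not_subset.1 fun hh => h (T.mem_bdryFacets_of_subset hd hK ha hh)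
  have hx₀K := (sK.mem_hull_facet_iff ha).1 hx₀
  have hx₀Ω : x₀ ∈ Ω := by
    rw [hΩ.frontier_eq] at hxΩ
    by_contra hh
    exact hxΩ ⟨T.hull_subset hK hx₀K.1, hh⟩
  obtain ⟨c, hc0, hcpos⟩ := sK.exists_mem_facet_interior hd ha
  -- The point of the facet found in `Ω` may lie on the relative boundary of the facet; a small move
  -- towards the barycenter of the facet remedies this.
  obtain ⟨x, hxΩ, hx0, hxpos⟩ : ∃ x ∈ Ω, pval (bary K a) x = 0 ∧
      ∀ b ∈ K, b ≠ a → 0 < pval (bary K b) x := by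
    have hcont : Continuous fun t : ℝ => x₀ + t • (c - x₀) := by fun_prop
    have h1 : ∀ᶠ t in 𝓝[>] (0 : ℝ), x₀ + t • (c - x₀) ∈ Ω :=
      nhdsWithin_le_nhds (hcont.continuousAt.eventually_mem (hΩ.mem_nhds (by simpa using hx₀Ω)))
    have h2 : ∀ᶠ t in 𝓝[>] (0 : ℝ), t < 1 :=
      nhdsWithin_le_nhds (eventually_lt_nhds one_pos)
    obtain ⟨t, ht, ht1, ht0⟩ := (h1.and (h2.and self_mem_nhdsWithin)).exists
    have hb : ∀ b, pval (bary K b) (x₀ + t • (c - x₀)) =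
        (1 - t) * pval (bary K b) x₀ + t * pval (bary K b) c := fun b => by
      simp only [pval_bary, inner_add_right, inner_smul_right, inner_sub_right]; ring
    refine ⟨_, ht, ?_, fun b hbK hba => ?_⟩
    · rw [hb, hx₀K.2, hc0]; ring
    · rw [hb]
      have := hcpos b hbK hba
      have := sK.bary_nonneg hbK hx₀K.1
      have : 0 ≤ 1 - t := by linarith
      positivity
  have hcont : Continuous fun t : ℝ => x + t • normal K a := by fun_prop
  -- Points just beyond the facet lie in `Ω` but not in `K`, so other elements cover them. As there
  -- are finitely many elements, one of them contains such points arbitrarily close to `x`, and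
  -- hence `x`.
  have h1 : ∀ᶠ t in 𝓝[>] (0 : ℝ), ∃ K' ∈ T.cells, K' ≠ K ∧ x + t • normal K a ∈ hull K' := by
    have : ∀ᶠ t in 𝓝[>] (0 : ℝ), x + t • normal K a ∈ Ω :=
      nhdsWithin_le_nhds (hcont.continuousAt.eventually_mem (hΩ.mem_nhds (by simpa using hxΩ)))
    filter_upwards [this, self_mem_nhdsWithin] with t ht ht0
    obtain ⟨K', hK', hm⟩ := T.exists_cell (subset_closure ht)
    refine ⟨K', hK', ?_, hm⟩
    rintro rfl
    have e1 := sK.bary_nonneg ha hm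
    have e2 := bary_sub K' a (x + t • normal K' a) x
    rw [add_sub_cancel_left, real_inner_smul_right, hx0, sub_zero, sK.inner_bgrad_normal hd ha] at e2
    have := norm_pos_iff.2 (sK.bgrad_ne_zero hd ha)
    rw [Set.mem_Ioi] at ht0
    nlinarith
  obtain ⟨K', hK', hne, hfr⟩ : ∃ K' ∈ T.cells, K' ≠ K ∧
      ∃ᶠ t in 𝓝[>] (0 : ℝ), x + t • normal K a ∈ hull K' := by
    by_contra! hcon
    have : ∀ᶠ t in 𝓝[>] (0 : ℝ), ∀ K' ∈ T.cells, K' ≠ K → x + t • normal K a ∉ hull K' := by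
      rw [Filter.eventually_all_finset]
      intro K' hK'
      by_cases hKK : K' = K
      · simp [hKK]
      · exact (hcon K' hK' hKK).mono fun t ht _ => ht
    obtain ⟨t, ⟨K', hK', hne, hm⟩, ht⟩ := (h1.and this).exists
    exact ht K' hK' hne hm
  have hxK' : x ∈ hull K' := by
    have hcl := (IsSimplex.isCompact_hull (K := K')).isClosed
    refine hcl.closure_subset (mem_closure_iff_frequently.2 ?_)
    have ht : Tendsto (fun t : ℝ => x + t • normal K a) (𝓝[>] 0) (𝓝 x) := by
      have := hcont.tendsto 0
      simp only [zero_smul, add_zero] at this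
      exact this.mono_left nhdsWithin_le_nhds
    exact ht.frequently hfr
  have hxe := sK.mem_hull_facet_of_pos ha hx0 hxpos
  have hxK := ((sK.mem_hull_facet_iff ha).1 hxe).1
  -- The point `x` lies in the hull of the common vertices, while its coordinates at all vertices of
  -- the facet are positive. So all these vertices are common.
  have hxi := T.hull_inter_subset hK hK' (s := K ∩ K') (by simp +contextual) ⟨hxK, hxK'⟩
  have hsub : facet K a ⊆ K' := by
    intro b hb
    obtain ⟨hba, hbK⟩ := mem_facet.1 hb
    by_contra hbK'
    have := ((sK.mem_hull_subset_iff Finset.inter_subset_left).1 hxi).2 b hbK (by simp [hbK'])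
    exact (hxpos b hbK hba).ne' this
  obtain ⟨a', ha', he⟩ := Finset.exists_eq_insert_iff.2
    ⟨hsub, by rw [sK.card_facet ha, (T.isSimplex hK').card]⟩
  refine ⟨K', hK', hne, a', he ▸ Finset.mem_insert_self _ _, ?_⟩
  rw [← he, facet, Finset.erase_insert ha']

/-- The relative interior of a common facet of two elements lies in the domain. -/
theorem mem_of_facet_interior (hd : 1 ≤ d) (hΩ : interior (closure Ω) = Ω) {K K' : Finset (Pt d)}
    (hK : K ∈ T.cells) (hK' : K' ∈ T.cells)
    (hne : K ≠ K') {a a' : Pt d} (ha : a ∈ K) (ha' : a' ∈ K') (h : facet K a = facet K' a')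
    {x : Pt d} (h0 : pval (bary K a) x = 0) (hpos : ∀ b ∈ K, b ≠ a → 0 < pval (bary K b) x) :
    x ∈ Ω := by
  have sK := T.isSimplex hK
  have sK' := T.isSimplex hK'
  obtain ⟨c, hc, hcw⟩ := T.bgrad_opposite hd hK hK' hne ha ha' h
  have hxe := sK.mem_hull_facet_of_pos ha h0 hpos
  have hxe' : x ∈ hull (facet K' a') := h ▸ hxe
  have hx' := (sK'.mem_hull_facet_iff ha').1 hxe'
  have hpos' : ∀ b ∈ K', b ≠ a' → 0 < pval (bary K' b) x := by
    intro b hb hba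
    refine lt_of_le_of_ne (sK'.bary_nonneg hb hx'.1) fun heq => ?_
    -- otherwise `x` lies in the hull of the facet without `b`
    have hbe : b ∈ facet K a := h ▸ mem_facet.2 ⟨hba, hb⟩
    classical
    have hm : x ∈ hull ((facet K a).erase b) := by
      refine (sK'.mem_hull_subset_iff ?_).2 ⟨hx'.1, fun i hi hie => ?_⟩
      · rw [h]; exact (Finset.erase_subset _ _).trans (IsSimplex.facet_subset _)
      · by_cases hib : i = b
        · rw [hib, heq]
        · have : i ∉ facet K' a' := fun hm => hie (Finset.mem_erase.2 ⟨hib, h ▸ hm⟩)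
          have : i = a' := by
            by_contra hia
            exact this (mem_facet.2 ⟨hia, hi⟩)
          rw [this, hx'.2]
    have := ((sK.mem_hull_subset_iff ((Finset.erase_subset _ _).trans
      (IsSimplex.facet_subset _))).1 hm).2 b (mem_facet.1 hbe).2 (by simp)
    exact (hpos b (mem_facet.1 hbe).2 (mem_facet.1 hbe).1).ne' this
  rw [← hΩ, mem_interior_iff_mem_nhds]
  have hcont : ∀ L b, Continuous fun y : Pt d => pval (bary L b) y := fun L b => by fun_prop
  have ev : ∀ L : Finset (Pt d), ∀ v, (∀ b ∈ L, b ≠ v → 0 < pval (bary L b) x) →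
      ∀ᶠ y in 𝓝 x, ∀ b ∈ L, b ≠ v → 0 < pval (bary L b) y := by
    intro L v hL
    rw [Filter.eventually_all_finset]
    intro b hb
    by_cases hbv : b = v
    · simp [hbv]
    · exact ((hcont L b).continuousAt.eventually_const_lt (hL b hb hbv)).mono fun y hy _ => hy
  -- Near `x` the coordinates of the common vertices stay positive in both simplices. Since the two
  -- gradients are opposite, the remaining coordinate is nonnegative in at least one of the
  -- simplices.
  filter_upwards [ev K a hpos, ev K' a' hpos'] with y hy hy'
  have e1 := bary_sub K a y x
  have e2 := bary_sub K' a' y x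
  rw [hcw, real_inner_smul_left, hx'.2, sub_zero] at e2
  rw [h0, sub_zero] at e1
  rcases le_total 0 (pval (bary K a) y) with hs | hs
  · refine T.hull_subset hK (sK.mem_hull_iff.2 fun b hb => ?_)
    by_cases hba : b = a
    · rw [hba]; exact hs
    · exact (hy b hb hba).le
  · refine T.hull_subset hK' (sK'.mem_hull_iff.2 fun b hb => ?_)
    by_cases hba : b = a'
    · rw [hba, e2, ← e1]
      exact mul_nonneg_of_nonpos_of_nonpos hc.le hs
    · exact (hy' b hb hba).le

/-- A sum over the sides of an interior facet vanishes if the terms of the two sides cancel. -/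
theorem sum_facet_eq_zero (hd : 1 ≤ d) (hΩ : IsOpen Ω) {e : Finset (Pt d)}
    (he : e ∉ T.bdryFacets) (X : T.cells → Pt d → ℝ)
    (hX : ∀ (K K' : T.cells), K ≠ K' → ∀ a ∈ K.1, ∀ a' ∈ K'.1, facet K.1 a = e →
      facet K'.1 a' = e → X K a + X K' a' = 0) :
    open Classical in ∑ K : T.cells, ∑ a ∈ K.1, (if facet K.1 a = e then X K a else 0) = 0 := by
  classical
  have inner : ∀ (K : T.cells) (a : Pt d), a ∈ K.1 → facet K.1 a = e →
      ∑ b ∈ K.1, (if facet K.1 b = e then X K b else 0) = X K a := by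
    intro K a ha hae
    rw [Finset.sum_eq_single_of_mem a ha, if_pos hae]
    intro b hb hba
    rw [if_neg]
    exact fun hbe => hba (IsSimplex.facet_injOn hb (hbe.trans hae.symm))
  by_cases hex : ∃ (K : T.cells) (a : Pt d), a ∈ K.1 ∧ facet K.1 a = e
  · obtain ⟨K, a, ha, hae⟩ := hex
    obtain ⟨K', hK', hne, a', ha', hae'⟩ := T.exists_neighbor hd hΩ K.2 ha (hae ▸ he)
    have hne' : K ≠ ⟨K', hK'⟩ := fun h => hne (congrArg Subtype.val h).symm
    rw [← Finset.add_sum_erase _ _ (Finset.mem_univ K), ← Finset.add_sum_erase _ _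
      (Finset.mem_erase.2 ⟨hne'.symm, Finset.mem_univ (⟨K', hK'⟩ : T.cells)⟩), inner K a ha hae,
      inner ⟨K', hK'⟩ a' ha' (hae'.trans hae), Finset.sum_eq_zero, add_zero,
      hX K ⟨K', hK'⟩ hne' a ha a' ha' hae (hae'.trans hae)]
    intro L hL
    refine Finset.sum_eq_zero fun b hb => if_neg fun hbe => ?_
    simp only [Finset.mem_erase, Finset.mem_univ, and_true] at hL
    obtain ⟨hL1, hL2⟩ := hL
    -- A third element `L` on the same facet is impossible: any two of the three gradients would
    -- have to be negative multiples of each other.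
    obtain ⟨c, hc, h1⟩ := T.bgrad_opposite hd K.2 hK' hne.symm ha ha' hae'.symm
    obtain ⟨c', hc', h2⟩ := T.bgrad_opposite hd K.2 L.2 (fun h => hL2 (Subtype.ext h.symm)) ha hb
      (hae.trans hbe.symm)
    obtain ⟨c'', hc'', h3⟩ := T.bgrad_opposite hd hK' L.2
      (fun h => hL1 (Subtype.ext h.symm)) ha' hb ((hae'.trans hae).trans hbe.symm)
    rw [h1, h2, smul_smul] at h3
    have hw := (T.isSimplex K.2).bgrad_ne_zero hd ha
    have := smul_left_injective ℝ hw h3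
    nlinarith
  · push Not at hex
    exact Finset.sum_eq_zero fun K _ => Finset.sum_eq_zero fun a ha => if_neg (hex K a ha)

end Mesh

/-! ### Cutoff functions -/

theorem inner_gradient (f : Pt d → ℝ) (x v : Pt d) : ⟪∇ f x, v⟫ = fderiv ℝ f x v := by
  unfold gradient
  rw [InnerProductSpace.toDual_symm_apply]

theorem memLp_coord {α : Type*} [MeasurableSpace α] {μ : Measure α} {G : α → Pt d} {p : ENNReal}
    (hG : MemLp G p μ) (i : Fin d) : MemLp (fun x => G x i) p μ :=
  (EuclideanSpace.proj i : Pt d →L[ℝ] ℝ).comp_memLp' hG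

theorem gradient_mul {f g : Pt d → ℝ} {x : Pt d} (hf : DifferentiableAt ℝ f x)
    (hg : DifferentiableAt ℝ g x) :
    ∇ (fun y => f y * g y) x = f x • ∇ g x + g x • ∇ f x := by
  refine ext_inner_right ℝ fun v => ?_
  rw [inner_gradient, inner_add_left, real_inner_smul_left, real_inner_smul_left, inner_gradient,
    inner_gradient, fderiv_fun_mul hf hg]
  simp

theorem gradient_eq_zero_of_eventuallyEq {f : Pt d → ℝ} {x : Pt d} {c : ℝ}
    (h : f =ᶠ[𝓝 x] fun _ => c) : ∇ f x = 0 := by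
  unfold gradient
  rw [h.fderiv_eq]
  simp

/-- A smooth transition from `0` on `(-∞, 1]` to `1` on `[2, ∞)`. -/
def step (t : ℝ) : ℝ := Real.smoothTransition (t - 1)

theorem contDiff_step {n : ℕ∞} : ContDiff ℝ n step :=
  Real.smoothTransition.contDiff.comp (contDiff_id.sub contDiff_const)

theorem step_nonneg (t : ℝ) : 0 ≤ step t := Real.smoothTransition.nonneg _

theorem step_le_one (t : ℝ) : step t ≤ 1 := Real.smoothTransition.le_one _

theorem step_eq_zero {t : ℝ} (h : t ≤ 1) : step t = 0 :=
  Real.smoothTransition.zero_of_nonpos (by linarith)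

theorem step_eq_one {t : ℝ} (h : 2 ≤ t) : step t = 1 :=
  Real.smoothTransition.one_of_one_le (by linarith)

/-- The derivative of `step` is supported in `[1, 2]`. The weight `t` appears because `step (N * λ)`
will be differentiated along fields whose component in the direction of `∇λ` is of order `λ`. -/
theorem exists_mul_deriv_step_le : ∃ M : ℝ, 0 ≤ M ∧ ∀ t, |t * deriv step t| ≤ M := by
  have hc : Continuous fun t => t * deriv step t :=
    continuous_id.mul ((contDiff_step (n := 1)).continuous_deriv le_rfl)
  obtain ⟨M, hM⟩ := (isCompact_Icc (a := (1 : ℝ)) (b := 2)).exists_bound_of_continuousOn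
    hc.continuousOn
  have hM0 : 0 ≤ M := (norm_nonneg _).trans (hM 1 ⟨le_rfl, by norm_num⟩)
  refine ⟨M, hM0, fun t => ?_⟩
  rcases lt_or_ge t 1 with h1 | h1
  · have : step =ᶠ[𝓝 t] fun _ => 0 := by
      filter_upwards [eventually_lt_nhds h1] with s hs
      exact step_eq_zero hs.le
    rw [this.deriv_eq]
    simpa using hM0
  rcases lt_or_ge 2 t with h2 | h2
  · have : step =ᶠ[𝓝 t] fun _ => 1 := by
      filter_upwards [eventually_gt_nhds h2] with s hs
      exact step_eq_one hs.le
    rw [this.deriv_eq]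
    simpa using hM0
  · exact hM t ⟨h1, h2⟩

/-- The product of `step (N λ_i)` for `i ∈ s`, where `λ_i` are the barycentric coordinates. -/
def cutoff (K s : Finset (Pt d)) (N : ℝ) (x : Pt d) : ℝ := ∏ i ∈ s, step (N * pval (bary K i) x)

section cutoff

variable (K s : Finset (Pt d)) (N : ℝ)

theorem contDiff_cutoff : ContDiff ℝ ∞ (cutoff K s N) := by
  unfold cutoff
  exact contDiff_prod fun i _ => contDiff_step.comp (contDiff_const.mul (contDiff_pval _))

theorem cutoff_nonneg (x : Pt d) : 0 ≤ cutoff K s N x := Finset.prod_nonneg fun _ _ => step_nonneg _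

theorem cutoff_le_one (x : Pt d) : cutoff K s N x ≤ 1 :=
  Finset.prod_le_one (fun _ _ => step_nonneg _) fun _ _ => step_le_one _

variable {K s N}

theorem cutoff_eq_zero {x : Pt d} {i : Pt d} (hi : i ∈ s) (h : N * pval (bary K i) x ≤ 1) :
    cutoff K s N x = 0 := Finset.prod_eq_zero hi (step_eq_zero h)

theorem cutoff_eq_one {x : Pt d} (h : ∀ i ∈ s, 2 ≤ N * pval (bary K i) x) :
    cutoff K s N x = 1 := Finset.prod_eq_one fun i hi => step_eq_one (h i hi)

theorem gradient_cutoff_eq_zero {x : Pt d} {i : Pt d} (hi : i ∈ s)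
    (h : N * pval (bary K i) x < 1) : ∇ (cutoff K s N) x = 0 := by
  refine gradient_eq_zero_of_eventuallyEq (c := 0) ?_
  have hc : Continuous fun y => N * pval (bary K i) y := by fun_prop
  filter_upwards [hc.continuousAt.eventually_lt_const h] with y hy
  exact cutoff_eq_zero hi hy.le

theorem gradient_cutoff_eq_zero' {x : Pt d} (h : ∀ i ∈ s, 2 < N * pval (bary K i) x) :
    ∇ (cutoff K s N) x = 0 := by
  refine gradient_eq_zero_of_eventuallyEq (c := 1) ?_
  have hc : ∀ i, Continuous fun y => N * pval (bary K i) y := fun i => by fun_prop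
  have : ∀ᶠ y in 𝓝 x, ∀ i ∈ s, 2 < N * pval (bary K i) y := by
    rw [Filter.eventually_all_finset]
    exact fun i hi => (hc i).continuousAt.eventually_const_lt (h i hi)
  filter_upwards [this] with y hy
  exact cutoff_eq_one fun i hi => (hy i hi).le

open Classical in
theorem inner_gradient_cutoff (x v : Pt d) : ⟪∇ (cutoff K s N) x, v⟫ =
    ∑ i ∈ s, (∏ j ∈ s.erase i, step (N * pval (bary K j) x)) *
      (deriv step (N * pval (bary K i) x) * (N * ⟪bgrad K i, v⟫)) := by
  rw [inner_gradient]
  have h : ∀ i ∈ s, HasFDerivAt (fun y => step (N * pval (bary K i) y))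
      (deriv step (N * pval (bary K i) x) •
        (N • InnerProductSpace.toDual ℝ (Pt d) (bgrad K i))) x := by
    intro i _
    have h1 := (hasGradientAt_pval (bary K i) x).hasFDerivAt.const_mul N
    rw [pgrad_bary] at h1
    have h2 : HasDerivAt step (deriv step (N * pval (bary K i) x)) (N * pval (bary K i) x) :=
      ((contDiff_step (n := 1)).differentiable (by norm_num) _).hasDerivAt
    exact HasDerivAt.comp_hasFDerivAt (h₂ := step) (f := fun y => N * pval (bary K i) y) x h2 h1
  have := HasFDerivAt.finsetProd h
  rw [show fderiv ℝ (cutoff K s N) x = _ from this.fderiv]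
  simp

/-- The factor `N` from the chain rule is absorbed by the coordinate that bounds the directional
derivative, so only `t * deriv step t` at `t = N * λ_i` occurs. The bound does not depend on `N`. -/
theorem abs_inner_gradient_cutoff_le {M : ℝ} (hM : ∀ t, |t * deriv step t| ≤ M) {x v : Pt d}
    {C : ℝ} (hC : 0 ≤ C) (hN : 0 ≤ N) (h0 : ∀ i ∈ s, 0 ≤ pval (bary K i) x)
    (hv : ∀ i ∈ s, |⟪bgrad K i, v⟫| ≤ C * pval (bary K i) x) :
    |⟪∇ (cutoff K s N) x, v⟫| ≤ s.card * (C * M) := by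
  classical
  rw [inner_gradient_cutoff, ← nsmul_eq_mul]
  refine (Finset.abs_sum_le_sum_abs _ _).trans (Finset.sum_le_card_nsmul _ _ _ fun i hi => ?_)
  rw [abs_mul, abs_of_nonneg (Finset.prod_nonneg fun _ _ => step_nonneg _)]
  have h1 : ∏ j ∈ s.erase i, step (N * pval (bary K j) x) ≤ 1 :=
    Finset.prod_le_one (fun _ _ => step_nonneg _) fun _ _ => step_le_one _
  have h2 : |deriv step (N * pval (bary K i) x) * (N * ⟪bgrad K i, v⟫)| ≤ C * M := by
    rw [abs_mul, abs_mul, abs_of_nonneg hN]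
    calc |deriv step (N * pval (bary K i) x)| * (N * |⟪bgrad K i, v⟫|)
        ≤ |deriv step (N * pval (bary K i) x)| * (N * (C * pval (bary K i) x)) := by
          have := hv i hi
          gcongr
      _ = C * |N * pval (bary K i) x * deriv step (N * pval (bary K i) x)| := by
          rw [abs_mul, abs_of_nonneg (mul_nonneg hN (h0 i hi))]; ring
      _ ≤ C * M := by have := hM (N * pval (bary K i) x); gcongr
  calc _ ≤ 1 * (C * M) := mul_le_mul h1 h2 (abs_nonneg _) zero_le_one
    _ = C * M := one_mul _

end cutoff

namespace IsSimplex

variable {K : Finset (Pt d)} (hK : IsSimplex K)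
include hK

/-- Fields whose normal component vanishes linearly at the facets in question can be cut off there
at no cost in the limit. The terms with the gradient of the cutoff are dominated uniformly in `N`
and vanish eventually at every interior point. -/
theorem tendsto_integral_cutoff {s : Finset (Pt d)} (hs : s ⊆ K) {Φ φ : Pt d → ℝ} {Q : Pt d → Pt d}
    (hΦ : Integrable Φ (volume.restrict (hull K))) (hφ : Integrable φ (volume.restrict (hull K)))
    (hQ : Continuous Q) {C : ℝ} (hC : 0 ≤ C)
    (hbd : ∀ x ∈ hull K, ∀ i ∈ s, |⟪bgrad K i, Q x⟫| ≤ C * pval (bary K i) x) :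
    Tendsto (fun N : ℕ => ∫ x in hull K, (cutoff K s N x * Φ x + φ x * ⟪∇ (cutoff K s N) x, Q x⟫))
      atTop (𝓝 (∫ x in hull K, Φ x)) := by
  obtain ⟨M, hM0, hM⟩ := exists_mul_deriv_step_le
  have hmem : ∀ᵐ x ∂(volume.restrict (hull K)), x ∈ hull K :=
    ae_restrict_mem measurableSet_hull
  have hint : ∀ᵐ x ∂(volume.restrict (hull K)), x ∈ interior (hull K) := by
    rw [← hK.ae_restrict_interior]
    exact ae_restrict_mem isOpen_interior.measurableSet
  have hcg : ∀ N : ℕ, Continuous fun x => ⟪∇ (cutoff K s N) x, Q x⟫ := fun N =>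
    (continuous_gradient ((contDiff_cutoff K s N).of_le (by exact_mod_cast le_top))).inner hQ
  refine tendsto_integral_of_dominated_convergence
    (fun x => |Φ x| + |φ x| * (s.card * (C * M))) (fun N => ?_)
    (hΦ.abs.add (hφ.abs.mul_const _)) (fun N => ?_) ?_
  · exact ((contDiff_cutoff K s N).continuous.aestronglyMeasurable.mul hΦ.1).add
      (hφ.1.mul (hcg N).aestronglyMeasurable)
  · filter_upwards [hmem] with x hx
    refine (norm_add_le _ _).trans (add_le_add ?_ ?_)
    · rw [norm_mul, Real.norm_of_nonneg (cutoff_nonneg _ _ _ _)]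
      exact mul_le_of_le_one_left (norm_nonneg _) (cutoff_le_one _ _ _ _)
    · rw [norm_mul]
      exact mul_le_mul_of_nonneg_left (abs_inner_gradient_cutoff_le hM hC (Nat.cast_nonneg _)
        (fun i hi => hK.bary_nonneg (hs hi) hx) (hbd x hx)) (norm_nonneg _)
  · filter_upwards [hint] with x hx
    rw [hK.interior_hull] at hx
    refine tendsto_const_nhds.congr' ?_
    have : ∀ᶠ N : ℕ in atTop, ∀ i ∈ s, 2 < N * pval (bary K i) x := by
      rw [Filter.eventually_all_finset]
      intro i hi
      have := tendsto_natCast_atTop_atTop (R := ℝ).atTop_mul_const (hx i (hs hi))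
      exact this.eventually_gt_atTop 2
    filter_upwards [this] with N hN
    rw [cutoff_eq_one fun i hi => (hN i hi).le, gradient_cutoff_eq_zero' hN]
    simp

/-- Each factor vanishes where `N * λ_i ≤ 1`, both near the facet and beyond it, so the support is a
closed subset of the open simplex. -/
theorem isTest_cutoff_mul {Ω : Set (Pt d)} (hKΩ : interior (hull K) ⊆ Ω) (N : ℕ) (p : MPoly d) :
    IsTest Ω (fun x => cutoff K K N x * pval p x) := by
  have hcl : IsClosed (⋂ i ∈ K, {x : Pt d | 1 ≤ (N : ℝ) * pval (bary K i) x}) :=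
    isClosed_biInter fun i _ => isClosed_le continuous_const (by fun_prop)
  have hsub : tsupport (fun x => cutoff K K N x * pval p x) ⊆
      ⋂ i ∈ K, {x : Pt d | 1 ≤ (N : ℝ) * pval (bary K i) x} := by
    refine closure_minimal (fun x hx => ?_) hcl
    simp only [Set.mem_iInter, Set.mem_ofPred_eq]
    intro i hi
    by_contra! h
    exact hx (by simp only [cutoff_eq_zero hi h.le, zero_mul])
  have hint : (⋂ i ∈ K, {x : Pt d | 1 ≤ (N : ℝ) * pval (bary K i) x}) ⊆ interior (hull K) := by
    intro x hx
    simp only [Set.mem_iInter, Set.mem_ofPred_eq] at hx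
    rw [hK.interior_hull]
    intro i hi
    by_contra! h
    have h1 := hx i hi
    have h2 : (N : ℝ) * pval (bary K i) x ≤ 0 := mul_nonpos_of_nonneg_of_nonpos (by positivity) h
    linarith
  refine ⟨(contDiff_cutoff K K N).mul (contDiff_pval p), ?_, hsub.trans (hint.trans hKΩ)⟩
  exact (isCompact_hull (K := K)).of_isClosed_subset (isClosed_tsupport _)
    (hsub.trans (hint.trans interior_subset))

/-- Green's formula on a simplex for a function in `H¹` and a polynomial field that is tangential on
all facets. -/
theorem integral_green_tangential {Ω : Set (Pt d)} (hΩ : IsOpen Ω) {φ : Pt d → ℝ} {G : Pt d → Pt d}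
    (h : HasWeakGrad Ω φ G) (hKΩ : interior (hull K) ⊆ Ω) {P : Fin d → MPoly d} {C : ℝ}
    (hC : 0 ≤ C) (hbd : ∀ x ∈ hull K, ∀ i ∈ K, |⟪bgrad K i, vval P x⟫| ≤ C * pval (bary K i) x) :
    ∫ x in hull K, (φ x * pval (pdiv P) x + ⟪G x, vval P x⟫) = 0 := by
  have hle : volume.restrict (hull K) ≤ volume.restrict Ω := by
    rw [← hK.ae_restrict_interior]; exact Measure.restrict_mono hKΩ le_rfl
  have hφ := h.memLp.mono_measure hle
  have hG := h.memLp_grad.mono_measure hle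
  have hPc : Continuous (vval P) := by fun_prop
  have hfin := hK.isFiniteMeasure
  have i1 : Integrable (fun x => φ x * pval (pdiv P) x) (volume.restrict (hull K)) :=
    integrable_mul_of_memLp hφ (memLp_of_continuous (by fun_prop) _)
  have i2 : Integrable (fun x => ⟪G x, vval P x⟫) (volume.restrict (hull K)) :=
    integrable_inner_of_memLp hG (memLp_of_continuous (by fun_prop) _)
  have hlim := hK.tendsto_integral_cutoff (s := K) subset_rfl (i1.add i2)
    (hφ.integrable (by norm_num)) hPc hC hbd
  refine tendsto_nhds_unique hlim (tendsto_const_nhds.congr fun N => ?_)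
  have hred : ∀ g : Pt d → ℝ, (∀ x, x ∉ interior (hull K) → g x = 0) →
      ∫ x in Ω, g x = ∫ x in hull K, g x := fun g hg => by
    rw [setIntegral_eq_of_subset_of_forall_sdiff_eq_zero hΩ.measurableSet hKΩ fun x hx => hg x hx.2,
      hK.ae_restrict_interior]
  have hz : ∀ x, x ∉ interior (hull K) → ∃ i ∈ K, (N : ℝ) * pval (bary K i) x < 1 := by
    intro x hx
    rw [hK.interior_hull] at hx
    simp only [Set.mem_ofPred_eq, not_forall, not_lt] at hx
    obtain ⟨i, hi, h⟩ := hx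
    exact ⟨i, hi, (mul_nonpos_of_nonneg_of_nonpos (by positivity) h).trans_lt one_pos⟩
  have hcd : ∀ x, DifferentiableAt ℝ (cutoff K K N) x := fun x =>
    (contDiff_cutoff K K N).differentiable (by simp) x
  have hg : ∀ (i : Fin d) (x : Pt d), (∇ (fun y => cutoff K K N y * pval (P i) y) x) i =
      cutoff K K N x * pval (MvPolynomial.pderiv i (P i)) x +
        pval (P i) x * (∇ (cutoff K K N) x) i := by
    intro i x
    rw [gradient_mul (hcd x) ((contDiff_pval _).differentiable (by simp) x), gradient_pval]
    simp
  have hcg : Continuous fun x => ∇ (cutoff K K N) x :=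
    continuous_gradient ((contDiff_cutoff K K N).of_le (by exact_mod_cast le_top))
  have hcc := (contDiff_cutoff K K N).continuous
  -- The weak derivative identity for the test function `cutoff * P i`. Summed over `i` it is
  -- Green's formula for the field multiplied by the cutoff.
  have hw : ∀ i : Fin d, ∫ x in hull K, (φ x * (cutoff K K N x *
      pval (MvPolynomial.pderiv i (P i)) x + pval (P i) x * (∇ (cutoff K K N) x) i) +
      G x i * (cutoff K K N x * pval (P i) x)) = 0 := by
    intro i
    have := h.weak _ (hK.isTest_cutoff_mul hKΩ N (P i)) i
    simp only [hg] at this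
    rw [hred, hred] at this
    · have hci : Continuous fun x => (∇ (cutoff K K N) x) i :=
        (EuclideanSpace.proj i : Pt d →L[ℝ] ℝ).continuous.comp hcg
      have hGi : MemLp (fun x => G x i) 2 (volume.restrict (hull K)) :=
        memLp_coord hG i
      rw [integral_add, this, neg_add_cancel]
      · exact integrable_mul_of_memLp hφ (memLp_of_continuous (by fun_prop) _)
      · exact integrable_mul_of_memLp hGi (memLp_of_continuous (by fun_prop) _)
    · intro x hx
      obtain ⟨j, hj, hlt⟩ := hz x hx
      rw [cutoff_eq_zero hj hlt.le]; simp
    · intro x hx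
      obtain ⟨j, hj, hlt⟩ := hz x hx
      rw [cutoff_eq_zero hj hlt.le, gradient_cutoff_eq_zero hj hlt]; simp
  have hw' : ∀ i : Fin d, Integrable (fun x => (φ x * (cutoff K K N x *
      pval (MvPolynomial.pderiv i (P i)) x + pval (P i) x * (∇ (cutoff K K N) x) i) +
      G x i * (cutoff K K N x * pval (P i) x))) (volume.restrict (hull K)) := by
    intro i
    have hci : Continuous fun x => (∇ (cutoff K K N) x) i :=
      (EuclideanSpace.proj i : Pt d →L[ℝ] ℝ).continuous.comp hcg
    have hGi : MemLp (fun x => G x i) 2 (volume.restrict (hull K)) :=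
      memLp_coord hG i
    exact (integrable_mul_of_memLp hφ (memLp_of_continuous (by fun_prop) _)).add
      (integrable_mul_of_memLp hGi (memLp_of_continuous (by fun_prop) _))
  have := integral_finsetSum Finset.univ (fun i _ => hw' i)
  rw [Finset.sum_congr rfl (fun i _ => hw i), Finset.sum_const_zero] at this
  rw [← this]
  refine integral_congr_ae (ae_of_all _ fun x => ?_)
  simp only [Pi.add_apply, pdiv, pval_sum, PiLp.inner_apply, RCLike.inner_apply, RCLike.conj_to_real,
    vval_apply, Finset.mul_sum, ← Finset.sum_add_distrib]
  refine Finset.sum_congr rfl fun i _ => ?_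
  ring

end IsSimplex

/-! ### Weak traces on facets -/

/-- The integral `∫_K (d φ m + ∇(φ m) · (x - a))` for a function `φ` with gradient `G`; it is a
multiple of the integral of `φ m` over the facet opposite to the vertex `a`. -/
def coneInt (K : Finset (Pt d)) (a : Pt d) (φ : Pt d → ℝ) (G : Pt d → Pt d) (m : Pt d → ℝ) : ℝ :=
  ∫ x in hull K, (φ x * (d * m x + ⟪∇ m x, x - a⟫) + ⟪G x, m x • (x - a)⟫)

namespace IsSimplex

variable {K : Finset (Pt d)} (hK : IsSimplex K)
include hK

/-- The cone identity for the product `φ * m`. It justifies using `coneInt` as the facet moment of a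
function that merely has a weak gradient. -/
theorem coneInt_smooth (hd : 1 ≤ d) {a : Pt d} (ha : a ∈ K) {φ m : Pt d → ℝ} (hφ : ContDiff ℝ 1 φ)
    (hm : ContDiff ℝ 1 m) :
    ‖bgrad K a‖ * coneInt K a φ (∇ φ) m = ∫ x, φ x * m x ∂(surf (facet K a)) := by
  have h := hK.integral_cone hd ha (hφ.mul hm)
  rw [eq_inv_mul_iff_mul_eq₀ (norm_ne_zero_iff.2 (hK.bgrad_ne_zero hd ha))] at h
  rw [← h]
  congr 1
  refine integral_congr_ae (ae_of_all _ fun x => ?_)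
  simp only
  rw [gradient_mul (hφ.differentiable (by norm_num) x) (hm.differentiable (by norm_num) x),
    inner_add_left, real_inner_smul_left, real_inner_smul_left, real_inner_smul_right]
  ring

-- For fixed `m` the functional is continuous in `(φ, G)` with respect to `L²` on any set that
-- carries `m`. Since smooth approximations converge only on compact subsets of `Ω`, `m` and its
-- gradient have to vanish off such a set.
omit hK in
theorem tendsto_coneInt {S : Set (Pt d)} (hS : IsCompact S) (hSK : S ⊆ hull K) (a : Pt d)
    {φ : Pt d → ℝ} {G : Pt d → Pt d} (hφ : MemLp φ 2 (volume.restrict S))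
    (hG : MemLp G 2 (volume.restrict S)) {χ : ℕ → Pt d → ℝ} (hχ : ∀ n, ContDiff ℝ ∞ (χ n))
    (h1 : Tendsto (fun n => eLpNorm (fun x => χ n x - φ x) 2 (volume.restrict S)) atTop (𝓝 0))
    (h2 : Tendsto (fun n => eLpNorm (fun x => ∇ (χ n) x - G x) 2 (volume.restrict S)) atTop (𝓝 0))
    {m : Pt d → ℝ} (hm : ContDiff ℝ 1 m) (hm0 : ∀ x ∈ hull K, x ∉ S → m x = 0 ∧ ∇ m x = 0) :
    Tendsto (fun n => coneInt K a (χ n) (∇ (χ n)) m) atTop (𝓝 (coneInt K a φ G m)) := by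
  have hmc := hm.continuous
  have hmg := continuous_gradient hm
  have b1 : MemLp (fun x => d * m x + ⟪∇ m x, x - a⟫) 2 (volume.restrict S) :=
    memLp_restrict_of_continuous (by fun_prop) hS 2
  have b2 : MemLp (fun x => m x • (x - a)) 2 (volume.restrict S) :=
    memLp_restrict_of_continuous (by fun_prop) hS 2
  have hred : ∀ (ψ : Pt d → ℝ) (H : Pt d → Pt d), MemLp ψ 2 (volume.restrict S) →
      MemLp H 2 (volume.restrict S) → coneInt K a ψ H m =
        (∫ x in S, ⟪ψ x, d * m x + ⟪∇ m x, x - a⟫⟫) + ∫ x in S, ⟪H x, m x • (x - a)⟫ := by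
    intro ψ H hψ hH
    rw [coneInt, setIntegral_eq_of_subset_of_forall_sdiff_eq_zero measurableSet_hull hSK
      (fun x hx => by rw [(hm0 x hx.1 hx.2).1, (hm0 x hx.1 hx.2).2]; simp),
      ← integral_add (integrable_inner_of_memLp hψ b1) (integrable_inner_of_memLp hH b2)]
    simp only [RCLike.inner_apply, RCLike.conj_to_real, mul_comm]
  have hc1 : ∀ n, ContDiff ℝ 1 (χ n) := fun n => (hχ n).of_le (by exact_mod_cast le_top)
  have hχS : ∀ n, MemLp (χ n) 2 (volume.restrict S) :=
    fun n => memLp_restrict_of_continuous (hχ n).continuous hS 2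
  have hgS : ∀ n, MemLp (∇ (χ n)) 2 (volume.restrict S) :=
    fun n => memLp_restrict_of_continuous (continuous_gradient (hc1 n)) hS 2
  rw [hred φ G hφ hG]
  simp only [fun n => hred (χ n) (∇ (χ n)) (hχS n) (hgS n)]
  exact (tendsto_integral_inner hφ hχS h1 b1).add (tendsto_integral_inner hG hgS h2 b2)

/-- The cutoff acts near the facets through `a` only. There the radial field `x - a` is tangential:
its product with `bgrad K i` is exactly the coordinate of `i`. -/
theorem tendsto_coneInt_cutoff {a : Pt d} (ha : a ∈ K) {φ : Pt d → ℝ} {G : Pt d → Pt d}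
    (hφ : MemLp φ 2 (volume.restrict (hull K))) (hG : MemLp G 2 (volume.restrict (hull K)))
    (p : MPoly d) :
    Tendsto (fun N : ℕ => coneInt K a φ G fun x => pval p x * cutoff K (facet K a) N x) atTop
      (𝓝 (coneInt K a φ G (pval p))) := by
  have hpm : ∀ q : MPoly d, MemLp (pval q) 2 (volume.restrict (hull K)) :=
    fun q => memLp_of_continuous (by fun_prop) _
  have i1 : Integrable (fun x => φ x * (d * pval p x + ⟪∇ (pval p) x, x - a⟫))
      (volume.restrict (hull K)) := by
    simp only [gradient_pval]
    exact integrable_mul_of_memLp hφ (memLp_of_continuous (by fun_prop) _)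
  have i2 : Integrable (fun x => ⟪G x, pval p x • (x - a)⟫) (volume.restrict (hull K)) :=
    integrable_inner_of_memLp hG (memLp_of_continuous (by fun_prop) _)
  have := hK.tendsto_integral_cutoff (s := facet K a) (Q := fun x => x - a)
    (φ := fun x => φ x * pval p x) (facet_subset a) (i1.add i2)
    (integrable_mul_of_memLp hφ (hpm p)) (by fun_prop) zero_le_one (fun x hx i hi => by
      obtain ⟨hia, hiK⟩ := mem_facet.1 hi
      rw [← bary_sub, hK.bary_of_ne hiK ha hia.symm, sub_zero, one_mul,
        abs_of_nonneg (hK.bary_nonneg hiK hx)])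
  refine this.congr fun N => integral_congr_ae (ae_of_all _ fun x => ?_)
  simp only [Pi.add_apply]
  rw [gradient_mul ((contDiff_pval _).differentiable (by simp) x)
    ((contDiff_cutoff _ _ _).differentiable (by simp) x)]
  simp only [inner_add_left, real_inner_smul_left, real_inner_smul_right]
  ring

/-- On a common face the coordinates of a common vertex are determined by its vertices alone. So
cutoffs built in two neighboring elements agree on their common facet. -/
theorem bary_eq_of_mem_facet {K' : Finset (Pt d)} (hK' : IsSimplex K') {s : Finset (Pt d)}
    (hs : s ⊆ K) (hs' : s ⊆ K') {x : Pt d} (hx : x ∈ hull s) {i : Pt d} (hi : i ∈ s) :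
    pval (bary K i) x = pval (bary K' i) x := by
  obtain ⟨w, -, hw1, rfl⟩ := Finset.mem_convexHull'.1 hx
  have key : ∀ L : Finset (Pt d), pval (bary L i) (∑ y ∈ s, w y • y) =
      ∑ y ∈ s, w y * pval (bary L i) y := fun L => by
    simp only [pval_bary, inner_sum, real_inner_smul_right, mul_add, Finset.sum_add_distrib,
      ← Finset.sum_mul, hw1, one_mul]
  rw [key, key]
  refine Finset.sum_congr rfl fun y hy => ?_
  by_cases hyi : y = i
  · rw [hyi, hK.bary_self (hs hi), hK'.bary_self (hs' hi)]
  · rw [hK.bary_of_ne (hs hi) (hs hy) hyi, hK'.bary_of_ne (hs' hi) (hs' hy) hyi]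

end IsSimplex

namespace Mesh

variable {Ω : Set (Pt d)} (T : Mesh Ω)

/-- The traces of a function in `H¹` from the two sides of a facet agree. -/
theorem coneInt_neighbor (hd : 1 ≤ d) (hΩo : IsOpen Ω) (hΩ : interior (closure Ω) = Ω)
    {K K' : Finset (Pt d)} (hK : K ∈ T.cells) (hK' : K' ∈ T.cells) (hne : K ≠ K') {a a' : Pt d}
    (ha : a ∈ K) (ha' : a' ∈ K') (h : facet K a = facet K' a') {φ : Pt d → ℝ} {G : Pt d → Pt d}
    (hφ : HasWeakGrad Ω φ G) {p p' : MPoly d}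
    (hp : ∀ x ∈ hull (facet K a), pval p x = pval p' x) :
    ‖bgrad K a‖ * coneInt K a φ G (pval p) = ‖bgrad K' a'‖ * coneInt K' a' φ G (pval p') := by
  have sK := T.isSimplex hK
  have sK' := T.isSimplex hK'
  have hle := T.restrict_hull_le hΩ hK
  have hle' := T.restrict_hull_le hΩ hK'
  have lim := (sK.tendsto_coneInt_cutoff ha (hφ.memLp.mono_measure hle)
    (hφ.memLp_grad.mono_measure hle) p).const_mul ‖bgrad K a‖
  have lim' := (sK'.tendsto_coneInt_cutoff ha' (hφ.memLp.mono_measure hle')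
    (hφ.memLp_grad.mono_measure hle') p').const_mul ‖bgrad K' a'‖
  -- It suffices to compare the two sides after cutting off. The support of the cutoff in each
  -- element meets the boundary only in the relative interior of the common facet, which lies in
  -- `Ω`; so the function can be smoothly approximated on both supports at once.
  refine tendsto_nhds_unique lim (lim'.congr fun N => ?_)
  -- the supports of the cutoff functions
  have hS : ∀ {L L' : Finset (Pt d)}, L ∈ T.cells → L' ∈ T.cells → L ≠ L' → ∀ {b b' : Pt d},
      b ∈ L → b' ∈ L' → facet L b = facet L' b' →
      IsCompact (hull L ∩ ⋂ i ∈ facet L b, {x : Pt d | 1 ≤ (N : ℝ) * pval (bary L i) x}) ∧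
      (hull L ∩ ⋂ i ∈ facet L b, {x : Pt d | 1 ≤ (N : ℝ) * pval (bary L i) x}) ⊆ Ω ∧
      ∀ q : MPoly d, ∀ x ∈ hull L, x ∉ (hull L ∩ ⋂ i ∈ facet L b,
        {x : Pt d | 1 ≤ (N : ℝ) * pval (bary L i) x}) →
        pval q x * cutoff L (facet L b) N x = 0 ∧
          ∇ (fun y => pval q y * cutoff L (facet L b) N y) x = 0 := by
    intro L L' hL hL' hLL b b' hb hb' hf
    have sL := T.isSimplex hL
    refine ⟨IsSimplex.isCompact_hull.inter_right (isClosed_biInter fun i _ =>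
      isClosed_le continuous_const (by fun_prop)), fun x hx => ?_, fun q x hx hxS => ?_⟩
    · obtain ⟨hxL, hx⟩ := hx
      simp only [Set.mem_iInter, Set.mem_ofPred_eq] at hx
      have hpos : ∀ i ∈ L, i ≠ b → 0 < pval (bary L i) x := by
        intro i hi hib
        by_contra! hle
        have h1 := hx i (mem_facet.2 ⟨hib, hi⟩)
        have h2 : (N : ℝ) * pval (bary L i) x ≤ 0 :=
          mul_nonpos_of_nonneg_of_nonpos (by positivity) hle
        linarith
      rcases (sL.bary_nonneg hb hxL).eq_or_lt with h0 | h0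
      · exact T.mem_of_facet_interior hd hΩ hL hL' hLL hb hb' hf h0.symm hpos
      · refine T.interior_hull_subset hΩ hL ?_
        rw [sL.interior_hull]
        intro i hi
        by_cases hib : i = b
        · rw [hib]; exact h0
        · exact hpos i hi hib
    · obtain ⟨i, hi, hlt⟩ : ∃ i ∈ facet L b, (N : ℝ) * pval (bary L i) x < 1 := by
        by_contra! hcon
        exact hxS ⟨hx, by simpa using hcon⟩
      rw [gradient_mul ((contDiff_pval _).differentiable (by simp) x)
        ((contDiff_cutoff _ _ _).differentiable (by simp) x), cutoff_eq_zero hi hlt.le,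
        gradient_cutoff_eq_zero hi hlt]
      simp
  obtain ⟨c1, s1, z1⟩ := hS hK hK' hne ha ha' h
  obtain ⟨c2, s2, z2⟩ := hS hK' hK hne.symm ha' ha h.symm
  obtain ⟨χ, hχ, t1, t2⟩ := exists_smooth_approx hΩo hφ (c1.union c2) (Set.union_subset s1 s2)
  have sub : ∀ {E : Type} [NormedAddCommGroup E] {F : ℕ → Pt d → E} {S S' : Set (Pt d)}, S ⊆ S' →
      Tendsto (fun n => eLpNorm (F n) 2 (volume.restrict S')) atTop (𝓝 0) →
      Tendsto (fun n => eLpNorm (F n) 2 (volume.restrict S)) atTop (𝓝 0) := by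
    intro E _ F S S' hSS ht
    exact tendsto_of_tendsto_of_tendsto_of_le_of_le tendsto_const_nhds ht (fun _ => zero_le)
      fun n => eLpNorm_mono_measure _ (Measure.restrict_mono hSS le_rfl)
  have hm : ∀ (L s : Finset (Pt d)) (q : MPoly d),
      ContDiff ℝ ∞ fun x => pval q x * cutoff L s N x :=
    fun L s q => (contDiff_pval q).mul (contDiff_cutoff L s N)
  have r1 := (IsSimplex.tendsto_coneInt c1 Set.inter_subset_left a
    (hφ.memLp.mono_measure (Measure.restrict_mono s1 le_rfl))
    (hφ.memLp_grad.mono_measure (Measure.restrict_mono s1 le_rfl)) hχ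
    (sub Set.subset_union_left t1) (sub Set.subset_union_left t2)
    ((hm K (facet K a) p).of_le (by exact_mod_cast le_top)) (z1 p)).const_mul ‖bgrad K a‖
  have r2 := (IsSimplex.tendsto_coneInt c2 Set.inter_subset_left a'
    (hφ.memLp.mono_measure (Measure.restrict_mono s2 le_rfl))
    (hφ.memLp_grad.mono_measure (Measure.restrict_mono s2 le_rfl)) hχ
    (sub Set.subset_union_right t1) (sub Set.subset_union_right t2)
    ((hm K' (facet K' a') p').of_le (by exact_mod_cast le_top)) (z2 p')).const_mul ‖bgrad K' a'‖
  -- For a smooth approximation both sides are the same integral over the common facet, because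
  -- polynomials and cutoffs agree there.
  refine tendsto_nhds_unique r2 (r1.congr fun n => ?_)
  have hχ1 : ContDiff ℝ 1 (χ n) := (hχ n).of_le (by exact_mod_cast le_top)
  rw [sK.coneInt_smooth hd ha hχ1 ((hm K (facet K a) p).of_le (by exact_mod_cast le_top)),
    sK'.coneInt_smooth hd ha' hχ1 ((hm K' (facet K' a') p').of_le (by exact_mod_cast le_top)), ← h]
  refine integral_congr_ae ?_
  filter_upwards [IsSimplex.ae_surf_mem (facet K a)] with x hx
  rw [hp x hx, cutoff, cutoff]
  congr 2
  refine Finset.prod_congr rfl fun i hi => ?_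
  rw [sK.bary_eq_of_mem_facet sK' (IsSimplex.facet_subset a) (h ▸ IsSimplex.facet_subset a') hx hi]

end Mesh

/-! ### Polynomials that are homogeneous about a point -/

/-- `β` is homogeneous of degree `n` about the point `a` (Euler's relation). -/
def IsHomAt (a : Pt d) (n : ℕ) (β : MPoly d) : Prop :=
  ∀ x, ⟪pgrad β x, x - a⟫ = n * pval β x

namespace IsHomAt

variable {a : Pt d} {m n : ℕ} {β β' : MPoly d}

theorem add (h : IsHomAt a n β) (h' : IsHomAt a n β') : IsHomAt a n (β + β') := fun x => by
  rw [pgrad_add, inner_add_left, h, h', pval_add]; ring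

theorem smul (c : ℝ) (h : IsHomAt a n β) : IsHomAt a n (c • β) := fun x => by
  rw [pgrad_smul, real_inner_smul_left, h, pval_smul]; ring

theorem zero : IsHomAt a n (0 : MPoly d) := fun x => by
  have h1 : pgrad (0 : MPoly d) x = 0 := by simpa using pgrad_C (0 : ℝ) x
  rw [h1]; simp

theorem one : IsHomAt a 0 (1 : MPoly d) := fun x => by
  have h1 : pgrad (1 : MPoly d) x = 0 := by simpa using pgrad_C (1 : ℝ) x
  rw [h1]; simp

theorem mul (h : IsHomAt a m β) (h' : IsHomAt a n β') : IsHomAt a (m + n) (β * β') := fun x => by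
  rw [pgrad_mul, inner_add_left, real_inner_smul_left, real_inner_smul_left, h, h', pval_mul]
  push_cast; ring

theorem pow (h : IsHomAt a 1 β) : ∀ n : ℕ, IsHomAt a n (β ^ n)
  | 0 => by simpa using one
  | n + 1 => by rw [pow_succ]; exact (pow h n).mul h

theorem prod_pow {ι : Type*} (s : Finset ι) {f : ι → MPoly d} {e : ι → ℕ}
    (h : ∀ i ∈ s, IsHomAt a 1 (f i)) : IsHomAt a (∑ i ∈ s, e i) (∏ i ∈ s, f i ^ e i) := by
  classical
  induction s using Finset.induction_on with
  | empty => simpa using one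
  | insert i s hi ih =>
    rw [Finset.sum_insert hi, Finset.prod_insert hi]
    exact ((h i (Finset.mem_insert_self i s)).pow _).mul
      (ih fun j hj => h j (Finset.mem_insert_of_mem hj))

theorem sum {ι : Type*} (s : Finset ι) {f : ι → MPoly d} (h : ∀ i ∈ s, IsHomAt a n (f i)) :
    IsHomAt a n (∑ i ∈ s, f i) := by
  classical
  induction s using Finset.induction_on with
  | empty => simpa using zero
  | insert i s hi ih =>
    rw [Finset.sum_insert hi]
    exact (h i (Finset.mem_insert_self i s)).add (ih fun j hj => h j (Finset.mem_insert_of_mem hj))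

end IsHomAt

theorem pgrad_X (i : Fin d) (x : Pt d) :
    pgrad (MvPolynomial.X i : MPoly d) x = EuclideanSpace.single i 1 := by
  classical
  ext j
  by_cases h : i = j
  · subst h; simp
  · simp [MvPolynomial.pderiv_X, h, Ne.symm h]

namespace IsSimplex

variable {K : Finset (Pt d)} (hK : IsSimplex K)
include hK

/-- The function `1 - λ_a` vanishes at `a` and equals one on the opposite facet, so it serves as
homogenizing variable. -/
theorem isHomAt_height {a : Pt d} (ha : a ∈ K) : IsHomAt a 1 (1 - bary K a) := fun x => by
  have h1 : pgrad (1 : MPoly d) x = 0 := by simpa using pgrad_C (1 : ℝ) x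
  rw [pgrad_sub, h1, pgrad_bary, zero_sub, inner_neg_left, ← bary_sub, hK.bary_self ha]
  simp

/-- Every polynomial of degree at most `k` agrees with one that is homogeneous of degree `k` about a
vertex on the opposite facet. -/
theorem exists_homogenization {a : Pt d} (ha : a ∈ K) {k : ℕ} {μ : MPoly d}
    (hμ : μ.totalDegree ≤ k) : ∃ β : MPoly d, β.totalDegree ≤ k ∧ IsHomAt a k β ∧
      ∀ x, pval (bary K a) x = 0 → pval β x = pval μ x := by
  -- `Y i` agrees with `x i` on the facet, where `λ_a = 0`, and is homogeneous of degree one about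
  -- `a`. Substituting it for the variables and filling up the degree with powers of `1 - λ_a` makes
  -- every monomial homogeneous of degree `k`.
  obtain ⟨Y, hY⟩ : ∃ Y : Fin d → MPoly d, ∀ i, Y i = (MvPolynomial.X i - MvPolynomial.C (a i)) +
      (a i) • (1 - bary K a) := ⟨_, fun i => rfl⟩
  have hYd : ∀ i, (Y i).totalDegree ≤ 1 := by
    intro i
    rw [hY]
    refine (MvPolynomial.totalDegree_add _ _).trans (max_le ?_ ?_)
    · refine (MvPolynomial.totalDegree_sub _ _).trans (max_le ?_ ?_)
      · exact (MvPolynomial.totalDegree_X i).le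
      · exact (MvPolynomial.totalDegree_C _).trans_le zero_le_one
    · refine (MvPolynomial.totalDegree_smul_le _ _).trans ?_
      exact (MvPolynomial.totalDegree_sub _ _).trans (max_le (by simp) (totalDegree_bary_le K a))
  have hYh : ∀ i, IsHomAt a 1 (Y i) := by
    intro i
    rw [hY]
    refine IsHomAt.add (fun x => ?_) ((hK.isHomAt_height ha).smul _)
    rw [pgrad_sub, pgrad_X, pgrad_C, sub_zero, EuclideanSpace.inner_single_left]
    simp
  have hL := hK.isHomAt_height ha
  have hLd : (1 - bary K a).totalDegree ≤ 1 :=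
    (MvPolynomial.totalDegree_sub _ _).trans (max_le (by simp) (totalDegree_bary_le K a))
  have hsum : ∀ s ∈ μ.support, ∑ i, s i ≤ k := by
    intro s hs
    have := (MvPolynomial.le_totalDegree hs).trans hμ
    rwa [Finsupp.sum_fintype _ _ (fun _ => rfl)] at this
  refine ⟨∑ s ∈ μ.support, (μ.coeff s) • ((∏ i, Y i ^ s i) * (1 - bary K a) ^ (k - ∑ i, s i)),
    ?_, ?_, fun x hx => ?_⟩
  · refine (MvPolynomial.totalDegree_finsetSum _ _).trans (Finset.sup_le fun s hs => ?_)
    refine (MvPolynomial.totalDegree_smul_le _ _).trans ((MvPolynomial.totalDegree_mul _ _).trans ?_)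
    have h1 : (∏ i, Y i ^ s i).totalDegree ≤ ∑ i, s i :=
      (MvPolynomial.totalDegree_finsetProd _ _).trans (Finset.sum_le_sum fun i _ =>
        (MvPolynomial.totalDegree_pow _ _).trans (by nlinarith [hYd i, Nat.zero_le (s i)]))
    have h2 : ((1 - bary K a) ^ (k - ∑ i, s i)).totalDegree ≤ k - ∑ i, s i :=
      (MvPolynomial.totalDegree_pow _ _).trans (by nlinarith [Nat.zero_le (k - ∑ i, s i)])
    have := hsum s hs
    omega
  · refine IsHomAt.sum _ fun s hs => IsHomAt.smul _ ?_
    have := (IsHomAt.prod_pow Finset.univ (e := s) fun i _ => hYh i).mul (hL.pow (k - ∑ i, s i))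
    rwa [Nat.add_sub_cancel' (hsum s hs)] at this
  · have hYx : ∀ i, pval (Y i) x = x i := fun i => by
      rw [hY]; simp [hx]
    have hprod : ∀ s : Fin d →₀ ℕ, pval (∏ i, Y i ^ s i) x = ∏ i, x i ^ s i := fun s => by
      rw [pval, map_prod]
      exact Finset.prod_congr rfl fun i _ => by rw [map_pow]; exact congrArg (· ^ s i) (hYx i)
    rw [pval_sum]
    simp only [pval_smul, pval_mul, hprod, pval_pow, pval_sub, pval_one, hx, sub_zero, one_pow,
      mul_one]
    rw [pval, MvPolynomial.eval_eq']

end IsSimplex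

/-! ### Extrapolation of polynomials -/

/-- Along a ray from `c` a polynomial of degree at most `k` is determined by `k + 1` values;
Lagrange interpolation at nodes in `[1/2, 3/4]` recovers the value at parameter one. The weights do
not depend on the simplex, which replaces a compactness argument on a reference element. -/
theorem exists_extrapolation (k : ℕ) : ∃ L t : Fin (k + 1) → ℝ,
    (∀ j, 2⁻¹ ≤ t j ∧ t j ≤ 3 / 4) ∧ ∀ (s : MPoly d), s.totalDegree ≤ k →
      ∀ c x : Pt d, pval s x = ∑ j, L j * pval s (c + t j • (x - c)) := by
  obtain ⟨t, ht⟩ : ∃ t : Fin (k + 1) → ℝ, ∀ j, t j = 2⁻¹ + j / (4 * (k + 1)) := ⟨_, fun j => rfl⟩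
  have hinj : Set.InjOn t (Finset.univ : Finset (Fin (k + 1))) := by
    intro i _ j _ hij
    rw [ht, ht] at hij
    have : (0 : ℝ) < 4 * (k + 1) := by positivity
    field_simp at hij
    have h2 := add_left_cancel hij
    exact Fin.ext (by exact_mod_cast (by linarith : ((i : ℕ) : ℝ) = j))
  refine ⟨fun j => (Lagrange.basis Finset.univ t j).eval 1, t, fun j => ⟨?_, ?_⟩, ?_⟩
  · rw [ht]
    have : (0 : ℝ) ≤ (j : ℕ) / (4 * (k + 1)) := by positivity
    linarith
  · rw [ht]
    have h1 : ((j : ℕ) : ℝ) ≤ k := by exact_mod_cast Nat.lt_succ_iff.1 j.2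
    have : ((j : ℕ) : ℝ) / (4 * (k + 1)) ≤ 1 / 4 := by
      rw [div_le_div_iff₀ (by positivity) (by norm_num)]; linarith
    linarith
  · intro s hs c x
    obtain ⟨f, hf⟩ : ∃ f, f = MvPolynomial.aeval
      (fun i => Polynomial.C (c i) + Polynomial.X * Polynomial.C (x i - c i)) s := ⟨_, rfl⟩
    have hdeg : f.degree < (Finset.univ : Finset (Fin (k + 1))).card := by
      have h1 : f.natDegree ≤ k * 1 := by
        rw [hf]
        refine MvPolynomial.aeval_natDegree_le s hs _ fun i => ?_
        compute_degree
      rw [Finset.card_fin]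
      refine (Polynomial.degree_le_natDegree).trans_lt ?_
      exact_mod_cast Nat.lt_succ_iff.2 (by simpa using h1)
    have hev : ∀ τ : ℝ, f.eval τ = pval s (c + τ • (x - c)) := by
      intro τ
      rw [hf, pval, ← Polynomial.coe_evalRingHom, MvPolynomial.aeval_def, MvPolynomial.eval₂_eq',
        map_sum, MvPolynomial.eval_eq']
      simp [Polynomial.eval_prod]
    have h1 := congrArg (Polynomial.eval 1) (Lagrange.eq_interpolate hinj hdeg)
    rw [hev, one_smul, add_sub_cancel, Lagrange.interpolate_apply, Polynomial.eval_finsetSum] at h1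
    rw [h1]
    refine Finset.sum_congr rfl fun j _ => ?_
    rw [Polynomial.eval_mul, Polynomial.eval_C, hev, mul_comm]

/-! ### Raviart-Thomas fields -/

theorem totalDegree_X_mul_sub_le {k : ℕ} {β : MPoly d} (hβ : β.totalDegree ≤ k) (i : Fin d) :
    (MvPolynomial.X i * (β - MvPolynomial.homogeneousComponent k β)).totalDegree ≤ k := by
  obtain ⟨δ, hδ⟩ : ∃ δ, δ = β - MvPolynomial.homogeneousComponent k β := ⟨_, rfl⟩
  rw [← hδ]
  have hlt : ∀ s ∈ δ.support, s.sum (fun _ e => e) < k := by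
    intro s hs
    rw [MvPolynomial.mem_support_iff, hδ, MvPolynomial.coeff_sub,
      MvPolynomial.coeff_homogeneousComponent] at hs
    have hne : s.degree ≠ k := fun h => hs (by simp [h])
    rw [if_neg hne, sub_zero] at hs
    have := (MvPolynomial.le_totalDegree (MvPolynomial.mem_support_iff.2 hs)).trans hβ
    exact lt_of_le_of_ne this hne
  by_cases h0 : δ = 0
  · simp [h0]
  · obtain ⟨s, hs⟩ := MvPolynomial.support_nonempty.2 h0
    have hk := hlt s hs
    have h1 : δ.totalDegree ≤ k - 1 := Finset.sup_le fun s hs => by have := hlt s hs; omega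
    refine (MvPolynomial.totalDegree_mul _ _).trans ?_
    have h2 := MvPolynomial.totalDegree_X (R := ℝ) i
    omega

namespace IsRT

variable {k : ℕ} {Q Q' : Fin d → MPoly d}

theorem of_totalDegree_le (h : ∀ i, (Q i).totalDegree ≤ k) : IsRT k Q :=
  ⟨Q, 0, h, MvPolynomial.isHomogeneous_zero _ _ _, fun i => by simp⟩

theorem add (h : IsRT k Q) (h' : IsRT k Q') : IsRT k (Q + Q') := by
  obtain ⟨p, r, hp, hr, e⟩ := h
  obtain ⟨p', r', hp', hr', e'⟩ := h'
  refine ⟨p + p', r + r', fun i => (MvPolynomial.totalDegree_add _ _).trans (max_le (hp i) (hp' i)),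
    hr.add hr', fun i => ?_⟩
  rw [Pi.add_apply, Pi.add_apply, e, e']; ring

theorem neg (h : IsRT k Q) : IsRT k (-Q) := by
  obtain ⟨p, r, hp, hr, e⟩ := h
  refine ⟨-p, -r, fun i => by simpa using hp i, hr.neg, fun i => ?_⟩
  rw [Pi.neg_apply, Pi.neg_apply, e]; ring

theorem sub (h : IsRT k Q) (h' : IsRT k Q') : IsRT k (Q - Q') := by
  rw [sub_eq_add_neg]; exact h.add h'.neg

theorem sum {ι : Type*} (s : Finset ι) {f : ι → Fin d → MPoly d} (h : ∀ i ∈ s, IsRT k (f i)) :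
    IsRT k (∑ i ∈ s, f i) := by
  classical
  induction s using Finset.induction_on with
  | empty => simpa using of_totalDegree_le (Q := (0 : Fin d → MPoly d)) fun i => by simp
  | insert i s hi ih =>
    rw [Finset.sum_insert hi]
    exact (h i (Finset.mem_insert_self i s)).add (ih fun j hj => h j (Finset.mem_insert_of_mem hj))

/-- Only the homogeneous part of `β` of degree `k` needs the factor `x`; the rest of `x β` and the
term `a β` have degree at most `k`. -/
theorem radial (a : Pt d) {β : MPoly d} (hβ : β.totalDegree ≤ k) :
    IsRT k fun i => (MvPolynomial.X i - MvPolynomial.C (a i)) * β := by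
  refine ⟨fun i => MvPolynomial.X i * (β - MvPolynomial.homogeneousComponent k β) -
    MvPolynomial.C (a i) * β, MvPolynomial.homogeneousComponent k β, fun i => ?_,
    MvPolynomial.homogeneousComponent_isHomogeneous k β, fun i => by ring⟩
  refine (MvPolynomial.totalDegree_sub _ _).trans (max_le (totalDegree_X_mul_sub_le hβ i) ?_)
  refine (MvPolynomial.totalDegree_mul _ _).trans ?_
  rw [MvPolynomial.totalDegree_C, zero_add]
  exact hβ

theorem totalDegree_pdiv_le (h : IsRT k Q) : (pdiv Q).totalDegree ≤ k := by
  obtain ⟨p, r, hp, hr, e⟩ := h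
  refine (MvPolynomial.totalDegree_finsetSum _ _).trans (Finset.sup_le fun i _ => ?_)
  refine (totalDegree_pderiv_le _ i).trans ?_
  have : (Q i).totalDegree ≤ k + 1 := by
    rw [e]
    refine (MvPolynomial.totalDegree_add _ _).trans (max_le ((hp i).trans (Nat.le_succ k)) ?_)
    refine (MvPolynomial.totalDegree_mul _ _).trans ?_
    have h1 := MvPolynomial.totalDegree_X (R := ℝ) i
    have h2 := hr.totalDegree_le
    omega
  omega

end IsRT

/-- The normal component of a Raviart-Thomas field on a facet is a polynomial of degree `k`. -/
theorem IsSimplex.exists_normal_component {K : Finset (Pt d)} (hK : IsSimplex K) (hd : 1 ≤ d)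
    {k : ℕ} {Q : Fin d → MPoly d} (hQ : IsRT k Q) {a : Pt d} (ha : a ∈ K) :
    ∃ ν : MPoly d, ν.totalDegree ≤ k ∧
      ∀ x ∈ hull (facet K a), ⟪vval Q x, normal K a⟫ = pval ν x := by
  obtain ⟨p, r, hp, hr, e⟩ := hQ
  obtain ⟨n, hn⟩ : ∃ n, n = normal K a := ⟨_, rfl⟩
  -- On the facet `x · n` is constant, so the part `x r` contributes only a multiple of `r` to the
  -- normal component.
  have hconst : ∃ c : ℝ, ∀ x ∈ hull (facet K a), ⟪x, n⟫ = c := by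
    refine ⟨(baryCoef K a).1 * ‖bgrad K a‖⁻¹, fun x hx => ?_⟩
    have h0 := ((hK.mem_hull_facet_iff ha).1 hx).2
    rw [pval_bary] at h0
    rw [hn, hK.normal_eq hd ha, inner_neg_right, real_inner_smul_right, real_inner_comm]
    linear_combination (-‖bgrad K a‖⁻¹) * h0
  obtain ⟨c, hc⟩ := hconst
  refine ⟨∑ i, n i • p i + c • r, ?_, fun x hx => ?_⟩
  · refine (MvPolynomial.totalDegree_add _ _).trans (max_le ?_ ?_)
    · exact (MvPolynomial.totalDegree_finsetSum _ _).trans (Finset.sup_le fun i _ =>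
        (MvPolynomial.totalDegree_smul_le _ _).trans (hp i))
    · exact (MvPolynomial.totalDegree_smul_le _ _).trans hr.totalDegree_le
  · rw [← hn, pval_add, pval_sum, pval_smul, ← hc x hx]
    simp only [PiLp.inner_apply, RCLike.inner_apply, RCLike.conj_to_real, vval_apply, e, pval_add,
      pval_mul, pval_X, pval_smul, Finset.sum_mul, ← Finset.sum_add_distrib]
    exact Finset.sum_congr rfl fun i _ => by ring

/-! ### Calculus of weak gradients -/

namespace IsTest

variable {Ω Ω' : Set (Pt d)} {φ : Pt d → ℝ}

theorem gradient_eq_zero {x : Pt d} (hx : x ∉ tsupport φ) : ∇ φ x = 0 :=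
  gradient_eq_zero_of_eventuallyEq (notMem_tsupport_iff_eventuallyEq.1 hx)

theorem mono (h : IsTest Ω φ) (hΩ : Ω ⊆ Ω') : IsTest Ω' φ := ⟨h.smooth, h.compact, h.support.trans hΩ⟩

theorem continuous_grad (h : IsTest Ω φ) : Continuous (∇ φ) :=
  continuous_gradient (h.smooth.of_le (by exact_mod_cast le_top))

theorem memLp (h : IsTest Ω φ) (S : Set (Pt d)) : MemLp φ 2 (volume.restrict S) :=
  (h.smooth.continuous.memLp_of_hasCompactSupport h.compact).mono_measure Measure.restrict_le_self

theorem memLp_grad (h : IsTest Ω φ) (S : Set (Pt d)) : MemLp (∇ φ) 2 (volume.restrict S) :=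
  (h.continuous_grad.memLp_of_hasCompactSupport (h.compact.mono' fun x hx => by
    by_contra hxt
    exact hx (gradient_eq_zero hxt))).mono_measure Measure.restrict_le_self

theorem setIntegral_eq (h : IsTest Ω φ) (hΩ : Ω ⊆ Ω') (hm : MeasurableSet Ω') {g : Pt d → ℝ}
    (hg : ∀ x, x ∉ tsupport φ → g x = 0) : ∫ x in Ω', g x = ∫ x in Ω, g x :=
  setIntegral_eq_of_subset_of_forall_sdiff_eq_zero hm hΩ fun x hx =>
    hg x fun hxt => hx.2 (h.support hxt)

end IsTest

namespace HasWeakGrad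

variable {Ω Ω' : Set (Pt d)} {u v : Pt d → ℝ} {G H : Pt d → Pt d}

theorem mono (h : HasWeakGrad Ω' u G) (hΩ : Ω ⊆ Ω') (hm : MeasurableSet Ω') : HasWeakGrad Ω u G := by
  have hle : volume.restrict Ω ≤ volume.restrict Ω' := Measure.restrict_mono hΩ le_rfl
  refine ⟨h.memLp.mono_measure hle, h.memLp_grad.mono_measure hle, fun φ hφ i => ?_⟩
  rw [← hφ.setIntegral_eq hΩ hm fun x hx => by rw [IsTest.gradient_eq_zero hx]; simp,
    ← hφ.setIntegral_eq hΩ hm fun x hx => by rw [image_eq_zero_of_notMem_tsupport hx, mul_zero]]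
  exact h.weak φ (hφ.mono hΩ) i

theorem add (h : HasWeakGrad Ω u G) (h' : HasWeakGrad Ω v H) :
    HasWeakGrad Ω (fun x => u x + v x) (fun x => G x + H x) := by
  refine ⟨h.memLp.add h'.memLp, h.memLp_grad.add h'.memLp_grad, fun φ hφ i => ?_⟩
  have hg := memLp_coord (hφ.memLp_grad Ω) i
  have hs := hφ.memLp Ω
  simp only [add_mul, PiLp.add_apply]
  rw [integral_add (integrable_mul_of_memLp h.memLp hg) (integrable_mul_of_memLp h'.memLp hg),
    integral_add (integrable_mul_of_memLp (memLp_coord h.memLp_grad i) hs)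
      (integrable_mul_of_memLp (memLp_coord h'.memLp_grad i) hs), h.weak φ hφ i, h'.weak φ hφ i]
  ring

theorem smul (c : ℝ) (h : HasWeakGrad Ω u G) :
    HasWeakGrad Ω (fun x => c * u x) (fun x => c • G x) := by
  refine ⟨h.memLp.const_mul c, h.memLp_grad.const_smul c, fun φ hφ i => ?_⟩
  simp only [mul_assoc, PiLp.smul_apply, smul_eq_mul, integral_const_mul]
  rw [h.weak φ hφ i]
  ring

theorem sub (h : HasWeakGrad Ω u G) (h' : HasWeakGrad Ω v H) :
    HasWeakGrad Ω (fun x => u x - v x) (fun x => G x - H x) := by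
  have := h.add (h'.smul (-1))
  simpa only [neg_one_mul, neg_one_smul, ← sub_eq_add_neg, neg_smul, one_smul] using this

theorem zero : HasWeakGrad Ω (fun _ => 0) (fun _ => 0) :=
  ⟨MemLp.zero', MemLp.zero', fun φ hφ i => by simp⟩

theorem sum {ι : Type*} (s : Finset ι) {f : ι → Pt d → ℝ} {F : ι → Pt d → Pt d}
    (h : ∀ i ∈ s, HasWeakGrad Ω (f i) (F i)) :
    HasWeakGrad Ω (fun x => ∑ i ∈ s, f i x) (fun x => ∑ i ∈ s, F i x) := by
  classical
  induction s using Finset.induction_on with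
  | empty => simpa using zero
  | insert i s hi ih =>
    simp only [Finset.sum_insert hi]
    exact (h i (Finset.mem_insert_self i s)).add (ih fun j hj => h j (Finset.mem_insert_of_mem hj))

end HasWeakGrad

/-- Integration by parts on the simplex; the boundary terms vanish because test functions are
supported in the interior. -/
theorem IsSimplex.hasWeakGrad_pval {K : Finset (Pt d)} (hK : IsSimplex K) (hd : 1 ≤ d)
    (p : MPoly d) : HasWeakGrad (interior (hull K)) (pval p) (pgrad p) := by
  refine ⟨?_, ?_, fun φ hφ i => ?_⟩
  · rw [hK.ae_restrict_interior]; exact memLp_of_continuous (by fun_prop) _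
  · rw [hK.ae_restrict_interior]; exact memLp_of_continuous (by fun_prop) _
  · rw [hK.ae_restrict_interior]
    have hφ1 : ContDiff ℝ 1 φ := hφ.smooth.of_le (by exact_mod_cast le_top)
    have h1 := hK.integral_inner_gradient hd (hφ1.mul ((contDiff_pval p).of_le (by norm_num)))
      (EuclideanSpace.single i 1)
    have h2 : ∀ a ∈ K, ∫ x, φ x * pval p x ∂(surf (facet K a)) = 0 := by
      intro a ha
      refine integral_eq_zero_of_ae ?_
      filter_upwards [ae_surf_mem (facet K a)] with x hx
      have : x ∉ tsupport φ := fun hxt => by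
        have := hφ.support hxt
        rw [hK.interior_hull] at this
        exact (this a ha).ne' ((hK.mem_hull_facet_iff ha).1 hx).2
      rw [image_eq_zero_of_notMem_tsupport this]
      simp
    rw [Finset.sum_eq_zero fun a ha => by rw [h2 a ha, mul_zero]] at h1
    have h3 : ∀ x, ⟪∇ (fun y => φ y * pval p y) x, EuclideanSpace.single i (1 : ℝ)⟫ =
        pval p x * (∇ φ x) i + pgrad p x i * φ x := by
      intro x
      rw [gradient_mul (hφ1.differentiable (by norm_num) x)
        ((contDiff_pval p).differentiable (by simp) x), gradient_pval,
        EuclideanSpace.inner_single_right]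
      simp
      ring
    simp only [h3] at h1
    have hgc : Continuous fun x => (∇ φ x) i :=
      (EuclideanSpace.proj i : Pt d →L[ℝ] ℝ).continuous.comp hφ.continuous_grad
    have hpc : Continuous fun x => pgrad p x i :=
      (EuclideanSpace.proj i : Pt d →L[ℝ] ℝ).continuous.comp (continuous_pgrad p)
    have hφc := hφ.smooth.continuous
    have i1 : Integrable (fun x => pval p x * (∇ φ x) i) (volume.restrict (hull K)) :=
      integrable_of_continuous ((continuous_pval p).mul hgc)
    have i2 : Integrable (fun x => pgrad p x i * φ x) (volume.restrict (hull K)) :=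
      integrable_of_continuous (hpc.mul hφc)
    rw [integral_add i1 i2] at h1
    linarith

/-! ### Radial fields and tangential fields -/

theorem vval_radial (a : Pt d) (β : MPoly d) (x : Pt d) :
    vval (fun i => (MvPolynomial.X i - MvPolynomial.C (a i)) * β) x = pval β x • (x - a) := by
  ext i
  simp [mul_comm]

theorem pval_pdiv_radial (a : Pt d) (β : MPoly d) (x : Pt d) :
    pval (pdiv fun i => (MvPolynomial.X i - MvPolynomial.C (a i)) * β) x =
      d * pval β x + ⟪pgrad β x, x - a⟫ := by
  simp only [pdiv, pval_sum, Derivation.leibniz, map_sub, MvPolynomial.pderiv_C,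
    MvPolynomial.pderiv_X_self, sub_zero, smul_eq_mul, mul_one, pval_add, pval_mul, pval_sub, pval_X,
    pval_C, Finset.sum_add_distrib, PiLp.inner_apply, RCLike.inner_apply, RCLike.conj_to_real,
    pgrad_apply, PiLp.sub_apply, Finset.sum_const, Finset.card_univ, Fintype.card_fin, nsmul_eq_mul]
  rw [show pval ((d : ℕ) : MPoly d) x = d by simp [pval]]
  ring

theorem vval_add (P Q : Fin d → MPoly d) (x : Pt d) : vval (P + Q) x = vval P x + vval Q x := by
  ext i; simp

theorem vval_sub (P Q : Fin d → MPoly d) (x : Pt d) : vval (P - Q) x = vval P x - vval Q x := by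
  ext i; simp

theorem vval_sum {ι : Type*} (s : Finset ι) (P : ι → Fin d → MPoly d) (x : Pt d) :
    vval (∑ i ∈ s, P i) x = ∑ i ∈ s, vval (P i) x := by
  ext i
  rw [vval_apply, Finset.sum_apply, pval_sum, WithLp.ofLp_sum, Finset.sum_apply]
  rfl

theorem pdiv_add (P Q : Fin d → MPoly d) : pdiv (P + Q) = pdiv P + pdiv Q := by
  simp [pdiv, Finset.sum_add_distrib]

theorem pdiv_sub (P Q : Fin d → MPoly d) : pdiv (P - Q) = pdiv P - pdiv Q := by
  simp [pdiv, Finset.sum_sub_distrib]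

theorem pdiv_sum {ι : Type*} (s : Finset ι) (P : ι → Fin d → MPoly d) :
    pdiv (∑ i ∈ s, P i) = ∑ i ∈ s, pdiv (P i) := by
  simp only [pdiv, Finset.sum_apply, map_sum]
  exact Finset.sum_comm

/-- The derivative of `w` in the direction `a`. -/
def dirDeriv (a : Pt d) (w : MPoly d) : MPoly d := ∑ j, a j • MvPolynomial.pderiv j w

theorem pval_dirDeriv (a : Pt d) (w : MPoly d) (x : Pt d) :
    pval (dirDeriv a w) x = ⟪a, pgrad w x⟫ := by
  simp [dirDeriv, pval_sum, PiLp.inner_apply, mul_comm]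

/-- The field `-∑ λ_a (a · ∇w) (x - a)`, which is tangential on all facets. -/
def tangField (K : Finset (Pt d)) (w : MPoly d) : Fin d → MPoly d :=
  ∑ a ∈ K, fun i => (MvPolynomial.X i - MvPolynomial.C (a i)) * (-(bary K a * dirDeriv a w))

theorem vval_tangField (K : Finset (Pt d)) (w : MPoly d) (x : Pt d) : vval (tangField K w) x =
    ∑ a ∈ K, (pval (bary K a) x * ⟪a, pgrad w x⟫) • (a - x) := by
  rw [tangField, vval_sum]
  refine Finset.sum_congr rfl fun a _ => ?_
  rw [vval_radial, pval_neg, pval_mul, pval_dirDeriv, neg_smul, ← smul_neg, neg_sub]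

/-- In each summand the degree lost by differentiation pays for the barycentric coordinate. The case
`k = 0` is separate because `k - 1` is truncated there; then the derivative vanishes. -/
theorem isRT_tangField (K : Finset (Pt d)) {k : ℕ} {w : MPoly d} (hw : w.totalDegree ≤ k) :
    IsRT k (tangField K w) := by
  refine IsRT.sum _ fun a _ => IsRT.radial a ?_
  rw [MvPolynomial.totalDegree_neg]
  rcases Nat.eq_zero_or_pos k with rfl | hk
  · have : dirDeriv a w = 0 := by
      rw [MvPolynomial.totalDegree_eq_zero_iff_eq_C.1 (Nat.le_zero.1 hw)]
      simp [dirDeriv]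
    simp [this]
  · refine (MvPolynomial.totalDegree_mul _ _).trans ?_
    have h1 := totalDegree_bary_le K a
    have h2 : (dirDeriv a w).totalDegree ≤ k - 1 :=
      (MvPolynomial.totalDegree_finsetSum _ _).trans (Finset.sup_le fun j _ =>
        (MvPolynomial.totalDegree_smul_le _ _).trans ((totalDegree_pderiv_le w j).trans (by omega)))
    omega

namespace IsSimplex

variable {K : Finset (Pt d)} (hK : IsSimplex K)
include hK

/-- Every summand produces a factor `λ_c`: the one of `c` carries it explicitly, and for the others
`⟪bgrad K c, a - x⟫ = -λ_c(x)`. So the normal component vanishes on the facet opposite to `c`. -/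
theorem inner_bgrad_tangField {c : Pt d} (hc : c ∈ K) (w : MPoly d) (x : Pt d) :
    ⟪bgrad K c, vval (tangField K w) x⟫ = pval (bary K c) x * ⟪c - x, pgrad w x⟫ := by
  classical
  rw [vval_tangField, inner_sum]
  have h1 : ∀ a ∈ K, ⟪bgrad K c, (pval (bary K a) x * ⟪a, pgrad w x⟫) • (a - x)⟫ =
      (if a = c then pval (bary K c) x * ⟪c, pgrad w x⟫ else 0) -
        pval (bary K c) x * ⟪pval (bary K a) x • a, pgrad w x⟫ := by
    intro a ha
    rw [real_inner_smul_right, ← bary_sub, real_inner_smul_left]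
    split_ifs with h
    · rw [h, hK.bary_self hc]; ring
    · rw [hK.bary_of_ne hc ha h]; ring
  rw [Finset.sum_congr rfl h1, Finset.sum_sub_distrib, Finset.sum_ite_eq' K c, if_pos hc,
    ← Finset.mul_sum, ← sum_inner, hK.sum_bary_smul, inner_sub_left]
  ring

/-- Since `∑ λ_a (a - x) = 0`, the direction `a` of the derivative may be replaced by `a - x`. The
form with fixed directions shows that the field is Raviart-Thomas; this one shows its size and the
positivity of its product with `∇w`. -/
theorem vval_tangField_eq (w : MPoly d) (x : Pt d) : vval (tangField K w) x =
    ∑ a ∈ K, (pval (bary K a) x * ⟪a - x, pgrad w x⟫) • (a - x) := by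
  have h0 : ∑ a ∈ K, pval (bary K a) x • (a - x) = 0 := by
    simp only [smul_sub, Finset.sum_sub_distrib, ← Finset.sum_smul, hK.sum_bary, hK.sum_bary_smul,
      one_smul, sub_self]
  have h1 : ∀ a : Pt d, (pval (bary K a) x * ⟪a - x, pgrad w x⟫) • (a - x) =
      (pval (bary K a) x * ⟪a, pgrad w x⟫) • (a - x) -
        ⟪x, pgrad w x⟫ • (pval (bary K a) x • (a - x)) := fun a => by
    rw [inner_sub_left, smul_smul, ← sub_smul]
    congr 1
    ring
  rw [vval_tangField]
  simp only [h1, Finset.sum_sub_distrib, ← Finset.smul_sum, h0, smul_zero, sub_zero]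

theorem norm_tangField_le (w : MPoly d) {x : Pt d} (hx : x ∈ hull K) :
    ‖vval (tangField K w) x‖ ≤ diamK K ^ 2 * ‖pgrad w x‖ := by
  rw [hK.vval_tangField_eq]
  have hh := diamK_nonneg (K := K)
  calc _ ≤ ∑ a ∈ K, pval (bary K a) x * (diamK K ^ 2 * ‖pgrad w x‖) := by
        refine norm_sum_le_of_le _ fun a ha => ?_
        have h1 := norm_sub_le_diam (mem_hull_of_mem ha) hx
        have h2 := hK.bary_nonneg ha hx
        rw [norm_smul, norm_mul, Real.norm_of_nonneg h2, mul_assoc]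
        refine mul_le_mul_of_nonneg_left ?_ h2
        calc ‖⟪a - x, pgrad w x⟫‖ * ‖a - x‖ ≤ ‖a - x‖ * ‖pgrad w x‖ * ‖a - x‖ := by
              gcongr; exact norm_inner_le_norm _ _
          _ ≤ diamK K * ‖pgrad w x‖ * diamK K := by gcongr
          _ = _ := by ring
    _ = diamK K ^ 2 * ‖pgrad w x‖ := by rw [← Finset.sum_mul, hK.sum_bary, one_mul]

theorem inner_tangField_self (w : MPoly d) (x : Pt d) : ⟪vval (tangField K w) x, pgrad w x⟫ =
    ∑ a ∈ K, pval (bary K a) x * ⟪a - x, pgrad w x⟫ ^ 2 := by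
  rw [hK.vval_tangField_eq, sum_inner]
  refine Finset.sum_congr rfl fun a _ => ?_
  rw [real_inner_smul_left]; ring

/-- Where all coordinates are at least `m`, the form controls the derivative of `w` in every
direction `a - x`, hence along every edge `b - a`, hence by the width estimate the full gradient. -/
theorem sq_norm_le_inner_tangField {c : Pt d} {r : ℝ} (hr : 0 < r)
    (hb : Metric.closedBall c r ⊆ hull K) (w : MPoly d) {m : ℝ} (hm : 0 ≤ m) {x : Pt d}
    (hx : ∀ a ∈ K, m ≤ pval (bary K a) x) :
    m * (2 * r * ‖pgrad w x‖) ^ 2 ≤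
      4 * (d + 1) * ⟪vval (tangField K w) x, pgrad w x⟫ := by
  have h1 := hK.sq_width_le hr hb (pgrad w x)
  have h2 : ∑ a ∈ K, ∑ b ∈ K, ⟪pgrad w x, b - a⟫ ^ 2 ≤
      4 * (d + 1) * ∑ a ∈ K, ⟪a - x, pgrad w x⟫ ^ 2 := by
    calc _ ≤ ∑ a ∈ K, ∑ b ∈ K, (2 * ⟪b - x, pgrad w x⟫ ^ 2 + 2 * ⟪a - x, pgrad w x⟫ ^ 2) := by
          refine Finset.sum_le_sum fun a _ => Finset.sum_le_sum fun b _ => ?_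
          have : ⟪pgrad w x, b - a⟫ = ⟪b - x, pgrad w x⟫ - ⟪a - x, pgrad w x⟫ := by
            rw [← inner_sub_left, real_inner_comm]; congr 1; abel
          rw [this]
          nlinarith [sq_nonneg (⟪b - x, pgrad w x⟫ + ⟪a - x, pgrad w x⟫)]
      _ = _ := by
          simp only [Finset.sum_add_distrib, Finset.sum_const, hK.card, nsmul_eq_mul,
            ← Finset.mul_sum]
          push_cast; ring
  rw [hK.inner_tangField_self]
  calc m * (2 * r * ‖pgrad w x‖) ^ 2 ≤ m * (4 * (d + 1) * ∑ a ∈ K, ⟪a - x, pgrad w x⟫ ^ 2) := by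
        have := h1.trans h2; gcongr
    _ = 4 * (d + 1) * ∑ a ∈ K, m * ⟪a - x, pgrad w x⟫ ^ 2 := by rw [← Finset.mul_sum]; ring
    _ ≤ _ := by
        gcongr with a ha
        exact hx a ha

end IsSimplex

/-- Coercivity of the form defined by the tangential fields. -/
theorem exists_tangField_coercive (d k : ℕ) : ∃ C : ℝ, 0 ≤ C ∧ ∀ (K : Finset (Pt d)),
    IsSimplex K → ∀ (c : Pt d) (r : ℝ), 0 < r → Metric.closedBall c r ⊆ hull K →
    ∀ w : MPoly d, w.totalDegree ≤ k → r ^ 2 * l2 (volume.restrict (hull K)) (pgrad w) ^ 2 ≤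
      C * ∫ x in hull K, ⟪vval (tangField K w) x, pgrad w x⟫ := by
  obtain ⟨L, t, ht, hext⟩ := exists_extrapolation (d := d) k
  refine ⟨(∑ j, L j ^ 2) * ((k + 1) * (2 ^ d * (4 * (d + 1) ^ 2))), by positivity,
    fun K hK c r hr hb w hw => ?_⟩
  have hcard : (0 : ℝ) < d + 1 := by positivity
  -- The form degenerates at the boundary. So the gradient is estimated at the points `z + t j • (x
  -- - z)`, with `z` the barycenter and `t j ≤ 3/4`, where all coordinates are at least `1 / (4 (d +
  -- 1))`. From there it is extrapolated to `x`; the contraction estimate with `t j ≥ 1/2` finally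
  -- returns to an integral over the simplex.
  obtain ⟨z, hz⟩ : ∃ z : Pt d, ∀ a ∈ K, pval (bary K a) z = ((d : ℝ) + 1)⁻¹ := by
    refine ⟨∑ b ∈ K, ((d : ℝ) + 1)⁻¹ • b, fun a ha => ?_⟩
    rw [hK.bary_combination_eq ha (t := fun _ => ((d : ℝ) + 1)⁻¹)]
    rw [Finset.sum_const, hK.card, nsmul_eq_mul]
    push_cast
    field_simp
  have hzK : z ∈ hull K := hK.mem_hull_iff.2 fun a ha => by rw [hz a ha]; positivity
  have hWc : Continuous fun x => |⟪vval (tangField K w) x, pgrad w x⟫| := by fun_prop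
  have hpt : ∀ x ∈ hull K, ∀ j, r ^ 2 * ‖pgrad w (z + t j • (x - z))‖ ^ 2 ≤
      4 * (d + 1) ^ 2 * |⟪vval (tangField K w) (z + t j • (x - z)), pgrad w (z + t j • (x - z))⟫| := by
    intro x hx j
    have hm : ∀ a ∈ K, (4 * ((d : ℝ) + 1))⁻¹ ≤ pval (bary K a) (z + t j • (x - z)) := by
      intro a ha
      have e : pval (bary K a) (z + t j • (x - z)) =
          (1 - t j) * pval (bary K a) z + t j * pval (bary K a) x := by
        simp only [pval_bary, inner_add_right, inner_smul_right, inner_sub_right]; ring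
      rw [e, hz a ha, mul_inv]
      have h1 := mul_nonneg (by linarith [(ht j).1] : 0 ≤ t j) (hK.bary_nonneg ha hx)
      have h2 : (4 : ℝ)⁻¹ ≤ 1 - t j := by linarith [(ht j).2]
      have h3 := mul_le_mul_of_nonneg_right h2 (inv_nonneg.2 hcard.le)
      linarith
    have := (hK.sq_norm_le_inner_tangField hr hb w (by positivity) hm).trans
      (mul_le_mul_of_nonneg_left (le_abs_self _) (by positivity))
    rw [inv_mul_le_iff₀ (by positivity)] at this
    nlinarith
  have hpg : ∀ x, pgrad w x = ∑ j, L j • pgrad w (z + t j • (x - z)) := by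
    intro x
    ext i
    rw [pgrad_apply, hext _ ((totalDegree_pderiv_le w i).trans (by omega)) z x]
    simp [pgrad_apply]
  have hsq : ∀ x ∈ hull K, r ^ 2 * ‖pgrad w x‖ ^ 2 ≤ (∑ j, L j ^ 2) * ∑ j, 4 * (d + 1) ^ 2 *
      |⟪vval (tangField K w) (z + t j • (x - z)), pgrad w (z + t j • (x - z))⟫| := by
    intro x hx
    have h1 : ‖pgrad w x‖ ≤ ∑ j, |L j| * ‖pgrad w (z + t j • (x - z))‖ := by
      conv_lhs => rw [hpg x]
      exact norm_sum_le_of_le _ fun j _ => by rw [norm_smul, Real.norm_eq_abs]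
    have h2 := Finset.sum_mul_sq_le_sq_mul_sq Finset.univ (fun j => |L j|)
      (fun j => ‖pgrad w (z + t j • (x - z))‖)
    simp only [sq_abs] at h2
    calc r ^ 2 * ‖pgrad w x‖ ^ 2
        ≤ r ^ 2 * ((∑ j, L j ^ 2) * ∑ j, ‖pgrad w (z + t j • (x - z))‖ ^ 2) := by
          have := (pow_le_pow_left₀ (norm_nonneg _) h1 2).trans h2
          gcongr
      _ = (∑ j, L j ^ 2) * ∑ j, r ^ 2 * ‖pgrad w (z + t j • (x - z))‖ ^ 2 := by
          rw [← Finset.mul_sum]; ring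
      _ ≤ _ := mul_le_mul_of_nonneg_left (Finset.sum_le_sum fun j _ => hpt x hx j)
          (Finset.sum_nonneg fun _ _ => sq_nonneg _)
  have hint : ∀ j, Integrable (fun x => 4 * ((d : ℝ) + 1) ^ 2 *
      |⟪vval (tangField K w) (z + t j • (x - z)), pgrad w (z + t j • (x - z))⟫|)
      (volume.restrict (hull K)) := fun j =>
    IsSimplex.integrable_of_continuous (continuous_const.mul
      (hWc.comp (by fun_prop : Continuous fun x : Pt d => z + t j • (x - z))))
  have hnn : ∀ x ∈ hull K, 0 ≤ ⟪vval (tangField K w) x, pgrad w x⟫ := fun x hx => by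
    rw [hK.inner_tangField_self]
    exact Finset.sum_nonneg fun a ha => mul_nonneg (hK.bary_nonneg ha hx) (sq_nonneg _)
  calc r ^ 2 * l2 (volume.restrict (hull K)) (pgrad w) ^ 2
      = ∫ x in hull K, r ^ 2 * ‖pgrad w x‖ ^ 2 := by rw [l2_sq, integral_const_mul]
    _ ≤ ∫ x in hull K, (∑ j, L j ^ 2) * ∑ j, 4 * (d + 1) ^ 2 *
      |⟪vval (tangField K w) (z + t j • (x - z)), pgrad w (z + t j • (x - z))⟫| :=
        setIntegral_mono_on (IsSimplex.integrable_of_continuous (by fun_prop))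
          (Integrable.const_mul (integrable_finsetSum Finset.univ fun j _ => hint j)
            (∑ j, L j ^ 2))
          IsSimplex.measurableSet_hull hsq
    _ = (∑ j, L j ^ 2) * ∑ j, 4 * (d + 1) ^ 2 * ∫ x in hull K,
      |⟪vval (tangField K w) (z + t j • (x - z)), pgrad w (z + t j • (x - z))⟫| := by
        rw [integral_const_mul, integral_finsetSum _ fun j _ => hint j]
        simp only [integral_const_mul]
    _ ≤ (∑ j, L j ^ 2) * ∑ j : Fin (k + 1), 4 * (d + 1) ^ 2 * (2 ^ d * ∫ x in hull K,
      |⟪vval (tangField K w) x, pgrad w x⟫|) := by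
        gcongr with j _
        exact integral_contract_le IsSimplex.isCompact_hull IsSimplex.convex_hull hWc
          (fun x => abs_nonneg _) hzK (ht j).1 ((ht j).2.trans (by norm_num))
    _ = _ := by
        rw [setIntegral_congr_fun IsSimplex.measurableSet_hull
          (fun x hx => abs_of_nonneg (hnn x hx)), Finset.sum_const, Finset.card_univ,
          Fintype.card_fin, nsmul_eq_mul]
        push_cast; ring

/-! ### The facet functionals -/

namespace IsSimplex

variable {K : Finset (Pt d)} (hK : IsSimplex K)
include hK

omit hK in
theorem integrable_coneInt (a : Pt d) {φ : Pt d → ℝ} {G : Pt d → Pt d}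
    (hφ : MemLp φ 2 (volume.restrict (hull K))) (hG : MemLp G 2 (volume.restrict (hull K)))
    (μ : MPoly d) : Integrable (fun x => φ x * (d * pval μ x + ⟪∇ (pval μ) x, x - a⟫) +
      ⟪G x, pval μ x • (x - a)⟫) (volume.restrict (hull K)) := by
  simp only [gradient_pval]
  exact (integrable_mul_of_memLp hφ (memLp_of_continuous (by fun_prop) _)).add
    (integrable_inner_of_memLp hG (memLp_of_continuous (by fun_prop) _))

omit hK in
theorem coneInt_add_left (a : Pt d) {φ ψ : Pt d → ℝ} {G H : Pt d → Pt d}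
    (hφ : MemLp φ 2 (volume.restrict (hull K))) (hG : MemLp G 2 (volume.restrict (hull K)))
    (hψ : MemLp ψ 2 (volume.restrict (hull K))) (hH : MemLp H 2 (volume.restrict (hull K)))
    (μ : MPoly d) : coneInt K a (fun x => φ x + ψ x) (fun x => G x + H x) (pval μ) =
      coneInt K a φ G (pval μ) + coneInt K a ψ H (pval μ) := by
  rw [coneInt, coneInt, coneInt, ← integral_add (integrable_coneInt a hφ hG μ)
    (integrable_coneInt a hψ hH μ)]
  refine integral_congr_ae (ae_of_all _ fun x => ?_)
  simp only [inner_add_left]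
  ring

omit hK in
theorem coneInt_neg_left (a : Pt d) (φ : Pt d → ℝ) (G : Pt d → Pt d) (m : Pt d → ℝ) :
    coneInt K a (fun x => -φ x) (fun x => -G x) m = -coneInt K a φ G m := by
  rw [coneInt, coneInt, ← integral_neg]
  refine integral_congr_ae (ae_of_all _ fun x => ?_)
  simp only [inner_neg_left]
  ring

omit hK in
theorem coneInt_add_right (a : Pt d) {φ : Pt d → ℝ} {G : Pt d → Pt d}
    (hφ : MemLp φ 2 (volume.restrict (hull K))) (hG : MemLp G 2 (volume.restrict (hull K)))
    (μ ν : MPoly d) : coneInt K a φ G (pval (μ + ν)) =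
      coneInt K a φ G (pval μ) + coneInt K a φ G (pval ν) := by
  rw [coneInt, coneInt, coneInt, ← integral_add (integrable_coneInt a hφ hG μ)
    (integrable_coneInt a hφ hG ν)]
  refine integral_congr_ae (ae_of_all _ fun x => ?_)
  simp only [gradient_pval, pgrad_add, pval_add, inner_add_left, add_smul, inner_add_right]
  ring

omit hK in
theorem coneInt_smul_right (a : Pt d) (φ : Pt d → ℝ) (G : Pt d → Pt d) (c : ℝ) (μ : MPoly d) :
    coneInt K a φ G (pval (c • μ)) = c * coneInt K a φ G (pval μ) := by
  rw [coneInt, coneInt, ← integral_const_mul]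
  refine integral_congr_ae (ae_of_all _ fun x => ?_)
  simp only [gradient_pval, pgrad_smul, pval_smul, real_inner_smul_left, real_inner_smul_right]
  ring

omit hK in
theorem coneInt_of_isHomAt {a : Pt d} {k : ℕ} {μ : MPoly d} (hμ : IsHomAt a k μ) (φ : Pt d → ℝ)
    (G : Pt d → Pt d) : coneInt K a φ G (pval μ) =
      ∫ x in hull K, ((d + k) * (φ x * pval μ x) + ⟪G x, pval μ x • (x - a)⟫) := by
  rw [coneInt]
  refine integral_congr_ae (ae_of_all _ fun x => ?_)
  simp only [gradient_pval, hμ x]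
  ring

-- By Euler's relation all derivatives become multiples of the functions, so on polynomials
-- homogeneous about `a` the facet functional is a multiple of the `L²` inner product of the
-- simplex.
omit hK in
theorem coneInt_isHomAt_isHomAt {a : Pt d} {k l : ℕ} {β μ : MPoly d} (hβ : IsHomAt a l β)
    (hμ : IsHomAt a k μ) : coneInt K a (pval β) (pgrad β) (pval μ) =
      (d + k + l) * ∫ x in hull K, pval β x * pval μ x := by
  rw [coneInt_of_isHomAt hμ, ← integral_const_mul]
  refine integral_congr_ae (ae_of_all _ fun x => ?_)
  simp only [real_inner_smul_right, hβ x]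
  ring

theorem coneInt_pval (hd : 1 ≤ d) {a : Pt d} (ha : a ∈ K) (β μ : MPoly d) :
    ‖bgrad K a‖ * coneInt K a (pval β) (pgrad β) (pval μ) =
      ∫ x, pval β x * pval μ x ∂(surf (facet K a)) := by
  have := hK.coneInt_smooth hd ha ((contDiff_pval β).of_le (by norm_num))
    ((contDiff_pval μ).of_le (by norm_num))
  rw [← this, show ∇ (pval β) = pgrad β from funext (gradient_pval β)]

/-- The facet functional does not see functions that vanish on the facet. -/
theorem coneInt_bary_mul {Ω : Set (Pt d)} (hΩ : IsOpen Ω) (hKΩ : interior (hull K) ⊆ Ω)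
    {φ : Pt d → ℝ} {G : Pt d → Pt d} (h : HasWeakGrad Ω φ G) {a : Pt d} (ha : a ∈ K)
    (ν : MPoly d) : coneInt K a φ G (pval (bary K a * ν)) = 0 := by
  obtain ⟨M, hM⟩ := (isCompact_hull (K := K)).exists_bound_of_continuousOn
    (continuous_pval ν).continuousOn
  have hM0 : 0 ≤ M := (norm_nonneg _).trans (hM a (mem_hull_of_mem ha))
  -- The field `(x - a) λ_a ν` is tangential on all facets: on those through `a` because it is
  -- radial, on the opposite one because of the factor `λ_a`.
  have := hK.integral_green_tangential hΩ h hKΩ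
    (P := fun i => (MvPolynomial.X i - MvPolynomial.C (a i)) * (bary K a * ν)) hM0 (by
      intro x hx b hb
      have h1 := hM x hx
      rw [Real.norm_eq_abs] at h1
      have h2 := hK.bary_nonneg ha hx
      have h3 := hK.bary_le_one ha hx
      have h4 := hK.bary_nonneg hb hx
      rw [vval_radial, real_inner_smul_right, ← bary_sub, pval_mul, abs_mul, abs_mul,
        abs_of_nonneg h2]
      by_cases hba : b = a
      · have h5 : |pval ν x| * (1 - pval (bary K a) x) ≤ M :=
          (mul_le_of_le_one_right (abs_nonneg _) (by linarith)).trans h1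
        rw [hba, hK.bary_self ha,
          abs_of_nonpos (show pval (bary K a) x - 1 ≤ 0 by linarith)]
        have h6 := mul_le_mul_of_nonneg_left h5 h2
        linarith
      · have h5 : pval (bary K a) x * |pval ν x| ≤ M :=
          (mul_le_of_le_one_left (abs_nonneg _) h3).trans h1
        rw [hK.bary_of_ne hb ha (Ne.symm hba), sub_zero, abs_of_nonneg h4]
        exact mul_le_mul_of_nonneg_right h5 h4)
  rw [coneInt, ← this]
  refine integral_congr_ae (ae_of_all _ fun x => ?_)
  simp only [gradient_pval, pval_pdiv_radial, vval_radial]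

/-- Among the polynomials that are homogeneous about a vertex, one represents the trace functional
on the opposite facet. -/
theorem exists_facet_representative (hd : 1 ≤ d) {a : Pt d} (ha : a ∈ K) (k : ℕ)
    {φ : Pt d → ℝ} {G : Pt d → Pt d} (hφ : MemLp φ 2 (volume.restrict (hull K)))
    (hG : MemLp G 2 (volume.restrict (hull K))) :
    ∃ β : MPoly d, β.totalDegree ≤ k ∧ IsHomAt a k β ∧
      (∀ μ : MPoly d, μ.totalDegree ≤ k → IsHomAt a k μ →
        coneInt K a (pval β) (pgrad β) (pval μ) = coneInt K a φ G (pval μ)) ∧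
      l2 (volume.restrict (hull K)) (pval β) ≤ l2 (volume.restrict (hull K)) φ +
        diamK K * l2 (volume.restrict (hull K)) G := by
  have hi : ∀ p q : MPoly d, Integrable (fun x => pval p x * pval q x) (volume.restrict (hull K)) :=
    fun p q => integrable_of_continuous (by fun_prop)
  have hdp : (1 : ℝ) ≤ d := by exact_mod_cast hd
  have hk0 : (0 : ℝ) ≤ k := Nat.cast_nonneg k
  -- `D` is the ratio between the facet functional and the `L²` inner product for two polynomials
  -- homogeneous of degree `k` about `a`. The representative therefore solves a definite problem in
  -- `L²(K)`.
  obtain ⟨D, hD⟩ : ∃ D : ℝ, D = d + k + k := ⟨_, rfl⟩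
  have hD0 : 0 < D := by linarith
  let V : Submodule ℝ (MPoly d) := MvPolynomial.restrictTotalDegree (Fin d) ℝ k ⊓
    { carrier := {β | IsHomAt a k β}
      add_mem' := fun h h' => IsHomAt.add h h'
      zero_mem' := IsHomAt.zero
      smul_mem' := fun c _ h => IsHomAt.smul c h }
  have hV : ∀ β, β ∈ V ↔ β.totalDegree ≤ k ∧ IsHomAt a k β := fun β => by
    rw [Submodule.mem_inf, MvPolynomial.mem_restrictTotalDegree]; rfl
  have : FiniteDimensional ℝ V := Submodule.finiteDimensional_of_le inf_le_left
  obtain ⟨β, ⟨hβV, hβ⟩, -⟩ := exists_unique_on_submodule V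
    (fun p q => ∫ x in hull K, pval p x * pval q x)
    (fun p q v => by simp only [pval_add, add_mul]; exact integral_add (hi _ _) (hi _ _))
    (fun c p v => by simp only [pval_smul, mul_assoc]; exact integral_const_mul _ _)
    (fun p q v => by simp only [pval_add, mul_add]; exact integral_add (hi _ _) (hi _ _))
    (fun c p v => by simp only [pval_smul, mul_left_comm]; exact integral_const_mul _ _)
    (fun v _ hv => hK.poly_eq_zero_of_l2 hv)
    { toFun := fun μ => D⁻¹ * coneInt K a φ G (pval μ)
      map_add' := fun p q => by rw [coneInt_add_right a hφ hG, mul_add]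
      map_smul' := fun c p => by
        rw [coneInt_smul_right, RingHom.id_apply, smul_eq_mul, mul_left_comm] }
  simp only [LinearMap.coe_mk, AddHom.coe_mk] at hβ
  have hrep : ∀ μ : MPoly d, μ.totalDegree ≤ k → IsHomAt a k μ →
      coneInt K a (pval β) (pgrad β) (pval μ) = coneInt K a φ G (pval μ) := by
    intro μ hμ hμh
    rw [coneInt_isHomAt_isHomAt ((hV β).1 hβV).2 hμh, hβ μ ((hV μ).2 ⟨hμ, hμh⟩), ← hD,
      mul_inv_cancel_left₀ hD0.ne']
  refine ⟨β, ((hV β).1 hβV).1, ((hV β).1 hβV).2, hrep, ?_⟩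
  obtain ⟨hβd, hβh⟩ := (hV β).1 hβV
  -- Testing with `β` itself gives `D ‖β‖²` on the left. The coefficients `d + k` and `1` on the
  -- right are at most `D`, so the final bound is free of constants.
  have e := hrep β hβd hβh
  have hβm : MemLp (pval β) 2 (volume.restrict (hull K)) := memLp_of_continuous (by fun_prop) _
  have hbx : MemLp (fun x => pval β x • (x - a)) 2 (volume.restrict (hull K)) :=
    memLp_of_continuous (by fun_prop) _
  have hh := diamK_nonneg (K := K)
  rw [coneInt_isHomAt_isHomAt hβh hβh, coneInt_of_isHomAt hβh, integral_add
    ((integrable_mul_of_memLp hφ hβm).const_mul _) (integrable_inner_of_memLp hG hbx),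
    integral_const_mul, ← hD] at e
  have n1 := (le_abs_self _).trans (abs_integral_mul_le hφ hβm)
  have n2 := (le_abs_self _).trans (abs_integral_inner_le hG hbx)
  have n3 : l2 (volume.restrict (hull K)) (fun x => pval β x • (x - a)) ≤
      diamK K * l2 (volume.restrict (hull K)) (pval β) := by
    refine l2_mono hβm hh ?_
    filter_upwards [ae_restrict_mem measurableSet_hull] with x hx
    rw [norm_smul, mul_comm]
    have := norm_sub_le_diam hx (mem_hull_of_mem ha)
    gcongr
  have n4 : ∫ x in hull K, pval β x * pval β x = l2 (volume.restrict (hull K)) (pval β) ^ 2 := by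
    rw [l2_sq]; simp only [Real.norm_eq_abs, sq_abs]; simp only [sq]
  rw [n4] at e
  have p1 := l2_nonneg (μ := volume.restrict (hull K)) φ
  have p2 := l2_nonneg (μ := volume.restrict (hull K)) G
  have p3 := l2_nonneg (μ := volume.restrict (hull K)) (pval β)
  obtain ⟨B, hB⟩ : ∃ B, B = l2 (volume.restrict (hull K)) (pval β) := ⟨_, rfl⟩
  rw [← hB] at e n1 n3 p3 ⊢
  rcases p3.eq_or_lt with h0 | h0
  · rw [← h0]; positivity
  · refine le_of_mul_le_mul_left ?_ (mul_pos hD0 h0)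
    have q1 : ∫ x in hull K, ⟪G x, pval β x • (x - a)⟫ ≤
        l2 (volume.restrict (hull K)) G * (diamK K * B) :=
      n2.trans (mul_le_mul_of_nonneg_left n3 p2)
    have q2 : (d + k : ℝ) * ∫ x in hull K, φ x * pval β x ≤
        D * (l2 (volume.restrict (hull K)) φ * B) := by
      refine (mul_le_mul_of_nonneg_left n1 (by positivity)).trans ?_
      refine mul_le_mul_of_nonneg_right (by linarith) (by positivity)
    have q3 : l2 (volume.restrict (hull K)) G * (diamK K * B) ≤
        D * (l2 (volume.restrict (hull K)) G * (diamK K * B)) :=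
      le_mul_of_one_le_left (by positivity) (by linarith)
    nlinarith

end IsSimplex

/-! ### Components of vector fields in `H¹` -/

theorem HasWeakGrad.inner_const {Ω : Set (Pt d)} {E : Pt d → Pt d} {H : Fin d → Pt d → Pt d}
    (h : ∀ j, HasWeakGrad Ω (fun x => E x j) (H j)) (v : Pt d) :
    HasWeakGrad Ω (fun x => ⟪E x, v⟫) (fun x => ∑ j, v j • H j x) := by
  have := HasWeakGrad.sum Finset.univ fun j _ => (h j).smul (v j)
  simpa [PiLp.inner_apply] using this

theorem memLp_of_coord {α : Type*} [MeasurableSpace α] {μ : Measure α} {G : α → Pt d} {p : ENNReal}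
    (h : ∀ i, MemLp (fun x => G x i) p μ) : MemLp G p μ := by
  have h1 : MemLp (fun x => ∑ i, G x i • EuclideanSpace.single i (1 : ℝ)) p μ := by
    refine memLp_finsetSum _ fun i _ => ?_
    exact ((ContinuousLinearMap.toSpanSingleton ℝ (EuclideanSpace.single i (1 : ℝ) : Pt d))).comp_memLp'
      (h i)
  refine h1.ae_eq (ae_of_all _ fun x => ?_)
  have := (EuclideanSpace.basisFun (Fin d) ℝ).sum_repr (G x)
  simpa using this

theorem l2_sum_smul_le {α : Type*} [MeasurableSpace α] {μ : Measure α} {H : Fin d → α → Pt d}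
    (hH : ∀ j, MemLp (H j) 2 μ) (v : Pt d) :
    l2 μ (fun x => ∑ j, v j • H j x) ≤ ‖v‖ * ∑ j, l2 μ (H j) := by
  refine (l2_sum_le Finset.univ fun j _ => (hH j).const_smul (v j)).trans ?_
  rw [Finset.mul_sum]
  refine Finset.sum_le_sum fun j _ => ?_
  refine (l2_const_smul (v j) (H j)).trans_le ?_
  have : |v j| ≤ ‖v‖ := by simpa using PiLp.norm_apply_le v j
  exact mul_le_mul_of_nonneg_right this (l2_nonneg _)

theorem l2_inner_le {α : Type*} [MeasurableSpace α] {μ : Measure α} {E : α → Pt d}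
    (hE : MemLp E 2 μ) (v : Pt d) : l2 μ (fun x => ⟪E x, v⟫) ≤ ‖v‖ * l2 μ E :=
  l2_mono hE (norm_nonneg v) (ae_of_all _ fun _ =>
    (norm_inner_le_norm _ _).trans_eq (mul_comm _ _))

namespace IsSimplex

variable {K : Finset (Pt d)} (hK : IsSimplex K)
include hK

/-- The divergence theorem for fields in `H¹`, expressed by the facet functionals. -/
theorem sum_coneInt_eq (hd : 1 ≤ d) {E : Pt d → Pt d} {H : Fin d → Pt d → Pt d}
    (h : ∀ j, HasWeakGrad (interior (hull K)) (fun x => E x j) (H j)) (k : ℕ) :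
    ∑ a ∈ K, ‖bgrad K a‖ * coneInt K a (fun x => ⟪E x, normal K a⟫)
      (fun x => ∑ j, normal K a j • H j x) (pval ((1 - bary K a) ^ k)) =
      ∫ x in hull K, ∑ j, H j x j := by
  have hEm : MemLp E 2 (volume.restrict (hull K)) :=
    memLp_of_coord fun j => by rw [← hK.ae_restrict_interior]; exact (h j).memLp
  have hHm : ∀ j, MemLp (H j) 2 (volume.restrict (hull K)) :=
    fun j => by rw [← hK.ae_restrict_interior]; exact (h j).memLp_grad
  have hfin := hK.isFiniteMeasure
  -- By the geometric sum, `(1 - λ_a) ^ k` differs from `1` by a multiple of `λ_a`, which the facet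
  -- functional does not see.
  have h1 : ∀ a ∈ K, coneInt K a (fun x => ⟪E x, normal K a⟫)
      (fun x => ∑ j, normal K a j • H j x) (pval ((1 - bary K a) ^ k)) =
      coneInt K a (fun x => ⟪E x, normal K a⟫) (fun x => ∑ j, normal K a j • H j x) (pval 1) := by
    intro a ha
    have hw := HasWeakGrad.inner_const h (normal K a)
    have e : (1 - bary K a) ^ k = 1 + bary K a * (-∑ i ∈ Finset.range k, (1 - bary K a) ^ i) := by
      have := mul_neg_geom_sum (1 - bary K a) k
      rw [sub_sub_cancel] at this
      rw [mul_neg, this]; ring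
    rw [e, coneInt_add_right a (by rw [← hK.ae_restrict_interior]; exact hw.memLp)
      (by rw [← hK.ae_restrict_interior]; exact hw.memLp_grad),
      hK.coneInt_bary_mul isOpen_interior subset_rfl hw ha, add_zero]
  have hint : ∀ a ∈ K, Integrable (fun x => ‖bgrad K a‖ * (d * ⟪E x, normal K a⟫ +
      ∑ j, normal K a j * ⟪H j x, x - a⟫)) (volume.restrict (hull K)) := by
    intro a ha
    refine Integrable.const_mul (Integrable.add ?_ (integrable_finsetSum _ fun j _ => ?_)) _
    · exact (integrable_inner_of_memLp hEm (memLp_const _)).const_mul _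
    · exact (integrable_inner_of_memLp (hHm j) (memLp_of_continuous (by fun_prop) _)).const_mul _
  have h2 : ∀ a ∈ K, ‖bgrad K a‖ * coneInt K a (fun x => ⟪E x, normal K a⟫)
      (fun x => ∑ j, normal K a j • H j x) (pval ((1 - bary K a) ^ k)) =
      ∫ x in hull K, ‖bgrad K a‖ * (d * ⟪E x, normal K a⟫ +
        ∑ j, normal K a j * ⟪H j x, x - a⟫) := by
    intro a ha
    rw [h1 a ha, coneInt, ← integral_const_mul]
    refine integral_congr_ae (ae_of_all _ fun x => ?_)
    have h0 : pgrad (1 : MPoly d) x = 0 := by simpa using pgrad_C (1 : ℝ) x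
    simp only [gradient_pval, h0, pval_one, inner_zero_left, one_smul, sum_inner,
      real_inner_smul_left, add_zero, mul_one]
    ring
  rw [Finset.sum_congr rfl h2, ← integral_finsetSum _ hint]
  refine integral_congr_ae (ae_of_all _ fun x => ?_)
  -- With `‖bgrad K a‖ n_a = -bgrad K a`, the identities `∑ bgrad K a = 0` and `∑ bgrad K a j • a =
  -- e_j` cancel all terms but the diagonal derivatives.
  have hb : ∀ a ∈ K, ‖bgrad K a‖ * (d * ⟪E x, normal K a⟫ +
      ∑ j, normal K a j * ⟪H j x, x - a⟫) = -(d * ⟪E x, bgrad K a⟫) -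
        ∑ j, (⟪H j x, x⟫ * bgrad K a j - ⟪H j x, bgrad K a j • a⟫) := by
    intro a ha
    have e1 : bgrad K a = -(‖bgrad K a‖ • normal K a) := hK.bgrad_eq hd ha
    obtain ⟨c, hc⟩ : ∃ c, c = ‖bgrad K a‖ := ⟨_, rfl⟩
    rw [← hc] at e1 ⊢
    rw [e1]
    simp only [inner_neg_right, real_inner_smul_right, inner_sub_right, PiLp.neg_apply,
      PiLp.smul_apply, smul_eq_mul, neg_smul, mul_add, Finset.mul_sum, mul_neg, sub_neg_eq_add]
    rw [sub_eq_add_neg, ← Finset.sum_neg_distrib]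
    congr 1
    · ring
    · refine Finset.sum_congr rfl fun j _ => by ring
  simp only
  rw [Finset.sum_congr rfl hb, Finset.sum_sub_distrib, Finset.sum_neg_distrib, ← Finset.mul_sum,
    ← inner_sum, hK.sum_bgrad, inner_zero_right, mul_zero, neg_zero, zero_sub, Finset.sum_comm,
    ← Finset.sum_neg_distrib]
  refine Finset.sum_congr rfl fun j _ => ?_
  have e2 : ∑ a ∈ K, bgrad K a j = 0 := by
    have := congrArg (fun v : Pt d => v j) hK.sum_bgrad
    simpa using this
  have e3 : ∑ a ∈ K, bgrad K a j • a = EuclideanSpace.single j (1 : ℝ) := by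
    have := hK.sum_inner_bgrad_smul (EuclideanSpace.single j (1 : ℝ))
    simpa [EuclideanSpace.inner_single_right] using this
  rw [Finset.sum_sub_distrib, ← Finset.mul_sum, e2, ← inner_sum, e3,
    EuclideanSpace.inner_single_right]
  simp

end IsSimplex

/-! ### Interpolation by Raviart-Thomas fields -/

namespace IsSimplex

variable {K : Finset (Pt d)} (hK : IsSimplex K)
include hK

theorem poly_eq_of_moments {k : ℕ} {p q : MPoly d} (hp : p.totalDegree ≤ k) (hq : q.totalDegree ≤ k)
    (h : ∀ v : MPoly d, v.totalDegree ≤ k →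
      ∫ x in hull K, pval p x * pval v x = ∫ x in hull K, pval q x * pval v x) : p = q := by
  rw [← sub_eq_zero]
  refine hK.poly_eq_zero_of_l2 ?_
  have := h (p - q) ((MvPolynomial.totalDegree_sub _ _).trans (max_le hp hq))
  rw [← sub_eq_zero, ← integral_sub (integrable_of_continuous (by fun_prop))
    (integrable_of_continuous (by fun_prop))] at this
  rw [← this]
  refine integral_congr_ae (ae_of_all _ fun x => ?_)
  simp only [pval_sub]; ring

omit hK in
theorem coneInt_one {a : Pt d} {k : ℕ} {β : MPoly d} (hβ : IsHomAt a k β) :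
    coneInt K a (pval β) (pgrad β) (pval 1) = (d + k) * ∫ x in hull K, pval β x := by
  rw [coneInt, ← integral_const_mul]
  refine integral_congr_ae (ae_of_all _ fun x => ?_)
  have h0 : pgrad (1 : MPoly d) x = 0 := by simpa using pgrad_C (1 : ℝ) x
  simp only [gradient_pval, h0, pval_one, inner_zero_left, one_smul, hβ x]
  ring

/-- The integral of the divergence of a tangential field against a polynomial. -/
theorem integral_pdiv_tangField (hd : 1 ≤ d) (w v : MPoly d) :
    ∫ x in hull K, pval (pdiv (tangField K w)) x * pval v x =
      -∫ x in hull K, ⟪vval (tangField K w) x, pgrad v x⟫ := by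
  have h := hK.integral_divergence hd ((contDiff_pval v).of_le (by norm_num)) (tangField K w)
  have h0 : bdryInt K (fun a x => ⟪vval (tangField K w) x, normal K a⟫ * pval v x) = 0 := by
    refine Finset.sum_eq_zero fun a ha => integral_eq_zero_of_ae ?_
    filter_upwards [ae_surf_mem (facet K a)] with x hx
    have h1 := hK.inner_bgrad_tangField ha w x
    rw [((hK.mem_hull_facet_iff ha).1 hx).2, zero_mul] at h1
    rw [hK.normal_eq hd ha, inner_neg_right, real_inner_smul_right, real_inner_comm, h1]
    simp
  rw [h0] at h
  simp only [gradient_pval] at h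
  simp only [mul_comm (pval (pdiv (tangField K w)) _)]
  linarith

/-- A tangential Raviart-Thomas field with prescribed divergence. -/
theorem exists_tangential_correction (hd : 1 ≤ d) (k : ℕ) {C : ℝ} (hC : 0 ≤ C) {r γ : ℝ}
    (hr : 0 < r) (hγ : diamK K ≤ γ * (2 * r))
    (hcoer : ∀ w : MPoly d, w.totalDegree ≤ k →
      r ^ 2 * l2 (volume.restrict (hull K)) (pgrad w) ^ 2 ≤
        C * ∫ x in hull K, ⟪vval (tangField K w) x, pgrad w x⟫)
    {g : MPoly d} (hg : g.totalDegree ≤ k) (hg0 : ∫ x in hull K, pval g x = 0) :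
    ∃ w : MPoly d, w.totalDegree ≤ k ∧ pdiv (tangField K w) = g ∧
      l2 (volume.restrict (hull K)) (vval (tangField K w)) ≤
        4 * γ ^ 2 * C * 2 ^ d * (diamK K * l2 (volume.restrict (hull K)) (pval g)) := by
  have hpm : ∀ q : MPoly d, MemLp (pval q) 2 (volume.restrict (hull K)) :=
    fun q => memLp_of_continuous (by fun_prop) _
  have hpv : ∀ w : MPoly d, MemLp (vval (tangField K w)) 2 (volume.restrict (hull K)) :=
    fun q => memLp_of_continuous (by fun_prop) _
  have hfin := hK.isFiniteMeasure
  have hh := diamK_nonneg (K := K)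
  have hi : ∀ p q : MPoly d, Integrable (fun x => ⟪vval (tangField K p) x, pgrad q x⟫)
      (volume.restrict (hull K)) := fun p q => integrable_of_continuous (by fun_prop)
  have hig : ∀ v : MPoly d, Integrable (fun x => pval g x * pval v x) (volume.restrict (hull K)) :=
    fun v => integrable_mul_of_memLp (hpm g) (hpm v)
  have hint : ∀ p : MPoly d, Integrable (pval p) (volume.restrict (hull K)) :=
    fun p => integrable_of_continuous (by fun_prop)
  obtain ⟨M, hM⟩ : ∃ M : MPoly d →ₗ[ℝ] ℝ, ∀ p, M p = ∫ x in hull K, pval p x :=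
    ⟨{ toFun := fun p => ∫ x in hull K, pval p x
       map_add' := fun p q => by
        simp only [pval_add]
        exact integral_add (hint p) (hint q)
       map_smul' := fun c p => by simp only [pval_smul]; exact integral_const_mul _ _ },
      fun p => rfl⟩
  have hmem : ∀ p : MPoly d, p ∈ MvPolynomial.restrictTotalDegree (Fin d) ℝ k ⊓ LinearMap.ker M ↔
      p.totalDegree ≤ k ∧ ∫ x in hull K, pval p x = 0 := fun p => by
    rw [Submodule.mem_inf, MvPolynomial.mem_restrictTotalDegree, LinearMap.mem_ker, hM]
  have : FiniteDimensional ℝ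
      (MvPolynomial.restrictTotalDegree (Fin d) ℝ k ⊓ LinearMap.ker M : Submodule ℝ (MPoly d)) :=
    Submodule.finiteDimensional_of_le inf_le_left
  have hadd : ∀ p q x, vval (tangField K (p + q)) x =
      vval (tangField K p) x + vval (tangField K q) x := fun p q x => by
    simp only [vval_tangField, pgrad_add, inner_add_right, mul_add, add_smul, Finset.sum_add_distrib]
  have hsmul : ∀ (s : ℝ) p x, vval (tangField K (s • p)) x = s • vval (tangField K p) x :=
    fun s p x => by
      simp only [vval_tangField, pgrad_smul, real_inner_smul_right, Finset.smul_sum, smul_smul,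
        mul_left_comm]
  -- For a tangential field Green's formula has no boundary term, so the field has divergence `g`
  -- when tested with mean-free polynomials if `w` solves this variational problem. Against
  -- constants both the divergence and `g` integrate to zero.
  obtain ⟨w, ⟨hwV, hw⟩, -⟩ := exists_unique_on_submodule
    (MvPolynomial.restrictTotalDegree (Fin d) ℝ k ⊓ LinearMap.ker M)
    (fun p q => ∫ x in hull K, ⟪vval (tangField K p) x, pgrad q x⟫)
    (fun p q v => by simp only [hadd, inner_add_left]; exact integral_add (hi _ _) (hi _ _))
    (fun c p v => by simp only [hsmul, real_inner_smul_left]; exact integral_const_mul _ _)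
    (fun p q v => by
      simp only [pgrad_add, inner_add_right]; exact integral_add (hi _ _) (hi _ _))
    (fun c p v => by simp only [pgrad_smul, real_inner_smul_right]; exact integral_const_mul _ _)
    (fun v hv h => by
      have h1 := hcoer v ((hmem v).1 hv).1
      rw [h, mul_zero] at h1
      have h2 : l2 (volume.restrict (hull K)) (pgrad v) = 0 := by
        have : l2 (volume.restrict (hull K)) (pgrad v) ^ 2 ≤ 0 := by
          by_contra! hlt
          have := mul_pos (pow_pos hr 2) hlt
          linarith
        exact pow_eq_zero_iff (two_ne_zero) |>.1 (le_antisymm this (sq_nonneg _))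
      have h3 := hK.poincare_poly ((hmem v).1 hv).2
      rw [h2, mul_zero] at h3
      have h4 := l2_sq (μ := volume.restrict (hull K)) (pval v)
      rw [le_antisymm h3 (l2_nonneg _)] at h4
      refine hK.poly_eq_zero_of_l2 ?_
      simp only [Real.norm_eq_abs, sq_abs] at h4
      simp only [← sq, ← h4]
      norm_num)
    { toFun := fun v => -∫ x in hull K, pval g x * pval v x
      map_add' := fun p q => by
        simp only [pval_add, mul_add]; rw [integral_add (hig p) (hig q)]; ring
      map_smul' := fun s p => by
        simp only [pval_smul, mul_left_comm _ s, integral_const_mul, RingHom.id_apply, smul_eq_mul]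
        ring }
  simp only [LinearMap.coe_mk, AddHom.coe_mk] at hw
  obtain ⟨hwd, hw0⟩ := (hmem w).1 hwV
  refine ⟨w, hwd, ?_, ?_⟩
  · refine hK.poly_eq_of_moments (isRT_tangField K hwd).totalDegree_pdiv_le hg fun v hv => ?_
    obtain ⟨m, hm⟩ := hK.exists_mean (pval v)
    have hv' : v - MvPolynomial.C m ∈
        MvPolynomial.restrictTotalDegree (Fin d) ℝ k ⊓ LinearMap.ker M := by
      refine (hmem _).2 ⟨(MvPolynomial.totalDegree_sub _ _).trans (max_le hv
        ((MvPolynomial.totalDegree_C _).trans_le (Nat.zero_le _))), ?_⟩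
      simp only [pval_sub, pval_C]
      rw [integral_sub (hint v) (integrable_const _), hm, sub_self]
    have h1 := hw _ hv'
    simp only [pgrad_sub, pgrad_C, sub_zero, pval_sub, pval_C, mul_sub] at h1
    rw [integral_sub (hig v) ((hint g).mul_const m), integral_mul_const, hg0] at h1
    rw [hK.integral_pdiv_tangField hd, h1]
    ring
  -- Coercivity and the Poincaré inequality bound `r ^ 2 * ‖∇w‖` by a multiple of `diamK K * ‖g‖`.
  -- The field has size `diamK K ^ 2 * ‖∇w‖`, and shape regularity bounds `diamK K ^ 2` by `4 * γ ^
  -- 2 * r ^ 2`.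
  · have h1 := hcoer w hwd
    rw [hw w hwV] at h1
    have h2 := hK.poincare_poly hw0
    have h3 := (neg_le_abs _).trans (abs_integral_mul_le (hpm g) (hpm w))
    have p1 := l2_nonneg (μ := volume.restrict (hull K)) (pgrad w)
    have p2 := l2_nonneg (μ := volume.restrict (hull K)) (pval g)
    have h4 : l2 (volume.restrict (hull K)) (vval (tangField K w)) ≤
        diamK K ^ 2 * l2 (volume.restrict (hull K)) (pgrad w) := by
      refine l2_mono (memLp_of_continuous (by fun_prop) _) (by positivity) ?_
      filter_upwards [ae_restrict_mem measurableSet_hull] with x hx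
      exact hK.norm_tangField_le w hx
    have h5 : r ^ 2 * l2 (volume.restrict (hull K)) (pgrad w) ≤
        C * (2 ^ d * diamK K * l2 (volume.restrict (hull K)) (pval g)) := by
      rcases p1.eq_or_lt with h0 | h0
      · rw [← h0, mul_zero]; positivity
      · refine le_of_mul_le_mul_right ?_ h0
        calc _ = r ^ 2 * l2 (volume.restrict (hull K)) (pgrad w) ^ 2 := by ring
          _ ≤ _ := h1
          _ ≤ C * (l2 (volume.restrict (hull K)) (pval g) *
              l2 (volume.restrict (hull K)) (pval w)) := mul_le_mul_of_nonneg_left h3 hC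
          _ ≤ C * (l2 (volume.restrict (hull K)) (pval g) *
              (2 ^ d * diamK K * l2 (volume.restrict (hull K)) (pgrad w))) := by gcongr
          _ = _ := by ring
    have h6 : diamK K ^ 2 ≤ 4 * γ ^ 2 * r ^ 2 := by
      calc diamK K ^ 2 ≤ (γ * (2 * r)) ^ 2 := by gcongr
        _ = _ := by ring
    calc _ ≤ diamK K ^ 2 * l2 (volume.restrict (hull K)) (pgrad w) := h4
      _ ≤ 4 * γ ^ 2 * r ^ 2 * l2 (volume.restrict (hull K)) (pgrad w) := by gcongr
      _ = 4 * γ ^ 2 * (r ^ 2 * l2 (volume.restrict (hull K)) (pgrad w)) := by ring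
      _ ≤ 4 * γ ^ 2 * (C * (2 ^ d * diamK K * l2 (volume.restrict (hull K)) (pval g))) := by gcongr
      _ = _ := by ring

-- On the facet opposite to `b` the radial field from a vertex `a ≠ b` has no normal component, so
-- each radial correction affects the moments of one facet only.
omit hK in
theorem inner_radial_normal (hK : IsSimplex K) (hd : 1 ≤ d) {a b : Pt d} (hb : b ∈ K)
    {x : Pt d} (hx : pval (bary K b) x = 0) :
    ‖bgrad K b‖ * ⟪x - a, normal K b⟫ = pval (bary K b) a := by
  have h1 := bary_sub K b x a
  rw [hx, hK.bgrad_eq hd hb, inner_neg_left, real_inner_smul_left, real_inner_comm] at h1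
  obtain ⟨c, hc⟩ : ∃ c, c = ‖bgrad K b‖ := ⟨_, rfl⟩
  rw [← hc] at h1 ⊢
  linarith

end IsSimplex

/-- The Raviart-Thomas interpolant: its divergence is the projection of the divergence, its facet
moments are those of the given field, and it is quasi-optimal. -/
theorem exists_rt_interpolant (hd : 1 ≤ d) (k : ℕ) (γ : ℝ) : ∃ C : ℝ, 0 ≤ C ∧
    ∀ (K : Finset (Pt d)), IsSimplex K → ∀ (c : Pt d) (r : ℝ), 0 < r →
    Metric.closedBall c r ⊆ hull K → diamK K ≤ γ * (2 * r) →
    ∀ (q : Pt d → Pt d) (H : Fin d → Pt d → Pt d),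
    (∀ j, HasWeakGrad (interior (hull K)) (fun x => q x j) (H j)) →
    ∀ (F : MPoly d), F.totalDegree ≤ k → (∀ v : MPoly d, v.totalDegree ≤ k →
      ∫ x in hull K, pval F x * pval v x = ∫ x in hull K, (∑ j, H j x j) * pval v x) →
    ∀ (p : Fin d → MPoly d), (∀ j, (p j).totalDegree ≤ k) →
    ∃ Q : Fin d → MPoly d, IsRT k Q ∧ pdiv Q = F ∧
      (∀ a ∈ K, ∀ μ : MPoly d, μ.totalDegree ≤ k → ∃ μ' : MPoly d,
        (∀ x ∈ hull (facet K a), pval μ' x = pval μ x) ∧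
        ∫ x, ⟪vval Q x, normal K a⟫ * pval μ x ∂(surf (facet K a)) =
          ‖bgrad K a‖ * coneInt K a (fun x => ⟪q x, normal K a⟫)
            (fun x => ∑ j, normal K a j • H j x) (pval μ')) ∧
      l2 (volume.restrict (hull K)) (fun x => q x - vval Q x) ≤
        C * (l2 (volume.restrict (hull K)) (fun x => q x - vval p x) +
          diamK K * ∑ j, l2 (volume.restrict (hull K)) (fun x => H j x - pgrad (p j) x)) := by
  obtain ⟨Cc, hCc0, hCc⟩ := exists_tangField_coercive d k
  -- The three summands belong to the field `p`, to the radial corrections at the `d + 1` vertices,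
  -- and to the tangential correction of the divergence.
  refine ⟨1 + (d + 1) * |γ| + 4 * γ ^ 2 * Cc * 2 ^ d * (1 + (d + 1) * (d + k) * |γ|), by positivity,
    fun K hK c r hr hb hγ q H hq F hF hFm p hp => ?_⟩
  have hpm : ∀ s : MPoly d, MemLp (pval s) 2 (volume.restrict (hull K)) :=
    fun s => IsSimplex.memLp_of_continuous (by fun_prop) _
  have hqm : ∀ j, MemLp (fun x => q x j) 2 (volume.restrict (hull K)) :=
    fun j => by rw [← hK.ae_restrict_interior]; exact (hq j).memLp
  have hHm : ∀ j, MemLp (H j) 2 (volume.restrict (hull K)) :=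
    fun j => by rw [← hK.ae_restrict_interior]; exact (hq j).memLp_grad
  have hfin := hK.isFiniteMeasure
  have hh := IsSimplex.diamK_nonneg (K := K)
  -- the error of the polynomial field `p`
  obtain ⟨E, hE⟩ : ∃ E : Pt d → Pt d, ∀ x, E x = q x - vval p x := ⟨_, fun x => rfl⟩
  obtain ⟨HE, hHE⟩ : ∃ HE : Fin d → Pt d → Pt d, ∀ j x, HE j x = H j x - pgrad (p j) x :=
    ⟨_, fun j x => rfl⟩
  have hEw : ∀ j, HasWeakGrad (interior (hull K)) (fun x => E x j) (HE j) := fun j => by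
    simp only [hE, funext (hHE j)]
    exact (hq j).sub (hK.hasWeakGrad_pval hd (p j))
  have hEm : MemLp E 2 (volume.restrict (hull K)) :=
    memLp_of_coord fun j => by rw [← hK.ae_restrict_interior]; exact (hEw j).memLp
  have hHEm : ∀ j, MemLp (HE j) 2 (volume.restrict (hull K)) :=
    fun j => by rw [← hK.ae_restrict_interior]; exact (hEw j).memLp_grad
  simp only [← hE, ← hHE]
  obtain ⟨e, he⟩ : ∃ e, e = l2 (volume.restrict (hull K)) E := ⟨_, rfl⟩
  obtain ⟨D, hD⟩ : ∃ D, D = ∑ j, l2 (volume.restrict (hull K)) (HE j) := ⟨_, rfl⟩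
  have he0 : 0 ≤ e := he ▸ l2_nonneg _
  have hD0 : 0 ≤ D := hD ▸ Finset.sum_nonneg fun _ _ => l2_nonneg _
  -- corrections of the facet moments
  have hφ : ∀ n : Pt d, MemLp (fun x => ⟪E x, n⟫) 2 (volume.restrict (hull K)) := fun n => by
    rw [← hK.ae_restrict_interior]; exact (HasWeakGrad.inner_const hEw n).memLp
  have hΦ : ∀ n : Pt d, MemLp (fun x => ∑ j, n j • HE j x) 2 (volume.restrict (hull K)) :=
    fun n => by rw [← hK.ae_restrict_interior]; exact (HasWeakGrad.inner_const hEw n).memLp_grad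
  have hex : ∀ a : Pt d, ∃ β : MPoly d, a ∈ K → β.totalDegree ≤ k ∧ IsHomAt a k β ∧
      (∀ μ : MPoly d, μ.totalDegree ≤ k → IsHomAt a k μ →
        coneInt K a (pval β) (pgrad β) (pval μ) = coneInt K a (fun x => ⟪E x, normal K a⟫)
          (fun x => ∑ j, normal K a j • HE j x) (pval μ)) ∧
      l2 (volume.restrict (hull K)) (pval β) ≤ e + diamK K * D := by
    intro a
    by_cases ha : a ∈ K
    · obtain ⟨β, h1, h2, h3, h4⟩ := hK.exists_facet_representative hd ha k (hφ (normal K a))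
        (hΦ (normal K a))
      refine ⟨β, fun _ => ⟨h1, h2, h3, h4.trans (add_le_add ?_ (mul_le_mul_of_nonneg_left ?_ hh))⟩⟩
      · simpa [hK.norm_normal hd ha, he] using l2_inner_le hEm (normal K a)
      · simpa [hK.norm_normal hd ha, hD] using l2_sum_smul_le hHEm (normal K a)
    · exact ⟨0, fun h => absurd h ha⟩
  choose β hβ using hex
  -- The factor `‖bgrad K a‖` is the reciprocal height; it normalizes the normal component of `x -
  -- a` on the opposite facet to one, so the normal component of `R` there is `β a`.
  obtain ⟨R, hR⟩ : ∃ R : Fin d → MPoly d, R = ∑ a ∈ K, fun i =>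
      (MvPolynomial.X i - MvPolynomial.C (a i)) * (‖bgrad K a‖ • β a) := ⟨_, rfl⟩
  have hRrt : IsRT k R := by
    rw [hR]
    exact IsRT.sum _ fun a ha => IsRT.radial a ((MvPolynomial.totalDegree_smul_le _ _).trans (hβ a ha).1)
  have hprt : IsRT k p := IsRT.of_totalDegree_le hp
  have hRv : ∀ x, vval R x = ∑ a ∈ K, (‖bgrad K a‖ * pval (β a) x) • (x - a) := fun x => by
    rw [hR, vval_sum]
    exact Finset.sum_congr rfl fun a _ => by rw [vval_radial, pval_smul]
  have hRd : ∀ x, pval (pdiv R) x = ∑ a ∈ K, ‖bgrad K a‖ * ((d + k) * pval (β a) x) := fun x => by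
    rw [hR, pdiv_sum, pval_sum]
    refine Finset.sum_congr rfl fun a ha => ?_
    rw [pval_pdiv_radial, pgrad_smul, pval_smul, real_inner_smul_left, (hβ a ha).2.1 x]
    ring
  have hγb : ∀ a ∈ K, diamK K * ‖bgrad K a‖ ≤ |γ| := fun a ha =>
    (hK.diamK_mul_norm_bgrad_le hr hb hγ ha).trans (le_abs_self γ)
  obtain ⟨N, hN⟩ : ∃ N, N = e + diamK K * D := ⟨_, rfl⟩
  have hN0 : 0 ≤ N := hN ▸ by positivity
  have hβN : ∀ a ∈ K, diamK K * ‖bgrad K a‖ * l2 (volume.restrict (hull K)) (pval (β a)) ≤ |γ| * N :=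
    fun a ha => mul_le_mul (hγb a ha) (hN ▸ (hβ a ha).2.2.2) (l2_nonneg _) (abs_nonneg _)
  have hconst : ∀ x : ℝ, ∑ _ ∈ K, x = (d + 1) * x := fun x => by
    rw [Finset.sum_const, hK.card, nsmul_eq_mul]; push_cast; ring
  have hRn : l2 (volume.restrict (hull K)) (vval R) ≤ (d + 1) * (|γ| * N) := by
    rw [funext hRv, ← hconst]
    refine (l2_sum_le _ fun a _ => IsSimplex.memLp_of_continuous (by fun_prop) _).trans
      (Finset.sum_le_sum fun a ha => le_trans ?_ (hβN a ha))
    refine l2_mono (hpm (β a)) (by positivity) ?_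
    filter_upwards [ae_restrict_mem IsSimplex.measurableSet_hull] with x hx
    have := IsSimplex.norm_sub_le_diam hx (IsSimplex.mem_hull_of_mem ha)
    rw [norm_smul, norm_mul, norm_norm]
    calc _ ≤ ‖bgrad K a‖ * ‖pval (β a) x‖ * diamK K := by gcongr
      _ = _ := by ring
  -- the defect of the divergence
  obtain ⟨g, hg⟩ : ∃ g, g = F - pdiv (p + R) := ⟨_, rfl⟩
  have hgd : g.totalDegree ≤ k := by
    rw [hg]
    exact (MvPolynomial.totalDegree_sub _ _).trans (max_le hF (hprt.add hRrt).totalDegree_pdiv_le)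
  have hdivE : MemLp (fun x => ∑ j, HE j x j) 2 (volume.restrict (hull K)) :=
    memLp_finsetSum _ fun j _ => memLp_coord (hHEm j) j
  have hdivEn : l2 (volume.restrict (hull K)) (fun x => ∑ j, HE j x j) ≤ D := by
    rw [hD]
    refine (l2_sum_le _ fun j _ => memLp_coord (hHEm j) j).trans (Finset.sum_le_sum fun j _ => ?_)
    have := l2_mono (f := fun x => HE j x j) (hHEm j) zero_le_one (ae_of_all _ fun x => by
      simpa using PiLp.norm_apply_le (HE j x) j)
    simpa using this
  have hFp : ∀ v : MPoly d, v.totalDegree ≤ k → ∫ x in hull K, pval (F - pdiv p) x * pval v x =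
      ∫ x in hull K, (∑ j, HE j x j) * pval v x := by
    intro v hv
    have hdm : MemLp (fun x => ∑ j, H j x j) 2 (volume.restrict (hull K)) :=
      memLp_finsetSum _ fun j _ => memLp_coord (hHm j) j
    have e1 : ∀ x, (∑ j, HE j x j) * pval v x =
        (∑ j, H j x j) * pval v x - pval (pdiv p) x * pval v x := fun x => by
      simp only [hHE, pdiv, pval_sum, PiLp.sub_apply, pgrad_apply, Finset.sum_sub_distrib, sub_mul]
    simp only [e1, pval_sub, sub_mul]
    rw [integral_sub (integrable_mul_of_memLp (hpm _) (hpm _))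
      (integrable_mul_of_memLp (hpm _) (hpm _)), integral_sub (integrable_mul_of_memLp hdm (hpm _))
      (integrable_mul_of_memLp (hpm _) (hpm _)), hFm v hv]
  -- After the facet correction `p + R` has the total flux of `q` through the boundary. So the
  -- defect `g` of the divergence has mean zero, which a tangential correction requires.
  have hRint : ∫ x in hull K, pval (pdiv R) x = ∫ x in hull K, ∑ j, HE j x j := by
    rw [← hK.sum_coneInt_eq hd hEw k]
    simp only [hRd]
    rw [integral_finsetSum _ fun a _ => IsSimplex.integrable_of_continuous (by fun_prop)]
    refine Finset.sum_congr rfl fun a ha => ?_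
    obtain ⟨h1, h2, h3, -⟩ := hβ a ha
    have hL := (hK.isHomAt_height ha).pow k
    have hLd : ((1 - bary K a) ^ k).totalDegree ≤ k := by
      refine (MvPolynomial.totalDegree_pow _ _).trans ?_
      have : (1 - bary K a).totalDegree ≤ 1 :=
        (MvPolynomial.totalDegree_sub _ _).trans (max_le (by simp) (totalDegree_bary_le K a))
      nlinarith [Nat.zero_le k]
    rw [← h3 _ hLd hL, integral_const_mul, integral_const_mul, hK.coneInt_pval hd ha]
    have h4 : ∫ x, pval (β a) x * pval ((1 - bary K a) ^ k) x ∂(surf (facet K a)) =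
        ∫ x, pval (β a) x * pval 1 x ∂(surf (facet K a)) := by
      refine integral_congr_ae ?_
      filter_upwards [IsSimplex.ae_surf_mem (facet K a)] with x hx
      simp [((hK.mem_hull_facet_iff ha).1 hx).2]
    rw [h4, ← hK.coneInt_pval hd ha, IsSimplex.coneInt_one h2]
  have hg0 : ∫ x in hull K, pval g x = 0 := by
    have h1 := hFp 1 (by simp)
    simp only [pval_one, mul_one] at h1
    rw [hg, pdiv_add, ← sub_sub]
    simp only [pval_sub _ (pdiv R)]
    rw [integral_sub (IsSimplex.integrable_of_continuous (by fun_prop))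
      (IsSimplex.integrable_of_continuous (by fun_prop)), h1, hRint, sub_self]
  have hFn : l2 (volume.restrict (hull K)) (pval (F - pdiv p)) ≤ D := by
    have h1 := hFp (F - pdiv p) ((MvPolynomial.totalDegree_sub _ _).trans
      (max_le hF hprt.totalDegree_pdiv_le))
    have h2 := (le_abs_self _).trans (abs_integral_mul_le hdivE (hpm (F - pdiv p)))
    have h3 : ∫ x in hull K, pval (F - pdiv p) x * pval (F - pdiv p) x =
        l2 (volume.restrict (hull K)) (pval (F - pdiv p)) ^ 2 := by
      rw [l2_sq]; simp only [Real.norm_eq_abs, sq_abs]; simp only [sq]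
    rw [← h1, h3] at h2
    have h4 := l2_nonneg (μ := volume.restrict (hull K)) (pval (F - pdiv p))
    rcases h4.eq_or_lt with h0 | h0
    · rw [← h0]; exact hD0
    · refine le_of_mul_le_mul_right ?_ h0
      rw [sq] at h2
      exact h2.trans (mul_le_mul_of_nonneg_right hdivEn h4)
  have hgn : diamK K * l2 (volume.restrict (hull K)) (pval g) ≤
      (1 + (d + 1) * (d + k) * |γ|) * N := by
    have h1 : pval g = fun x => pval (F - pdiv p) x - pval (pdiv R) x := by
      ext x; rw [hg, pdiv_add, ← sub_sub, pval_sub]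
    have h2 : diamK K * l2 (volume.restrict (hull K)) (pval (pdiv R)) ≤
        (d + 1) * ((d + k) * (|γ| * N)) := by
      rw [funext hRd, ← hconst]
      refine (mul_le_mul_of_nonneg_left (l2_sum_le _ fun a _ =>
        IsSimplex.memLp_of_continuous (by fun_prop) _) hh).trans ?_
      rw [Finset.mul_sum]
      refine Finset.sum_le_sum fun a ha => ?_
      have h3 : l2 (volume.restrict (hull K)) (fun x => ‖bgrad K a‖ * ((d + k) * pval (β a) x)) ≤
          ‖bgrad K a‖ * (d + k) * l2 (volume.restrict (hull K)) (pval (β a)) :=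
        l2_mono (hpm (β a)) (by positivity) (ae_of_all _ fun x => by
          rw [norm_mul, norm_mul, norm_norm, Real.norm_of_nonneg (by positivity : (0 : ℝ) ≤ d + k),
            mul_assoc])
      calc _ ≤ diamK K * (‖bgrad K a‖ * (d + k) * l2 (volume.restrict (hull K)) (pval (β a))) := by
            gcongr
        _ = (d + k) * (diamK K * ‖bgrad K a‖ * l2 (volume.restrict (hull K)) (pval (β a))) := by ring
        _ ≤ _ := by have := hβN a ha; gcongr
    rw [h1]
    calc _ ≤ diamK K * (D + l2 (volume.restrict (hull K)) (pval (pdiv R))) := by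
          refine mul_le_mul_of_nonneg_left ((l2_sub_le (hpm _) (hpm _)).trans ?_) hh
          gcongr
      _ = diamK K * D + diamK K * l2 (volume.restrict (hull K)) (pval (pdiv R)) := by ring
      _ ≤ N + (d + 1) * ((d + k) * (|γ| * N)) := by
          refine add_le_add ?_ h2
          rw [hN]; linarith
      _ = _ := by ring
  obtain ⟨w, hwd, hwg, hwn⟩ := hK.exists_tangential_correction hd k hCc0 hr hγ
    (hCc K hK c r hr hb) hgd hg0
  refine ⟨p + R + tangField K w, (hprt.add hRrt).add (isRT_tangField K hwd), ?_, ?_, ?_⟩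
  · rw [pdiv_add, hwg, hg]; abel
  · intro a ha μ hμ
    -- The representative `β a` reproduces the moments for polynomials homogeneous about `a`, so the
    -- test polynomial is replaced by its homogenization; on the facet nothing changes.
    obtain ⟨μ', hμ'd, hμ'h, hμ'⟩ := hK.exists_homogenization ha hμ
    have hfac : ∀ x ∈ hull (facet K a), pval (bary K a) x = 0 := fun x hx =>
      ((hK.mem_hull_facet_iff ha).1 hx).2
    refine ⟨μ', fun x hx => hμ' x (hfac x hx), ?_⟩
    have hw0 : ‖bgrad K a‖ ≠ 0 := norm_ne_zero_iff.2 (hK.bgrad_ne_zero hd ha)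
    obtain ⟨P, hP⟩ : ∃ P : MPoly d, P = ∑ j, normal K a j • p j := ⟨_, rfl⟩
    have hPv : ∀ x, pval P x = ⟪vval p x, normal K a⟫ := fun x => by
      rw [hP, pval_sum]; simp [PiLp.inner_apply]
    have hPg : ∀ x, pgrad P x = ∑ j, normal K a j • pgrad (p j) x := fun x => by
      ext i
      rw [pgrad_apply, hP, map_sum, pval_sum, WithLp.ofLp_sum, Finset.sum_apply]
      simp
    have h1 : ∫ x, ⟪vval (p + R + tangField K w) x, normal K a⟫ * pval μ x ∂(surf (facet K a)) =
        ∫ x, (pval P x * pval μ' x + pval (β a) x * pval μ' x) ∂(surf (facet K a)) := by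
      refine integral_congr_ae ?_
      filter_upwards [IsSimplex.ae_surf_mem (facet K a)] with x hx
      have hx0 := hfac x hx
      have t1 : ⟪vval (tangField K w) x, normal K a⟫ = 0 := by
        have := hK.inner_bgrad_tangField ha w x
        rw [hx0, zero_mul] at this
        rw [hK.normal_eq hd ha, inner_neg_right, real_inner_smul_right, real_inner_comm, this]
        simp
      have t2 : ⟪vval R x, normal K a⟫ = pval (β a) x := by
        rw [hRv, sum_inner, Finset.sum_eq_single_of_mem a ha]
        · have := hK.inner_radial_normal hd (a := a) ha hx0
          rw [hK.bary_self ha] at this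
          rw [real_inner_smul_left, mul_right_comm, this, one_mul]
        · intro b hbK hba
          have := hK.inner_radial_normal hd (a := b) ha hx0
          rw [hK.bary_of_ne ha hbK hba, mul_eq_zero] at this
          rw [real_inner_smul_left, this.resolve_left hw0, mul_zero]
      rw [vval_add, vval_add, inner_add_left, inner_add_left, t1, t2, hPv, hμ' x hx0]
      ring
    rw [h1, integral_add (hK.integrable_surf_of_continuous hd ha (by fun_prop))
      (hK.integrable_surf_of_continuous hd ha (by fun_prop)), ← hK.coneInt_pval hd ha,
      ← hK.coneInt_pval hd ha, (hβ a ha).2.2.1 μ' hμ'd hμ'h, ← mul_add,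
      ← IsSimplex.coneInt_add_left a (hpm P) (IsSimplex.memLp_of_continuous (by fun_prop) _)
        (hφ (normal K a)) (hΦ (normal K a))]
    congr 2
    · ext x
      rw [hPv, hE, inner_sub_left]; ring
    · ext1 x
      rw [hPg, ← Finset.sum_add_distrib]
      refine Finset.sum_congr rfl fun j _ => ?_
      rw [hHE, ← smul_add, add_sub_cancel]
  · have h1 : (fun x => q x - vval (p + R + tangField K w) x) =
        fun x => (E x - vval R x) - vval (tangField K w) x := by
      ext1 x; rw [hE, vval_add, vval_add]; abel
    have hRm : MemLp (vval R) 2 (volume.restrict (hull K)) :=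
      IsSimplex.memLp_of_continuous (by fun_prop) _
    have hTm : MemLp (vval (tangField K w)) 2 (volume.restrict (hull K)) :=
      IsSimplex.memLp_of_continuous (by fun_prop) _
    rw [h1]
    have t1 : _ ≤ l2 (volume.restrict (hull K)) (fun x => E x - vval R x) + _ :=
      l2_sub_le (hEm.sub hRm) hTm
    have t2 := l2_sub_le hEm hRm
    have t3 : 4 * γ ^ 2 * Cc * 2 ^ d * (diamK K * l2 (volume.restrict (hull K)) (pval g)) ≤
        4 * γ ^ 2 * Cc * 2 ^ d * ((1 + (d + 1) * (d + k) * |γ|) * N) := by gcongr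
    have t4 : e ≤ N := by rw [hN]; have := mul_nonneg hh hD0; linarith
    refine t1.trans ?_
    rw [← he, ← hD, ← hN]
    rw [← he] at t2
    linarith

/-! ### Uniqueness of weak derivatives -/

/-- The fundamental lemma of the calculus of variations, applied to the difference. It gives
uniqueness of weak gradients and divergences. -/
theorem ae_eq_of_forall_isTest {Ω : Set (Pt d)} (hΩ : IsOpen Ω) {v w : Pt d → ℝ}
    (hv : MemLp v 2 (volume.restrict Ω)) (hw : MemLp w 2 (volume.restrict Ω))
    (h : ∀ φ, IsTest Ω φ → ∫ x in Ω, v x * φ x = ∫ x in Ω, w x * φ x) :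
    v =ᵐ[volume.restrict Ω] w := by
  have hvw : MemLp (fun x => v x - w x) 2 (volume.restrict Ω) := hv.sub hw
  have hloc : LocallyIntegrableOn (fun x => v x - w x) Ω volume := by
    intro x hx
    obtain ⟨ε, hε, hball⟩ := Metric.isOpen_iff.1 hΩ x hx
    refine ⟨Metric.ball x ε, mem_nhdsWithin_of_mem_nhds (Metric.ball_mem_nhds x hε), ?_⟩
    have h1 : MemLp (fun x => v x - w x) 2 (volume.restrict (Metric.ball x ε)) :=
      hvw.mono_measure (Measure.restrict_mono hball le_rfl)
    have : IsFiniteMeasure (volume.restrict (Metric.ball x ε)) :=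
      ⟨by simpa using measure_ball_lt_top⟩
    exact h1.integrable one_le_two
  have h0 := hΩ.ae_eq_zero_of_integral_contDiff_smul_eq_zero (μ := volume) hloc
    fun φ h1 h2 h3 => by
      have hφ : IsTest Ω φ := ⟨h1, h2, h3⟩
      have e := hφ.setIntegral_eq (Set.subset_univ Ω) MeasurableSet.univ
        (g := fun x => φ x • (v x - w x))
        fun x hx => by rw [image_eq_zero_of_notMem_tsupport hx, zero_smul]
      rw [setIntegral_univ] at e
      rw [e]
      have e2 : ∀ x, φ x • (v x - w x) = v x * φ x - w x * φ x := fun x => by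
        rw [smul_eq_mul]; ring
      simp_rw [e2]
      have e3 := integral_sub (hv.integrable_mul (hφ.memLp Ω)) (hw.integrable_mul (hφ.memLp Ω))
      simp only [Pi.mul_apply] at e3
      rw [e3, h φ hφ, sub_self]
  rw [EventuallyEq, ae_restrict_iff' hΩ.measurableSet]
  filter_upwards [h0] with x hx hxΩ
  exact sub_eq_zero.1 (hx hxΩ)

theorem IsTest.fderiv_apply {Ω : Set (Pt d)} {φ : Pt d → ℝ} (h : IsTest Ω φ) (v : Pt d) :
    IsTest Ω fun x => fderiv ℝ φ x v := by
  refine ⟨?_, h.compact.fderiv_apply ℝ v, (tsupport_fderiv_apply_subset ℝ v).trans h.support⟩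
  exact (h.smooth.fderiv_right (m := ∞) (by simp)).clm_apply contDiff_const

theorem HasWeakGrad.congr {Ω : Set (Pt d)} {u u' : Pt d → ℝ} {G G' : Pt d → Pt d}
    (h : HasWeakGrad Ω u G) (hu : u =ᵐ[volume.restrict Ω] u') (hG : G =ᵐ[volume.restrict Ω] G') :
    HasWeakGrad Ω u' G' := by
  refine ⟨(memLp_congr_ae hu).1 h.memLp, (memLp_congr_ae hG).1 h.memLp_grad, fun φ hφ i => ?_⟩
  have h1 : (fun x => u' x * (∇ φ x) i) =ᵐ[volume.restrict Ω] fun x => u x * (∇ φ x) i := by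
    filter_upwards [hu] with x hx; rw [hx]
  have h2 : (fun x => G' x i * φ x) =ᵐ[volume.restrict Ω] fun x => G x i * φ x := by
    filter_upwards [hG] with x hx; rw [hx]
  rw [integral_congr_ae h1, integral_congr_ae h2, h.weak φ hφ i]

theorem HasWeakGrad.ae_eq {Ω : Set (Pt d)} (hΩ : IsOpen Ω) {u : Pt d → ℝ} {G G' : Pt d → Pt d}
    (h : HasWeakGrad Ω u G) (h' : HasWeakGrad Ω u G') : G =ᵐ[volume.restrict Ω] G' := by
  have : ∀ i, (fun x => G x i) =ᵐ[volume.restrict Ω] fun x => G' x i := fun i =>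
    ae_eq_of_forall_isTest hΩ (memLp_coord h.memLp_grad i) (memLp_coord h'.memLp_grad i)
      fun φ hφ => by rw [← neg_inj, ← h.weak φ hφ i, h'.weak φ hφ i]
  filter_upwards [ae_all_iff.2 this] with x hx
  ext i; exact hx i

/-- A field with components in `H¹` has the trace of its gradient as weak divergence. -/
theorem HasWeakDiv.ae_eq {Ω : Set (Pt d)} (hΩ : IsOpen Ω) {q : Pt d → Pt d} {f : Pt d → ℝ}
    (h : HasWeakDiv Ω q f) {H : Fin d → Pt d → Pt d}
    (hH : ∀ j, HasWeakGrad Ω (fun x => q x j) (H j)) :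
    f =ᵐ[volume.restrict Ω] fun x => ∑ j, H j x j := by
  have hm : ∀ j, MemLp (fun x => H j x j) 2 (volume.restrict Ω) := fun j =>
    memLp_coord (hH j).memLp_grad j
  refine ae_eq_of_forall_isTest hΩ h.memLp_div (memLp_finsetSum _ fun j _ => hm j)
    fun φ hφ => ?_
  rw [← neg_inj, ← h.weak φ hφ]
  have e1 : ∀ x, ⟪q x, ∇ φ x⟫ = ∑ j, q x j * (∇ φ x) j := fun x => by
    simp only [PiLp.inner_apply, RCLike.inner_apply, RCLike.conj_to_real, mul_comm]
  simp_rw [e1, Finset.sum_mul]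
  have e2 := integral_finsetSum Finset.univ fun j _ =>
    (hH j).memLp.integrable_mul (memLp_coord (hφ.memLp_grad Ω) j)
  have e3 := integral_finsetSum Finset.univ fun j _ => (hm j).integrable_mul (hφ.memLp Ω)
  simp only [Pi.mul_apply] at e2 e3
  rw [e2, e3, ← Finset.sum_neg_distrib]
  exact Finset.sum_congr rfl fun j _ => (hH j).weak φ hφ j

/-! ### Families of weak derivatives indexed by lists of directions -/

/-- `E l` is the weak derivative of `E []` in the directions listed in `l`, for lists of length at
most `m`. -/
structure IsWeakJet (m : ℕ) (Ω : Set (Pt d)) (E : List (Fin d) → Pt d → ℝ) : Prop where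
  memLp : ∀ l, MemLp (E l) 2 (volume.restrict Ω)
  grad : ∀ l, l.length < m → HasWeakGrad Ω (E l) fun x => WithLp.toLp 2 fun j => E (j :: l) x
  perm : ∀ l l', l.Perm l' → E l =ᵐ[volume.restrict Ω] E l'

theorem memLp_toLp {μ : Measure (Pt d)} {g : Fin d → Pt d → ℝ} (h : ∀ j, MemLp (g j) 2 μ) :
    MemLp (fun x => (WithLp.toLp 2 fun j => g j x : Pt d)) 2 μ :=
  memLp_of_coord fun j => h j

/-- The weak identity of order `n + 1` is the one of order `n` tested with a first derivative of the
test function. The iterated derivative splits off its last argument, which is why the new direction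
is appended at the end. -/
theorem IsSobolev.hasWeakGrad {m : ℕ} {Ω : Set (Pt d)} {u : Pt d → ℝ}
    {D : (n : ℕ) → (Fin n → Fin d) → Pt d → ℝ} (h : IsSobolev m Ω u D) {n : ℕ} (hn : n < m)
    (i : Fin n → Fin d) :
    HasWeakGrad Ω (D n i) fun x => WithLp.toLp 2 fun j => D (n + 1) (Fin.snoc i j) x := by
  refine ⟨(h.2 n hn.le i).1, memLp_toLp fun j => (h.2 (n + 1) hn _).1, fun φ hφ j => ?_⟩
  have h1 := (h.2 (n + 1) hn (Fin.snoc i j)).2 φ hφ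
  have h2 := (h.2 n hn.le i).2 _ (hφ.fderiv_apply (EuclideanSpace.single j 1))
  have e : ∀ x, iteratedFDeriv ℝ (n + 1) φ x
      (fun a => EuclideanSpace.single ((Fin.snoc i j : Fin (n + 1) → Fin d) a) 1) =
      iteratedFDeriv ℝ n (fun y => fderiv ℝ φ y (EuclideanSpace.single j 1)) x
        (fun a => EuclideanSpace.single (i a) 1) := fun x => by
    rw [iteratedFDeriv_succ_apply_right]
    have h3 : ContDiff ℝ ∞ (fderiv ℝ φ) := hφ.smooth.fderiv_right (by simp)
    have h4 := ContinuousLinearMap.iteratedFDeriv_comp_left (𝕜 := ℝ)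
      (ContinuousLinearMap.apply ℝ ℝ (EuclideanSpace.single j (1 : ℝ) : Pt d)) (f := fderiv ℝ φ)
      (x := x) (n := ∞) h3.contDiffAt (i := n) (by exact_mod_cast le_top)
    have h5 : (fun y => fderiv ℝ φ y (EuclideanSpace.single j 1)) =
      (ContinuousLinearMap.apply ℝ ℝ (EuclideanSpace.single j (1 : ℝ) : Pt d)) ∘ fderiv ℝ φ := rfl
    rw [h5, h4]
    simp only [Fin.snoc_last, ContinuousLinearMap.compContinuousMultilinearMap_coe,
      Function.comp_apply, ContinuousLinearMap.apply_apply]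
    congr 2
    funext a
    simp [Fin.init]
  simp_rw [e] at h1
  rw [h1, pow_succ] at h2
  have h6 : ∫ x in Ω, D n i x * (fderiv ℝ φ x) (EuclideanSpace.single j 1) =
      - ∫ x in Ω, D (n + 1) (Fin.snoc i j) x * φ x := by
    have h7 : ((-1 : ℝ)) ^ n ≠ 0 := pow_ne_zero n (by norm_num)
    refine mul_left_cancel₀ h7 ?_
    linear_combination -h2
  rw [← h6]
  refine integral_congr_ae (ae_of_all _ fun x => ?_)
  simp only [gradient_apply]

theorem fderiv_fderiv_comm {φ : Pt d → ℝ} (h : ContDiff ℝ ∞ φ) (v w x : Pt d) :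
    fderiv ℝ (fun y => fderiv ℝ φ y v) x w = fderiv ℝ (fun y => fderiv ℝ φ y w) x v := by
  have h1 : DifferentiableAt ℝ (fderiv ℝ φ) x :=
    (h.fderiv_right (m := ∞) (by simp)).differentiable (by simp) x
  have e : ∀ v w, fderiv ℝ (fun y => fderiv ℝ φ y v) x w = fderiv ℝ (fderiv ℝ φ) x w v := by
    intro v w
    rw [fderiv_clm_apply h1 (differentiableAt_const v)]
    simp
  rw [e, e]
  exact (h.contDiffAt.isSymmSndFDerivAt (by simp; exact WithTop.coe_le_coe.2 le_top)) w v

/-- Weak second derivatives are symmetric. -/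
theorem HasWeakGrad.ae_eq_of_comm {Ω : Set (Pt d)} (hΩ : IsOpen Ω) {u : Pt d → ℝ}
    {G : Pt d → Pt d} (h : HasWeakGrad Ω u G) {H : Fin d → Pt d → Pt d}
    (hH : ∀ j, HasWeakGrad Ω (fun x => G x j) (H j)) (a b : Fin d) :
    (fun x => H a x b) =ᵐ[volume.restrict Ω] fun x => H b x a := by
  have key : ∀ (a b : Fin d) φ, IsTest Ω φ → ∫ x in Ω, H a x b * φ x =
      ∫ x in Ω, u x * fderiv ℝ (fun y => fderiv ℝ φ y (EuclideanSpace.single b 1)) x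
        (EuclideanSpace.single a 1) := by
    intro a b φ hφ
    have h1 := (hH a).weak φ hφ b
    have h2 := h.weak _ (hφ.fderiv_apply (EuclideanSpace.single b 1)) a
    simp_rw [gradient_apply] at h1 h2
    rw [h2, h1, neg_neg]
  refine ae_eq_of_forall_isTest hΩ (memLp_coord (hH a).memLp_grad b)
    (memLp_coord (hH b).memLp_grad a) fun φ hφ => ?_
  rw [key a b φ hφ, key b a φ hφ]
  simp_rw [fderiv_fderiv_comm hφ.smooth (EuclideanSpace.single b 1)]

namespace IsWeakJet

variable {m : ℕ} {Ω : Set (Pt d)} {E : List (Fin d) → Pt d → ℝ}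

/-- Symmetry under permutations comes for free: uniqueness of weak gradients propagates an equality
under a further derivative, and symmetry of second derivatives gives transpositions of the first two
directions. The value zero beyond order `m` settles long lists. -/
theorem of_grad (hΩ : IsOpen Ω) (hm : ∀ l, MemLp (E l) 2 (volume.restrict Ω))
    (h0 : ∀ l, m < l.length → E l = 0)
    (hg : ∀ l, l.length < m → HasWeakGrad Ω (E l) fun x => WithLp.toLp 2 fun j => E (j :: l) x) :
    IsWeakJet m Ω E := by
  refine ⟨hm, hg, fun l l' hp => ?_⟩
  induction hp with
  | nil => rfl
  | @cons j l l' hp ih =>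
    by_cases hl : l.length < m
    · have h1 := (hg l hl).congr ih (EventuallyEq.refl _ _)
      filter_upwards [h1.ae_eq hΩ (hg l' (hp.length_eq ▸ hl))] with x hx
      exact congrArg (fun v : Pt d => v j) hx
    · rw [h0 (j :: l) (by simp; omega), h0 (j :: l') (by simp [← hp.length_eq]; omega)]
  | swap a b l =>
    by_cases hl : l.length + 1 < m
    · exact (hg l (by omega)).ae_eq_of_comm hΩ (H := fun j x => WithLp.toLp 2 fun i => E (i :: j :: l) x)
        (fun j => hg (j :: l) (by simpa using hl)) a b
    · rw [h0 (b :: a :: l) (by simp; omega), h0 (a :: b :: l) (by simp; omega)]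
  | trans _ _ h1 h2 => exact h1.trans h2

theorem mono {Ω' : Set (Pt d)} (h : IsWeakJet m Ω E) (hΩ : Ω' ⊆ Ω) (hm : MeasurableSet Ω) :
    IsWeakJet m Ω' E :=
  ⟨fun l => (h.memLp l).mono_measure (Measure.restrict_mono hΩ le_rfl),
    fun l hl => (h.grad l hl).mono hΩ hm, fun l l' hp =>
      ae_mono (Measure.restrict_mono hΩ le_rfl) (h.perm l l' hp)⟩

theorem sub {E' : List (Fin d) → Pt d → ℝ} (h : IsWeakJet m Ω E) (h' : IsWeakJet m Ω E') :
    IsWeakJet m Ω fun l x => E l x - E' l x := by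
  refine ⟨fun l => (h.memLp l).sub (h'.memLp l), fun l hl => ?_, fun l l' hp => ?_⟩
  · exact ((h.grad l hl).sub (h'.grad l hl)).congr (EventuallyEq.refl _ _)
      (ae_of_all _ fun x => by ext j; rfl)
  · filter_upwards [h.perm l l' hp, h'.perm l l' hp] with x h1 h2
    rw [h1, h2]

end IsWeakJet

/-- A function in `H^m(Ω)` has a family of weak derivatives indexed by lists. -/
theorem IsSobolev.exists_isWeakJet {m : ℕ} {Ω : Set (Pt d)} (hΩ : IsOpen Ω) {u : Pt d → ℝ}
    {D : (n : ℕ) → (Fin n → Fin d) → Pt d → ℝ} (h : IsSobolev m Ω u D) :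
    ∃ E, IsWeakJet m Ω E ∧ E [] =ᵐ[volume.restrict Ω] u ∧
      ∀ l : List (Fin d), l.length = m → ∃ i, E l = D m i := by
  classical
  -- Lists grow at the head and index families at the last place, hence the reversal.
  obtain ⟨E, hE⟩ : ∃ E : List (Fin d) → Pt d → ℝ, ∀ l, E l =
      if l.length ≤ m then D l.length (fun t => l.get t.rev) else 0 := ⟨_, fun _ => rfl⟩
  refine ⟨E, IsWeakJet.of_grad hΩ (fun l => ?_) (fun l hl => ?_) (fun l hl => ?_), ?_, ?_⟩
  · rw [hE]; split_ifs with hl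
    · exact (h.2 _ hl _).1
    · exact MemLp.zero
  · rw [hE, if_neg (by omega)]
  · have h1 := h.hasWeakGrad hl (fun t => l.get t.rev)
    have h2 : ∀ j, E (j :: l) = D (l.length + 1) (Fin.snoc (fun t => l.get t.rev) j) := by
      intro j
      rw [hE, if_pos (by simpa using hl)]
      change D (l.length + 1) _ = _
      congr 1
      funext t
      refine Fin.lastCases ?_ (fun t => ?_) t
      · simp
      · simp [Fin.rev_castSucc]
    have h3 : E l = D l.length (fun t => l.get t.rev) := by rw [hE, if_pos hl.le]
    rw [h3]
    simp_rw [h2]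
    exact h1
  · refine ae_eq_of_forall_isTest hΩ ?_ h.1 fun φ hφ => ?_
    · rw [hE]; exact (h.2 0 (by simp) _).1
    · have := (h.2 0 (by simp) (fun t => ([] : List (Fin d)).get t.rev)).2 φ hφ
      rw [hE]
      simpa using this.symm
  · rintro l rfl
    exact ⟨_, by rw [hE, if_pos le_rfl]⟩

theorem l2_toLp_le {μ : Measure (Pt d)} {g : Fin d → Pt d → ℝ} (h : ∀ j, MemLp (g j) 2 μ) :
    l2 μ (fun x => (WithLp.toLp 2 fun j => g j x : Pt d)) ≤ ∑ j, l2 μ (g j) := by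
  have e : ∀ x, (WithLp.toLp 2 fun j => g j x : Pt d) =
      ∑ j, g j x • EuclideanSpace.single j (1 : ℝ) := fun x => by
    ext i; simp [Finset.sum_apply, Pi.single_apply]
  simp_rw [e]
  have hm : ∀ j, MemLp (fun x => g j x • (EuclideanSpace.single j (1 : ℝ) : Pt d)) 2 μ := fun j =>
    (ContinuousLinearMap.toSpanSingleton ℝ (EuclideanSpace.single j (1 : ℝ) : Pt d)).comp_memLp' (h j)
  refine (l2_sum_le _ fun j _ => hm j).trans (Finset.sum_le_sum fun j _ => ?_)
  refine (l2_mono (h j) zero_le_one (ae_of_all _ fun x => ?_)).trans_eq (one_mul _)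
  simp [norm_smul]

/-! ### Iterated derivatives of polynomials -/

/-- The derivative of `p` in the directions listed in `l`. -/
def pdList (l : List (Fin d)) (p : MPoly d) : MPoly d := l.foldr (fun j q => MvPolynomial.pderiv j q) p

@[simp] theorem pdList_nil (p : MPoly d) : pdList [] p = p := rfl

@[simp] theorem pdList_cons (j : Fin d) (l : List (Fin d)) (p : MPoly d) :
    pdList (j :: l) p = MvPolynomial.pderiv j (pdList l p) := rfl

theorem pdList_pderiv (l : List (Fin d)) (j : Fin d) (p : MPoly d) :
    pdList l (MvPolynomial.pderiv j p) = MvPolynomial.pderiv j (pdList l p) := by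
  induction l with
  | nil => rfl
  | cons i l ih => rw [pdList_cons, ih, pdList_cons, pderiv_comm]

theorem pdList_perm {l l' : List (Fin d)} (h : l.Perm l') (p : MPoly d) : pdList l p = pdList l' p := by
  induction h with
  | nil => rfl
  | cons j _ ih => rw [pdList_cons, pdList_cons, ih]
  | swap a b l => simp only [pdList_cons]; rw [pderiv_comm]
  | trans _ _ h1 h2 => rw [h1, h2]

theorem pdList_add (l : List (Fin d)) (p q : MPoly d) : pdList l (p + q) = pdList l p + pdList l q := by
  induction l with
  | nil => rfl
  | cons j l ih => simp [ih]

theorem pdList_eq_zero {l : List (Fin d)} {p : MPoly d} (h : p.totalDegree < l.length) :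
    pdList l p = 0 := by
  induction l generalizing p with
  | nil => simp at h
  | cons j l ih =>
    rw [pdList_cons, ← pdList_pderiv]
    by_cases h0 : p.totalDegree = 0
    · have h1 : pdList l (0 : MPoly d) = 0 := by
        have := pdList_add l (0 : MPoly d) 0
        simpa using this
      rw [MvPolynomial.totalDegree_eq_zero_iff_eq_C.1 h0, MvPolynomial.pderiv_C, h1]
    · refine ih ((totalDegree_pderiv_le p j).trans_lt ?_)
      simp at h; omega

/-- The homogeneous polynomial of degree `n` with prescribed derivatives of order `n`. -/
def taylorPoly : ℕ → (List (Fin d) → ℝ) → MPoly d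
  | 0, c => MvPolynomial.C (c [])
  | n + 1, c => ((n : ℝ) + 1)⁻¹ • ∑ j, MvPolynomial.X j * taylorPoly n fun l => c (j :: l)

theorem totalDegree_taylorPoly_le (n : ℕ) (c : List (Fin d) → ℝ) :
    (taylorPoly n c).totalDegree ≤ n := by
  induction n generalizing c with
  | zero => simp [taylorPoly]
  | succ n ih =>
    rw [taylorPoly]
    refine (MvPolynomial.totalDegree_smul_le _ _).trans ?_
    refine (MvPolynomial.totalDegree_finsetSum _ _).trans (Finset.sup_le fun j _ => ?_)
    refine (MvPolynomial.totalDegree_mul _ _).trans ?_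
    have := ih fun l => c (j :: l)
    rw [MvPolynomial.totalDegree_X]; omega

/-- The product rule for `∑ x_j T_j` gives `T_a + ∑ x_j ∂_a T_j`. In the inductive step symmetry of
`c` identifies the sum with `(n + 1) T_a`, and the normalization cancels the total factor `n + 2`.
-/
theorem pderiv_taylorPoly (n : ℕ) {c : List (Fin d) → ℝ} (hc : ∀ l l', l.Perm l' → c l = c l')
    (a : Fin d) :
    MvPolynomial.pderiv a (taylorPoly (n + 1) c) = taylorPoly n fun l => c (a :: l) := by
  classical
  induction n generalizing c with
  | zero =>
    simp [taylorPoly, MvPolynomial.pderiv_X, Pi.single_apply]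
  | succ n ih =>
    have h1 : ∀ j, MvPolynomial.pderiv a (taylorPoly (n + 1) fun l => c (j :: l)) =
        taylorPoly n fun l => c (a :: j :: l) := fun j => by
      rw [ih fun l l' h => hc _ _ (h.cons j)]
      congr 1; funext l
      exact hc _ _ (List.Perm.swap _ _ _)
    have h2 : ((n : ℝ) + 1) • (taylorPoly (n + 1) fun l => c (a :: l)) =
        ∑ j, MvPolynomial.X j * taylorPoly n fun l => c (a :: j :: l) := by
      rw [taylorPoly, smul_smul, mul_inv_cancel₀ (by positivity), one_smul]
    rw [taylorPoly, Derivation.map_smul, map_sum]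
    simp_rw [Derivation.leibniz, h1, smul_eq_mul, MvPolynomial.pderiv_X, Finset.sum_add_distrib,
      ← h2]
    simp only [Pi.single_apply, mul_ite, mul_one, mul_zero, Finset.sum_ite_eq', Finset.mem_univ,
      if_true]
    have h3 : ∀ P : MPoly d, ((n : ℝ) + 1) • P + P = ((n : ℝ) + 1 + 1) • P := fun P => by
      rw [add_smul ((n : ℝ) + 1) 1 P, one_smul]
    rw [h3, smul_smul]
    push_cast
    rw [inv_mul_cancel₀ (by positivity), one_smul]

theorem pdList_taylorPoly {n : ℕ} {c : List (Fin d) → ℝ} (hc : ∀ l l', l.Perm l' → c l = c l')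
    {l : List (Fin d)} (hl : l.length = n) :
    pdList l (taylorPoly n c) = MvPolynomial.C (c l) := by
  induction l generalizing n c with
  | nil => subst hl; rfl
  | cons j l ih =>
    subst hl
    rw [pdList_cons, ← pdList_pderiv, List.length_cons, pderiv_taylorPoly _ hc,
      ih (fun l l' h => hc _ _ (h.cons j)) rfl]

/-! ### Approximation of Sobolev functions by polynomials -/

namespace IsSimplex

variable {K : Finset (Pt d)} (hK : IsSimplex K)
include hK

theorem isWeakJet_pval (hd : 1 ≤ d) (m : ℕ) (p : MPoly d) :
    IsWeakJet m (interior (hull K)) fun l => pval (pdList l p) :=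
  ⟨fun l => (hK.hasWeakGrad_pval hd (pdList l p)).memLp,
    fun l _ => hK.hasWeakGrad_pval hd (pdList l p),
    fun l l' h => by rw [pdList_perm h]⟩

/-- There is a polynomial with the same mean derivatives up to a given order. -/
theorem exists_pdList_mean_eq (m : ℕ) {E : List (Fin d) → Pt d → ℝ}
    (hm : ∀ l, MemLp (E l) 2 (volume.restrict (hull K)))
    (hp : ∀ l l', l.Perm l' → E l =ᵐ[volume.restrict (hull K)] E l') :
    ∃ p : MPoly d, p.totalDegree ≤ m ∧
      ∀ l : List (Fin d), l.length ≤ m → ∫ x in hull K, (E l x - pval (pdList l p) x) = 0 := by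
  have hfin := hK.isFiniteMeasure
  have hpm : ∀ p : MPoly d, MemLp (pval p) 2 (volume.restrict (hull K)) := fun p =>
    memLp_restrict_of_continuous (contDiff_pval p).continuous isCompact_hull 2
  have hv := hK.volume_hull_pos
  obtain ⟨c, hc⟩ : ∃ c : List (Fin d) → ℝ, ∀ l, c l =
    (volume.real (hull K))⁻¹ * ∫ x in hull K, E l x := ⟨_, fun _ => rfl⟩
  have hcp : ∀ l l', l.Perm l' → c l = c l' := fun l l' h => by
    rw [hc, hc, integral_congr_ae (hp l l' h)]
  have hc0 : ∀ l, ∫ x in hull K, (E l x - pval (MvPolynomial.C (c l)) x) = 0 := fun l => by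
    rw [integral_sub ((hm l).integrable one_le_two) ((hpm _).integrable one_le_two)]
    simp only [pval_C, integral_const, hc, smul_eq_mul, measureReal_restrict_apply MeasurableSet.univ,
      Set.univ_inter]
    rw [← mul_assoc, mul_inv_cancel₀ hv.ne', one_mul, sub_self]
  induction m generalizing E c with
  | zero =>
    refine ⟨MvPolynomial.C (c []), by simp, fun l hl => ?_⟩
    obtain rfl : l = [] := List.length_eq_zero_iff.1 (by omega)
    exact hc0 []
  | succ m ih =>
    -- The mean derivatives of top order are matched first, by a homogeneous polynomial. The
    -- correction of lower degree found by induction does not disturb them.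
    obtain ⟨Q, hQ⟩ : ∃ Q, Q = taylorPoly (m + 1) c := ⟨_, rfl⟩
    obtain ⟨E', hE'⟩ : ∃ E' : List (Fin d) → Pt d → ℝ,
      ∀ l, E' l = fun x => E l x - pval (pdList l Q) x := ⟨_, fun _ => rfl⟩
    have hm' : ∀ l, MemLp (E' l) 2 (volume.restrict (hull K)) := fun l => by
      rw [hE']; exact (hm l).sub (hpm _)
    have hp' : ∀ l l', l.Perm l' → E' l =ᵐ[volume.restrict (hull K)] E' l' := fun l l' h => by
      rw [hE', hE']
      filter_upwards [hp l l' h] with x hx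
      rw [hx, pdList_perm h]
    obtain ⟨p, hpd, hp0⟩ := ih (E := E') hm' hp'
      (fun l => (volume.real (hull K))⁻¹ * ∫ x in hull K, E' l x) (fun _ => rfl)
      (fun l l' h => by simp only [integral_congr_ae (hp' l l' h)])
      (fun l => by
        rw [integral_sub ((hm' l).integrable one_le_two) ((hpm _).integrable one_le_two)]
        simp only [pval_C, integral_const, smul_eq_mul,
          measureReal_restrict_apply MeasurableSet.univ, Set.univ_inter]
        rw [← mul_assoc, mul_inv_cancel₀ hv.ne', one_mul, sub_self])
    refine ⟨Q + p, (MvPolynomial.totalDegree_add _ _).trans (max_le ?_ (hpd.trans m.le_succ)),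
      fun l hl => ?_⟩
    · rw [hQ]; exact totalDegree_taylorPoly_le _ _
    · rcases Nat.lt_or_ge l.length (m + 1) with h | h
      · have := hp0 l (by omega)
        rw [hE'] at this
        simpa only [pdList_add, pval_add, sub_sub] using this
      · have hl' : l.length = m + 1 := by omega
        rw [pdList_add, pdList_eq_zero (p := p) (by omega), add_zero, hQ, pdList_taylorPoly hcp hl']
        exact hc0 l

/-- The Bramble-Hilbert lemma: polynomial approximation of all derivatives. -/
theorem bramble_hilbert (hd : 1 ≤ d) (m : ℕ) {E : List (Fin d) → Pt d → ℝ}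
    (hE : IsWeakJet (m + 1) (interior (hull K)) E) :
    ∃ p : MPoly d, p.totalDegree ≤ m ∧
      ∀ N, (∀ l : List (Fin d), l.length = m + 1 → l2 (volume.restrict (hull K)) (E l) ≤ N) →
        ∀ t l, l.length + t = m + 1 →
          l2 (volume.restrict (hull K)) (fun x => E l x - pval (pdList l p) x) ≤
            (d * 2 ^ d * diamK K) ^ t * N := by
  have hm : ∀ l, MemLp (E l) 2 (volume.restrict (hull K)) := fun l => by
    rw [← hK.ae_restrict_interior]; exact hE.memLp l
  obtain ⟨p, hpd, hp0⟩ := hK.exists_pdList_mean_eq m hm fun l l' h => by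
    rw [← hK.ae_restrict_interior]; exact hE.perm l l' h
  refine ⟨p, hpd, fun N hN t => ?_⟩
  have hJ := hE.sub (hK.isWeakJet_pval hd (m + 1) p)
  have hJm : ∀ l, MemLp (fun x => E l x - pval (pdList l p) x) 2 (volume.restrict (hull K)) :=
    fun l => by rw [← hK.ae_restrict_interior]; exact hJ.memLp l
  -- The number `t` counts the orders still missing to `m + 1`. At `t = 0` the polynomial no longer
  -- contributes; each further step applies the Poincaré inequality to a mean-free derivative and
  -- sums over `d` directions, which gains the factor `d * 2 ^ d * diamK K`.
  induction t with
  | zero =>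
    intro l hl
    rw [pdList_eq_zero (p := p) (by omega)]
    simpa using hN l (by omega)
  | succ t ih =>
    intro l hl
    have h1 := hK.poincare_l2_of_le (hK.poincare isOpen_interior (hJ.grad l (by omega)) subset_rfl)
      (hp0 l (by omega))
    refine h1.trans ?_
    have hdiam : 0 ≤ diamK K := Metric.diam_nonneg
    calc _ ≤ 2 ^ d * diamK K * ∑ _j : Fin d, (d * 2 ^ d * diamK K) ^ t * N := by
          gcongr
          refine (l2_toLp_le fun j => hJm (j :: l)).trans (Finset.sum_le_sum fun j _ => ?_)
          exact ih (j :: l) (by simp; omega)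
      _ = _ := by
          rw [Finset.sum_const, Finset.card_univ, Fintype.card_fin, nsmul_eq_mul, pow_succ]; ring

/-- Polynomial approximation of a function in `H^{m+1}(Ω)` and of its gradient on a simplex. -/
theorem exists_approx (hd : 1 ≤ d) (m : ℕ) {Ω : Set (Pt d)} (hΩ : IsOpen Ω)
    (hKΩ : interior (hull K) ⊆ Ω) {u : Pt d → ℝ} {D : (n : ℕ) → (Fin n → Fin d) → Pt d → ℝ}
    (hu : IsSobolev (m + 1) Ω u D) {G : Pt d → Pt d} (hG : HasWeakGrad Ω u G) :
    ∃ p : MPoly d, p.totalDegree ≤ m ∧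
      l2 (volume.restrict (hull K)) (fun x => u x - pval p x) ≤
        (d * 2 ^ d * diamK K) ^ (m + 1) * √(∑ i, ∫ x in hull K, D (m + 1) i x ^ 2) ∧
      l2 (volume.restrict (hull K)) (fun x => G x - pgrad p x) ≤
        d * ((d * 2 ^ d * diamK K) ^ m * √(∑ i, ∫ x in hull K, D (m + 1) i x ^ 2)) := by
  obtain ⟨E, hE, hE0, hEm⟩ := hu.exists_isWeakJet hΩ
  have hle : volume.restrict (hull K) ≤ volume.restrict Ω := by
    rw [← hK.ae_restrict_interior]; exact Measure.restrict_mono hKΩ le_rfl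
  obtain ⟨p, hpd, hp⟩ := hK.bramble_hilbert hd m (hE.mono hKΩ hΩ.measurableSet)
  have hN : ∀ l : List (Fin d), l.length = m + 1 → l2 (volume.restrict (hull K)) (E l) ≤
      √(∑ i, ∫ x in hull K, D (m + 1) i x ^ 2) := fun l hl => by
    obtain ⟨i, hi⟩ := hEm l hl
    rw [hi, l2]
    refine Real.sqrt_le_sqrt ?_
    simp_rw [Real.norm_eq_abs, sq_abs]
    exact Finset.single_le_sum (f := fun i => ∫ x in hull K, D (m + 1) i x ^ 2)
      (fun i _ => integral_nonneg fun x => sq_nonneg _) (Finset.mem_univ i)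
  refine ⟨p, hpd, ?_, ?_⟩
  · refine le_trans (le_of_eq ?_) (hp _ hN (m + 1) [] (by simp))
    rw [l2, l2]
    congr 1
    refine integral_congr_ae ?_
    filter_upwards [ae_mono hle hE0] with x hx
    rw [hx, pdList_nil]
  · have hGE := hG.ae_eq hΩ ((hE.grad [] (by simp)).congr hE0 (EventuallyEq.refl _ _))
    have e : l2 (volume.restrict (hull K)) (fun x => G x - pgrad p x) =
        l2 (volume.restrict (hull K)) (fun x => (WithLp.toLp 2 fun j =>
          E [j] x - pval (pdList [j] p) x : Pt d)) := by
      rw [l2, l2]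
      congr 1
      refine integral_congr_ae ?_
      filter_upwards [ae_mono hle hGE] with x hx
      rw [hx]; rfl
    have hm : ∀ j, MemLp (fun x => E [j] x - pval (pdList [j] p) x) 2
        (volume.restrict (hull K)) := fun j =>
      ((hE.memLp [j]).mono_measure hle).sub
        (memLp_restrict_of_continuous (contDiff_pval _).continuous isCompact_hull 2)
    rw [e]
    refine (l2_toLp_le hm).trans ((Finset.sum_le_sum fun j _ => hp _ hN m [j] (by simp; omega)).trans
      (le_of_eq ?_))
    rw [Finset.sum_const, Finset.card_univ, Fintype.card_fin, nsmul_eq_mul]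

end IsSimplex

/-- The components of a function in `H^m`, `m ≥ 1`, have weak gradients. -/
theorem IsSobolev.exists_hasWeakGrad {m : ℕ} {Ω : Set (Pt d)} (hΩ : IsOpen Ω) {u : Pt d → ℝ}
    {D : (n : ℕ) → (Fin n → Fin d) → Pt d → ℝ} (hu : IsSobolev (m + 1) Ω u D) :
    ∃ H, HasWeakGrad Ω u H := by
  obtain ⟨E, hE, hE0, -⟩ := hu.exists_isWeakJet hΩ
  exact ⟨_, (hE.grad [] (by simp)).congr hE0 (EventuallyEq.refl _ _)⟩

/-! ### Sums over the facets of a triangulation -/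

theorem bdryInt_congr {K : Finset (Pt d)} {F F' : Pt d → Pt d → ℝ}
    (h : ∀ a ∈ K, ∀ x ∈ hull (facet K a), F a x = F' a x) : bdryInt K F = bdryInt K F' := by
  refine Finset.sum_congr rfl fun a ha => integral_congr_ae ?_
  filter_upwards [IsSimplex.ae_surf_mem (facet K a)] with x hx
  exact h a ha x hx

namespace Mesh

variable {Ω : Set (Pt d)} (T : Mesh Ω)

open Classical in
/-- The facets of the elements. -/
def facets : Finset (Finset (Pt d)) :=
  Finset.univ.biUnion fun K : T.cells => K.1.image (facet K.1)

theorem mem_facets {e : Finset (Pt d)} : e ∈ T.facets ↔ ∃ K ∈ T.cells, ∃ a ∈ K, facet K a = e := by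
  simp [facets]

theorem bdryFacets_subset : T.bdryFacets ⊆ T.facets := by
  intro e he
  simp only [bdryFacets, Finset.mem_filter, Set.Finite.mem_toFinset] at he
  obtain ⟨K, hK, hs, hcard⟩ := T.pure e he.1
  obtain ⟨a, haK, hae⟩ : ∃ a ∈ K, a ∉ e := by
    by_contra! h
    have := Finset.card_le_card h
    omega
  refine T.mem_facets.2 ⟨K, T.mem_cells.2 ⟨hK, hcard⟩, a, haK, ?_⟩
  refine (Finset.eq_of_subset_of_card_le (fun b hb => mem_facet.2 ⟨?_, hs hb⟩) ?_).symm
  · rintro rfl; exact hae hb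
  · rw [(T.isSimplex (T.mem_cells.2 ⟨hK, hcard⟩)).card_facet haK, he.2.1]

theorem hull_subset_frontier {e : Finset (Pt d)} (he : e ∈ T.bdryFacets) : hull e ⊆ frontier Ω := by
  simp only [bdryFacets, Finset.mem_filter] at he
  exact he.2.2

open Classical in
/-- The sum of the polynomials `ν K a` over the pairs with `facet K a = e`. -/
def facetSum (ν : T.cells → Pt d → MPoly d) (e : Finset (Pt d)) : MPoly d :=
  ∑ K : T.cells, ∑ a ∈ K.1, if facet K.1 a = e then ν K a else 0

theorem totalDegree_facetSum_le {k : ℕ} {ν : T.cells → Pt d → MPoly d}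
    (hν : ∀ K a, (ν K a).totalDegree ≤ k) (e : Finset (Pt d)) :
    (T.facetSum ν e).totalDegree ≤ k := by
  refine (MvPolynomial.totalDegree_finsetSum _ _).trans (Finset.sup_le fun K _ => ?_)
  refine (MvPolynomial.totalDegree_finsetSum _ _).trans (Finset.sup_le fun a _ => ?_)
  split_ifs
  · exact hν K a
  · simp

/-- The sum is regrouped by facets. At an interior facet the contributions of both sides meet, so
for normal components `facetSum` is the jump. -/
theorem sum_bdryInt_eq_sum_facets (hd : 1 ≤ d) (ν : T.cells → Pt d → MPoly d)
    {ψ : Finset (Pt d) → Pt d → ℝ} (hψ : ∀ e, Continuous (ψ e)) :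
    ∑ K : T.cells, bdryInt K.1 (fun a x => pval (ν K a) x * ψ (facet K.1 a) x) =
      ∑ e ∈ T.facets, ∫ x, pval (T.facetSum ν e) x * ψ e x ∂(surf e) := by
  classical
  have h1 : ∀ e ∈ T.facets, ∫ x, pval (T.facetSum ν e) x * ψ e x ∂(surf e) =
      ∑ K : T.cells, ∑ a ∈ K.1,
        if facet K.1 a = e then ∫ x, pval (ν K a) x * ψ e x ∂(surf e) else 0 := by
    intro e he
    obtain ⟨K₀, hK₀, a₀, ha₀, rfl⟩ := T.mem_facets.1 he
    have hi : ∀ p : MPoly d, Integrable (fun x => pval p x * ψ (facet K₀ a₀) x)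
        (surf (facet K₀ a₀)) := fun p =>
      (T.isSimplex hK₀).integrable_surf_of_continuous hd ha₀ (by have := hψ (facet K₀ a₀); fun_prop)
    simp_rw [facetSum, pval_sum, Finset.sum_mul]
    rw [integral_finsetSum _ fun K _ => integrable_finsetSum _ fun a _ => hi _]
    refine Finset.sum_congr rfl fun K _ => ?_
    rw [integral_finsetSum _ fun a _ => hi _]
    refine Finset.sum_congr rfl fun a _ => ?_
    split_ifs <;> simp
  rw [Finset.sum_congr rfl h1, Finset.sum_comm]
  refine Finset.sum_congr rfl fun K _ => ?_
  rw [bdryInt, Finset.sum_comm]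
  refine Finset.sum_congr rfl fun a ha => ?_
  rw [Finset.sum_ite_eq, if_pos (T.mem_facets.2 ⟨K.1, K.2, a, ha, rfl⟩)]

/-- If the jumps of the normal components of Raviart-Thomas fields are orthogonal to polynomials on
the facets inside the domain, then only the boundary facets contribute to sums over all facets. -/
theorem exists_sum_bdryInt_eq (hd : 1 ≤ d) {k : ℕ} {s : T.cells → Fin d → MPoly d}
    (hs : ∀ K, IsRT k (s K)) (hc : ∀ e ∉ T.bdryFacets, ∀ μ : MPoly d, μ.totalDegree ≤ k →
      open Classical in ∑ K : T.cells, bdryInt K.1 (fun a x => ⟪vval (s K) x, normal K.1 a⟫ *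
        pval ((Function.update 0 e μ : Finset (Pt d) → MPoly d) (facet K.1 a)) x) = 0) :
    ∃ N : Finset (Pt d) → MPoly d, (∀ e, (N e).totalDegree ≤ k) ∧
      ∀ ψ : Finset (Pt d) → Pt d → ℝ, (∀ e, Continuous (ψ e)) →
        ∑ K : T.cells, bdryInt K.1 (fun a x => ⟪vval (s K) x, normal K.1 a⟫ *
          ψ (facet K.1 a) x) = ∑ e ∈ T.bdryFacets, ∫ x, pval (N e) x * ψ e x ∂(surf e) := by
  classical
  have hex : ∀ (K : T.cells) (a : Pt d), ∃ ν : MPoly d, ν.totalDegree ≤ k ∧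
      (a ∈ K.1 → ∀ x ∈ hull (facet K.1 a), ⟪vval (s K) x, normal K.1 a⟫ = pval ν x) := by
    intro K a
    by_cases ha : a ∈ K.1
    · obtain ⟨ν, h1, h2⟩ := (T.isSimplex K.2).exists_normal_component hd (hs K) ha
      exact ⟨ν, h1, fun _ => h2⟩
    · exact ⟨0, by simp, fun h => absurd h ha⟩
  choose ν hνd hν using hex
  have hsum : ∀ ψ : Finset (Pt d) → Pt d → ℝ, (∀ e, Continuous (ψ e)) →
      ∑ K : T.cells, bdryInt K.1 (fun a x => ⟪vval (s K) x, normal K.1 a⟫ *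
        ψ (facet K.1 a) x) = ∑ e ∈ T.facets, ∫ x, pval (T.facetSum ν e) x * ψ e x ∂(surf e) := by
    intro ψ hψ
    rw [← T.sum_bdryInt_eq_sum_facets hd ν hψ]
    refine Finset.sum_congr rfl fun K _ => bdryInt_congr fun a ha x hx => ?_
    rw [hν K a ha x hx]
  refine ⟨T.facetSum ν, T.totalDegree_facetSum_le hνd, fun ψ hψ => ?_⟩
  rw [hsum ψ hψ]
  refine (Finset.sum_subset T.bdryFacets_subset fun e he heb => ?_).symm
  -- The jump is itself an admissible test polynomial, so its `L²` norm on an interior facet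
  -- vanishes.
  have h1 := hc e heb (T.facetSum ν e) (T.totalDegree_facetSum_le hνd e)
  rw [hsum (fun e' => pval ((Function.update 0 e (T.facetSum ν e) : Finset (Pt d) → MPoly d) e'))
    fun e' => by fun_prop, Finset.sum_eq_single_of_mem e he fun e' _ hne => by
      simp [Function.update_of_ne hne]] at h1
  simp only [Function.update_self] at h1
  obtain ⟨K, hK, a, ha, rfl⟩ := T.mem_facets.1 he
  have h2 : ∀ᵐ x ∂(surf (facet K a)), pval (T.facetSum ν (facet K a)) x *
      pval (T.facetSum ν (facet K a)) x = 0 :=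
    (integral_eq_zero_iff_of_nonneg (fun x => mul_self_nonneg _)
      ((T.isSimplex hK).integrable_surf_of_continuous hd ha
        ((contDiff_pval _).continuous.mul (contDiff_pval _).continuous))).1 h1
  refine integral_eq_zero_of_ae ?_
  filter_upwards [h2] with x hx
  rw [mul_self_eq_zero.1 hx, zero_mul]; rfl

/-- The sum over the elements with a test function living on one facet. -/
theorem sum_bdryInt_update (e : Finset (Pt d)) (μ : MPoly d) (X : T.cells → Pt d → Pt d → ℝ) :
    open Classical in ∑ K : T.cells, bdryInt K.1 (fun a x => X K a x *
        pval ((Function.update 0 e μ : Finset (Pt d) → MPoly d) (facet K.1 a)) x) =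
      ∑ K : T.cells, ∑ a ∈ K.1,
        if facet K.1 a = e then ∫ x, X K a x * pval μ x ∂(surf (facet K.1 a)) else 0 := by
  classical
  refine Finset.sum_congr rfl fun K _ => Finset.sum_congr rfl fun a _ => ?_
  split_ifs with h
  · simp only [h, Function.update_self]
  · simp only [Function.update_of_ne h, Pi.zero_apply, pval_zero, mul_zero, integral_zero]

/-- Fields with the normal moments of a field in `H¹` have continuous normal moments. -/
theorem sum_bdryInt_interpolant_eq_zero (hd : 1 ≤ d) (hΩo : IsOpen Ω)
    (hΩ : interior (closure Ω) = Ω) {k : ℕ} {q : Pt d → Pt d} {H : Fin d → Pt d → Pt d}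
    (hH : ∀ j, HasWeakGrad Ω (fun x => q x j) (H j)) {Q : T.cells → Fin d → MPoly d}
    (hQ : ∀ K : T.cells, ∀ a ∈ K.1, ∀ μ : MPoly d, μ.totalDegree ≤ k → ∃ μ' : MPoly d,
        (∀ x ∈ hull (facet K.1 a), pval μ' x = pval μ x) ∧
        ∫ x, ⟪vval (Q K) x, normal K.1 a⟫ * pval μ x ∂(surf (facet K.1 a)) =
          ‖bgrad K.1 a‖ * coneInt K.1 a (fun x => ⟪q x, normal K.1 a⟫)
            (fun x => ∑ j, normal K.1 a j • H j x) (pval μ'))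
    {e : Finset (Pt d)} (he : e ∉ T.bdryFacets) {μ : MPoly d} (hμ : μ.totalDegree ≤ k) :
    open Classical in ∑ K : T.cells, bdryInt K.1 (fun a x => ⟪vval (Q K) x, normal K.1 a⟫ *
        pval ((Function.update 0 e μ : Finset (Pt d) → MPoly d) (facet K.1 a)) x) = 0 := by
  classical
  rw [T.sum_bdryInt_update e μ fun K a x => ⟪vval (Q K) x, normal K.1 a⟫]
  refine T.sum_facet_eq_zero hd hΩo he
    (fun K a => ∫ x, ⟪vval (Q K) x, normal K.1 a⟫ * pval μ x ∂(surf (facet K.1 a)))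
    fun K K' hne a ha a' ha' h h' => ?_
  have hne' : K.1 ≠ K'.1 := fun hh => hne (Subtype.ext hh)
  -- The two sides come with different test polynomials `μ₁` and `μ₂`, which agree on the facet. The
  -- traces from both sides agree and the exterior normals are opposite, so the contributions
  -- cancel.
  obtain ⟨μ₁, h1, e1⟩ := hQ K a ha μ hμ
  obtain ⟨μ₂, h2, e2⟩ := hQ K' a' ha' μ hμ
  rw [e1, e2, T.normal_opposite hd K.2 K'.2 hne' ha ha' (h.trans h'.symm)]
  have h3 := T.coneInt_neighbor hd hΩo hΩ K.2 K'.2 hne' ha ha' (h.trans h'.symm)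
    (HasWeakGrad.inner_const hH (normal K.1 a)) (p := μ₁) (p' := μ₂) fun x hx => by
      rw [h1 x hx, h2 x (by rw [h', ← h]; exact hx)]
  rw [h3]
  have h4 := IsSimplex.coneInt_neg_left (K := K'.1) a' (fun x => ⟪q x, normal K.1 a⟫)
    (fun x => ∑ j, normal K.1 a j • H j x) (pval μ₂)
  simp only [inner_neg_right, PiLp.neg_apply, neg_smul, Finset.sum_neg_distrib] at h4 ⊢
  rw [h4]; ring

end Mesh

/-! ### The error of the Raviart-Thomas flux -/

theorem IsCoeff.inv {S : Set (Pt d)} {κ₀ κ₁ : ℝ} {κ : Pt d → ℝ} (h : IsCoeff S κ₀ κ₁ κ)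
    (h₀ : 0 < κ₀) : IsCoeff S κ₁⁻¹ κ₀⁻¹ fun x => (κ x)⁻¹ := by
  refine ⟨h.1.aemeasurable.inv.aestronglyMeasurable, ?_⟩
  filter_upwards [h.2] with x hx
  have := h₀.trans_le hx.1
  exact ⟨inv_anti₀ this hx.2, inv_anti₀ h₀ hx.1⟩

namespace Mesh

variable {Ω : Set (Pt d)} {T : Mesh Ω} {k : ℕ} {κ f g : Pt d → ℝ} {qh : T.cells → Fin d → MPoly d}
  {uh : T.cells → MPoly d} {lam : Finset (Pt d) → MPoly d}

/-- The divergence of a Raviart-Thomas field has degree at most `k`, so the second equation, tested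
on a single element, characterizes it as the projection. -/
theorem IsRTSolution.pdiv_eq_proj (h : T.IsRTSolution k κ f g qh uh lam) (K : T.cells)
    (hf : MemLp f 2 (volume.restrict (hull K.1))) : pdiv (qh K) = proj k K.1 f := by
  classical
  refine ((T.isSimplex K.2).existsUnique_isL2Proj k hf).unique
    ⟨(h.mem_V K).totalDegree_pdiv_le, fun v hv => ?_⟩ ((T.isSimplex K.2).isL2Proj_proj k hf)
  have h1 := h.divergence (Function.update 0 K v) fun K' => by
    by_cases hK : K' = K
    · subst hK; simpa using hv
    · simp [Function.update_of_ne hK]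
  rwa [Finset.sum_eq_single_of_mem K (Finset.mem_univ K), Finset.sum_eq_single_of_mem K
    (Finset.mem_univ K), Function.update_self] at h1
  all_goals
    intro K' _ hK
    simp [Function.update_of_ne hK]

/-- Green's formula on the triangulation for divergence free fields with continuous normal
components, for a function with a trace. -/
theorem sum_integral_inner_eq_trace (hd : 1 ≤ d) (hΩ : interior (closure Ω) = Ω)
    {s : T.cells → Fin d → MPoly d} (hdiv : ∀ K, pdiv (s K) = 0) {N : Finset (Pt d) → MPoly d}
    (hN : ∀ ψ : Finset (Pt d) → Pt d → ℝ, (∀ e, Continuous (ψ e)) →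
        ∑ K : T.cells, bdryInt K.1 (fun a x => ⟪vval (s K) x, normal K.1 a⟫ *
          ψ (facet K.1 a) x) = ∑ e ∈ T.bdryFacets, ∫ x, pval (N e) x * ψ e x ∂(surf e))
    {u : Pt d → ℝ} {G : Pt d → Pt d} (hu : HasWeakGrad Ω u G) (htr : HasTrace Ω u G g) :
    ∑ K : T.cells, ∫ x in hull K.1, ⟪G x, vval (s K) x⟫ =
      ∑ e ∈ T.bdryFacets, ∫ x, pval (N e) x * g x ∂(surf e) := by
  obtain ⟨hg, φ, hφ, -, hφG, hφg⟩ := htr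
  have hφ1 : ∀ n, ContDiff ℝ 1 (φ n) := fun n => (hφ n).of_le (by exact_mod_cast le_top)
  have hle : ∀ K : T.cells, volume.restrict (hull K.1) ≤ volume.restrict Ω := fun K =>
    T.restrict_hull_le hΩ K.2
  -- For smooth functions this is Green's formula on the elements. The notion of trace supplies
  -- smooth functions that converge in the domain and on its boundary, so both sides pass to the
  -- limit.
  have hn : ∀ n, ∑ K : T.cells, ∫ x in hull K.1, ⟪∇ (φ n) x, vval (s K) x⟫ =
      ∑ e ∈ T.bdryFacets, ∫ x, pval (N e) x * φ n x ∂(surf e) := by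
    intro n
    rw [← hN (fun _ => φ n) fun _ => (hφ n).continuous]
    refine Finset.sum_congr rfl fun K _ => ?_
    have := (T.isSimplex K.2).integral_divergence hd (hφ1 n) (s K)
    rw [hdiv] at this
    simp only [pval_zero, mul_zero, integral_zero, zero_add] at this
    rw [← this]
    simp_rw [real_inner_comm]
  have h1 : Tendsto (fun n => ∑ K : T.cells, ∫ x in hull K.1, ⟪∇ (φ n) x, vval (s K) x⟫) atTop
      (𝓝 (∑ K : T.cells, ∫ x in hull K.1, ⟪G x, vval (s K) x⟫)) := by
    refine tendsto_finsetSum _ fun K _ => tendsto_integral_inner (hu.memLp_grad.mono_measure (hle K))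
      (fun n => memLp_restrict_of_continuous (continuous_gradient (hφ1 n)) IsSimplex.isCompact_hull 2)
      (tendsto_of_tendsto_of_tendsto_of_le_of_le tendsto_const_nhds hφG (fun _ => zero_le)
        fun n => eLpNorm_mono_measure _ (hle K))
      (memLp_restrict_of_continuous (by fun_prop) IsSimplex.isCompact_hull 2)
  have h2 : Tendsto (fun n => ∑ e ∈ T.bdryFacets, ∫ x, pval (N e) x * φ n x ∂(surf e)) atTop
      (𝓝 (∑ e ∈ T.bdryFacets, ∫ x, pval (N e) x * g x ∂(surf e))) := by
    refine tendsto_finsetSum _ fun e he => ?_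
    obtain ⟨K, hK, a, ha, rfl⟩ := T.mem_facets.1 (T.bdryFacets_subset he)
    have hsub : hull (facet K a) ⊆ frontier Ω := T.hull_subset_frontier he
    have hse : surf (facet K a) ≤ (μHE[d - 1]).restrict (frontier Ω) :=
      Measure.restrict_mono hsub le_rfl
    have := tendsto_integral_inner (hg.mono_measure hse)
      (fun n => (T.isSimplex hK).memLp_surf_of_continuous hd ha (hφ n).continuous 2)
      (tendsto_of_tendsto_of_tendsto_of_le_of_le tendsto_const_nhds hφg (fun _ => zero_le)
        fun n => eLpNorm_mono_measure _ hse)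
      ((T.isSimplex hK).memLp_surf_of_continuous hd ha
        (contDiff_pval (N (facet K a))).continuous 2)
    simpa only [RCLike.inner_apply, RCLike.conj_to_real] using this
  simp_rw [hn] at h1
  exact tendsto_nhds_unique h1 h2

/-- The error of the Raviart-Thomas flux is orthogonal to divergence free conforming fields. -/
theorem IsRTSolution.sum_integral_sub_eq_zero (h : T.IsRTSolution k κ f g qh uh lam) (hd : 1 ≤ d)
    (hΩ : interior (closure Ω) = Ω) {κ₀ κ₁ : ℝ} (h₀ : 0 < κ₀) (hκ : IsCoeff Ω κ₀ κ₁ κ)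
    {u : Pt d → ℝ} {G q : Pt d → Pt d} (hsol : IsSolution Ω κ f u G q) (htr : HasTrace Ω u G g)
    {s : T.cells → Fin d → MPoly d} (hs : ∀ K, IsRT k (s K)) (hdiv : ∀ K, pdiv (s K) = 0)
    (hc : ∀ e ∉ T.bdryFacets, ∀ μ : MPoly d, μ.totalDegree ≤ k →
      open Classical in ∑ K : T.cells, bdryInt K.1 (fun a x => ⟪vval (s K) x, normal K.1 a⟫ *
        pval ((Function.update 0 e μ : Finset (Pt d) → MPoly d) (facet K.1 a)) x) = 0) :
    ∑ K : T.cells, ∫ x in hull K.1, (κ x)⁻¹ * ⟪q x - vval (qh K) x, vval (s K) x⟫ = 0 := by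
  obtain ⟨N, hNd, hN⟩ := T.exists_sum_bdryInt_eq hd hs hc
  have hle : ∀ K : T.cells, volume.restrict (hull K.1) ≤ volume.restrict Ω := fun K =>
    T.restrict_hull_le hΩ K.2
  -- The terms with `u_h` vanish because `s` is divergence-free. Continuity of the normal components
  -- leaves only boundary facets in the terms with the hybrid variable, where it may be replaced by
  -- `g`, the trace of `u`.
  have h1 := sum_integral_inner_eq_trace hd hΩ hdiv hN hsol.grad htr
  have h2 := h.gradient s hs
  have h3 := hN (fun e => pval (lam e)) fun e => (contDiff_pval _).continuous
  have h4 := h.boundary N hNd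
  have h5 : ∀ K : T.cells, ∫ x in hull K.1, (κ x)⁻¹ * ⟪q x - vval (qh K) x, vval (s K) x⟫ =
      -(∫ x in hull K.1, ⟪G x, vval (s K) x⟫) -
        ∫ x in hull K.1, (κ x)⁻¹ * ⟪vval (qh K) x, vval (s K) x⟫ := by
    intro K
    have hκK := (hκ.mono (hle K)).inv h₀
    have hvm : ∀ R : Fin d → MPoly d, MemLp (vval R) 2 (volume.restrict (hull K.1)) := fun R =>
      memLp_restrict_of_continuous (by fun_prop) IsSimplex.isCompact_hull 2
    have hq := hsol.div.memLp.mono_measure (hle K)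
    have i1 := integrable_inner_of_memLp (hsol.grad.memLp_grad.mono_measure (hle K)) (hvm (s K))
    have i2 : Integrable (fun x => (κ x)⁻¹ * ⟪vval (qh K) x, vval (s K) x⟫)
        (volume.restrict (hull K.1)) := by
      have hb : ∀ᵐ x ∂(volume.restrict (hull K.1)), ‖(κ x)⁻¹‖ ≤ κ₀⁻¹ := by
        filter_upwards [(hκ.mono (hle K)).2] with x hx
        rw [Real.norm_of_nonneg (inv_nonneg.2 (h₀.le.trans hx.1))]
        exact inv_anti₀ h₀ hx.1
      exact (integrable_inner_of_memLp (hvm (qh K)) (hvm (s K))).bdd_mul hκK.1 hb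
    rw [← integral_neg]
    refine Eq.trans ?_ (integral_sub i1.neg i2)
    refine integral_congr_ae ?_
    filter_upwards [ae_mono (hle K) hsol.law] with x hx
    have hG : G x = -((κ x)⁻¹ • q x) := eq_neg_of_add_eq_zero_right hx
    rw [hG, inner_neg_left, neg_neg, real_inner_smul_left, inner_sub_left]
    ring
  simp_rw [h5, Finset.sum_sub_distrib, Finset.sum_neg_distrib]
  have h6 : ∀ K : T.cells, ∫ x in hull K.1, pval (uh K) x * pval (pdiv (s K)) x = 0 := fun K => by
    simp [hdiv]
  simp_rw [h6, sub_zero, Finset.sum_add_distrib] at h2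
  simp_rw [mul_comm ⟪_, _⟫] at h3
  have h7 : ∑ e ∈ T.bdryFacets, ∫ x, pval (N e) x * pval (lam e) x ∂(surf e) =
      ∑ e ∈ T.bdryFacets, ∫ x, pval (N e) x * g x ∂(surf e) := by
    simpa only [mul_comm] using h4
  rw [h1, ← h7, ← h3]
  linarith

/-- The error of the flux is bounded by the error of any conforming interpolant with the same
divergence. -/
theorem IsRTSolution.flux_error_le (h : T.IsRTSolution k κ f g qh uh lam) (hd : 1 ≤ d)
    (hΩ : interior (closure Ω) = Ω) {κ₀ κ₁ : ℝ} (h₀ : 0 < κ₀) (h₁ : κ₀ ≤ κ₁)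
    (hκ : IsCoeff Ω κ₀ κ₁ κ)
    {u : Pt d → ℝ} {G q : Pt d → Pt d} (hsol : IsSolution Ω κ f u G q) (htr : HasTrace Ω u G g)
    {Q : T.cells → Fin d → MPoly d} (hQ : ∀ K, IsRT k (Q K)) (hdiv : ∀ K, pdiv (Q K) = proj k K.1 f)
    (hc : ∀ e ∉ T.bdryFacets, ∀ μ : MPoly d, μ.totalDegree ≤ k →
      open Classical in ∑ K : T.cells, bdryInt K.1 (fun a x => ⟪vval (Q K) x, normal K.1 a⟫ *
        pval ((Function.update 0 e μ : Finset (Pt d) → MPoly d) (facet K.1 a)) x) = 0) :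
    √(∑ K : T.cells, l2 (volume.restrict (hull K.1)) (fun x => q x - vval (qh K) x) ^ 2) ≤
      (1 + κ₁ * κ₀⁻¹) *
        √(∑ K : T.cells, l2 (volume.restrict (hull K.1)) (fun x => q x - vval (Q K) x) ^ 2) := by
  classical
  have hle : ∀ K : T.cells, volume.restrict (hull K.1) ≤ volume.restrict Ω := fun K =>
    T.restrict_hull_le hΩ K.2
  have hκ₁ : 0 < κ₁ := h₀.trans_le h₁
  have hfK : ∀ K : T.cells, MemLp f 2 (volume.restrict (hull K.1)) := fun K =>
    hsol.div.memLp_div.mono_measure (hle K)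
  have hqK : ∀ K : T.cells, MemLp q 2 (volume.restrict (hull K.1)) := fun K =>
    hsol.div.memLp.mono_measure (hle K)
  have hvm : ∀ (K : T.cells) (R : Fin d → MPoly d), MemLp (vval R) 2 (volume.restrict (hull K.1)) :=
    fun K R => memLp_restrict_of_continuous (by fun_prop) IsSimplex.isCompact_hull 2
  -- The difference `Q - q_h` is divergence-free and conforming, so the error `q - q_h` is
  -- orthogonal to it. The bounds for `κ⁻¹` then give `‖Q - q_h‖ ≤ κ₁ κ₀⁻¹ ‖q - Q‖`.
  obtain ⟨s, hs⟩ : ∃ s : T.cells → Fin d → MPoly d, ∀ K, s K = Q K - qh K := ⟨_, fun _ => rfl⟩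
  have hsv : ∀ K x, vval (s K) x = vval (Q K) x - vval (qh K) x := fun K x => by
    rw [hs, vval_sub]
  have horth := h.sum_integral_sub_eq_zero hd hΩ h₀ hκ hsol htr (s := s)
    (fun K => by rw [hs]; exact (hQ K).sub (h.mem_V K))
    (fun K => by rw [hs, pdiv_sub, hdiv, h.pdiv_eq_proj K (hfK K), sub_self]) ?_
  · have key : κ₁⁻¹ * ∑ K : T.cells, l2 (volume.restrict (hull K.1)) (vval (s K)) ^ 2 ≤
        κ₀⁻¹ * ∑ K : T.cells, l2 (volume.restrict (hull K.1)) (fun x => q x - vval (Q K) x) *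
          l2 (volume.restrict (hull K.1)) (vval (s K)) := by
      have e1 : ∀ K : T.cells, κ₁⁻¹ * l2 (volume.restrict (hull K.1)) (vval (s K)) ^ 2 -
          κ₀⁻¹ * (l2 (volume.restrict (hull K.1)) (fun x => q x - vval (Q K) x) *
            l2 (volume.restrict (hull K.1)) (vval (s K))) ≤
          ∫ x in hull K.1, (κ x)⁻¹ * ⟪q x - vval (qh K) x, vval (s K) x⟫ := by
        intro K
        have hκK := (hκ.mono (hle K)).inv h₀
        have hκ₁' : 0 < κ₁⁻¹ := inv_pos.2 hκ₁
        have b1 := hκK.mul_l2_sq_le hκ₁' (hvm K (s K))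
        have b2 := hκK.integral_inner_le hκ₁' (inv_pos.2 h₀).le
          ((hvm K (Q K)).sub (hqK K)) (hvm K (s K))
        have i1 := hκK.integrable_inner hκ₁' (hvm K (s K)) (hvm K (s K))
        have i2 := hκK.integrable_inner hκ₁' ((hvm K (Q K)).sub (hqK K)) (hvm K (s K))
        have e2 : ∫ x in hull K.1, (κ x)⁻¹ * ⟪q x - vval (qh K) x, vval (s K) x⟫ =
            (∫ x in hull K.1, (κ x)⁻¹ * ⟪vval (s K) x, vval (s K) x⟫) -
              ∫ x in hull K.1, (κ x)⁻¹ * ⟪(vval (Q K) - q) x, vval (s K) x⟫ := by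
          rw [← integral_sub i1 i2]
          refine integral_congr_ae (ae_of_all _ fun x => ?_)
          simp only
          rw [← mul_sub, ← inner_sub_left]
          congr 2
          rw [hsv, Pi.sub_apply]; abel
        have e3 : l2 (volume.restrict (hull K.1)) (vval (Q K) - q) =
            l2 (volume.restrict (hull K.1)) (fun x => q x - vval (Q K) x) := by
          rw [l2, l2]; simp_rw [Pi.sub_apply, norm_sub_rev]
        rw [e3] at b2
        rw [e2]
        linarith
      have := Finset.sum_le_sum fun K (_ : K ∈ Finset.univ) => e1 K
      rw [horth, Finset.sum_sub_distrib, ← Finset.mul_sum, ← Finset.mul_sum] at this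
      linarith
    have hCS := Real.sum_mul_le_sqrt_mul_sqrt Finset.univ
      (fun K : T.cells => l2 (volume.restrict (hull K.1)) (fun x => q x - vval (Q K) x))
      (fun K : T.cells => l2 (volume.restrict (hull K.1)) (vval (s K)))
    obtain ⟨A, hA⟩ : ∃ A, A = √(∑ K : T.cells, l2 (volume.restrict (hull K.1)) (vval (s K)) ^ 2) :=
      ⟨_, rfl⟩
    obtain ⟨B, hB⟩ : ∃ B, B = √(∑ K : T.cells, l2 (volume.restrict (hull K.1))
      (fun x => q x - vval (Q K) x) ^ 2) := ⟨_, rfl⟩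
    have hA0 : 0 ≤ A := hA ▸ Real.sqrt_nonneg _
    have hB0 : 0 ≤ B := hB ▸ Real.sqrt_nonneg _
    have hA2 : ∑ K : T.cells, l2 (volume.restrict (hull K.1)) (vval (s K)) ^ 2 = A ^ 2 := by
      rw [hA, Real.sq_sqrt (Finset.sum_nonneg fun K _ => sq_nonneg _)]
    rw [hA2] at key
    rw [← hA, ← hB] at hCS
    have hAB : A ≤ κ₁ * κ₀⁻¹ * B := by
      have h3 : κ₁⁻¹ * A ^ 2 ≤ κ₀⁻¹ * (B * A) :=
        key.trans (mul_le_mul_of_nonneg_left hCS (inv_pos.2 h₀).le)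
      rcases hA0.eq_or_lt with h4 | h4
      · rw [← h4]; positivity
      · have h5 : κ₁⁻¹ * A ≤ κ₀⁻¹ * B := le_of_mul_le_mul_right (by linarith) h4
        calc A = κ₁ * (κ₁⁻¹ * A) := by rw [mul_inv_cancel_left₀ hκ₁.ne']
          _ ≤ κ₁ * (κ₀⁻¹ * B) := mul_le_mul_of_nonneg_left h5 hκ₁.le
          _ = _ := by ring
    have h6 : ∀ K : T.cells, l2 (volume.restrict (hull K.1)) (fun x => q x - vval (qh K) x) ≤
        l2 (volume.restrict (hull K.1)) (fun x => q x - vval (Q K) x) +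
          l2 (volume.restrict (hull K.1)) (vval (s K)) := fun K => by
      refine le_trans (le_of_eq ?_) (l2_add_le ((hqK K).sub (hvm K (Q K))) (hvm K (s K)))
      congr 1; funext x
      rw [hsv]; abel
    refine (sqrt_sum_sq_le _ _ _ (fun K _ => l2_nonneg _) fun K _ => h6 K).trans ?_
    refine (sqrt_sum_add_sq_le _ _ _).trans ?_
    rw [← hA, ← hB]
    linarith
  · intro e he μ hμ
    have h1 := hc e he μ hμ
    have h2 := h.continuity (Function.update 0 e μ) (fun e' => by
      by_cases hee : e' = e
      · subst hee; simpa using hμ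
      · simp [Function.update_of_ne hee]) (fun e' he' => by
        rw [Function.update_of_ne (by rintro rfl; exact he he')]; rfl)
    refine Eq.trans ?_ (sub_eq_zero.2 (h1.trans h2.symm))
    rw [← Finset.sum_sub_distrib]
    refine Finset.sum_congr rfl fun K _ => ?_
    rw [bdryInt, bdryInt, bdryInt, ← Finset.sum_sub_distrib]
    refine Finset.sum_congr rfl fun a ha => ?_
    rw [← integral_sub ((T.isSimplex K.2).integrable_surf_of_continuous hd ha (by fun_prop))
      ((T.isSimplex K.2).integrable_surf_of_continuous hd ha (by fun_prop))]
    refine integral_congr_ae (ae_of_all _ fun x => ?_)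
    simp only [hsv, inner_sub_left, sub_mul]

end Mesh

/-! ### Postprocessing of the Raviart-Thomas approximation -/

theorem pval_pdiv (Q : Fin d → MPoly d) (x : Pt d) :
    pval (pdiv Q) x = ∑ j, pgrad (Q j) x j := by
  simp [pdiv]

namespace IsSimplex

variable {K : Finset (Pt d)} (hK : IsSimplex K)
include hK

/-- The local error of the postprocessing in terms of the error of the flux. -/
theorem postprocessing_error_le (hd : 1 ≤ d) {κ₀ κ₁ : ℝ} (h₀ : 0 < κ₀) (h₁ : κ₀ ≤ κ₁)
    {κ f u : Pt d → ℝ} {G q : Pt d → Pt d} (hκ : IsCoeff (hull K) κ₀ κ₁ κ)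
    (hu : MemLp u 2 (volume.restrict (hull K))) (hG : MemLp G 2 (volume.restrict (hull K)))
    (hq : MemLp q 2 (volume.restrict (hull K))) (hf : MemLp f 2 (volume.restrict (hull K)))
    (hlaw : ∀ᵐ x ∂(volume.restrict (hull K)), (κ x)⁻¹ • q x + G x = 0) (k : ℕ) {n : ℕ}
    {R : Fin d → MPoly d} (hR : pdiv R = proj k K f) {uh w P : MPoly d} (hw : w.totalDegree ≤ n)
    (hP : P.totalDegree ≤ n) (hmean : ∫ x in hull K, pval w x = ∫ x in hull K, pval uh x)
    (hflux : ∀ v : MPoly d, v.totalDegree ≤ n →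
      ∫ x in hull K, κ x * ⟪pgrad w x, pgrad v x⟫ = (∫ x in hull K, f x * pval v x) -
        bdryInt K fun a x => ⟪vval R x, normal K a⟫ * pval v x) :
    l2 (volume.restrict (hull K)) (fun x => u x - pval w x) ≤
      2 * l2 (volume.restrict (hull K)) (fun x => u x - pval P x) +
      l2 (volume.restrict (hull K)) (fun x => pval uh x - pval (proj k K u) x) +
      2 ^ d * κ₀⁻¹ * diamK K * (κ₁ * l2 (volume.restrict (hull K)) (fun x => G x - pgrad P x) +
        2 ^ d * diamK K * l2 (volume.restrict (hull K)) (fun x => f x - pval (proj k K f) x) +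
        l2 (volume.restrict (hull K)) (fun x => q x - vval R x)) := by
  have hκ₁ : 0 ≤ κ₁ := h₀.le.trans h₁
  have hdiam : 0 ≤ diamK K := Metric.diam_nonneg
  have hpm : ∀ p : MPoly d, MemLp (pval p) 2 (volume.restrict (hull K)) := fun p =>
    memLp_restrict_of_continuous (contDiff_pval p).continuous isCompact_hull 2
  have hgm : ∀ p : MPoly d, MemLp (pgrad p) 2 (volume.restrict (hull K)) := fun p =>
    memLp_restrict_of_continuous (by fun_prop) isCompact_hull 2
  have hvm : MemLp (vval R) 2 (volume.restrict (hull K)) :=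
    memLp_restrict_of_continuous (by fun_prop) isCompact_hull 2
  have n1 := l2_nonneg (μ := volume.restrict (hull K)) fun x => G x - pgrad P x
  have n2 := l2_nonneg (μ := volume.restrict (hull K)) fun x => f x - pval (proj k K f) x
  have n3 := l2_nonneg (μ := volume.restrict (hull K)) fun x => q x - vval R x
  refine hK.local_error h₀ hκ hu (hpm uh) k hw hP hmean (by positivity) fun v hv h0 => ?_
  have e1 := hflux v hv
  -- Because `div R = Π_k f`, the right side of the local problem becomes `(f - Π_k f, v) - (R,
  -- ∇v)`. Only volume norms remain, and no estimate for the normal trace of `q - R` is needed.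
  have e2 := hK.integral_divergence hd ((contDiff_pval v).of_le (by norm_num)) R
  simp only [gradient_pval] at e2
  rw [← e2, hR] at e1
  have i1 := hκ.integrable_inner h₀ (hG.sub (hgm P)) (hgm v)
  have i2 := integrable_inner_of_memLp (hq.sub hvm) (hgm v)
  have i3 : Integrable (fun x => (f x - pval (proj k K f) x) * pval v x) (volume.restrict (hull K)) :=
    (hf.sub (hpm _)).integrable_mul (hpm v)
  have key : ∫ x in hull K, κ x * ⟪pgrad w x - pgrad P x, pgrad v x⟫ =
      (∫ x in hull K, κ x * ⟪(G - pgrad P) x, pgrad v x⟫) +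
        (∫ x in hull K, ⟪(q - vval R) x, pgrad v x⟫) +
        ∫ x in hull K, (f x - pval (proj k K f) x) * pval v x := by
    have iw := hκ.integrable_inner h₀ (hgm w) (hgm v)
    have iP := hκ.integrable_inner h₀ (hgm P) (hgm v)
    have iR := integrable_inner_of_memLp hvm (hgm v)
    have iq := integrable_inner_of_memLp hq (hgm v)
    have iG := hκ.integrable_inner h₀ hG (hgm v)
    have jf : Integrable (fun x => f x * pval v x) (volume.restrict (hull K)) :=
      hf.integrable_mul (hpm v)
    have jp : Integrable (fun x => pval v x * pval (proj k K f) x) (volume.restrict (hull K)) :=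
      (hpm v).integrable_mul (hpm _)
    have g1 : ∫ x in hull K, κ x * ⟪G x, pgrad v x⟫ = - ∫ x in hull K, ⟪q x, pgrad v x⟫ := by
      rw [← integral_neg]
      refine integral_congr_ae ?_
      filter_upwards [hlaw, hκ.2] with x hx hκx
      have hk : κ x ≠ 0 := (h₀.trans_le hκx.1).ne'
      have hGx : G x = -((κ x)⁻¹ • q x) := eq_neg_of_add_eq_zero_right hx
      rw [hGx, inner_neg_left, real_inner_smul_left, mul_neg, mul_inv_cancel_left₀ hk]
    have g2 : ∫ x in hull K, κ x * ⟪pgrad w x - pgrad P x, pgrad v x⟫ =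
        (∫ x in hull K, κ x * ⟪pgrad w x, pgrad v x⟫) -
          ∫ x in hull K, κ x * ⟪pgrad P x, pgrad v x⟫ := by
      rw [← integral_sub iw iP]; simp_rw [inner_sub_left, mul_sub]
    have g3 : ∫ x in hull K, κ x * ⟪(G - pgrad P) x, pgrad v x⟫ =
        (∫ x in hull K, κ x * ⟪G x, pgrad v x⟫) -
          ∫ x in hull K, κ x * ⟪pgrad P x, pgrad v x⟫ := by
      rw [← integral_sub iG iP]; simp_rw [Pi.sub_apply, inner_sub_left, mul_sub]
    have g4 : ∫ x in hull K, ⟪(q - vval R) x, pgrad v x⟫ =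
        (∫ x in hull K, ⟪q x, pgrad v x⟫) - ∫ x in hull K, ⟪vval R x, pgrad v x⟫ := by
      rw [← integral_sub iq iR]; simp_rw [Pi.sub_apply, inner_sub_left]
    have g5 : ∫ x in hull K, (f x - pval (proj k K f) x) * pval v x =
        (∫ x in hull K, f x * pval v x) - ∫ x in hull K, pval v x * pval (proj k K f) x := by
      rw [← integral_sub jf jp]
      refine integral_congr_ae (ae_of_all _ fun x => ?_)
      simp only; ring
    rw [g2, g3, g4, g5, g1, e1]
    ring
  have b1 := hκ.integral_inner_le h₀ hκ₁ (hG.sub (hgm P)) (hgm v)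
  have b2 := (le_abs_self _).trans (abs_integral_inner_le (hq.sub hvm) (hgm v))
  -- The projection error of `f` is only of order `h^k`; the Poincaré inequality for the mean-free
  -- `v` supplies an additional factor `diamK K`.
  have b3 : ∫ x in hull K, (f x - pval (proj k K f) x) * pval v x ≤
      l2 (volume.restrict (hull K)) (fun x => f x - pval (proj k K f) x) *
        (2 ^ d * diamK K * l2 (volume.restrict (hull K)) (pgrad v)) := by
    have h3 := (le_abs_self _).trans (abs_integral_inner_le (hpm v) (hf.sub (hpm (proj k K f))))
    simp only [RCLike.inner_apply, RCLike.conj_to_real] at h3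
    refine le_trans h3 ?_
    rw [mul_comm]
    exact mul_le_mul_of_nonneg_left (hK.poincare_poly h0) n2
  rw [key]
  have e3 : l2 (volume.restrict (hull K)) (G - pgrad P) =
    l2 (volume.restrict (hull K)) fun x => G x - pgrad P x := rfl
  have e4 : l2 (volume.restrict (hull K)) (q - vval R) =
    l2 (volume.restrict (hull K)) fun x => q x - vval R x := rfl
  rw [e3] at b1
  rw [e4] at b2
  linarith

end IsSimplex

/-- Approximation of a smooth flux and of its divergence on a simplex. -/
theorem exists_flux_interpolant (hd : 1 ≤ d) (k : ℕ) (γ : ℝ) : ∃ C : ℝ, 0 ≤ C ∧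
    ∀ (Ω : Set (Pt d)), IsOpen Ω → ∀ (q : Pt d → Pt d) (f : Pt d → ℝ), HasWeakDiv Ω q f →
    ∀ (Dq : Fin d → (n : ℕ) → (Fin n → Fin d) → Pt d → ℝ),
    (∀ j, IsSobolev (k + 1) Ω (fun x => q x j) (Dq j)) →
    ∀ (H : Fin d → Pt d → Pt d), (∀ j, HasWeakGrad Ω (fun x => q x j) (H j)) →
    ∀ (K : Finset (Pt d)), IsSimplex K → interior (hull K) ⊆ Ω → ∀ (c : Pt d) (r : ℝ), 0 < r →
    Metric.closedBall c r ⊆ hull K → diamK K ≤ γ * (2 * r) →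
    ∃ Q : Fin d → MPoly d, IsRT k Q ∧ pdiv Q = proj k K f ∧
      (∀ a ∈ K, ∀ μ : MPoly d, μ.totalDegree ≤ k → ∃ μ' : MPoly d,
        (∀ x ∈ hull (facet K a), pval μ' x = pval μ x) ∧
        ∫ x, ⟪vval Q x, normal K a⟫ * pval μ x ∂(surf (facet K a)) =
          ‖bgrad K a‖ * coneInt K a (fun x => ⟪q x, normal K a⟫)
            (fun x => ∑ j, normal K a j • H j x) (pval μ')) ∧
      l2 (volume.restrict (hull K)) (fun x => q x - vval Q x) ≤
        C * diamK K ^ (k + 1) * ∑ j, √(∑ i, ∫ x in hull K, Dq j (k + 1) i x ^ 2) ∧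
      l2 (volume.restrict (hull K)) (fun x => f x - pval (proj k K f) x) ≤
        C * diamK K ^ k * ∑ j, √(∑ i, ∫ x in hull K, Dq j (k + 1) i x ^ 2) := by
  obtain ⟨C, hC, hint⟩ := exists_rt_interpolant hd k γ
  obtain ⟨b, hb⟩ : ∃ b : ℝ, b = d * 2 ^ d := ⟨_, rfl⟩
  have hb0 : 0 ≤ b := by rw [hb]; positivity
  refine ⟨C * (b ^ (k + 1) + d * b ^ k) + d * b ^ k, by positivity,
    fun Ω hΩ q f hq Dq hDq H hH K hK hKΩ c r hr hball hdiam => ?_⟩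
  have hle : volume.restrict (hull K) ≤ volume.restrict Ω := by
    rw [← hK.ae_restrict_interior]; exact Measure.restrict_mono hKΩ le_rfl
  have hdiv := ae_mono hle (hq.ae_eq hΩ hH)
  have hf := hq.memLp_div.mono_measure hle
  have hh : 0 ≤ diamK K := Metric.diam_nonneg
  choose p hpd hp1 hp2 using fun j => hK.exists_approx hd k hΩ hKΩ (hDq j) (hH j)
  obtain ⟨V, hV⟩ : ∃ V : Fin d → ℝ, ∀ j, V j = √(∑ i, ∫ x in hull K, Dq j (k + 1) i x ^ 2) :=
    ⟨_, fun _ => rfl⟩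
  have hV0 : ∀ j, 0 ≤ V j := fun j => hV j ▸ Real.sqrt_nonneg _
  simp_rw [← hV, ← hb] at hp1 hp2 ⊢
  have hVs : 0 ≤ ∑ j, V j := Finset.sum_nonneg fun j _ => hV0 j
  have hproj := hK.isL2Proj_proj k hf
  obtain ⟨Q, hQ1, hQ2, hQ3, hQ4⟩ := hint K hK c r hr hball hdiam q H
    (fun j => (hH j).mono hKΩ hΩ.measurableSet) (proj k K f) hproj.1
    (fun v hv => by
      rw [hproj.2 v hv]
      refine integral_congr_ae ?_
      filter_upwards [hdiv] with x hx
      rw [hx]) p hpd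
  have hpm : ∀ p : MPoly d, MemLp (pval p) 2 (volume.restrict (hull K)) := fun p =>
    memLp_restrict_of_continuous (contDiff_pval p).continuous IsSimplex.isCompact_hull 2
  have hHm : ∀ j, MemLp (fun x => H j x - pgrad (p j) x) 2 (volume.restrict (hull K)) := fun j =>
    ((hH j).memLp_grad.mono_measure hle).sub
      (memLp_restrict_of_continuous (by fun_prop) IsSimplex.isCompact_hull 2)
  have b1 : l2 (volume.restrict (hull K)) (fun x => q x - vval p x) ≤
      (b * diamK K) ^ (k + 1) * ∑ j, V j := by
    rw [Finset.mul_sum]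
    refine le_trans (le_of_eq ?_) ((l2_toLp_le fun j => ((hH j).memLp.mono_measure hle).sub
      (hpm (p j))).trans (Finset.sum_le_sum fun j _ => hp1 j))
    rfl
  have b2 : ∑ j, l2 (volume.restrict (hull K)) (fun x => H j x - pgrad (p j) x) ≤
      d * (b * diamK K) ^ k * ∑ j, V j := by
    rw [Finset.mul_sum]
    exact Finset.sum_le_sum fun j _ => (hp2 j).trans_eq (by ring)
  have b3 : l2 (volume.restrict (hull K)) (fun x => f x - pval (proj k K f) x) ≤
      d * (b * diamK K) ^ k * ∑ j, V j := by
    -- Almost everywhere `f` is the divergence of `q`, so `div p` is a competitor for the best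
    -- approximation of `f`.
    refine le_trans ?_ b2
    have hdeg : (pdiv p).totalDegree ≤ k := (IsRT.of_totalDegree_le hpd).totalDegree_pdiv_le
    refine (hK.l2_sub_proj_le k hf hdeg).trans ?_
    have e : l2 (volume.restrict (hull K)) (fun x => f x - pval (pdiv p) x) =
        l2 (volume.restrict (hull K)) (fun x => ∑ j, (H j x - pgrad (p j) x) j) := by
      rw [l2, l2]
      congr 1
      refine integral_congr_ae ?_
      filter_upwards [hdiv] with x hx
      simp only [hx, pval_pdiv, PiLp.sub_apply, Finset.sum_sub_distrib]
    rw [e]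
    refine (l2_sum_le _ fun j _ => memLp_coord (hHm j) j).trans (Finset.sum_le_sum fun j _ => ?_)
    refine (l2_mono (hHm j) zero_le_one (ae_of_all _ fun x => ?_)).trans_eq (one_mul _)
    rw [one_mul]
    exact PiLp.norm_apply_le _ j
  refine ⟨Q, hQ1, hQ2, hQ3, ?_, ?_⟩
  · calc _ ≤ C * ((b * diamK K) ^ (k + 1) * ∑ j, V j + diamK K * (d * (b * diamK K) ^ k * ∑ j, V j)) := by
          refine hQ4.trans (mul_le_mul_of_nonneg_left ?_ hC)
          exact add_le_add b1 (mul_le_mul_of_nonneg_left b2 hh)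
      _ = (C * (b ^ (k + 1) + d * b ^ k)) * diamK K ^ (k + 1) * ∑ j, V j := by
          rw [mul_pow, mul_pow, pow_succ (diamK K)]; ring
      _ ≤ _ := by
          gcongr
          exact le_add_of_nonneg_right (by positivity)
  · calc _ ≤ d * (b * diamK K) ^ k * ∑ j, V j := b3
      _ = (d * b ^ k) * diamK K ^ k * ∑ j, V j := by rw [mul_pow]; ring
      _ ≤ _ := by
          gcongr
          exact le_add_of_nonneg_left (by positivity)

/-! ### Additivity of integrals and seminorms over the elements -/

namespace Mesh

variable {Ω : Set (Pt d)} (T : Mesh Ω)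

/-- Some vertex of `K` is missing from `K'`, so the intersection lies in the facet of `K` opposite
to it, where a barycentric coordinate of `K` vanishes. -/
theorem interior_hull_disjoint {K K' : Finset (Pt d)} (hK : K ∈ T.cells) (hK' : K' ∈ T.cells)
    (hne : K ≠ K') : Disjoint (interior (hull K)) (interior (hull K')) := by
  rw [Set.disjoint_left]
  intro x hx hx'
  obtain ⟨a, ha, haK'⟩ : ∃ a ∈ K, a ∉ K' := by
    by_contra! h
    exact hne (Finset.eq_of_subset_of_card_le h
      ((T.mem_cells.1 hK').2.trans (T.mem_cells.1 hK).2.symm).le)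
  have h1 := T.hull_inter_subset hK hK' (s := facet K a)
    (fun b hb hb' => mem_facet.2 ⟨by rintro rfl; exact haK' hb', hb⟩)
    ⟨interior_subset hx, interior_subset hx'⟩
  have h2 := (((T.isSimplex hK).mem_hull_facet_iff ha).1 h1).2
  rw [(T.isSimplex hK).interior_hull] at hx
  exact (hx a ha).ne' h2

theorem sum_integral_le (hΩ : interior (closure Ω) = Ω) {F : Pt d → ℝ} (hF : ∀ x, 0 ≤ F x)
    (hFi : IntegrableOn F Ω) : ∑ K : T.cells, ∫ x in hull K.1, F x ≤ ∫ x in Ω, F x := by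
  have hsub : ∀ K : T.cells, interior (hull K.1) ⊆ Ω := fun K => T.interior_hull_subset hΩ K.2
  have h1 : ∀ K : T.cells, ∫ x in hull K.1, F x = ∫ x in interior (hull K.1), F x := fun K => by
    rw [(T.isSimplex K.2).ae_restrict_interior]
  simp_rw [h1]
  rw [← integral_iUnion_fintype (fun K : T.cells => isOpen_interior.measurableSet)
    (fun K K' hne => T.interior_hull_disjoint K.2 K'.2 fun h => hne (Subtype.ext h))
    fun K => hFi.mono_set (hsub K)]
  exact setIntegral_mono_set hFi (ae_of_all _ hF) (Set.iUnion_subset hsub).eventuallyLE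

theorem sum_seminormSq_le (hΩ : interior (closure Ω) = Ω) {m : ℕ} {u : Pt d → ℝ}
    {D : (n : ℕ) → (Fin n → Fin d) → Pt d → ℝ} (hu : IsSobolev m Ω u D) :
    ∑ K : T.cells, ∑ i, ∫ x in hull K.1, D m i x ^ 2 ≤ seminormSq m Ω D := by
  rw [Finset.sum_comm, seminormSq]
  refine Finset.sum_le_sum fun i _ => T.sum_integral_le hΩ (fun x => sq_nonneg _) ?_
  exact (hu.2 m le_rfl i).1.integrable_sq

end Mesh

/-! ### The global estimate for the postprocessed Raviart-Thomas solution -/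

namespace Mesh

variable {Ω : Set (Pt d)} {T : Mesh Ω} {k : ℕ} {κ f g : Pt d → ℝ} {qh : T.cells → Fin d → MPoly d}
  {uh : T.cells → MPoly d} {lam : Finset (Pt d) → MPoly d}

/-- The Raviart-Thomas flux is locally conservative. -/
theorem IsRTSolution.isConservative (h : T.IsRTSolution k κ f g qh uh lam) (hd : 1 ≤ d)
    (hf : ∀ K : T.cells, MemLp f 2 (volume.restrict (hull K.1))) :
    T.IsConservative f fun K => vval (qh K) := by
  intro K
  rw [← (T.isSimplex K.2).integral_proj k (hf K), ← h.pdiv_eq_proj K (hf K)]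
  have h1 := (T.isSimplex K.2).integral_divergence hd (φ := fun _ => 1) contDiff_const (qh K)
  have h2 : ∇ (fun _ : Pt d => (1 : ℝ)) = 0 := by
    funext x; exact gradient_eq_zero_of_eventuallyEq (EventuallyEq.refl _ fun _ => (1 : ℝ))
  simpa [h2] using h1

theorem sqrt_sum_mul_sq {ι : Type*} (s : Finset ι) {c : ℝ} (hc : 0 ≤ c) (F : ι → ℝ) :
    √(∑ i ∈ s, (c * F i) ^ 2) = c * √(∑ i ∈ s, F i ^ 2) := by
  simp_rw [mul_pow]
  rw [← Finset.mul_sum, Real.sqrt_mul (sq_nonneg c), Real.sqrt_sq hc]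

/-- Superconvergence of the postprocessing of the Raviart-Thomas approximation. -/
theorem exists_rt_postprocessing_bound (hd : 1 ≤ d) (k : ℕ) (γ : ℝ) {κ₀ κ₁ : ℝ} (h₀ : 0 < κ₀)
    (h₁ : κ₀ ≤ κ₁) : ∃ C : ℝ, 0 ≤ C ∧
    ∀ (Ω : Set (Pt d)), IsOpen Ω → interior (closure Ω) = Ω → ∀ (T : Mesh Ω), T.ShapeRegular γ →
    ∀ (κ f g u : Pt d → ℝ) (G q : Pt d → Pt d), IsCoeff Ω κ₀ κ₁ κ → IsSolution Ω κ f u G q →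
    ∀ (Du : (n : ℕ) → (Fin n → Fin d) → Pt d → ℝ)
      (Dq : Fin d → (n : ℕ) → (Fin n → Fin d) → Pt d → ℝ)
      (qh : T.cells → Fin d → MPoly d) (uh : T.cells → MPoly d) (lam : Finset (Pt d) → MPoly d),
    HasTrace Ω u G g → IsSobolev (k + 2) Ω u Du →
    (∀ j, IsSobolev (k + 1) Ω (fun x => q x j) (Dq j)) → T.IsRTSolution k κ f g qh uh lam →
    ∀ w, T.IsPostprocessing k κ f (fun K => pval (uh K)) (fun K => vval (qh K)) w →
    T.norm (fun K x => u x - pval (w K) x) ≤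
      C * (√(seminormSq (k + 2) Ω Du) + √(∑ j, seminormSq (k + 1) Ω (Dq j))) * T.size ^ (k + 2) +
        T.norm (fun K x => pval (uh K) x - pval (proj k K.1 u) x) := by
  obtain ⟨C₁, hC₁, hint⟩ := exists_flux_interpolant hd k γ
  obtain ⟨b, hb⟩ : ∃ b : ℝ, b = d * 2 ^ d := ⟨_, rfl⟩
  have hb0 : 0 ≤ b := by rw [hb]; positivity
  obtain ⟨M, hM⟩ : ∃ M : ℝ, M = 2 ^ d * κ₀⁻¹ := ⟨_, rfl⟩
  have hM0 : 0 ≤ M := by rw [hM]; positivity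
  have hκ₁ : 0 ≤ κ₁ := h₀.le.trans h₁
  -- `A` collects the approximation errors of `u` and its gradient, `B` the projection error of `f`,
  -- and `E` the flux error. The factor `√d` below comes from Cauchy-Schwarz over the components of
  -- `q`.
  obtain ⟨A, hA⟩ : ∃ A : ℝ, A = 2 * b ^ (k + 2) + M * (κ₁ * (d * b ^ (k + 1))) := ⟨_, rfl⟩
  obtain ⟨B, hB⟩ : ∃ B : ℝ, B = M * (2 ^ d * C₁) := ⟨_, rfl⟩
  obtain ⟨E, hE⟩ : ∃ E : ℝ, E = M * ((1 + κ₁ * κ₀⁻¹) * C₁) := ⟨_, rfl⟩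
  have hA0 : 0 ≤ A := by rw [hA]; positivity
  have hB0 : 0 ≤ B := by rw [hB]; positivity
  have hE0 : 0 ≤ E := by rw [hE]; positivity
  refine ⟨A + (B + E) * √d, by positivity, fun Ω hΩo hΩ T hT κ f g u G q hκ hsol Du Dq qh uh lam
    htr hDu hDq hrt w hw => ?_⟩
  have hle : ∀ K : T.cells, volume.restrict (hull K.1) ≤ volume.restrict Ω := fun K =>
    T.restrict_hull_le hΩ K.2
  have hsub : ∀ K : T.cells, interior (hull K.1) ⊆ Ω := fun K => T.interior_hull_subset hΩ K.2
  have hfK : ∀ K : T.cells, MemLp f 2 (volume.restrict (hull K.1)) := fun K =>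
    hsol.div.memLp_div.mono_measure (hle K)
  choose H hH using fun j => (hDq j).exists_hasWeakGrad hΩo
  choose c r hr hball hdiam using hT
  choose Q hQ1 hQ2 hQ3 hQ4 hQ5 using fun K : T.cells => hint Ω hΩo q f hsol.div Dq hDq H hH K.1
    (T.isSimplex K.2) (hsub K) (c K.1 K.2) (r K.1 K.2) (hr K.1 K.2) (hball K.1 K.2)
    (hdiam K.1 K.2)
  choose P hPd hP1 hP2 using fun K : T.cells =>
    (T.isSimplex K.2).exists_approx hd (k + 1) hΩo (hsub K) hDu hsol.grad
  obtain ⟨U, hU⟩ : ∃ U : T.cells → ℝ, ∀ K, U K = √(∑ i, ∫ x in hull K.1, Du (k + 2) i x ^ 2) :=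
    ⟨_, fun _ => rfl⟩
  obtain ⟨V, hV⟩ : ∃ V : T.cells → ℝ, ∀ K, V K =
    ∑ j, √(∑ i, ∫ x in hull K.1, Dq j (k + 1) i x ^ 2) := ⟨_, fun _ => rfl⟩
  have hU0 : ∀ K, 0 ≤ U K := fun K => hU K ▸ Real.sqrt_nonneg _
  have hV0 : ∀ K, 0 ≤ V K := fun K => hV K ▸ Finset.sum_nonneg fun j _ => Real.sqrt_nonneg _
  simp_rw [← hV] at hQ4 hQ5
  simp_rw [← hb] at hP1 hP2
  have hP1' : ∀ K : T.cells, l2 (volume.restrict (hull K.1)) (fun x => u x - pval (P K) x) ≤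
    (b * diamK K.1) ^ (k + 2) * U K := fun K => by rw [hU]; exact hP1 K
  have hP2' : ∀ K : T.cells, l2 (volume.restrict (hull K.1)) (fun x => G x - pgrad (P K) x) ≤
    d * ((b * diamK K.1) ^ (k + 1) * U K) := fun K => by rw [hU]; exact hP2 K
  have hs0 := T.size_nonneg
  have hd0 : ∀ K : T.cells, 0 ≤ diamK K.1 := fun K => Metric.diam_nonneg
  have hds : ∀ (K : T.cells) (n : ℕ), diamK K.1 ^ n ≤ T.size ^ n := fun K n =>
    pow_le_pow_left₀ (hd0 K) (T.diamK_le_size K) n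
  -- the sums over the elements
  have hUs : √(∑ K, U K ^ 2) ≤ √(seminormSq (k + 2) Ω Du) := by
    refine Real.sqrt_le_sqrt (le_trans (le_of_eq ?_) (T.sum_seminormSq_le hΩ hDu))
    refine Finset.sum_congr rfl fun K _ => ?_
    rw [hU, Real.sq_sqrt (Finset.sum_nonneg fun i _ => integral_nonneg fun x => sq_nonneg _)]
  have hVs : √(∑ K, V K ^ 2) ≤ √d * √(∑ j, seminormSq (k + 1) Ω (Dq j)) := by
    rw [← Real.sqrt_mul (Nat.cast_nonneg d)]
    refine Real.sqrt_le_sqrt ?_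
    calc ∑ K, V K ^ 2 ≤ ∑ K : T.cells, d * ∑ j, ∑ i, ∫ x in hull K.1, Dq j (k + 1) i x ^ 2 := by
          refine Finset.sum_le_sum fun K _ => ?_
          rw [hV]
          refine (sq_sum_le_card_mul_sum_sq (s := Finset.univ)).trans_eq ?_
          rw [Finset.card_univ, Fintype.card_fin]
          congr 1
          refine Finset.sum_congr rfl fun j _ => ?_
          rw [Real.sq_sqrt (Finset.sum_nonneg fun i _ => integral_nonneg fun x => sq_nonneg _)]
      _ = d * ∑ j, ∑ K : T.cells, ∑ i, ∫ x in hull K.1, Dq j (k + 1) i x ^ 2 := by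
          rw [← Finset.mul_sum, Finset.sum_comm]
      _ ≤ _ := by
          gcongr with j _
          exact T.sum_seminormSq_le hΩ (hDq j)
  -- the flux
  obtain ⟨N, hN⟩ : ∃ N : T.cells → ℝ, ∀ K, N K =
    l2 (volume.restrict (hull K.1)) (fun x => q x - vval (qh K) x) := ⟨_, fun _ => rfl⟩
  have hN0 : ∀ K, 0 ≤ N K := fun K => hN K ▸ l2_nonneg _
  have hflux : √(∑ K, N K ^ 2) ≤
      (1 + κ₁ * κ₀⁻¹) * (C₁ * T.size ^ (k + 1) * √(∑ K, V K ^ 2)) := by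
    simp_rw [hN]
    refine (hrt.flux_error_le hd hΩ h₀ h₁ hκ hsol htr hQ1 hQ2 fun e he μ hμ =>
      T.sum_bdryInt_interpolant_eq_zero hd hΩo hΩ hH hQ3 he hμ).trans ?_
    refine mul_le_mul_of_nonneg_left ?_ (by positivity)
    rw [← sqrt_sum_mul_sq _ (by positivity)]
    refine sqrt_sum_sq_le _ _ _ (fun K _ => l2_nonneg _) fun K _ => (hQ4 K).trans ?_
    have := hV0 K
    exact mul_le_mul_of_nonneg_right (mul_le_mul_of_nonneg_left (hds K _) hC₁) this
  -- the local estimate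
  have hloc : ∀ K : T.cells, l2 (volume.restrict (hull K.1)) (fun x => u x - pval (w K) x) ≤
      (T.size ^ (k + 2) * A) * U K + (T.size ^ (k + 2) * B) * V K + (M * T.size) * N K +
        l2 (volume.restrict (hull K.1)) (fun x => pval (uh K) x - pval (proj k K.1 u) x) := by
    intro K
    have h1 := (T.isSimplex K.2).postprocessing_error_le hd h₀ h₁ (hκ.mono (hle K))
      (hsol.grad.memLp.mono_measure (hle K)) (hsol.grad.memLp_grad.mono_measure (hle K))
      (hsol.div.memLp.mono_measure (hle K)) (hfK K) (ae_mono (hle K) hsol.law) k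
      (hrt.pdiv_eq_proj K (hfK K)) (hw.degree K) (hPd K) (hw.mean K) (hw.flux K)
    rw [← hN, ← hM] at h1
    have hs := T.diamK_le_size K
    have p1 := hds K (k + 2)
    have p2 := hds K (k + 1)
    have p3 := hds K k
    have u0 := hU0 K
    have v0 := hV0 K
    have m0 := hN0 K
    have h0 := hd0 K
    have t1 : 2 * l2 (volume.restrict (hull K.1)) (fun x => u x - pval (P K) x) ≤
        2 * (b ^ (k + 2) * T.size ^ (k + 2) * U K) := by
      refine mul_le_mul_of_nonneg_left ((hP1' K).trans ?_) zero_le_two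
      rw [mul_pow]; gcongr
    have t2 : κ₁ * l2 (volume.restrict (hull K.1)) (fun x => G x - pgrad (P K) x) ≤
        κ₁ * (d * (b ^ (k + 1) * T.size ^ (k + 1) * U K)) := by
      refine mul_le_mul_of_nonneg_left ((hP2' K).trans ?_) hκ₁
      rw [mul_pow]; gcongr
    have t3 : 2 ^ d * diamK K.1 *
        l2 (volume.restrict (hull K.1)) (fun x => f x - pval (proj k K.1 f) x) ≤
        2 ^ d * T.size * (C₁ * T.size ^ k * V K) := by
      refine mul_le_mul (by gcongr) ((hQ5 K).trans ?_) (l2_nonneg _) (by positivity)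
      gcongr
    have t4 : M * diamK K.1 * (κ₁ * l2 (volume.restrict (hull K.1)) (fun x => G x - pgrad (P K) x) +
        2 ^ d * diamK K.1 * l2 (volume.restrict (hull K.1)) (fun x => f x - pval (proj k K.1 f) x) +
        N K) ≤ M * T.size * (κ₁ * (d * (b ^ (k + 1) * T.size ^ (k + 1) * U K)) +
          2 ^ d * T.size * (C₁ * T.size ^ k * V K) + N K) := by
      refine mul_le_mul (by gcongr) (by linarith) ?_ (by positivity)
      have := l2_nonneg (μ := volume.restrict (hull K.1)) fun x => G x - pgrad (P K) x
      have := l2_nonneg (μ := volume.restrict (hull K.1)) fun x => f x - pval (proj k K.1 f) x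
      positivity
    refine h1.trans ((add_le_add (add_le_add t1 le_rfl) t4).trans_eq ?_)
    rw [hA, hB]
    ring
  rw [T.norm_eq, T.norm_eq]
  refine (sqrt_sum_sq_le _ _ _ (fun K _ => l2_nonneg _) fun K _ => hloc K).trans ?_
  refine (sqrt_sum_add_sq_le _ _ _).trans (add_le_add ?_ le_rfl)
  refine (sqrt_sum_add_sq_le _ _ _).trans ?_
  rw [sqrt_sum_mul_sq _ (by positivity) N]
  refine (add_le_add (sqrt_sum_add_sq_le _ _ _) (mul_le_mul_of_nonneg_left hflux (by positivity))).trans ?_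
  rw [sqrt_sum_mul_sq _ (by positivity) U, sqrt_sum_mul_sq _ (by positivity) V]
  obtain ⟨X, hX⟩ : ∃ X, X = √(seminormSq (k + 2) Ω Du) := ⟨_, rfl⟩
  obtain ⟨Y, hY⟩ : ∃ Y, Y = √(∑ j, seminormSq (k + 1) Ω (Dq j)) := ⟨_, rfl⟩
  rw [← hX] at hUs ⊢
  rw [← hY] at hVs ⊢
  have hX0 : 0 ≤ X := hX ▸ Real.sqrt_nonneg _
  have hY0 : 0 ≤ Y := hY ▸ Real.sqrt_nonneg _
  calc T.size ^ (k + 2) * A * √(∑ K, U K ^ 2) + T.size ^ (k + 2) * B * √(∑ K, V K ^ 2) +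
        M * T.size * ((1 + κ₁ * κ₀⁻¹) * (C₁ * T.size ^ (k + 1) * √(∑ K, V K ^ 2))) =
        T.size ^ (k + 2) * (A * √(∑ K, U K ^ 2) + (B + E) * √(∑ K, V K ^ 2)) := by rw [hE]; ring
    _ ≤ T.size ^ (k + 2) * (A * X + (B + E) * (√d * Y)) := by gcongr
    _ ≤ T.size ^ (k + 2) * ((A + (B + E) * √d) * (X + Y)) := by
        refine mul_le_mul_of_nonneg_left ?_ (by positivity)
        have : 0 ≤ (B + E) * √d * X := by positivity
        have : 0 ≤ A * Y := by positivity
        linarith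
    _ = _ := by ring

theorem ErrorBound.mono {C C' : ℝ} {u : Pt d → ℝ} {G : Pt d → Pt d} {σ uh : T.cells → Pt d → ℝ}
    {qh : T.cells → Pt d → Pt d} {w : T.cells → MPoly d} (h : T.ErrorBound k C u G σ uh qh w)
    (hC : C ≤ C') : T.ErrorBound k C' u G σ uh qh w := by
  refine le_trans h (mul_le_mul_of_nonneg_right hC ?_)
  have := T.size_nonneg
  have := T.norm_nonneg (fun K x => u x - pval (proj (k + 1) K.1 u) x)
  have := T.norm_nonneg (fun K x => uh K x - pval (proj k K.1 u) x)
  have h1 : 0 ≤ T.scaledNorm (fun K x => G x - pgrad (proj (k + 1) K.1 u) x) := Real.sqrt_nonneg _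
  have h2 : 0 ≤ T.bdryNorm (fun K a x => σ K x - ⟪qh K x, normal K.1 a⟫) := Real.sqrt_nonneg _
  positivity

end Mesh

end MixedFEM

end

/-! ### Choice of the constant and assembly -/

theorem proposition4p2 (d : ℕ) (hd : 2 ≤ d) (k : ℕ) (γ κ₀ κ₁ : ℝ) (hκ₀ : 0 < κ₀) :
    ∃ C : ℝ, 0 < C ∧
      ∀ (Ω : Set (Pt d)) (_ : IsOpen Ω) (_ : interior (closure Ω) = Ω)
        (T : Mesh Ω) (_ : T.ShapeRegular γ)
        (κ f u : Pt d → ℝ) (G q : Pt d → Pt d)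
        (_ : IsCoeff Ω κ₀ κ₁ κ) (_ : IsSolution Ω κ f u G q),
        -- arbitrary approximations
        (∀ (σ : T.cells → Pt d → ℝ) (uh : T.cells → Pt d → ℝ) (qh : T.cells → Pt d → Pt d),
          (∀ K, HasNormalTrace K.1 q f (σ K)) →
          (∀ K, MemLp (uh K) 2 (volume.restrict (hull K.1))) →
          (∀ K, ∀ a ∈ K.1, MemLp (fun x => inner ℝ (qh K x) (normal K.1 a)) 2
            (surf (facet K.1 a))) →
          (T.IsConservative f qh →
            (∃! w, T.IsPostprocessing k κ f uh qh w) ∧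
            ∀ w, T.IsPostprocessing k κ f uh qh w → T.ErrorBound k C u G σ uh qh w) ∧
          (∃! w, T.IsSplitPostprocessing k κ f uh qh w) ∧
          ∀ w, T.IsSplitPostprocessing k κ f uh qh w → T.ErrorBound k C u G σ uh qh w) ∧
        -- the Raviart-Thomas approximation of a smooth solution, assuming superconvergence
        (∀ (g : Pt d → ℝ) (Du : (n : ℕ) → (Fin n → Fin d) → Pt d → ℝ)
          (Dq : Fin d → (n : ℕ) → (Fin n → Fin d) → Pt d → ℝ)
          (qh : T.cells → Fin d → MPoly d) (uh : T.cells → MPoly d) (lam : Finset (Pt d) → MPoly d)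
          (S : ℝ),
          HasTrace Ω u G g →
          IsSobolev (k + 2) Ω u Du →
          (∀ j, IsSobolev (k + 1) Ω (fun x => q x j) (Dq j)) →
          T.IsRTSolution k κ f g qh uh lam →
          T.norm (fun K x => pval (uh K) x - pval (proj k K.1 u) x) ≤ S * T.size ^ (k + 2) →
          (∃! w, T.IsPostprocessing k κ f (fun K => pval (uh K)) (fun K => vval (qh K)) w) ∧
          ∀ w, T.IsPostprocessing k κ f (fun K => pval (uh K)) (fun K => vval (qh K)) w →
            T.norm (fun K x => u x - pval (w K) x) ≤
              C * (√(seminormSq (k + 2) Ω Du) + √(∑ j, seminormSq (k + 1) Ω (Dq j)) + S) *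
                T.size ^ (k + 2)) := by
  have hd1 : 1 ≤ d := by omega
  -- The constant is chosen before the domain and the coefficient, and `κ₀ ≤ κ₁` is not among the
  -- assumptions; replacing `κ₁` by the maximum only weakens the bound on the coefficient.
  have h₁ : κ₀ ≤ max κ₀ κ₁ := le_max_left _ _
  obtain ⟨C₂, hC₂, hrt⟩ := Mesh.exists_rt_postprocessing_bound hd1 k γ hκ₀ h₁
  obtain ⟨C₁, hC₁⟩ : ∃ C₁ : ℝ, C₁ = 2 + 2 ^ d * κ₀⁻¹ *
    (|κ₁| + √((d + 1) * (|γ| * (d * 4 ^ d + 2 * 2 ^ d)))) := ⟨_, rfl⟩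
  have hC₁0 : 0 ≤ C₁ := by rw [hC₁]; positivity
  refine ⟨1 + C₁ + C₂, by positivity, fun Ω hΩo hΩ T hT κ f u G q hκ hsol => ⟨?_, ?_⟩⟩
  · intro σ uh qh hσ huh hqh
    have hle : ∀ K : T.cells, volume.restrict (hull K.1) ≤ volume.restrict Ω := fun K =>
      T.restrict_hull_le hΩ K.2
    have hf : ∀ K : T.cells, MemLp f 2 (volume.restrict (hull K.1)) := fun K =>
      hsol.div.memLp_div.mono_measure (hle K)
    have hex := T.existsUnique_isSplitPostprocessing hd1 hκ₀ (fun K => hκ.mono (hle K)) hf hqh k uh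
    have hb : ∀ w, T.IsSplitPostprocessing k κ f uh qh w →
        T.ErrorBound k (1 + C₁ + C₂) u G σ uh qh w := fun w hw =>
      (T.errorBound hd1 hΩ hT hκ₀ hκ hsol hσ huh hqh hw).mono (by rw [← hC₁]; linarith)
    refine ⟨fun hc => ?_, hex, hb⟩
    have hiff := T.isPostprocessing_iff (k := k) (κ := κ) (uh := uh) hd1 hf hqh hc
    simp only [hiff]
    exact ⟨hex, hb⟩
  · intro g Du Dq qh uh lam S htr hDu hDq hsolh hS
    have hle : ∀ K : T.cells, volume.restrict (hull K.1) ≤ volume.restrict Ω := fun K =>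
      T.restrict_hull_le hΩ K.2
    have hf : ∀ K : T.cells, MemLp f 2 (volume.restrict (hull K.1)) := fun K =>
      hsol.div.memLp_div.mono_measure (hle K)
    have hqh : ∀ K : T.cells, ∀ a ∈ K.1, MemLp (fun x => inner ℝ (vval (qh K) x) (normal K.1 a)) 2
        (surf (facet K.1 a)) := fun K a ha =>
      (T.isSimplex K.2).memLp_surf_of_continuous hd1 ha (by fun_prop) 2
    refine ⟨?_, fun w hw => ?_⟩
    · simp only [T.isPostprocessing_iff hd1 hf hqh (hsolh.isConservative hd1 hf)]
      exact T.existsUnique_isSplitPostprocessing hd1 hκ₀ (fun K => hκ.mono (hle K)) hf hqh k _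
    · have hκ' : IsCoeff Ω κ₀ (max κ₀ κ₁) κ :=
        ⟨hκ.1, hκ.2.mono fun x hx => ⟨hx.1, hx.2.trans (le_max_right _ _)⟩⟩
      have h1 := hrt Ω hΩo hΩ T hT κ f g u G q hκ' hsol Du Dq qh uh lam htr hDu hDq hsolh w hw
      obtain ⟨X, hX⟩ : ∃ X, X = √(seminormSq (k + 2) Ω Du) + √(∑ j, seminormSq (k + 1) Ω (Dq j)) :=
        ⟨_, rfl⟩
      have hX0 : 0 ≤ X := by rw [hX]; positivity
      rw [← hX] at h1 ⊢
      have hs := T.size_nonneg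
      -- The sign of `S` is not prescribed, but the product with the power of `h` bounds a norm. Its
      -- nonnegativity is what permits enlarging the coefficient of `S` to the common constant.
      have hS0 : 0 ≤ S * T.size ^ (k + 2) := (T.norm_nonneg _).trans hS
      have h2 : 0 ≤ (1 + C₁) * X * T.size ^ (k + 2) := by positivity
      have h3 : 0 ≤ (C₁ + C₂) * (S * T.size ^ (k + 2)) := by positivity
      calc _ ≤ C₂ * X * T.size ^ (k + 2) + S * T.size ^ (k + 2) := h1.trans (by gcongr)
        _ ≤ _ := by linarith
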